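/- Let $U\subset\mathbf R^2\times\mathbf R^6$ be an open set of 1-jets $(x,y,u,v,u_x,v_x,u_y,v_y)$, let $f,g\in C^\infty(U)$, and let $\mathcal R$ denote the system $$u_{xy}=f(x,y,u,v,u_x,v_x,u_y,v_y),\qquad v_{xy}=g(x,y,u,v,u_x,v_x,u_y,v_y).$$ Write $(u^1,u^2)=(u,v)$, $(f^1,f^2)=(f,g)$, and let $q$ be any point of the second-order jet space $J^2(\mathbf R^2,\mathbf R^2)$ that lies over a point $p\in U$ and satisfies the equations $\mathcal R$. *Lagrangians.* $\mathcal R$ admits $k$ Lagrangians near $p$ if on some connected open neighbourhood $V\subset U$ of $p$ there are smooth functions $L_1,\dots,L_k$ (first-order Lagrangians), linearly independent over $\mathbf R$, and smooth $2\times2$-matrix functions $M^1,\dots,M^k$, linearly independent over $\mathbf R$ and with $\det M^i\neq0$ everywhere on $V$, such that on the part of $J^2$ over $V$ $$E_\alpha(L_i)=\sum_\beta M^i_{\alpha\beta}\,(u^\beta_{xy}-f^\beta),\qquad E_\alpha(L)=\frac{\partial L}{\partial u^\alpha}-D_x\frac{\partial L}{\partial u^\alpha_x}-D_y\frac{\partial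 L}{\partial u^\alpha_y},$$ for $\alpha=1,2$ and $i=1,\dots,k$. *Contact equivalence.* $\mathcal R$ is contact equivalent near $q$ to a system $\bar u^\alpha_{\bar x\bar y}=\bar f^\alpha$ if there is a smooth diffeomorphism $\Phi$ from an open neighbourhood of $q$ in $J^2$ (lying over $U$) onto an open subset of $J^2$ (lying over the domain of the $\bar f^\alpha$) such that $\Phi^*\mathcal C\subset\mathcal C$ and $\Phi^*(\bar u^\alpha_{\bar x\bar y}-\bar f^\alpha)=\sum_\gamma Q^\alpha_\gamma\,(u^\gamma_{xy}-f^\gamma)$ for some smooth functions $Q^\alpha_\gamma$. Here $\mathcal C$ is the ideal generated by the forms $du^\alpha-u^\alpha_x\,dx-u^\alpha_y\,dy$, $du^\alpha_x-u^\alpha_{xx}\,dx-u^\alpha_{xy}\,dy$ and $du^\alpha_y-u^\alpha_{xy}\,dx-u^\alpha_{yy}\,dy$. **Theorem.** 1) $\mathcal R$ admits three Lagrangians near $p$ if and only if $\mathcal R$ is contact equivalent near $q$ to a system $$u_{xy}=\lambda(x,y)\,u,\qquad v_{xy}=\lambda(x,y)\,v,$$ where $\lambda$ is a smooth function on an open subset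 of $\mathbf R^2$. 2) $\mathcal R$ admits two Lagrangians near $p$ if and only if $\mathcal R$ is contact equivalent near $q$ to a system $$u_{xy}=W_v(x,y,u,v),\qquad v_{xy}=W_u(x,y,u,v),$$ where $W$ is a smooth function on an open subset of $\mathbf R^4$ that satisfies, on that whole set, one of the equations $W_{uu}+W_{vv}=0$, $W_{uu}=W_{vv}$, or $W_{vv}=0$. -/

import Mathlib

open scoped ContDiff

noncomputable section

/-- The space `J¹(ℝ², ℝᵐ)` of first-order jets, with coordinates `(x, y, u, u_x, u_y)`. -/
abbrev Jet1 (m : ℕ) : Type :=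
  ℝ × ℝ × (Fin m → ℝ) × (Fin m → ℝ) × (Fin m → ℝ)

/-- The space `J²(ℝ², ℝᵐ)` of second-order jets, with coordinates
`((x, y, u, u_x, u_y), u_xx, u_xy, u_yy)`; the first component is the underlying 1-jet. -/
abbrev Jet2 (m : ℕ) : Type :=
  Jet1 m × (Fin m → ℝ) × (Fin m → ℝ) × (Fin m → ℝ)

namespace Jet1

variable {m : ℕ}

def x (p : Jet1 m) : ℝ := p.1
def y (p : Jet1 m) : ℝ := p.2.1
def u (p : Jet1 m) : Fin m → ℝ := p.2.2.1
def ux (p : Jet1 m) : Fin m → ℝ := p.2.2.2.1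
def uy (p : Jet1 m) : Fin m → ℝ := p.2.2.2.2

/-- `∂h/∂u^α` -/
def partialU (h : Jet1 m → ℝ) (α : Fin m) (p : Jet1 m) : ℝ :=
  fderiv ℝ h p (0, 0, Pi.single α 1, 0, 0)

/-- `∂h/∂u^α_x` -/
def partialUx (h : Jet1 m → ℝ) (α : Fin m) (p : Jet1 m) : ℝ :=
  fderiv ℝ h p (0, 0, 0, Pi.single α 1, 0)

/-- `∂h/∂u^α_y` -/
def partialUy (h : Jet1 m → ℝ) (α : Fin m) (p : Jet1 m) : ℝ :=
  fderiv ℝ h p (0, 0, 0, 0, Pi.single α 1)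

end Jet1

namespace Jet2

variable {m : ℕ}

/-- The projection `J² → J¹`. -/
def toJet1 (q : Jet2 m) : Jet1 m := q.1
def ux (q : Jet2 m) : Fin m → ℝ := q.1.2.2.2.1
def uy (q : Jet2 m) : Fin m → ℝ := q.1.2.2.2.2
def uxx (q : Jet2 m) : Fin m → ℝ := q.2.1
def uxy (q : Jet2 m) : Fin m → ℝ := q.2.2.1
def uyy (q : Jet2 m) : Fin m → ℝ := q.2.2.2

/-- The total derivative `D_x h`, a function on `J²`, of a function `h` on `J¹`. -/
def totalX (h : Jet1 m → ℝ) (q : Jet2 m) : ℝ :=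
  fderiv ℝ h q.toJet1 (1, 0, q.ux, q.uxx, q.uxy)

/-- The total derivative `D_y h`, a function on `J²`, of a function `h` on `J¹`. -/
def totalY (h : Jet1 m → ℝ) (q : Jet2 m) : ℝ :=
  fderiv ℝ h q.toJet1 (0, 1, q.uy, q.uxy, q.uyy)

/-! The coordinate one-forms on `J²` that occur in the contact forms. -/

/-- The differential of the projection `J² → J¹`. -/
def dJet1 : Jet2 m →L[ℝ] Jet1 m := ContinuousLinearMap.fst ℝ _ _

def dx : Jet2 m →L[ℝ] ℝ := (ContinuousLinearMap.fst ℝ _ _).comp dJet1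

def dy : Jet2 m →L[ℝ] ℝ :=
  ((ContinuousLinearMap.fst ℝ _ _).comp (ContinuousLinearMap.snd ℝ _ _)).comp dJet1

def du (α : Fin m) : Jet2 m →L[ℝ] ℝ :=
  (ContinuousLinearMap.proj α).comp
    (((ContinuousLinearMap.fst ℝ _ _).comp ((ContinuousLinearMap.snd ℝ _ _).comp
      (ContinuousLinearMap.snd ℝ _ _))).comp dJet1)

def dux (α : Fin m) : Jet2 m →L[ℝ] ℝ :=
  (ContinuousLinearMap.proj α).comp
    (((ContinuousLinearMap.fst ℝ _ _).comp ((ContinuousLinearMap.snd ℝ _ _).comp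
      ((ContinuousLinearMap.snd ℝ _ _).comp (ContinuousLinearMap.snd ℝ _ _)))).comp dJet1)

def duy (α : Fin m) : Jet2 m →L[ℝ] ℝ :=
  (ContinuousLinearMap.proj α).comp
    (((ContinuousLinearMap.snd ℝ _ _).comp ((ContinuousLinearMap.snd ℝ _ _).comp
      ((ContinuousLinearMap.snd ℝ _ _).comp (ContinuousLinearMap.snd ℝ _ _)))).comp dJet1)

/-- The contact form `du^α - u^α_x dx - u^α_y dy` at the point `q`. -/
def theta (α : Fin m) (q : Jet2 m) : Jet2 m →L[ℝ] ℝ :=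
  du α - q.ux α • dx - q.uy α • dy

/-- The contact form `du^α_x - u^α_xx dx - u^α_xy dy` at the point `q`. -/
def thetaX (α : Fin m) (q : Jet2 m) : Jet2 m →L[ℝ] ℝ :=
  dux α - q.uxx α • dx - q.uxy α • dy

/-- The contact form `du^α_y - u^α_xy dx - u^α_yy dy` at the point `q`. -/
def thetaY (α : Fin m) (q : Jet2 m) : Jet2 m →L[ℝ] ℝ :=
  duy α - q.uxy α • dx - q.uyy α • dy

/-- The set of the generating contact one-forms. -/
def contactGenerators (m : ℕ) : Set (Jet2 m → (Jet2 m →L[ℝ] ℝ)) :=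
  Set.range theta ∪ Set.range thetaX ∪ Set.range thetaY

/-- The degree-one part of the contact ideal at the point `q`: the span of the generators. -/
def contactSpan (q : Jet2 m) : Submodule ℝ (Jet2 m →L[ℝ] ℝ) :=
  Submodule.span ℝ ((fun η => η q) '' contactGenerators m)

/-- `Φ^* C ⊆ C` on the set `Ω`. The contact ideal `C` is generated by pointwise linearly
independent one-forms, so this says that the pull-back of each generator is at every point
a linear combination of the generators (the coefficients are then automatically smooth). -/
def PreservesContact (Φ : Jet2 m → Jet2 m) (Ω : Set (Jet2 m)) : Prop :=
  ∀ q ∈ Ω, ∀ η ∈ contactGenerators m, (η (Φ q)).comp (fderiv ℝ Φ q) ∈ contactSpan q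

end Jet2

/-- The component `E_α(L) = ∂L/∂u^α - D_x (∂L/∂u^α_x) - D_y (∂L/∂u^α_y)` of the
Euler-Lagrange expression of a first-order Lagrangian `L`; it is a function on `J²`. -/
def eulerLagrange {m : ℕ} (L : Jet1 m → ℝ) (α : Fin m) (q : Jet2 m) : ℝ :=
  Jet1.partialU L α q.toJet1 - Jet2.totalX (Jet1.partialUx L α) q
    - Jet2.totalY (Jet1.partialUy L α) q

/-- The equation manifold in `J²` of the system `u_xy = F(x, y, u, u_x, u_y)`, where `F` is
defined on the set `U` of 1-jets. -/
def equationManifold {m : ℕ} (U : Set (Jet1 m)) (F : Jet1 m → Fin m → ℝ) : Set (Jet2 m) :=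
  {q | q.toJet1 ∈ U ∧ q.uxy = F q.toJet1}

/-- `M` is on `V` a (smooth, nondegenerate) variational multiplier of the system `u_xy = F`
with associated smooth first-order Lagrangian `L`, that is,
`E_α(L) = M_{αβ} (u^β_xy - F^β)` identically on the part of `J²` over `V`. -/
def IsLagrangianWithMultiplier {m : ℕ} (F : Jet1 m → Fin m → ℝ) (V : Set (Jet1 m))
    (L : Jet1 m → ℝ) (M : Jet1 m → Matrix (Fin m) (Fin m) ℝ) : Prop :=
  ContDiffOn ℝ ∞ L V ∧
  (∀ α β, ContDiffOn ℝ ∞ (fun p => M p α β) V) ∧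
  (∀ p ∈ V, (M p).det ≠ 0) ∧
  ∀ q : Jet2 m, q.toJet1 ∈ V → ∀ α,
    eulerLagrange L α q = ∑ β, M q.toJet1 α β * (q.uxy β - F q.toJet1 β)

/-- The system `u_xy = F` on `U` admits (at least) `k` Lagrangians near the 1-jet `p`: on some
connected open neighbourhood of `p` there are `k` linearly independent Lagrangians whose
variational multipliers are linearly independent (over `ℝ`, as functions). -/
def AdmitsLagrangiansAt {m : ℕ} (U : Set (Jet1 m)) (F : Jet1 m → Fin m → ℝ) (k : ℕ)
    (p : Jet1 m) : Prop :=
  ∃ V : Set (Jet1 m), IsOpen V ∧ IsConnected V ∧ p ∈ V ∧ V ⊆ U ∧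
    ∃ (L : Fin k → Jet1 m → ℝ) (M : Fin k → Jet1 m → Matrix (Fin m) (Fin m) ℝ),
      (∀ i, IsLagrangianWithMultiplier F V (L i) (M i)) ∧
      LinearIndependent ℝ (fun i => (fun p : V => L i p)) ∧
      LinearIndependent ℝ (fun i => (fun p : V => M i p))

/-- Near the point `q` of `J²`, the system `u_xy = F` on `U` is contact equivalent to the system
`u_xy = G` on `U'`: there is a diffeomorphism `Φ` of an open neighbourhood of `q` onto an open
subset of `J²`, preserving the contact ideal, with
`Φ^* (u^α_xy - G^α) = Q^α_γ (u^γ_xy - F^γ)` for some smooth matrix function `Q`. -/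
def ContactEquivalentAt {m : ℕ} (U : Set (Jet1 m)) (F : Jet1 m → Fin m → ℝ)
    (U' : Set (Jet1 m)) (G : Jet1 m → Fin m → ℝ) (q : Jet2 m) : Prop :=
  ∃ Φ : OpenPartialHomeomorph (Jet2 m) (Jet2 m),
    q ∈ Φ.source ∧
    (∀ r ∈ Φ.source, r.toJet1 ∈ U) ∧
    (∀ r ∈ Φ.target, r.toJet1 ∈ U') ∧
    ContDiffOn ℝ ∞ Φ Φ.source ∧
    ContDiffOn ℝ ∞ Φ.symm Φ.target ∧
    Jet2.PreservesContact Φ Φ.source ∧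
    ∃ Q : Jet2 m → Matrix (Fin m) (Fin m) ℝ,
      (∀ α γ, ContDiffOn ℝ ∞ (fun r => Q r α γ) Φ.source) ∧
      ∀ r ∈ Φ.source, ∀ α,
        (Φ r).uxy α - G (Φ r).toJet1 α = ∑ γ, Q r α γ * (r.uxy γ - F r.toJet1 γ)

/-- `∂h/∂u` for a function `h` of `(x, y, u, v)`. -/
def dU (h : ℝ × ℝ × ℝ × ℝ → ℝ) (z : ℝ × ℝ × ℝ × ℝ) : ℝ := fderiv ℝ h z (0, 0, 1, 0)

/-- `∂h/∂v` for a function `h` of `(x, y, u, v)`. -/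
def dV (h : ℝ × ℝ × ℝ × ℝ → ℝ) (z : ℝ × ℝ × ℝ × ℝ) : ℝ := fderiv ℝ h z (0, 0, 0, 1)

/-- The point `(x, y)` under a 1-jet. -/
def basePoint (p : Jet1 2) : ℝ × ℝ := (p.x, p.y)

/-- The point `(x, y, u, v)` under a 1-jet, for two dependent variables `u`, `v`. -/
def zeroJet (p : Jet1 2) : ℝ × ℝ × ℝ × ℝ := (p.x, p.y, p.u 0, p.u 1)

end

noncomputable section

open scoped ContDiff Topology
open Set Metric MeasureTheory

/-! ### Calculus: smooth extension, parametric integrals, the Poincaré lemma in `u`. -/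

section

section SmoothExtension

variable {E F : Type*} [NormedAddCommGroup E] [NormedSpace ℝ E] [FiniteDimensional ℝ E]
  [NormedAddCommGroup F] [NormedSpace ℝ F]

/-! Write the system as u_xy = F. Comparing coefficients of the second derivatives in the
Euler-Lagrange identity shows that a multiplier M is symmetric and depends on (x, y, u) only. It
also satisfies dM = -(MB + BᵀM), where the connection form B (`connMatrix`) is built from ∂F/∂u_x,
∂F/∂u_y and ∂²F/∂u_x∂u_y (`IsLagrangianWithMultiplier.isParallelForm`). So multipliers are parallel
symmetric forms. They are determined by their value at one point, and independence over ℝ is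
independence at every point.

Given two independent multipliers M, M', the matrix M⁻¹M' has constant trace and determinant, so
near p the pair is congruent to its value at p by a smooth frame P (`exists_frame`). In dimension
two such a pair has no infinitesimal isometries, which forces dP = -PB
(`IsParallelForm.frame_parallel`). A parallel frame is the Jacobian matrix ∂φ/∂u of a substitution,
and D_xD_yφ, taken on the equation, is free of first derivatives
(`IsParallelCoframe.exists_normalizesAt`). In the variables φ the system therefore reads u_xy = h(x,
y, u), and every multiplier becomes a constant matrix C. Subtracting the Lagrangian from the kinetic
one, -½ C_{αβ} D_xφ^α D_yφ^β, leaves Euler-Lagrange expressions of order zero, and their closedness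
says that C·∂h/∂u is symmetric.

With three matrices C, all symmetric matrices occur, so ∂h/∂u is a scalar λ(x, y) and h = λu + μ(x,
y). A solution of s_xy = λs + μ (`exists_goursat`) removes μ. With two, a constant linear change
brings their span to that of the off-diagonal matrix and diag(1, e) with e = 1, -1 or 0
(`exists_congruence_pencil`). The first gives h = (W_v, W_u), the second W_vv = e W_uu.

Conversely, a contact transformation of J² with two dependent variables comes from a point
transformation (`IsContactMap.fderiv_vertical`). On the equation the transformed mixed derivatives
do not see u_xx and u_yy, so the characteristic directions are preserved or interchanged
(`IsContactMap.characteristic_dichotomy`). Up to this interchange X = X(x) and Y = Y(y), and the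
dependent components φ alone normalize the given system, with right-hand side X'Y'·g. Kinetic minus
potential terms then give the Lagrangians (`NormalizesAt.exists_lagrangian`).

Everything is local. Functions on open sets are therefore replaced by globally smooth ones that
agree with them on a ball, by means of the lemma below, and derivatives can then be taken without
tracking domains. -/

theorem ContDiffOn.exists_contDiff_eqOn_ball {f : E → F} {U : Set E} (hU : IsOpen U)
    (hf : ContDiffOn ℝ ∞ f U) {p : E} (hp : p ∈ U) :
    ∃ g : E → F, ContDiff ℝ ∞ g ∧ ∃ r > 0, ball p r ⊆ U ∧ EqOn g f (ball p r) := by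
  obtain ⟨R, hR, hRU⟩ := Metric.nhds_basis_closedBall.mem_iff.1 (hU.mem_nhds hp)
  let χ : ContDiffBump p := ⟨R / 2, R, by positivity, by linarith⟩
  refine ⟨fun x => χ x • f x, ?_, R / 2, by positivity, ?_, ?_⟩
  · rw [contDiff_iff_contDiffAt]
    intro x
    by_cases hx : x ∈ closedBall p R
    · exact χ.contDiffAt.smul (hf.contDiffAt (hU.mem_nhds (hRU hx)))
    · have : (fun x => χ x • f x) =ᶠ[𝓝 x] fun _ => 0 := by
        filter_upwards [isClosed_closedBall.isOpen_compl.mem_nhds hx] with y hy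
        have : χ y = 0 := by
          refine χ.zero_of_le_dist ?_
          have h := not_le.1 (mt mem_closedBall.2 hy)
          exact h.le
        simp [this]
      exact contDiffAt_const.congr_of_eventuallyEq this
  · exact (ball_subset_closedBall.trans (closedBall_subset_closedBall (by linarith))).trans hRU
  · intro x hx
    have : χ x = 1 := χ.one_of_mem_closedBall (ball_subset_closedBall hx)
    simp [this]

end SmoothExtension

section ParametricIntegral

variable {E F : Type} [NormedAddCommGroup E] [NormedSpace ℝ E] [FiniteDimensional ℝ E]
  [NormedAddCommGroup F] [NormedSpace ℝ F]

theorem hasFDerivAt_unitIntervalIntegral {f : E → ℝ → F} (hf : ContDiff ℝ 1 (Function.uncurry f))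
    (z : E) :
    HasFDerivAt (fun z => ∫ t in (0 : ℝ)..1, f z t)
      (∫ t in (0 : ℝ)..1, fderiv ℝ (fun w => f w t) z) z := by
  have hpart : ∀ w t, HasFDerivAt (fun w => f w t)
      ((fderiv ℝ (Function.uncurry f) (w, t)).comp (ContinuousLinearMap.inl ℝ E ℝ)) w := by
    intro w t
    have h1 : HasFDerivAt (Function.uncurry f) (fderiv ℝ (Function.uncurry f) (w, t)) (w, t) :=
      (hf.differentiable one_ne_zero _).hasFDerivAt
    exact HasFDerivAt.comp (f := fun e => (e, t)) w h1 (hasFDerivAt_prodMk_left w t)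
  have heq : ∀ w t, fderiv ℝ (fun w => f w t) w =
      (fderiv ℝ (Function.uncurry f) (w, t)).comp (ContinuousLinearMap.inl ℝ E ℝ) :=
    fun w t => (hpart w t).fderiv
  have hcont : Continuous fun q : E × ℝ => fderiv ℝ (fun w => f w q.2) q.1 := by
    simp_rw [heq]
    have h2 : Continuous (fderiv ℝ (Function.uncurry f)) := hf.continuous_fderiv one_ne_zero
    exact h2.clm_comp continuous_const
  have hfc : ∀ w, Continuous (f w) := fun w =>
    hf.continuous.comp (Continuous.prodMk_right w)
  -- The dominating function is a constant: the partial derivative is continuous, hence bounded on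
  -- the compact set `closedBall z 1 × [0, 1]`.
  obtain ⟨C, hC⟩ := ((isCompact_closedBall z 1).prod (isCompact_Icc (a := (0 : ℝ)) (b := 1))).exists_bound_of_continuousOn
    hcont.continuousOn
  refine intervalIntegral.hasFDerivAt_integral_of_dominated_of_fderiv_le (s := ball z 1)
    (F := f) (F' := fun w t => fderiv ℝ (fun w => f w t) w) (bound := fun _ => C) (ball_mem_nhds z one_pos) ?_ ?_ ?_ ?_ ?_ ?_
  · exact Filter.Eventually.of_forall fun w => (hfc w).aestronglyMeasurable
  · exact (hfc z).intervalIntegrable _ _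
  · exact (hcont.comp (Continuous.prodMk_right z)).aestronglyMeasurable
  · refine Filter.Eventually.of_forall fun t ht w hw => hC (w, t) ⟨ball_subset_closedBall hw, ?_⟩
    rw [uIoc_of_le zero_le_one] at ht
    exact ⟨ht.1.le, ht.2⟩
  · exact intervalIntegrable_const
  · exact Filter.Eventually.of_forall fun t _ w _ => by rw [heq]; exact hpart w t

/-- The derivative is again an integral of this kind, with values in `E →L[ℝ] F`. This is why the
induction leaves the target space free. -/
theorem contDiff_nat_unitIntervalIntegral (n : ℕ) : ∀ {F : Type} [NormedAddCommGroup F]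
    [NormedSpace ℝ F] {f : E → ℝ → F}, ContDiff ℝ n (Function.uncurry f) →
    ContDiff ℝ n (fun z => ∫ t in (0 : ℝ)..1, f z t) := by
  induction n with
  | zero =>
    intro F _ _ f hf
    simp only [Nat.cast_zero, contDiff_zero] at hf ⊢
    exact intervalIntegral.continuous_parametric_intervalIntegral_of_continuous' hf 0 1
  | succ n ih =>
    intro F _ _ f hf
    push_cast at hf ⊢
    rw [contDiff_succ_iff_hasFDerivAt]
    have h1 : ContDiff ℝ 1 (Function.uncurry f) := hf.of_le (by simp)
    refine ⟨fun z => ∫ t in (0 : ℝ)..1, fderiv ℝ (fun w => f w t) z, ih ?_,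
      hasFDerivAt_unitIntervalIntegral h1⟩
    exact ContDiff.fderiv (f := fun (q : E × ℝ) w => f w q.2) (g := fun q : E × ℝ => q.1) (n := n)
      (m := n + 1) (by
        exact hf.comp (contDiff_snd.prodMk (contDiff_snd.comp contDiff_fst) :
          ContDiff ℝ (n + 1) fun q : (E × ℝ) × E => (q.2, q.1.2))) contDiff_fst le_rfl

theorem contDiff_unitIntervalIntegral {f : E → ℝ → F} (hf : ContDiff ℝ ∞ (Function.uncurry f)) :
    ContDiff ℝ ∞ (fun z => ∫ t in (0 : ℝ)..1, f z t) :=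
  contDiff_infty.2 fun n => contDiff_nat_unitIntervalIntegral n (contDiff_infty.1 hf n)

end ParametricIntegral

/-- The space of the variables `(x, y, u)`. -/
abbrev Jet0 (m : ℕ) : Type := ℝ × ℝ × (Fin m → ℝ)

/-- Poincaré lemma in the variables `u`, with parameters `x, y`. -/
theorem exists_potential {m : ℕ} {a : Fin m → Jet0 m → ℝ} (ha : ∀ α, ContDiff ℝ ∞ (a α))
    {z₀ : Jet0 m} {r : ℝ}
    (hclosed : ∀ z ∈ ball z₀ r, ∀ α β, fderiv ℝ (a α) z (0, 0, Pi.single β 1) =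
      fderiv ℝ (a β) z (0, 0, Pi.single α 1)) :
    ∃ φ : Jet0 m → ℝ, ContDiff ℝ ∞ φ ∧
      ∀ z ∈ ball z₀ r, ∀ α, fderiv ℝ φ z (0, 0, Pi.single α 1) = a α z := by
  -- Only the `u`-component is contracted to the centre; `x` and `y` are parameters. The path stays
  -- in the ball because the ball is a product of balls.
  let c : Jet0 m → ℝ → Jet0 m := fun z t => (z.1, z.2.1, z₀.2.2 + t • (z.2.2 - z₀.2.2))
  let f : Jet0 m → ℝ → ℝ := fun z t => ∑ β, a β (c z t) * (z.2.2 β - z₀.2.2 β)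
  have hc : ContDiff ℝ ∞ (Function.uncurry c) := by
    unfold c Function.uncurry
    fun_prop
  have hf : ContDiff ℝ ∞ (Function.uncurry f) := by
    have h1 : ∀ β, ContDiff ℝ ∞ fun w : Jet0 m × ℝ => a β (c w.1 w.2) := fun β => (ha β).comp hc
    unfold f Function.uncurry
    refine ContDiff.sum fun β _ => (h1 β).mul ?_
    fun_prop
  refine ⟨fun z => ∫ t in (0 : ℝ)..1, f z t, contDiff_unitIntervalIntegral hf, ?_⟩
  intro z hz α
  have hd : ∀ t, HasFDerivAt (fun w => f w t) (∑ β, ((a β (c z t)) •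
      ((ContinuousLinearMap.proj β).comp ((ContinuousLinearMap.snd ℝ _ _).comp (ContinuousLinearMap.snd ℝ _ _)) :
        Jet0 m →L[ℝ] ℝ) + (z.2.2 β - z₀.2.2 β) •
      ((fderiv ℝ (a β) (c z t)).comp
        ((ContinuousLinearMap.fst ℝ _ _).prod (((ContinuousLinearMap.fst ℝ _ _).comp (ContinuousLinearMap.snd ℝ _ _)).prod
          (t • ((ContinuousLinearMap.snd ℝ _ _).comp (ContinuousLinearMap.snd ℝ _ _)))) : Jet0 m →L[ℝ] Jet0 m)))) z := by
    intro t
    refine HasFDerivAt.fun_sum fun β _ => ?_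
    refine HasFDerivAt.mul ?_ ?_
    · have h1 : HasFDerivAt (a β) (fderiv ℝ (a β) (c z t)) (c z t) :=
        ((ha β).differentiable (by simp) _).hasFDerivAt
      refine h1.comp (g := a β) z ?_
      have : HasFDerivAt (fun w : Jet0 m => (w.1, w.2.1, z₀.2.2 + t • (w.2.2 - z₀.2.2)))
        ((ContinuousLinearMap.fst ℝ _ _).prod (((ContinuousLinearMap.fst ℝ _ _).comp (ContinuousLinearMap.snd ℝ _ _)).prod
          (t • ((ContinuousLinearMap.snd ℝ _ _).comp (ContinuousLinearMap.snd ℝ _ _))))) z := by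
        refine hasFDerivAt_fst.prodMk ((hasFDerivAt_fst.comp z hasFDerivAt_snd).prodMk ?_)
        exact (((hasFDerivAt_snd.comp z hasFDerivAt_snd).sub_const _).const_smul t).const_add _
      exact this
    · exact (((ContinuousLinearMap.proj β).comp ((ContinuousLinearMap.snd ℝ _ _).comp
        (ContinuousLinearMap.snd ℝ _ _)) : Jet0 m →L[ℝ] ℝ).hasFDerivAt).sub_const _
  have hint : ∀ z', IntervalIntegrable (fun t => fderiv ℝ (fun w => f w t) z') volume 0 1 := by
    intro z'
    apply Continuous.intervalIntegrable
    have := ContDiff.fderiv (f := fun (q : ℝ) w => f w q) (g := fun q : ℝ => z') (n := 0)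
      (m := 1) (by
        exact (hf.of_le (by simp)).comp (contDiff_snd.prodMk contDiff_fst)) contDiff_const (by simp)
    exact this.continuous
  rw [(hasFDerivAt_unitIntervalIntegral (hf.of_le (by simp)) z).fderiv,
    ContinuousLinearMap.intervalIntegral_apply (hint z)]
  -- By closedness the `u^α`-derivative of the integrand is the `t`-derivative of `t * a α (c z t)`,
  -- so the integral is the value at `t = 1`.
  have hda : ∀ t, HasDerivAt (fun t => t * a α (c z t))
      (1 * a α (c z t) + t * fderiv ℝ (a α) (c z t) (0, 0, z.2.2 - z₀.2.2)) t := by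
    intro t
    refine (hasDerivAt_id t).mul ?_
    have h1 : HasFDerivAt (a α) (fderiv ℝ (a α) (c z t)) (c z t) :=
        ((ha α).differentiable (by simp) _).hasFDerivAt
    refine h1.comp_hasDerivAt (f := c z) t ?_
    refine (hasDerivAt_const t z.1).prodMk ((hasDerivAt_const t z.2.1).prodMk ?_)
    simpa using ((hasDerivAt_id t).smul_const (z.2.2 - z₀.2.2)).const_add z₀.2.2
  have hcb : ∀ t ∈ Icc (0 : ℝ) 1, c z t ∈ ball z₀ r := by
    intro t ht
    have hr : 0 < r := pos_of_mem_ball hz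
    simp only [c, mem_ball, Prod.dist_eq, max_lt_iff] at hz ⊢
    refine ⟨hz.1, hz.2.1, ?_⟩
    rw [dist_eq_norm, add_sub_cancel_left, norm_smul]
    have h2 : ‖z.2.2 - z₀.2.2‖ < r := by rw [← dist_eq_norm]; exact hz.2.2
    calc ‖t‖ * ‖z.2.2 - z₀.2.2‖ ≤ 1 * ‖z.2.2 - z₀.2.2‖ := by
          gcongr
          rw [Real.norm_of_nonneg ht.1]; exact ht.2
      _ < r := by simpa using h2
  have hval : ∀ t ∈ uIcc (0 : ℝ) 1, fderiv ℝ (fun w => f w t) z (0, 0, Pi.single α 1) =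
      1 * a α (c z t) + t * fderiv ℝ (a α) (c z t) (0, 0, z.2.2 - z₀.2.2) := by
    intro t ht
    rw [uIcc_of_le zero_le_one] at ht
    rw [(hd t).fderiv]
    have hw : ((0, 0, z.2.2 - z₀.2.2) : Jet0 m) =
        ∑ β, (z.2.2 β - z₀.2.2 β) • ((0, 0, Pi.single β 1) : Jet0 m) := by
      refine Prod.ext ?_ (Prod.ext ?_ ?_)
      · simp [Prod.fst_sum]
      · simp [Prod.fst_sum, Prod.snd_sum]
      · ext i
        simp [Prod.snd_sum, Finset.sum_apply, Pi.single_apply]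
    rw [hw, map_sum]
    simp only [_root_.sum_apply, _root_.add_apply, _root_.smul_apply,
      Finset.sum_add_distrib, ContinuousLinearMap.comp_apply, ContinuousLinearMap.prod_apply, map_smul, smul_eq_mul]
    congr 1
    · simp [Pi.single_apply]
    · rw [Finset.mul_sum]
      refine Finset.sum_congr rfl fun β _ => ?_
      rw [hclosed _ (hcb t ht) α β]
      have : ((0, 0, t • Pi.single α 1) : Jet0 m) = t • ((0, 0, Pi.single α 1) : Jet0 m) := by simp
      simp only [ContinuousLinearMap.coe_fst', ContinuousLinearMap.coe_snd']
      rw [this, map_smul, smul_eq_mul]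
      ring
  have hcz : c z 1 = z := by simp [c]
  rw [intervalIntegral.integral_congr hval,
    intervalIntegral.integral_eq_sub_of_hasDerivAt (fun t _ => hda t)]
  · simp [hcz]
  · apply Continuous.intervalIntegrable
    have h3 : Continuous (c z) := hc.continuous.comp (Continuous.prodMk_right z)
    have h4 : Continuous (fderiv ℝ (a α)) := (ha α).continuous_fderiv (by simp)
    have h5 := (ha α).continuous
    fun_prop

end

/-! ### The Goursat problem and linear ordinary differential equations. -/

section

/-- `∫₀ˣ k(s, y) ds` -/
def primX (k : ℝ × ℝ → ℝ) (p : ℝ × ℝ) : ℝ := p.1 * ∫ s in (0 : ℝ)..1, k (p.1 * s, p.2)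

/-- `∫₀ʸ k(x, t) dt` -/
def primY (k : ℝ × ℝ → ℝ) (p : ℝ × ℝ) : ℝ := p.2 * ∫ t in (0 : ℝ)..1, k (p.1, p.2 * t)

theorem ContDiff.primX {k : ℝ × ℝ → ℝ} {n : ℕ} (hk : ContDiff ℝ n k) : ContDiff ℝ n (primX k) := by
  refine contDiff_fst.mul (contDiff_nat_unitIntervalIntegral n
    (f := fun (p : ℝ × ℝ) s => k (p.1 * s, p.2)) ?_)
  have : ContDiff ℝ n fun w : (ℝ × ℝ) × ℝ => (w.1.1 * w.2, w.1.2) := by fun_prop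
  exact hk.comp this

theorem ContDiff.primY {k : ℝ × ℝ → ℝ} {n : ℕ} (hk : ContDiff ℝ n k) : ContDiff ℝ n (primY k) := by
  refine contDiff_snd.mul (contDiff_nat_unitIntervalIntegral n
    (f := fun (p : ℝ × ℝ) s => k (p.1, p.2 * s)) ?_)
  have : ContDiff ℝ n fun w : (ℝ × ℝ) × ℝ => (w.1.1, w.1.2 * w.2) := by fun_prop
  exact hk.comp this

theorem Continuous.primX {k : ℝ × ℝ → ℝ} (hk : Continuous k) : Continuous (primX k) := by
  have := ContDiff.primX (n := 0) (k := k) (by simpa using hk)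
  simpa using this

theorem Continuous.primY {k : ℝ × ℝ → ℝ} (hk : Continuous k) : Continuous (primY k) := by
  have := ContDiff.primY (n := 0) (k := k) (by simpa using hk)
  simpa using this

theorem hasDerivAt_primX {k : ℝ × ℝ → ℝ} (hk : Continuous k) (p : ℝ × ℝ) :
    HasDerivAt (fun x => primX k (x, p.2)) (k p) p.1 := by
  have h : (fun x => primX k (x, p.2)) = fun x => ∫ s in (0 : ℝ)..x, k (s, p.2) := by
    ext x
    simp only [primX]
    rw [intervalIntegral.mul_integral_comp_mul_left (f := fun s => k (s, p.2))]
    simp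
  rw [h]
  exact intervalIntegral.integral_hasDerivAt_right (Continuous.intervalIntegrable (by fun_prop) _ _)
    (Continuous.stronglyMeasurableAtFilter (by fun_prop) _ _) (by fun_prop)

theorem hasDerivAt_primY {k : ℝ × ℝ → ℝ} (hk : Continuous k) (p : ℝ × ℝ) :
    HasDerivAt (fun y => primY k (p.1, y)) (k p) p.2 := by
  have h : (fun y => primY k (p.1, y)) = fun y => ∫ t in (0 : ℝ)..y, k (p.1, t) := by
    ext y
    simp only [primY]
    rw [intervalIntegral.mul_integral_comp_mul_left (f := fun t => k (p.1, t))]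
    simp
  rw [h]
  exact intervalIntegral.integral_hasDerivAt_right (Continuous.intervalIntegrable (by fun_prop) _ _)
    (Continuous.stronglyMeasurableAtFilter (by fun_prop) _ _) (by fun_prop)

/-- Fubini's theorem. It makes the `y`-derivative of the iterated primitive as accessible as its
`x`-derivative. -/
theorem primX_primY_comm {k : ℝ × ℝ → ℝ} (hk : Continuous k) :
    primX (primY k) = primY (primX k) := by
  ext p
  simp only [primX, primY]
  rw [intervalIntegral.integral_const_mul, intervalIntegral.integral_const_mul,
    intervalIntegral_intervalIntegral_swap]
  · ring
  · have h : Continuous (Function.uncurry fun s t => k (p.1 * s, p.2 * t)) := by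
      unfold Function.uncurry
      fun_prop
    exact (h.continuousOn.integrableOn_compact (isCompact_uIcc.prod isCompact_uIcc)).mono_set
      (Set.prod_mono uIoc_subset_uIcc uIoc_subset_uIcc)

theorem hasFDerivAt_primX_primY {k : ℝ × ℝ → ℝ} (hk : Continuous k) (p : ℝ × ℝ) :
    HasFDerivAt (primX (primY k)) ((ContinuousLinearMap.toSpanSingleton ℝ (primY k p)).coprod
      (ContinuousLinearMap.toSpanSingleton ℝ (primX k p))) p := by
  have := hasStrictFDerivAt_uncurry_coprod (𝕜 := ℝ) (u := p)
    (f := fun x y => primX (primY k) (x, y))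
    (f₁ := fun x y => ContinuousLinearMap.toSpanSingleton ℝ (primY k (x, y)))
    (f₂ := fun x y => ContinuousLinearMap.toSpanSingleton ℝ (primX k (x, y)))
    (Filter.Eventually.of_forall fun v => (hasDerivAt_primX hk.primY v).hasFDerivAt)
    (Filter.Eventually.of_forall fun v => by
      rw [primX_primY_comm hk]
      exact (hasDerivAt_primY hk.primX v).hasFDerivAt)
    (by
      have h1 := hk.primY
      have : Continuous fun q : ℝ × ℝ => ContinuousLinearMap.toSpanSingleton ℝ (primY k q) :=
        (ContinuousLinearMap.toSpanSingletonCLE (𝕜 := ℝ) (E := ℝ)).continuous.comp h1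
      exact this.continuousAt)
    (by
      have h1 := hk.primX
      have : Continuous fun q : ℝ × ℝ => ContinuousLinearMap.toSpanSingleton ℝ (primX k q) :=
        (ContinuousLinearMap.toSpanSingletonCLE (𝕜 := ℝ) (E := ℝ)).continuous.comp h1
      exact this.continuousAt)
  exact this.hasFDerivAt

/-- Both partial derivatives of the iterated primitive are single primitives of `k`, hence as smooth
as `k`. This gain of one derivative drives the bootstrap in `exists_goursat_zero`. -/
theorem contDiff_primX_primY_succ {k : ℝ × ℝ → ℝ} {n : ℕ} (hk : ContDiff ℝ n k) :
    ContDiff ℝ (n + 1) (primX (primY k)) := by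
  rw [contDiff_succ_iff_hasFDerivAt]
  refine ⟨_, ?_, hasFDerivAt_primX_primY hk.continuous⟩
  have h1 : ContDiff ℝ n fun q => ContinuousLinearMap.toSpanSingleton ℝ (primY k q) :=
    (ContinuousLinearMap.toSpanSingletonCLE (𝕜 := ℝ) (E := ℝ)).contDiff.comp hk.primY
  have h2 : ContDiff ℝ n fun q => ContinuousLinearMap.toSpanSingleton ℝ (primX k q) :=
    (ContinuousLinearMap.toSpanSingletonCLE (𝕜 := ℝ) (E := ℝ)).contDiff.comp hk.primX
  rw [contDiff_clm_apply_iff]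
  intro v
  simp only [ContinuousLinearMap.coprod_apply]
  exact (h1.clm_apply contDiff_const).add (h2.clm_apply contDiff_const)

theorem abs_primX_primY_le {k : ℝ × ℝ → ℝ} {C : ℝ} (hC : ∀ p, |k p| ≤ C) (p : ℝ × ℝ) :
    |primX (primY k) p| ≤ |p.1| * |p.2| * C := by
  have h1 : ∀ q, |primY k q| ≤ |q.2| * C := by
    intro q
    rw [primY, abs_mul]
    gcongr
    simpa using intervalIntegral.norm_integral_le_of_norm_le_const (a := (0 : ℝ)) (b := 1)
      (f := fun t => k (q.1, q.2 * t)) (C := C) fun t _ => hC _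
  rw [primX, abs_mul, mul_assoc]
  gcongr
  simpa using intervalIntegral.norm_integral_le_of_norm_le_const (a := (0 : ℝ)) (b := 1)
      (f := fun t => primY k (p.1 * t, p.2)) (C := |p.2| * C) fun t _ => h1 _

theorem primX_primY_sub {k l : ℝ × ℝ → ℝ} (hk : Continuous k) (hl : Continuous l) (p : ℝ × ℝ) :
    primX (primY (fun q => k q - l q)) p = primX (primY k) p - primX (primY l) p := by
  have h1 : primY (fun q => k q - l q) = fun q => primY k q - primY l q := by
    ext q
    simp only [primY]
    rw [intervalIntegral.integral_sub, mul_sub] <;>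
    exact Continuous.intervalIntegrable (by fun_prop) _ _
  have h2 := hk.primY
  have h3 := hl.primY
  rw [h1]
  simp only [primX]
  rw [intervalIntegral.integral_sub, mul_sub] <;>
    exact Continuous.intervalIntegrable (by fun_prop) _ _

-- The unknown is `k = s_xy`, with `s` its iterated primitive. Then `k ↦ λ s + μ` is a contraction
-- with constant 1/2 on bounded continuous functions.
open BoundedContinuousFunction in
theorem exists_continuous_goursat {lam mu : ℝ × ℝ → ℝ} (hlam : Continuous lam) (hmu : Continuous mu)
    {A : ℝ} (hA : ∀ p, |mu p| ≤ A) (hsmall : ∀ p, |lam p| * (|p.1| * |p.2|) ≤ 1 / 2) :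
    ∃ k : ℝ × ℝ → ℝ, Continuous k ∧ ∀ p, k p = lam p * primX (primY k) p + mu p := by
  have key : ∀ (k : ℝ × ℝ → ℝ) (C : ℝ), (∀ p, |k p| ≤ C) →
      ∀ p, |lam p * primX (primY k) p| ≤ 1 / 2 * C := by
    intro k C hC p
    have hC0 : 0 ≤ C := (abs_nonneg _).trans (hC p)
    rw [abs_mul]
    calc |lam p| * |primX (primY k) p| ≤ |lam p| * (|p.1| * |p.2| * C) := by
          gcongr; exact abs_primX_primY_le hC p
      _ = |lam p| * (|p.1| * |p.2|) * C := by ring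
      _ ≤ 1 / 2 * C := by gcongr; exact hsmall p
  have hex : ∀ k : ℝ × ℝ →ᵇ ℝ, ∃ l : ℝ × ℝ →ᵇ ℝ, ∀ p, l p = lam p * primX (primY k) p + mu p :=
    fun k => ⟨BoundedContinuousFunction.ofNormedAddCommGroup
      (fun p => lam p * primX (primY k) p + mu p)
      ((hlam.mul k.continuous.primY.primX).add hmu) (1 / 2 * ‖k‖ + A) (fun p =>
        (norm_add_le _ _).trans (add_le_add (key k ‖k‖ (fun q => k.norm_coe_le_norm q) p) (hA p))),
      fun p => rfl⟩
  choose T hTa using hex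
  have hT : ContractingWith (1 / 2) T := by
    have h2 : ((1 / 2 : NNReal) : ℝ) = 1 / 2 := by norm_num
    refine ⟨by rw [← NNReal.coe_lt_coe, h2]; norm_num, LipschitzWith.of_dist_le_mul fun k l => ?_⟩
    refine (BoundedContinuousFunction.dist_le (mul_nonneg (NNReal.coe_nonneg _) dist_nonneg)).2 fun p => ?_
    have h1 := key (fun q => k q - l q) (dist k l) (fun q => by
      have := BoundedContinuousFunction.dist_coe_le_dist (f := k) (g := l) q
      rwa [Real.dist_eq] at this) p
    rw [primX_primY_sub k.continuous l.continuous] at h1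
    rw [Real.dist_eq]
    rw [hTa, hTa]
    rw [h2]
    convert h1 using 2
    ring
  obtain ⟨k, hk⟩ : ∃ k, T k = k := ⟨_, hT.fixedPoint_isFixedPt⟩
  refine ⟨k, k.continuous, fun p => ?_⟩
  rw [← hTa, hk]

theorem exists_goursat_zero {lam mu : ℝ × ℝ → ℝ} (hlam : ContDiff ℝ ∞ lam) (hmu : ContDiff ℝ ∞ mu) :
    ∃ s : ℝ × ℝ → ℝ, ContDiff ℝ ∞ s ∧ ∃ r > 0, ∀ z ∈ ball (0 : ℝ × ℝ) r,
      fderiv ℝ (fun w => fderiv ℝ s w (1, 0)) z (0, 1) = lam z * s z + mu z := by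
  obtain ⟨A, hA⟩ := (isCompact_closedBall (0 : ℝ × ℝ) 1).exists_bound_of_continuousOn
    hlam.continuous.continuousOn
  obtain ⟨B, hB⟩ := (isCompact_closedBall (0 : ℝ × ℝ) 1).exists_bound_of_continuousOn
    hmu.continuous.continuousOn
  have hA0 : 0 ≤ A := (norm_nonneg _).trans (hA 0 (mem_closedBall_self zero_le_one))
  -- On the ball of radius `e ≤ 1` one has `|λ| |x| |y| ≤ A e ≤ 1/2`, as the contraction requires.
  -- The cut-off makes this bound global, and the equation is recovered where the cut-off is 1.
  let e : ℝ := 1 / (2 * (A + 1))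
  have he : 0 < e := by positivity
  have he1 : e ≤ 1 := by
    rw [div_le_one (by positivity)]; linarith
  have heA : A * e ≤ 1 / 2 := by
    rw [mul_one_div, div_le_div_iff₀ (by positivity) (by positivity)]; linarith
  let χ : ContDiffBump (0 : ℝ × ℝ) := ⟨e / 2, e, by positivity, by linarith⟩
  have hout : ∀ p, p ∉ ball (0 : ℝ × ℝ) e → χ p = 0 := fun p hp =>
    χ.zero_of_le_dist (not_lt.1 hp)
  have hl : ContDiff ℝ ∞ fun p => χ p * lam p := χ.contDiff.mul hlam
  have hm : ContDiff ℝ ∞ fun p => χ p * mu p := χ.contDiff.mul hmu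
  obtain ⟨k, hk, hkeq⟩ := exists_continuous_goursat (lam := fun p => χ p * lam p)
    (mu := fun p => χ p * mu p) hl.continuous hm.continuous (A := |B|) (by
      intro p
      by_cases hp : p ∈ ball (0 : ℝ × ℝ) e
      · rw [abs_mul, abs_of_nonneg χ.nonneg]
        calc χ p * |mu p| ≤ 1 * B := by
              gcongr
              · exact χ.le_one
              · exact hB p (ball_subset_closedBall (ball_subset_ball he1 hp))
          _ ≤ |B| := by rw [one_mul]; exact le_abs_self B
      · simp [hout p hp]) (by
      intro p
      by_cases hp : p ∈ ball (0 : ℝ × ℝ) e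
      · have hp' := hp
        rw [mem_ball_zero_iff, Prod.norm_def, max_lt_iff, Real.norm_eq_abs, Real.norm_eq_abs] at hp'
        rw [abs_mul, abs_of_nonneg χ.nonneg]
        calc χ p * |lam p| * (|p.1| * |p.2|) ≤ 1 * A * (1 * e) := by
              gcongr
              · exact χ.le_one
              · exact hA p (ball_subset_closedBall (ball_subset_ball he1 hp))
              · exact hp'.1.le.trans he1
              · exact hp'.2.le
          _ ≤ 1 / 2 := by linarith
      · simp [hout p hp])
  -- Bootstrap: if `s` is of class `n`, so is `k = λ s + μ` (with cut-offs), and then `s` is of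
  -- class `n + 1`.
  have hsmooth : ∀ n : ℕ, ContDiff ℝ n (primX (primY k)) := by
    intro n
    induction n with
    | zero => simpa using hk.primY.primX
    | succ n ih =>
      have : ContDiff ℝ n k := by
        have h1 : k = fun p => χ p * lam p * primX (primY k) p + χ p * mu p := funext hkeq
        rw [h1]
        exact ((contDiff_infty.1 hl n).mul ih).add (contDiff_infty.1 hm n)
      exact_mod_cast contDiff_primX_primY_succ this
  refine ⟨primX (primY k), contDiff_infty.2 hsmooth, e / 2, by positivity, fun z hz => ?_⟩
  have h1 : (fun w => fderiv ℝ (primX (primY k)) w (1, 0)) = primY k := by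
    ext w
    rw [(hasFDerivAt_primX_primY hk w).fderiv]
    simp
  have hχ : χ z = 1 := χ.one_of_mem_closedBall (ball_subset_closedBall hz)
  have hky : ContDiff ℝ 1 k := by
    have h1 : k = fun p => χ p * lam p * primX (primY k) p + χ p * mu p := funext hkeq
    rw [h1]
    exact ((contDiff_infty.1 hl 1).mul (hsmooth 1)).add (contDiff_infty.1 hm 1)
  have h2 : HasFDerivAt (primY k) (fderiv ℝ (primY k) z) z :=
    ((ContDiff.primY (n := 1) hky).differentiable (by simp) z).hasFDerivAt
  have h3 : HasDerivAt (fun y => (z.1, y)) ((0 : ℝ), (1 : ℝ)) z.2 :=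
    (hasDerivAt_const _ _).prodMk (hasDerivAt_id _)
  have h4 := (h2.comp_hasDerivAt (f := fun y => (z.1, y)) z.2 h3).unique (hasDerivAt_primY hk z)
  rw [h1, h4, hkeq z, hχ]
  ring

/-- Local solvability of the linear hyperbolic equation `s_xy = λ s + μ`. -/
theorem exists_goursat {lam mu : ℝ × ℝ → ℝ} (hlam : ContDiff ℝ ∞ lam) (hmu : ContDiff ℝ ∞ mu)
    (p : ℝ × ℝ) :
    ∃ s : ℝ × ℝ → ℝ, ContDiff ℝ ∞ s ∧ ∃ r > 0, ∀ z ∈ ball p r,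
      fderiv ℝ (fun w => fderiv ℝ s w (1, 0)) z (0, 1) = lam z * s z + mu z := by
  have ht : ContDiff ℝ ∞ fun z : ℝ × ℝ => z + p := contDiff_id.add contDiff_const
  obtain ⟨s, hs, r, hr, h⟩ := exists_goursat_zero (hlam.comp ht) (hmu.comp ht)
  refine ⟨fun z => s (z - p), hs.comp (contDiff_id.sub contDiff_const), r, hr, fun z hz => ?_⟩
  have h1 := h (z - p) (by rwa [mem_ball_zero_iff, ← dist_eq_norm])
  simp only [Function.comp_apply, sub_add_cancel] at h1
  rw [← h1]
  have h2 : (fun w => fderiv ℝ (fun z => s (z - p)) w (1, 0)) =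
      fun w => (fun w => fderiv ℝ s w (1, 0)) (w - p) := by
    ext w
    rw [fderiv_comp_sub]
  rw [h2, fderiv_comp_sub (f := fun w => fderiv ℝ s w (1, 0))]

/-- A solution of a linear system of ordinary differential equations which vanishes initially
vanishes. -/
theorem eq_zero_of_hasDerivAt_linear {n : Type*} [Fintype n] {s : ℝ → n → ℝ}
    {A : ℝ → (n → ℝ) →L[ℝ] (n → ℝ)} (hA : ContinuousOn A (Icc 0 1))
    (hs : ∀ t ∈ Icc (0 : ℝ) 1, HasDerivAt s (A t (s t)) t) (h0 : s 0 = 0) : s 1 = 0 := by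
  obtain ⟨K, hK⟩ := isCompact_Icc.exists_bound_of_continuousOn hA
  refine eq_zero_of_abs_deriv_le_mul_abs_self_of_eq_zero_right (f := s) (f' := fun t => A t (s t))
    (K := K) (a := 0) (b := 1) (fun t ht => (hs t ht).continuousAt.continuousWithinAt)
    (fun t ht => (hs t (Ico_subset_Icc_self ht)).hasDerivWithinAt) h0 (fun t ht => ?_) 1 (by simp)
  exact ((A t).le_opNorm _).trans (by gcongr; exact hK t (Ico_subset_Icc_self ht))

end

/-! ### Calculus on jets and Euler-Lagrange expressions of kinetic Lagrangians. -/

section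

section SecondDerivative

variable {E F : Type*} [NormedAddCommGroup E] [NormedSpace ℝ E]
  [NormedAddCommGroup F] [NormedSpace ℝ F]

theorem ContDiff.hasFDerivAt_of_smooth {h : E → F} (hh : ContDiff ℝ ∞ h) (p : E) :
    HasFDerivAt h (fderiv ℝ h p) p :=
  (hh.differentiable (by simp) p).hasFDerivAt

theorem ContDiff.fderiv_smooth {h : E → F} (hh : ContDiff ℝ ∞ h) : ContDiff ℝ ∞ (fderiv ℝ h) :=
  hh.fderiv_right (by simp)

theorem ContDiff.fderiv_apply_smooth {h : E → F} (hh : ContDiff ℝ ∞ h) (v : E) :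
    ContDiff ℝ ∞ (fun p => fderiv ℝ h p v) :=
  hh.fderiv_smooth.clm_apply contDiff_const

theorem ContDiff.hasFDerivAt_fderiv_apply {h : E → F} (hh : ContDiff ℝ ∞ h) (p v : E) :
    HasFDerivAt (fun p => fderiv ℝ h p v) ((fderiv ℝ (fderiv ℝ h) p).flip v) p := by
  have h1 := (hh.fderiv_smooth.hasFDerivAt_of_smooth p).clm_apply (hasFDerivAt_const v p)
  refine h1.congr_fderiv ?_
  ext w
  simp

theorem ContDiff.fderiv_fderiv_apply {h : E → F} (hh : ContDiff ℝ ∞ h) (p v w : E) :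
    fderiv ℝ (fun p => fderiv ℝ h p v) p w = fderiv ℝ (fderiv ℝ h) p w v := by
  rw [(hh.hasFDerivAt_fderiv_apply p v).fderiv]
  rfl

theorem ContDiff.fderiv_fderiv_comm {h : E → F} (hh : ContDiff ℝ ∞ h) (p v w : E) :
    fderiv ℝ (fderiv ℝ h) p v w = fderiv ℝ (fderiv ℝ h) p w v :=
  second_derivative_symmetric (fun y => hh.hasFDerivAt_of_smooth y)
    (hh.fderiv_smooth.hasFDerivAt_of_smooth p) v w

theorem ContDiff.fderiv_apply_comm {h : E → F} (hh : ContDiff ℝ ∞ h) (p v w : E) :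
    fderiv ℝ (fun p => fderiv ℝ h p v) p w = fderiv ℝ (fun p => fderiv ℝ h p w) p v := by
  rw [hh.fderiv_fderiv_apply, hh.fderiv_fderiv_apply, hh.fderiv_fderiv_comm]

theorem fderiv_mul_apply {f g : E → ℝ} (hf : ContDiff ℝ ∞ f) (hg : ContDiff ℝ ∞ g) (p v : E) :
    fderiv ℝ (fun p => f p * g p) p v = f p * fderiv ℝ g p v + g p * fderiv ℝ f p v := by
  rw [((hf.hasFDerivAt_of_smooth p).fun_mul (hg.hasFDerivAt_of_smooth p)).fderiv]
  simp

end SecondDerivative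

variable {m : ℕ}

/-- The projection `J¹ → J⁰`. -/
def Jet1.toJet0 : Jet1 m →L[ℝ] Jet0 m :=
  (ContinuousLinearMap.fst ℝ _ _).prod
    (((ContinuousLinearMap.fst ℝ _ _).comp (ContinuousLinearMap.snd ℝ _ _)).prod
      ((ContinuousLinearMap.fst ℝ _ _).comp
        ((ContinuousLinearMap.snd ℝ _ _).comp (ContinuousLinearMap.snd ℝ _ _))))

@[simp]
theorem Jet1.toJet0_apply (p : Jet1 m) : Jet1.toJet0 p = (p.1, p.2.1, p.2.2.1) := rfl

/-- The coordinates `u_x`, as a linear map. -/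
def Jet1.uxL : Jet1 m →L[ℝ] (Fin m → ℝ) :=
  (ContinuousLinearMap.fst ℝ _ _).comp ((ContinuousLinearMap.snd ℝ _ _).comp
    ((ContinuousLinearMap.snd ℝ _ _).comp (ContinuousLinearMap.snd ℝ _ _)))

@[simp]
theorem Jet1.uxL_apply (p : Jet1 m) : Jet1.uxL p = p.2.2.2.1 := rfl

/-- The coordinates `u_y`, as a linear map. -/
def Jet1.uyL : Jet1 m →L[ℝ] (Fin m → ℝ) :=
  (ContinuousLinearMap.snd ℝ _ _).comp ((ContinuousLinearMap.snd ℝ _ _).comp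
    ((ContinuousLinearMap.snd ℝ _ _).comp (ContinuousLinearMap.snd ℝ _ _)))

@[simp]
theorem Jet1.uyL_apply (p : Jet1 m) : Jet1.uyL p = p.2.2.2.2 := rfl

/-- The total derivative `D_x φ`, a function on `J¹`, of a function `φ` on `J⁰`. -/
def Jet1.totalX (φ : Jet0 m → ℝ) (p : Jet1 m) : ℝ := fderiv ℝ φ p.toJet0 (1, 0, p.ux)

/-- The total derivative `D_y φ`, a function on `J¹`, of a function `φ` on `J⁰`. -/
def Jet1.totalY (φ : Jet0 m → ℝ) (p : Jet1 m) : ℝ := fderiv ℝ φ p.toJet0 (0, 1, p.uy)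

/-- The part of `D_x D_y φ` that does not involve `u_xy`. -/
def Jet1.totalXY (φ : Jet0 m → ℝ) (p : Jet1 m) : ℝ :=
  fderiv ℝ (fderiv ℝ φ) p.toJet0 (1, 0, p.ux) (0, 1, p.uy)

theorem Jet0.mk_zero : ((0, 0, 0) : Jet0 m) = 0 := rfl

/-- `∂φ/∂u^β` -/
def Jet0.partialU (φ : Jet0 m → ℝ) (β : Fin m) (z : Jet0 m) : ℝ :=
  fderiv ℝ φ z (0, 0, Pi.single β 1)

theorem Jet0.fderiv_vertical (φ : Jet0 m → ℝ) (z : Jet0 m) (w : Fin m → ℝ) :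
    fderiv ℝ φ z (0, 0, w) = ∑ β, Jet0.partialU φ β z * w β := by
  have hw : ((0, 0, w) : Jet0 m) = ∑ β, w β • ((0, 0, Pi.single β 1) : Jet0 m) := by
    refine Prod.ext ?_ (Prod.ext ?_ ?_)
    · simp [Prod.fst_sum]
    · simp [Prod.fst_sum, Prod.snd_sum]
    · ext i
      simp [Prod.snd_sum, Finset.sum_apply, Pi.single_apply]
  rw [hw, map_sum]
  exact Finset.sum_congr rfl fun β _ => by rw [map_smul, smul_eq_mul, mul_comm]; rfl

theorem ContDiff.jet0_partialU {φ : Jet0 m → ℝ} (hφ : ContDiff ℝ ∞ φ) (β : Fin m) :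
    ContDiff ℝ ∞ (Jet0.partialU φ β) := hφ.fderiv_apply_smooth _

theorem Jet1.contDiff_totalX {φ : Jet0 m → ℝ} (hφ : ContDiff ℝ ∞ φ) :
    ContDiff ℝ ∞ (Jet1.totalX φ) := by
  refine (hφ.fderiv_smooth.comp Jet1.toJet0.contDiff).clm_apply ?_
  exact contDiff_const.prodMk (contDiff_const.prodMk Jet1.uxL.contDiff)

theorem Jet1.contDiff_totalY {φ : Jet0 m → ℝ} (hφ : ContDiff ℝ ∞ φ) :
    ContDiff ℝ ∞ (Jet1.totalY φ) := by
  refine (hφ.fderiv_smooth.comp Jet1.toJet0.contDiff).clm_apply ?_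
  exact contDiff_const.prodMk (contDiff_const.prodMk Jet1.uyL.contDiff)

theorem Jet1.contDiff_totalXY {φ : Jet0 m → ℝ} (hφ : ContDiff ℝ ∞ φ) :
    ContDiff ℝ ∞ (Jet1.totalXY φ) := by
  refine ((hφ.fderiv_smooth.fderiv_smooth.comp Jet1.toJet0.contDiff).clm_apply ?_).clm_apply ?_
  · exact contDiff_const.prodMk (contDiff_const.prodMk Jet1.uxL.contDiff)
  · exact contDiff_const.prodMk (contDiff_const.prodMk Jet1.uyL.contDiff)

theorem Jet1.hasFDerivAt_totalX {φ : Jet0 m → ℝ} (hφ : ContDiff ℝ ∞ φ) (p : Jet1 m) :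
    HasFDerivAt (Jet1.totalX φ)
      (((fderiv ℝ (fderiv ℝ φ) p.toJet0).flip (1, 0, p.ux)).comp Jet1.toJet0 +
        (fderiv ℝ φ p.toJet0).comp
          ((0 : Jet1 m →L[ℝ] ℝ).prod ((0 : Jet1 m →L[ℝ] ℝ).prod Jet1.uxL))) p := by
  have h1 : HasFDerivAt (fun p : Jet1 m => fderiv ℝ φ p.toJet0)
      ((fderiv ℝ (fderiv ℝ φ) p.toJet0).comp Jet1.toJet0) p :=
    (hφ.fderiv_smooth.hasFDerivAt_of_smooth _).comp p Jet1.toJet0.hasFDerivAt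
  have h2 : HasFDerivAt (fun p : Jet1 m => ((1, 0, p.ux) : Jet0 m))
      ((0 : Jet1 m →L[ℝ] ℝ).prod ((0 : Jet1 m →L[ℝ] ℝ).prod Jet1.uxL)) p :=
    (hasFDerivAt_const _ _).prodMk ((hasFDerivAt_const _ _).prodMk Jet1.uxL.hasFDerivAt)
  refine (h1.clm_apply h2).congr_fderiv ?_
  rw [add_comm]
  rfl

theorem Jet1.hasFDerivAt_totalY {φ : Jet0 m → ℝ} (hφ : ContDiff ℝ ∞ φ) (p : Jet1 m) :
    HasFDerivAt (Jet1.totalY φ)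
      (((fderiv ℝ (fderiv ℝ φ) p.toJet0).flip (0, 1, p.uy)).comp Jet1.toJet0 +
        (fderiv ℝ φ p.toJet0).comp
          ((0 : Jet1 m →L[ℝ] ℝ).prod ((0 : Jet1 m →L[ℝ] ℝ).prod Jet1.uyL))) p := by
  have h1 : HasFDerivAt (fun p : Jet1 m => fderiv ℝ φ p.toJet0)
      ((fderiv ℝ (fderiv ℝ φ) p.toJet0).comp Jet1.toJet0) p :=
    (hφ.fderiv_smooth.hasFDerivAt_of_smooth _).comp p Jet1.toJet0.hasFDerivAt
  have h2 : HasFDerivAt (fun p : Jet1 m => ((0, 1, p.uy) : Jet0 m))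
      ((0 : Jet1 m →L[ℝ] ℝ).prod ((0 : Jet1 m →L[ℝ] ℝ).prod Jet1.uyL)) p :=
    (hasFDerivAt_const _ _).prodMk ((hasFDerivAt_const _ _).prodMk Jet1.uyL.hasFDerivAt)
  refine (h1.clm_apply h2).congr_fderiv ?_
  rw [add_comm]
  rfl

theorem Jet1.fderiv_totalX {φ : Jet0 m → ℝ} (hφ : ContDiff ℝ ∞ φ) (p v : Jet1 m) :
    fderiv ℝ (Jet1.totalX φ) p v =
      fderiv ℝ (fderiv ℝ φ) p.toJet0 v.toJet0 (1, 0, p.ux) + fderiv ℝ φ p.toJet0 (0, 0, v.ux) := by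
  rw [(Jet1.hasFDerivAt_totalX hφ p).fderiv]
  rfl

theorem Jet1.fderiv_totalY {φ : Jet0 m → ℝ} (hφ : ContDiff ℝ ∞ φ) (p v : Jet1 m) :
    fderiv ℝ (Jet1.totalY φ) p v =
      fderiv ℝ (fderiv ℝ φ) p.toJet0 v.toJet0 (0, 1, p.uy) + fderiv ℝ φ p.toJet0 (0, 0, v.uy) := by
  rw [(Jet1.hasFDerivAt_totalY hφ p).fderiv]
  rfl

theorem Jet1.fderiv_comp_toJet0 {φ : Jet0 m → ℝ} (hφ : ContDiff ℝ ∞ φ) (p v : Jet1 m) :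
    fderiv ℝ (fun p : Jet1 m => φ p.toJet0) p v = fderiv ℝ φ p.toJet0 v.toJet0 := by
  have : HasFDerivAt (fun p : Jet1 m => φ p.toJet0) ((fderiv ℝ φ p.toJet0).comp Jet1.toJet0) p :=
    (hφ.hasFDerivAt_of_smooth _).comp p Jet1.toJet0.hasFDerivAt
  rw [this.fderiv]
  rfl

theorem eulerLagrange_congr {L₁ L₂ : Jet1 m → ℝ} {q : Jet2 m} (h : L₁ =ᶠ[𝓝 q.toJet1] L₂)
    (α : Fin m) : eulerLagrange L₁ α q = eulerLagrange L₂ α q := by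
  have h1 : ∀ v : Jet1 m, (fun p => fderiv ℝ L₁ p v) =ᶠ[𝓝 q.toJet1] fun p => fderiv ℝ L₂ p v :=
    fun v => h.fderiv.fun_comp (fun T : Jet1 m →L[ℝ] ℝ => T v)
  have h2 : ∀ v w : Jet1 m, fderiv ℝ (fun p => fderiv ℝ L₁ p v) q.toJet1 w =
      fderiv ℝ (fun p => fderiv ℝ L₂ p v) q.toJet1 w := fun v w => by rw [(h1 v).fderiv_eq]
  simp only [eulerLagrange, Jet1.partialU, Jet2.totalX, Jet2.totalY, h.fderiv_eq]
  exact congrArg₂ _ (congrArg₂ _ rfl (h2 _ _)) (h2 _ _)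

theorem eulerLagrange_sum {ι : Type*} (s : Finset ι) {L : ι → Jet1 m → ℝ} (c : ι → ℝ)
    (hL : ∀ i ∈ s, ContDiff ℝ ∞ (L i)) (α : Fin m) (q : Jet2 m) :
    eulerLagrange (fun p => ∑ i ∈ s, c i * L i p) α q = ∑ i ∈ s, c i * eulerLagrange (L i) α q := by
  have h1 : ∀ p v : Jet1 m, fderiv ℝ (fun p => ∑ i ∈ s, c i * L i p) p v =
      ∑ i ∈ s, c i * fderiv ℝ (L i) p v := by
    intro p v
    have : HasFDerivAt (fun p => ∑ i ∈ s, c i * L i p) (∑ i ∈ s, c i • fderiv ℝ (L i) p) p :=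
      HasFDerivAt.fun_sum fun i hi => ((hL i hi).hasFDerivAt_of_smooth p).const_mul (c i)
    rw [this.fderiv]
    simp
  have h2 : ∀ p v w : Jet1 m, fderiv ℝ (fun p => ∑ i ∈ s, c i * fderiv ℝ (L i) p v) p w =
      ∑ i ∈ s, c i * fderiv ℝ (fun p => fderiv ℝ (L i) p v) p w := by
    intro p v w
    have : HasFDerivAt (fun p => ∑ i ∈ s, c i * fderiv ℝ (L i) p v)
        (∑ i ∈ s, c i • fderiv ℝ (fun p => fderiv ℝ (L i) p v) p) p :=
      HasFDerivAt.fun_sum fun i hi =>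
        (((hL i hi).fderiv_apply_smooth v).hasFDerivAt_of_smooth p).const_mul (c i)
    rw [this.fderiv]
    simp
  have h3 : ∀ v, (fun p => fderiv ℝ (fun p => ∑ i ∈ s, c i * L i p) p v) =
      fun p => ∑ i ∈ s, c i * fderiv ℝ (L i) p v := fun v => funext fun p => h1 p v
  have h4 : ∀ (G : Jet1 m → ℝ) β, Jet1.partialUx G β =
    fun p => fderiv ℝ G p (0, 0, 0, Pi.single β 1, 0) := fun _ _ => rfl
  have h5 : ∀ (G : Jet1 m → ℝ) β, Jet1.partialUy G β =
    fun p => fderiv ℝ G p (0, 0, 0, 0, Pi.single β 1) := fun _ _ => rfl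
  simp only [eulerLagrange, Jet1.partialU, Jet2.totalX, Jet2.totalY, h4, h5,
    mul_sub, Finset.sum_sub_distrib]
  rw [← h2, ← h2, ← h3, ← h3, h1]

theorem eulerLagrange_sub {L₁ L₂ : Jet1 m → ℝ} (h₁ : ContDiff ℝ ∞ L₁) (h₂ : ContDiff ℝ ∞ L₂)
    (α : Fin m) (q : Jet2 m) : eulerLagrange (fun p => L₁ p - L₂ p) α q =
      eulerLagrange L₁ α q - eulerLagrange L₂ α q := by
  have h := eulerLagrange_sum Finset.univ (L := ![L₁, L₂]) ![1, -1] (fun i _ => by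
    fin_cases i <;> assumption) α q
  simp only [Fin.sum_univ_two, Matrix.cons_val_zero, Matrix.cons_val_one, one_mul, neg_mul] at h
  simpa only [sub_eq_add_neg] using h

theorem eulerLagrange_comp_toJet0 {H : Jet0 m → ℝ} (hH : ContDiff ℝ ∞ H) (α : Fin m) (q : Jet2 m) :
    eulerLagrange (fun p => H p.toJet0) α q = Jet0.partialU H α q.toJet1.toJet0 := by
  have h1 : ∀ w : Jet1 m, w.toJet0 = 0 → ∀ v, fderiv ℝ (fun p => fderiv ℝ (fun p => H (Jet1.toJet0 p)) p w) q.toJet1 v = 0 := by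
    intro w hw v
    have : (fun p => fderiv ℝ (fun p => H (Jet1.toJet0 p)) p w) = fun _ => 0 := by
      funext p
      rw [Jet1.fderiv_comp_toJet0 hH, hw, map_zero]
    rw [this]
    simp
  have h2 := Jet1.fderiv_comp_toJet0 hH q.toJet1 (0, 0, Pi.single α 1, 0, 0)
  simp only [eulerLagrange, Jet1.partialU, Jet2.totalX, Jet2.totalY]
  erw [h1 (0, 0, 0, Pi.single α 1, 0) rfl, h1 (0, 0, 0, 0, Pi.single α 1) rfl, h2]
  simp [Jet0.partialU]

/-- The Lagrangian `-½ C_{αβ} D_x φ^α D_y φ^β`. -/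
def kineticLagrangian (C : Fin m → Fin m → ℝ) (φ : Fin m → Jet0 m → ℝ) (p : Jet1 m) : ℝ :=
  ∑ α, ∑ β, (-(C α β) / 2) * (Jet1.totalX (φ α) p * Jet1.totalY (φ β) p)

theorem contDiff_kineticLagrangian (C : Fin m → Fin m → ℝ) {φ : Fin m → Jet0 m → ℝ}
    (hφ : ∀ α, ContDiff ℝ ∞ (φ α)) : ContDiff ℝ ∞ (kineticLagrangian C φ) :=
  ContDiff.sum fun α _ => ContDiff.sum fun β _ => contDiff_const.mul
    ((Jet1.contDiff_totalX (hφ α)).mul (Jet1.contDiff_totalY (hφ β)))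

/-- The variation of `D_x φ` is `D_x (φ_γ δu^γ)`. Integration by parts therefore gives `-φ_γ D_x D_y
ψ - ψ_γ D_x D_y φ`. -/
theorem eulerLagrange_totalX_mul_totalY {φ ψ : Jet0 m → ℝ} (hφ : ContDiff ℝ ∞ φ)
    (hψ : ContDiff ℝ ∞ ψ) (γ : Fin m) (q : Jet2 m) :
    eulerLagrange (fun p => Jet1.totalX φ p * Jet1.totalY ψ p) γ q =
      - (Jet0.partialU φ γ q.toJet1.toJet0 *
          (Jet1.totalXY ψ q.toJet1 + ∑ δ, Jet0.partialU ψ δ q.toJet1.toJet0 * q.uxy δ) +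
        Jet0.partialU ψ γ q.toJet1.toJet0 *
          (Jet1.totalXY φ q.toJet1 + ∑ δ, Jet0.partialU φ δ q.toJet1.toJet0 * q.uxy δ)) := by
  have h1 : ∀ p v : Jet1 m, fderiv ℝ (fun p => Jet1.totalX φ p * Jet1.totalY ψ p) p v =
      Jet1.totalX φ p * fderiv ℝ (Jet1.totalY ψ) p v +
        Jet1.totalY ψ p * fderiv ℝ (Jet1.totalX φ) p v := by
    intro p v
    exact fderiv_mul_apply (Jet1.contDiff_totalX hφ) (Jet1.contDiff_totalY hψ) p v
  have h2 : ∀ p : Jet1 m, Jet1.partialUx (fun p => Jet1.totalX φ p * Jet1.totalY ψ p) γ p =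
      Jet1.totalY ψ p * Jet0.partialU φ γ p.toJet0 := by
    intro p
    rw [Jet1.partialUx, h1, Jet1.fderiv_totalX hφ, Jet1.fderiv_totalY hψ]
    simp [Jet0.partialU, Jet1.ux, Jet1.uy, Jet0.mk_zero]
  have h3 : ∀ p : Jet1 m, Jet1.partialUy (fun p => Jet1.totalX φ p * Jet1.totalY ψ p) γ p =
      Jet1.totalX φ p * Jet0.partialU ψ γ p.toJet0 := by
    intro p
    rw [Jet1.partialUy, h1, Jet1.fderiv_totalX hφ, Jet1.fderiv_totalY hψ]
    simp [Jet0.partialU, Jet1.ux, Jet1.uy, Jet0.mk_zero]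
  have h4 : ∀ {χ : Jet0 m → ℝ} (hχ : ContDiff ℝ ∞ χ) (p v : Jet1 m),
      HasFDerivAt (fun p : Jet1 m => Jet0.partialU χ γ p.toJet0)
        (((fderiv ℝ (fderiv ℝ χ) p.toJet0).flip (0, 0, Pi.single γ 1)).comp Jet1.toJet0) p := by
    intro χ hχ p v
    exact (hχ.hasFDerivAt_fderiv_apply _ _).comp p Jet1.toJet0.hasFDerivAt
  have h5 : ∀ p v : Jet1 m, fderiv ℝ (fun p : Jet1 m => Jet1.totalY ψ p * Jet0.partialU φ γ p.toJet0) p v =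
      Jet1.totalY ψ p * fderiv ℝ (fderiv ℝ φ) p.toJet0 v.toJet0 (0, 0, Pi.single γ 1) +
        Jet0.partialU φ γ p.toJet0 * fderiv ℝ (Jet1.totalY ψ) p v := by
    intro p v
    rw [(((Jet1.contDiff_totalY hψ).hasFDerivAt_of_smooth p).fun_mul (h4 hφ p v)).fderiv]
    simp
  have h6 : ∀ p v : Jet1 m, fderiv ℝ (fun p : Jet1 m => Jet1.totalX φ p * Jet0.partialU ψ γ p.toJet0) p v =
      Jet1.totalX φ p * fderiv ℝ (fderiv ℝ ψ) p.toJet0 v.toJet0 (0, 0, Pi.single γ 1) +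
        Jet0.partialU ψ γ p.toJet0 * fderiv ℝ (Jet1.totalX φ) p v := by
    intro p v
    rw [(((Jet1.contDiff_totalX hφ).hasFDerivAt_of_smooth p).fun_mul (h4 hψ p v)).fderiv]
    simp
  rw [eulerLagrange, Jet2.totalX, Jet2.totalY, funext h2, funext h3, h5, h6, Jet1.partialU, h1]
  simp only [Jet1.fderiv_totalX hφ, Jet1.fderiv_totalY hψ, Jet1.totalXY,
    ← Jet0.fderiv_vertical]
  rw [hφ.fderiv_fderiv_comm _ (1, 0, q.toJet1.ux) (0, 1, q.toJet1.uy),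
    hφ.fderiv_fderiv_comm _ (Jet1.toJet0 (0, 0, Pi.single γ 1, 0, 0)),
    hψ.fderiv_fderiv_comm _ (Jet1.toJet0 (0, 0, Pi.single γ 1, 0, 0))]
  simp only [Jet1.toJet0_apply, Jet1.ux, Jet1.uy, Jet2.ux, Jet2.uy, Jet2.uxy, Jet2.toJet1]
  simp only [Jet0.mk_zero, map_zero]
  ring

/-- Symmetry of `C` makes the two terms of each product contribute equally after summation, which
cancels the factor `-1/2`. -/
theorem eulerLagrange_kineticLagrangian {C : Fin m → Fin m → ℝ} (hC : ∀ α β, C α β = C β α)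
    {φ : Fin m → Jet0 m → ℝ} (hφ : ∀ α, ContDiff ℝ ∞ (φ α)) (γ : Fin m) (q : Jet2 m) :
    eulerLagrange (kineticLagrangian C φ) γ q =
      ∑ α, ∑ β, Jet0.partialU (φ α) γ q.toJet1.toJet0 * C α β *
        (Jet1.totalXY (φ β) q.toJet1 + ∑ δ, Jet0.partialU (φ β) δ q.toJet1.toJet0 * q.uxy δ) := by
  have h1 : ∀ α β, ContDiff ℝ ∞ fun p : Jet1 m => Jet1.totalX (φ α) p * Jet1.totalY (φ β) p :=
    fun α β => (Jet1.contDiff_totalX (hφ α)).mul (Jet1.contDiff_totalY (hφ β))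
  have h2 : kineticLagrangian C φ = fun p => ∑ i : Fin m × Fin m,
      (-(C i.1 i.2) / 2) * (Jet1.totalX (φ i.1) p * Jet1.totalY (φ i.2) p) := by
    funext p
    rw [Fintype.sum_prod_type]
    rfl
  rw [h2, eulerLagrange_sum _ _ (fun i _ => h1 i.1 i.2), Fintype.sum_prod_type]
  simp only [eulerLagrange_totalX_mul_totalY (hφ _) (hφ _)]
  have h3 : ∀ T : Fin m → Fin m → ℝ, ∑ α, ∑ β, T α β = ∑ α, ∑ β, (T α β + T β α) / 2 := by
    intro T
    have : ∑ α, ∑ β, T β α = ∑ α, ∑ β, T α β := Finset.sum_comm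
    simp only [← Finset.sum_div, Finset.sum_add_distrib, this]
    ring
  conv_rhs => rw [h3]
  refine Finset.sum_congr rfl fun α _ => Finset.sum_congr rfl fun β _ => ?_
  rw [hC β α]
  ring

end

/-! ### From normalized systems to Lagrangians. -/

section

variable {m : ℕ}

/-- The Jacobian matrix `∂φ^α/∂u^β`. -/
def jacobianU (φ : Fin m → Jet0 m → ℝ) (z : Jet0 m) : Matrix (Fin m) (Fin m) ℝ :=
  Matrix.of fun α β => Jet0.partialU (φ α) β z

/-- Near `p`, the substitution `u ↦ φ(x, y, u)` turns the system `u_xy = F` into a system whose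
right-hand sides, expressed in the old variables, are functions `n(x, y, u)`. -/
structure NormalizesAt (F : Jet1 m → Fin m → ℝ) (p : Jet1 m) (r : ℝ)
    (φ n : Fin m → Jet0 m → ℝ) : Prop where
  pos : 0 < r
  smooth_map (α : Fin m) : ContDiff ℝ ∞ (φ α)
  smooth_rhs (α : Fin m) : ContDiff ℝ ∞ (n α)
  det_ne_zero : ∀ p' ∈ ball p r, (jacobianU φ p'.toJet0).det ≠ 0
  totalXY_eq : ∀ p' ∈ ball p r, ∀ α, Jet1.totalXY (φ α) p' +
    ∑ β, Jet0.partialU (φ α) β p'.toJet0 * F p' β = n α p'.toJet0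

/-- The components of the form `C_{αβ} n^β dφ^α`. -/
def forceForm (φ n : Fin m → Jet0 m → ℝ) (C : Matrix (Fin m) (Fin m) ℝ) (γ : Fin m)
    (z : Jet0 m) : ℝ :=
  ∑ α, ∑ β, Jet0.partialU (φ α) γ z * C α β * n β z

/-- The form `C_{αβ} n^β dφ^α` is closed in the variables `u`, on a ball. -/
def IsPotentialForm (φ n : Fin m → Jet0 m → ℝ) (z₀ : Jet0 m) (r : ℝ)
    (C : Matrix (Fin m) (Fin m) ℝ) : Prop :=
  ∀ z ∈ ball z₀ r, ∀ γ δ, Jet0.partialU (forceForm φ n C γ) δ z =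
    Jet0.partialU (forceForm φ n C δ) γ z

theorem contDiff_forceForm {φ n : Fin m → Jet0 m → ℝ} (hφ : ∀ α, ContDiff ℝ ∞ (φ α))
    (hn : ∀ α, ContDiff ℝ ∞ (n α)) (C : Matrix (Fin m) (Fin m) ℝ) (γ : Fin m) :
    ContDiff ℝ ∞ (forceForm φ n C γ) :=
  ContDiff.sum fun α _ => ContDiff.sum fun β _ =>
    (((hφ α).jet0_partialU γ).mul contDiff_const).mul (hn β)

theorem Jet1.toJet0_mem_ball {p p' : Jet1 m} {r : ℝ} (h : p' ∈ ball p r) :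
    p'.toJet0 ∈ ball p.toJet0 r := by
  simp only [mem_ball, Prod.dist_eq, max_lt_iff, Jet1.toJet0_apply] at h ⊢
  exact ⟨h.1, h.2.1, h.2.2.1⟩

theorem NormalizesAt.mono {F : Jet1 m → Fin m → ℝ} {p : Jet1 m} {r s : ℝ}
    {φ n : Fin m → Jet0 m → ℝ} (h : NormalizesAt F p r φ n) (hs : 0 < s) (hsr : s ≤ r) :
    NormalizesAt F p s φ n :=
  ⟨hs, h.smooth_map, h.smooth_rhs, fun p' hp' => h.det_ne_zero p' (ball_subset_ball hsr hp'),
    fun p' hp' => h.totalXY_eq p' (ball_subset_ball hsr hp')⟩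

/-- The Lagrangian is kinetic minus potential: the kinetic term yields `Pᵀ C D_x D_y φ`, and a
potential of the closed form `C_{αβ} n^β dφ^α` supplies the right-hand side. -/
theorem NormalizesAt.exists_lagrangian {F : Jet1 m → Fin m → ℝ} {p : Jet1 m} {r : ℝ}
    {φ n : Fin m → Jet0 m → ℝ} (h : NormalizesAt F p r φ n)
    {C : Matrix (Fin m) (Fin m) ℝ} (hsymm : C.IsSymm) (hdet : C.det ≠ 0)
    (hC : IsPotentialForm φ n p.toJet0 r C) :
    ∃ L, ContDiff ℝ ∞ L ∧ IsLagrangianWithMultiplier F (ball p r) L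
      (fun p => (jacobianU φ p.toJet0).transpose * C * jacobianU φ p.toJet0) := by
  obtain ⟨H, hH, hHa⟩ := exists_potential (contDiff_forceForm h.smooth_map h.smooth_rhs C)
    (fun z hz γ δ => hC z hz γ δ)
  have hsm : ContDiff ℝ ∞ fun p : Jet1 m => H p.toJet0 := hH.comp Jet1.toJet0.contDiff
  have hkin := contDiff_kineticLagrangian C h.smooth_map
  refine ⟨fun p => kineticLagrangian C φ p - H p.toJet0, hkin.sub hsm, (hkin.sub hsm).contDiffOn,
    fun α β => ?_, fun p' hp' => ?_, fun q hq γ => ?_⟩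
  · simp only [Matrix.mul_apply, Matrix.transpose_apply, jacobianU, Matrix.of_apply]
    refine ContDiff.contDiffOn (ContDiff.sum fun i _ => ContDiff.mul (ContDiff.sum fun j _ =>
      ContDiff.mul ?_ contDiff_const) ?_)
    · exact ((h.smooth_map _).jet0_partialU _).comp Jet1.toJet0.contDiff
    · exact ((h.smooth_map _).jet0_partialU _).comp Jet1.toJet0.contDiff
  · rw [Matrix.det_mul, Matrix.det_mul, Matrix.det_transpose]
    have := h.det_ne_zero p' hp'
    positivity
  · rw [eulerLagrange_sub hkin hsm, eulerLagrange_comp_toJet0 hH,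
      eulerLagrange_kineticLagrangian (fun α β => (hsymm.apply α β).symm) h.smooth_map,
      Jet0.partialU, hHa _ (Jet1.toJet0_mem_ball hq), forceForm]
    rw [← Finset.sum_sub_distrib]
    have h1 : ∀ α, (∑ β, Jet0.partialU (φ α) γ q.toJet1.toJet0 * C α β *
        (Jet1.totalXY (φ β) q.toJet1 + ∑ δ, Jet0.partialU (φ β) δ q.toJet1.toJet0 * q.uxy δ)) -
        ∑ β, Jet0.partialU (φ α) γ q.toJet1.toJet0 * C α β * n β q.toJet1.toJet0 =
        ∑ β, ∑ δ, Jet0.partialU (φ α) γ q.toJet1.toJet0 * C α β *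
          Jet0.partialU (φ β) δ q.toJet1.toJet0 * (q.uxy δ - F q.toJet1 δ) := by
      intro α
      rw [← Finset.sum_sub_distrib]
      refine Finset.sum_congr rfl fun β _ => ?_
      rw [← h.totalXY_eq q.toJet1 hq β, ← mul_sub, add_sub_add_left_eq_sub,
        ← Finset.sum_sub_distrib, Finset.mul_sum]
      exact Finset.sum_congr rfl fun δ _ => by ring
    simp only [h1, Matrix.mul_apply, Matrix.transpose_apply, jacobianU, Matrix.of_apply,
      Finset.sum_mul]
    rw [Finset.sum_comm]
    conv_rhs => rw [Finset.sum_comm]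
    refine Finset.sum_congr rfl fun β _ => ?_
    rw [Finset.sum_comm]

/-- The Euler-Lagrange operator is linear, so a relation among the Lagrangians gives the same
relation among their multipliers. -/
theorem linearIndependent_of_isLagrangianWithMultiplier {ι : Type*} [Fintype ι]
    {F : Jet1 m → Fin m → ℝ} {V : Set (Jet1 m)} (hV : IsOpen V) {L : ι → Jet1 m → ℝ}
    {M : ι → Jet1 m → Matrix (Fin m) (Fin m) ℝ}
    (hL : ∀ i, ContDiff ℝ ∞ (L i))
    (h : ∀ i, IsLagrangianWithMultiplier F V (L i) (M i))
    (hM : LinearIndependent ℝ (fun i => (fun p : V => M i p))) :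
    LinearIndependent ℝ (fun i => (fun p : V => L i p)) := by
  rw [Fintype.linearIndependent_iff] at hM ⊢
  intro c hc
  apply hM c
  have hc' : ∀ p ∈ V, ∑ i, c i * L i p = 0 := by
    intro p hp
    have := congrFun hc ⟨p, hp⟩
    simpa [Finset.sum_apply] using this
  funext ⟨p, hp⟩
  have hE : ∀ (q : Jet2 m) (α : Fin m), q.toJet1 = p → ∑ i, c i * eulerLagrange (L i) α q = 0 := by
    intro q α hq
    rw [← eulerLagrange_sum _ _ (fun i _ => hL i)]
    have : (fun p => ∑ i, c i * L i p) =ᶠ[𝓝 q.toJet1] fun _ => 0 := by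
      filter_upwards [hV.mem_nhds (hq ▸ hp : q.toJet1 ∈ V)] with p' hp' using hc' p' hp'
    rw [eulerLagrange_congr this]
    exact (eulerLagrange_comp_toJet0 (H := fun _ => 0) contDiff_const α q).trans
      (by simp [Jet0.partialU])
  ext α β
  -- At this 2-jet `u_xy - F` is the basis vector `β`, so the Euler-Lagrange expressions are column
  -- `β` of the multiplier.
  let q : Jet2 m := (p, 0, F p + Pi.single β 1, 0)
  have h1 := hE q α rfl
  simp only [fun i => (h i).2.2.2 q hp α] at h1
  simpa [q, Jet2.uxy, Jet2.toJet1, Pi.single_apply, Finset.sum_apply, Matrix.sum_apply] using h1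

theorem NormalizesAt.admitsLagrangiansAt {F : Jet1 m → Fin m → ℝ} {p : Jet1 m} {r : ℝ}
    {φ n : Fin m → Jet0 m → ℝ} (h : NormalizesAt F p r φ n) {U : Set (Jet1 m)}
    (hU : ball p r ⊆ U) {k : ℕ} {C : Fin k → Matrix (Fin m) (Fin m) ℝ}
    (hsymm : ∀ i, (C i).IsSymm) (hdet : ∀ i, (C i).det ≠ 0) (hind : LinearIndependent ℝ C)
    (hC : ∀ i, IsPotentialForm φ n p.toJet0 r (C i)) : AdmitsLagrangiansAt U F k p := by
  choose L hLs hL using fun i => h.exists_lagrangian (hsymm i) (hdet i) (hC i)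
  have hp : p ∈ ball p r := mem_ball_self h.pos
  have hM : LinearIndependent ℝ (fun i => (fun p : ball p r =>
      (jacobianU φ p.1.toJet0).transpose * C i * jacobianU φ p.1.toJet0)) := by
    rw [Fintype.linearIndependent_iff] at hind ⊢
    intro c hc
    apply hind c
    have h1 := congrFun hc ⟨p, hp⟩
    simp only [Finset.sum_apply, Pi.smul_apply, Pi.zero_apply] at h1
    set P := jacobianU φ p.toJet0 with hP
    have hPd : IsUnit P.det := (h.det_ne_zero p hp).isUnit
    have hPt : IsUnit P.transpose.det := by rwa [Matrix.det_transpose]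
    have h2 : P.transpose * (∑ i, c i • C i) * P = 0 := by
      rw [← h1, Finset.mul_sum, Finset.sum_mul]
      simp
    calc ∑ i, c i • C i = P.transpose⁻¹ * (P.transpose * (∑ i, c i • C i) * P) * P⁻¹ := by
          rw [Matrix.mul_assoc P.transpose, Matrix.nonsing_inv_mul_cancel_left _ _ hPt,
            Matrix.mul_nonsing_inv_cancel_right _ _ hPd]
      _ = 0 := by rw [h2]; simp
  refine ⟨ball p r, isOpen_ball, ⟨⟨p, hp⟩, (convex_ball p r).isPreconnected⟩, hp, hU, L, _, hL,
    linearIndependent_of_isLagrangianWithMultiplier isOpen_ball hLs hL hM, hM⟩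

end

/-! ### The Helmholtz conditions. -/

section

section DirDeriv

variable {E : Type*} [NormedAddCommGroup E] [NormedSpace ℝ E]

/-- The directional derivative, as a function. -/
def dirDeriv (v : E) (h : E → ℝ) (p : E) : ℝ := fderiv ℝ h p v

theorem ContDiff.dirDeriv {h : E → ℝ} (hh : ContDiff ℝ ∞ h) (v : E) : ContDiff ℝ ∞ (dirDeriv v h) :=
  hh.fderiv_apply_smooth v

theorem dirDeriv_comm {h : E → ℝ} (hh : ContDiff ℝ ∞ h) (v w : E) :
    dirDeriv v (dirDeriv w h) = dirDeriv w (dirDeriv v h) :=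
  funext fun p => hh.fderiv_apply_comm p w v

theorem fderiv_fderiv_eq_fderiv_dirDeriv {h : E → ℝ} (hh : ContDiff ℝ ∞ h) (p v w : E) :
    fderiv ℝ (fderiv ℝ h) p v w = fderiv ℝ (dirDeriv w h) p v :=
  (hh.fderiv_fderiv_apply p w v).symm

theorem Set.EqOn.fderiv_eq_of_isOpen {h k : E → ℝ} {V : Set E} (hV : IsOpen V) (hk : EqOn h k V)
    {p : E} (hp : p ∈ V) : fderiv ℝ h p = fderiv ℝ k p :=
  (hk.eventuallyEq_of_mem (hV.mem_nhds hp)).fderiv_eq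

theorem dirDeriv_eqOn {h k : E → ℝ} {V : Set E} (hV : IsOpen V) (hk : EqOn h k V) (v : E) :
    EqOn (dirDeriv v h) (dirDeriv v k) V := fun p hp => by
  rw [dirDeriv, dirDeriv, hk.fderiv_eq_of_isOpen hV hp]

theorem fderiv_eq_zero_of_eqOn_zero {h : E → ℝ} {V : Set E} (hV : IsOpen V)
    (hk : ∀ p ∈ V, h p = 0) {p : E} (hp : p ∈ V) : fderiv ℝ h p = 0 := by
  rw [Set.EqOn.fderiv_eq_of_isOpen (k := fun _ => 0) hV hk hp]
  simp

end DirDeriv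

variable {m : ℕ}

namespace Jet1

/-- The coordinate vector `∂/∂u^α`. -/
def dirU (α : Fin m) : Jet1 m := (0, 0, Pi.single α 1, 0, 0)

/-- The coordinate vector `∂/∂u^α_x`. -/
def dirUx (α : Fin m) : Jet1 m := (0, 0, 0, Pi.single α 1, 0)

/-- The coordinate vector `∂/∂u^α_y`. -/
def dirUy (α : Fin m) : Jet1 m := (0, 0, 0, 0, Pi.single α 1)

/-- The vector field `∂_x + u^α_x ∂/∂u^α`. -/
def vecX (p : Jet1 m) : Jet1 m := (1, 0, p.ux, 0, 0)

/-- The vector field `∂_y + u^α_y ∂/∂u^α`. -/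
def vecY (p : Jet1 m) : Jet1 m := (0, 1, p.uy, 0, 0)

/-- The extra term comes from the dependence of `vecX` on `p`: the bracket of `∂/∂u^α_x` with `vecX`
is `∂/∂u^α`. -/
theorem fderiv_along_vecX {G : Jet1 m → ℝ} (hG : ContDiff ℝ ∞ G) (p v : Jet1 m) :
    fderiv ℝ (fun p => fderiv ℝ G p (vecX p)) p v =
      fderiv ℝ (dirDeriv v G) p (vecX p) + fderiv ℝ G p (0, 0, v.ux, 0, 0) := by
  have h2 : HasFDerivAt (vecX (m := m)) ((0 : Jet1 m →L[ℝ] ℝ).prod ((0 : Jet1 m →L[ℝ] ℝ).prod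
      (Jet1.uxL.prod ((0 : Jet1 m →L[ℝ] (Fin m → ℝ)).prod (0 : Jet1 m →L[ℝ] (Fin m → ℝ)))))) p :=
    (hasFDerivAt_const _ _).prodMk ((hasFDerivAt_const _ _).prodMk
      (Jet1.uxL.hasFDerivAt.prodMk ((hasFDerivAt_const _ _).prodMk (hasFDerivAt_const _ _))))
  rw [((hG.fderiv_smooth.hasFDerivAt_of_smooth p).clm_apply h2).fderiv,
    ← fderiv_fderiv_eq_fderiv_dirDeriv hG, hG.fderiv_fderiv_comm p (vecX p)]
  exact add_comm _ _

theorem fderiv_along_vecY {G : Jet1 m → ℝ} (hG : ContDiff ℝ ∞ G) (p v : Jet1 m) :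
    fderiv ℝ (fun p => fderiv ℝ G p (vecY p)) p v =
      fderiv ℝ (dirDeriv v G) p (vecY p) + fderiv ℝ G p (0, 0, v.uy, 0, 0) := by
  have h2 : HasFDerivAt (vecY (m := m)) ((0 : Jet1 m →L[ℝ] ℝ).prod ((0 : Jet1 m →L[ℝ] ℝ).prod
      (Jet1.uyL.prod ((0 : Jet1 m →L[ℝ] (Fin m → ℝ)).prod (0 : Jet1 m →L[ℝ] (Fin m → ℝ)))))) p :=
    (hasFDerivAt_const _ _).prodMk ((hasFDerivAt_const _ _).prodMk
      (Jet1.uyL.hasFDerivAt.prodMk ((hasFDerivAt_const _ _).prodMk (hasFDerivAt_const _ _))))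
  rw [((hG.fderiv_smooth.hasFDerivAt_of_smooth p).clm_apply h2).fderiv,
    ← fderiv_fderiv_eq_fderiv_dirDeriv hG, hG.fderiv_fderiv_comm p (vecY p)]
  exact add_comm _ _

theorem contDiff_along_vecX {G : Jet1 m → ℝ} (hG : ContDiff ℝ ∞ G) :
    ContDiff ℝ ∞ (fun p => fderiv ℝ G p (vecX p)) :=
  hG.fderiv_smooth.clm_apply (contDiff_const.prodMk (contDiff_const.prodMk
    (Jet1.uxL.contDiff.prodMk (contDiff_const.prodMk contDiff_const))))

theorem contDiff_along_vecY {G : Jet1 m → ℝ} (hG : ContDiff ℝ ∞ G) :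
    ContDiff ℝ ∞ (fun p => fderiv ℝ G p (vecY p)) :=
  hG.fderiv_smooth.clm_apply (contDiff_const.prodMk (contDiff_const.prodMk
    (Jet1.uyL.contDiff.prodMk (contDiff_const.prodMk contDiff_const))))

end Jet1

open Jet1

/-- The Euler-Lagrange expressions of `L` over `V` are `M_{αβ} u^β_xy - N_α`. -/
structure HasEulerLagrange (L : Jet1 m → ℝ) (M : Fin m → Fin m → Jet1 m → ℝ)
    (N : Fin m → Jet1 m → ℝ) (V : Set (Jet1 m)) : Prop where
  isOpen : IsOpen V
  smooth : ContDiff ℝ ∞ L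
  smooth_force (α : Fin m) : ContDiff ℝ ∞ (N α)
  eq : ∀ q : Jet2 m, q.toJet1 ∈ V → ∀ α,
    eulerLagrange L α q = ∑ β, M α β q.toJet1 * q.uxy β - N α q.toJet1

namespace HasEulerLagrange

variable {L : Jet1 m → ℝ} {M : Fin m → Fin m → Jet1 m → ℝ} {N : Fin m → Jet1 m → ℝ}
  {V : Set (Jet1 m)}

theorem expand (h : HasEulerLagrange L M N V) {p : Jet1 m} (hp : p ∈ V) (a b c : Fin m → ℝ)
    (α : Fin m) :
    fderiv ℝ L p (dirU α) -
      (fderiv ℝ (dirDeriv (dirUx α) L) p (vecX p) + fderiv ℝ (dirDeriv (dirUx α) L) p (0, 0, 0, a, 0) +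
        fderiv ℝ (dirDeriv (dirUx α) L) p (0, 0, 0, 0, b)) -
      (fderiv ℝ (dirDeriv (dirUy α) L) p (vecY p) + fderiv ℝ (dirDeriv (dirUy α) L) p (0, 0, 0, b, 0) +
        fderiv ℝ (dirDeriv (dirUy α) L) p (0, 0, 0, 0, c)) =
      ∑ β, M α β p * b β - N α p := by
  refine Eq.trans ?_ (h.eq (p, a, b, c) hp α)
  rw [← map_add, ← map_add, ← map_add, ← map_add]
  simp only [eulerLagrange, Jet2.totalX, Jet2.totalY, vecX, vecY, Prod.mk_add_mk, add_zero, zero_add]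
  rfl

theorem force_eq (h : HasEulerLagrange L M N V) {p : Jet1 m} (hp : p ∈ V) (α : Fin m) :
    N α p = - fderiv ℝ L p (dirU α) + fderiv ℝ (dirDeriv (dirUx α) L) p (vecX p) +
      fderiv ℝ (dirDeriv (dirUy α) L) p (vecY p) := by
  have h0 : ((0, 0, 0, 0, 0) : Jet1 m) = 0 := rfl
  have := h.expand hp 0 0 0 α
  simp only [h0, map_zero, Pi.zero_apply, mul_zero, Finset.sum_const_zero] at this
  linarith

theorem hessian_ux (h : HasEulerLagrange L M N V) {p : Jet1 m} (hp : p ∈ V) (α γ : Fin m) :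
    dirDeriv (dirUx γ) (dirDeriv (dirUx α) L) p = 0 := by
  have h0 : ((0, 0, 0, 0, 0) : Jet1 m) = 0 := rfl
  have h1 := h.expand hp 0 0 0 α
  have h2 := h.expand hp (Pi.single γ 1) 0 0 α
  simp only [h0, map_zero] at h1 h2
  have : dirDeriv (dirUx γ) (dirDeriv (dirUx α) L) p =
    fderiv ℝ (dirDeriv (dirUx α) L) p (0, 0, 0, Pi.single γ 1, 0) := rfl
  linarith

theorem hessian_uy (h : HasEulerLagrange L M N V) {p : Jet1 m} (hp : p ∈ V) (α γ : Fin m) :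
    dirDeriv (dirUy γ) (dirDeriv (dirUy α) L) p = 0 := by
  have h0 : ((0, 0, 0, 0, 0) : Jet1 m) = 0 := rfl
  have h1 := h.expand hp 0 0 0 α
  have h2 := h.expand hp 0 0 (Pi.single γ 1) α
  simp only [h0, map_zero] at h1 h2
  have : dirDeriv (dirUy γ) (dirDeriv (dirUy α) L) p =
    fderiv ℝ (dirDeriv (dirUy α) L) p (0, 0, 0, 0, Pi.single γ 1) := rfl
  linarith

theorem multiplier_eq (h : HasEulerLagrange L M N V) {p : Jet1 m} (hp : p ∈ V) (α γ : Fin m) :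
    M α γ p = - (dirDeriv (dirUy γ) (dirDeriv (dirUx α) L) p +
      dirDeriv (dirUx γ) (dirDeriv (dirUy α) L) p) := by
  have h0 : ((0, 0, 0, 0, 0) : Jet1 m) = 0 := rfl
  have h1 := h.expand hp 0 0 0 α
  have h2 := h.expand hp 0 (Pi.single γ 1) 0 α
  simp only [h0, map_zero, Pi.zero_apply, mul_zero, Finset.sum_const_zero, Pi.single_apply, mul_ite,
    mul_one, Finset.sum_ite_eq', Finset.mem_univ, if_true] at h1 h2
  simp only [dirDeriv, dirUx, dirUy] at h1 h2 ⊢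
  linarith

theorem multiplier_symm (h : HasEulerLagrange L M N V) {p : Jet1 m} (hp : p ∈ V) (α γ : Fin m) :
    M α γ p = M γ α p := by
  rw [h.multiplier_eq hp, h.multiplier_eq hp, dirDeriv_comm h.smooth (dirUy γ),
    dirDeriv_comm h.smooth (dirUx γ)]
  ring

theorem fderiv_multiplier (h : HasEulerLagrange L M N V) {p : Jet1 m} (hp : p ∈ V)
    (v : Jet1 m) (α γ : Fin m) : fderiv ℝ (M α γ) p v =
      - (fderiv ℝ (dirDeriv (dirUy γ) (dirDeriv (dirUx α) L)) p v +
        fderiv ℝ (dirDeriv (dirUx γ) (dirDeriv (dirUy α) L)) p v) := by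
  have h1 : EqOn (M α γ) (fun p => - (dirDeriv (dirUy γ) (dirDeriv (dirUx α) L) p +
      dirDeriv (dirUx γ) (dirDeriv (dirUy α) L) p)) V := fun p hp => h.multiplier_eq hp α γ
  have h2 := ((((h.smooth.dirDeriv (dirUx α)).dirDeriv (dirUy γ)).hasFDerivAt_of_smooth p).add
    (((h.smooth.dirDeriv (dirUy α)).dirDeriv (dirUx γ)).hasFDerivAt_of_smooth p)).fun_neg
  rw [h1.fderiv_eq_of_isOpen h.isOpen hp]
  erw [h2.fderiv]
  simp

/-- The multiplier is a sum of mixed derivatives of `L` by one `u_x` and one `u_y`. A further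
`u_x`-derivative gives a derivative of `∂²L/∂u_x∂u_x`, which vanishes because `u_xx` does not occur.
-/
theorem fderiv_multiplier_ux (h : HasEulerLagrange L M N V) {p : Jet1 m} (hp : p ∈ V)
    (α γ δ : Fin m) : fderiv ℝ (M α γ) p (dirUx δ) = 0 := by
  have h1 : ∀ α : Fin m, dirDeriv (dirUx δ) (dirDeriv (dirUy γ) (dirDeriv (dirUx α) L)) p = 0 := by
    intro α
    rw [dirDeriv_comm (h.smooth.dirDeriv _), dirDeriv,
      fderiv_eq_zero_of_eqOn_zero h.isOpen (fun p hp => h.hessian_ux hp α δ) hp]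
    rfl
  have h2 : dirDeriv (dirUx δ) (dirDeriv (dirUx γ) (dirDeriv (dirUy α) L)) p = 0 := by
    rw [dirDeriv_comm h.smooth (dirUx γ), dirDeriv_comm (h.smooth.dirDeriv _), dirDeriv,
      fderiv_eq_zero_of_eqOn_zero h.isOpen (fun p hp => h.hessian_ux hp γ δ) hp]
    rfl
  rw [h.fderiv_multiplier hp]
  simp only [dirDeriv] at h1 h2 ⊢
  rw [h1, h2]
  simp

theorem fderiv_multiplier_uy (h : HasEulerLagrange L M N V) {p : Jet1 m} (hp : p ∈ V)
    (α γ δ : Fin m) : fderiv ℝ (M α γ) p (dirUy δ) = 0 := by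
  have h1 : dirDeriv (dirUy δ) (dirDeriv (dirUx γ) (dirDeriv (dirUy α) L)) p = 0 := by
    rw [dirDeriv_comm (h.smooth.dirDeriv _), dirDeriv,
      fderiv_eq_zero_of_eqOn_zero h.isOpen (fun p hp => h.hessian_uy hp α δ) hp]
    rfl
  have h2 : dirDeriv (dirUy δ) (dirDeriv (dirUy γ) (dirDeriv (dirUx α) L)) p = 0 := by
    rw [dirDeriv_comm h.smooth (dirUy γ), dirDeriv_comm (h.smooth.dirDeriv _), dirDeriv,
      fderiv_eq_zero_of_eqOn_zero h.isOpen (fun p hp => h.hessian_uy hp γ δ) hp]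
    rfl
  rw [h.fderiv_multiplier hp]
  simp only [dirDeriv] at h1 h2 ⊢
  rw [h1, h2]
  simp

theorem fderiv_force (h : HasEulerLagrange L M N V) {p : Jet1 m} (hp : p ∈ V) (v : Jet1 m)
    (α : Fin m) : fderiv ℝ (N α) p v = - fderiv ℝ (dirDeriv (dirU α) L) p v +
      (fderiv ℝ (dirDeriv v (dirDeriv (dirUx α) L)) p (vecX p) +
        fderiv ℝ (dirDeriv (dirUx α) L) p (0, 0, v.ux, 0, 0)) +
      (fderiv ℝ (dirDeriv v (dirDeriv (dirUy α) L)) p (vecY p) +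
        fderiv ℝ (dirDeriv (dirUy α) L) p (0, 0, v.uy, 0, 0)) := by
  have h1 : EqOn (N α) (fun p => - dirDeriv (dirU α) L p +
      fderiv ℝ (dirDeriv (dirUx α) L) p (vecX p) +
      fderiv ℝ (dirDeriv (dirUy α) L) p (vecY p)) V := fun p hp => h.force_eq hp α
  have h2 := ((((h.smooth.dirDeriv (dirU α)).hasFDerivAt_of_smooth p).fun_neg.fun_add
    ((contDiff_along_vecX (h.smooth.dirDeriv (dirUx α))).hasFDerivAt_of_smooth p)).fun_add
    ((contDiff_along_vecY (h.smooth.dirDeriv (dirUy α))).hasFDerivAt_of_smooth p))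
  rw [h1.fderiv_eq_of_isOpen h.isOpen hp, h2.fderiv]
  simp only [_root_.add_apply, _root_.neg_apply]
  rw [fderiv_along_vecX (h.smooth.dirDeriv _), fderiv_along_vecY (h.smooth.dirDeriv _)]

theorem fderiv_force_ux (h : HasEulerLagrange L M N V) {p : Jet1 m} (hp : p ∈ V)
    (α β : Fin m) : fderiv ℝ (N α) p (dirUx β) = - fderiv ℝ (dirDeriv (dirU α) L) p (dirUx β) +
      fderiv ℝ (dirDeriv (dirU β) L) p (dirUx α) +
      fderiv ℝ (dirDeriv (dirUx β) (dirDeriv (dirUy α) L)) p (vecY p) := by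
  rw [h.fderiv_force hp, fderiv_eq_zero_of_eqOn_zero h.isOpen (fun p hp => h.hessian_ux hp α β) hp,
    show ((0, 0, (dirUx β : Jet1 m).uy, 0, 0) : Jet1 m) = 0 from rfl,
    show ((0, 0, (dirUx β : Jet1 m).ux, 0, 0) : Jet1 m) = dirU β from rfl,
    show fderiv ℝ (dirDeriv (dirU β) L) p (dirUx α) = fderiv ℝ (dirDeriv (dirUx α) L) p (dirU β) from
      h.smooth.fderiv_apply_comm _ _ _]
  simp

theorem fderiv_force_uy (h : HasEulerLagrange L M N V) {p : Jet1 m} (hp : p ∈ V)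
    (α β : Fin m) : fderiv ℝ (N α) p (dirUy β) = - fderiv ℝ (dirDeriv (dirU α) L) p (dirUy β) +
      fderiv ℝ (dirDeriv (dirU β) L) p (dirUy α) +
      fderiv ℝ (dirDeriv (dirUy β) (dirDeriv (dirUx α) L)) p (vecX p) := by
  rw [h.fderiv_force hp, fderiv_eq_zero_of_eqOn_zero h.isOpen (fun p hp => h.hessian_uy hp α β) hp,
    show ((0, 0, (dirUy β : Jet1 m).ux, 0, 0) : Jet1 m) = 0 from rfl,
    show ((0, 0, (dirUy β : Jet1 m).uy, 0, 0) : Jet1 m) = dirU β from rfl,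
    show fderiv ℝ (dirDeriv (dirU β) L) p (dirUy α) = fderiv ℝ (dirDeriv (dirUy α) L) p (dirU β) from
      h.smooth.fderiv_apply_comm _ _ _]
  simp only [_root_.zero_apply, map_zero]
  ring

/-- Symmetrizing in `α`, `β` cancels the `∂²L/∂u∂u_x` terms, and the remaining mixed derivatives add
up to minus the multiplier. -/
theorem helmholtz_ux (h : HasEulerLagrange L M N V) {p : Jet1 m} (hp : p ∈ V) (α β : Fin m) :
    fderiv ℝ (N α) p (dirUx β) + fderiv ℝ (N β) p (dirUx α) = - fderiv ℝ (M α β) p (vecY p) := by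
  rw [h.fderiv_force_ux hp, h.fderiv_force_ux hp, h.fderiv_multiplier hp,
    dirDeriv_comm h.smooth (dirUy β)]
  ring

theorem helmholtz_uy (h : HasEulerLagrange L M N V) {p : Jet1 m} (hp : p ∈ V) (α β : Fin m) :
    fderiv ℝ (N α) p (dirUy β) + fderiv ℝ (N β) p (dirUy α) = - fderiv ℝ (M α β) p (vecX p) := by
  rw [h.fderiv_force_uy hp, h.fderiv_force_uy hp, h.fderiv_multiplier hp,
    dirDeriv_comm h.smooth (dirUx β)]
  ring

/-- Euler-Lagrange expressions which depend on `x`, `y`, `u` only are the components of a form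
that is closed in the variables `u`. -/
theorem closed_of_multiplier_eq_zero (h : HasEulerLagrange L M N V)
    (hM : ∀ p ∈ V, ∀ α β, M α β p = 0)
    (hx : ∀ p ∈ V, ∀ α β, fderiv ℝ (N α) p (dirUx β) = 0)
    (hy : ∀ p ∈ V, ∀ α β, fderiv ℝ (N α) p (dirUy β) = 0) {p : Jet1 m} (hp : p ∈ V)
    (α β : Fin m) : fderiv ℝ (N α) p (dirU β) = fderiv ℝ (N β) p (dirU α) := by
  set k := dirDeriv (dirUx β) (dirDeriv (dirUy α) L) with hk
  have hks : ContDiff ℝ ∞ k := (h.smooth.dirDeriv _).dirDeriv _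
  have hkd : EqOn (dirDeriv (dirUy β) (dirDeriv (dirUx α) L)) (fun p => - k p) V := by
    intro p hp
    have := h.multiplier_eq hp α β
    rw [hM p hp] at this
    linarith
  -- Since the multiplier vanishes, exchanging `α` and `β` turns `k` into `-k`. Independence of `N`
  -- from `u_x` makes the curl in `u` of `∂L/∂u_x` equal to `-vecY k`; `e2` likewise gives `vecX k`
  -- for `∂L/∂u_y`. In the curl of `N` these enter as `-vecX vecY k + vecY vecX k`, and the second
  -- derivatives of `k` cancel.
  have e1 : EqOn (fun p => dirDeriv (dirU β) (dirDeriv (dirUx α) L) p)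
      (fun p => dirDeriv (dirU α) (dirDeriv (dirUx β) L) p - fderiv ℝ k p (vecY p)) V := by
    intro p hp
    have h1 := h.fderiv_force_ux hp α β
    rw [hx p hp] at h1
    have h2 := congrFun (dirDeriv_comm h.smooth (dirU α) (dirUx β)) p
    have h3 := congrFun (dirDeriv_comm h.smooth (dirU β) (dirUx α)) p
    simp only [dirDeriv] at h1 h2 h3 ⊢
    rw [h2, h3]
    linarith
  have e2 : EqOn (fun p => dirDeriv (dirU β) (dirDeriv (dirUy α) L) p)
      (fun p => dirDeriv (dirU α) (dirDeriv (dirUy β) L) p + fderiv ℝ k p (vecX p)) V := by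
    intro p hp
    have h1 := h.fderiv_force_uy hp α β
    have h4 : fderiv ℝ (dirDeriv (dirUy β) (dirDeriv (dirUx α) L)) p (vecX p) =
        - fderiv ℝ k p (vecX p) := by
      rw [hkd.fderiv_eq_of_isOpen h.isOpen hp, ((hks.hasFDerivAt_of_smooth p).fun_neg).fderiv]
      rfl
    rw [hy p hp, h4] at h1
    have h2 := congrFun (dirDeriv_comm h.smooth (dirU α) (dirUy β)) p
    have h3 := congrFun (dirDeriv_comm h.smooth (dirU β) (dirUy α)) p
    simp only [dirDeriv] at h1 h2 h3 ⊢
    rw [h2, h3]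
    linarith
  have s1 : fderiv ℝ (dirDeriv (dirU β) (dirDeriv (dirUx α) L)) p (vecX p) =
      fderiv ℝ (dirDeriv (dirU α) (dirDeriv (dirUx β) L)) p (vecX p) -
        fderiv ℝ (fderiv ℝ k) p (vecX p) (vecY p) := by
    rw [show dirDeriv (dirU β) (dirDeriv (dirUx α) L) =
      fun p => dirDeriv (dirU β) (dirDeriv (dirUx α) L) p from rfl, e1.fderiv_eq_of_isOpen h.isOpen hp,
      ((((h.smooth.dirDeriv (dirUx β)).dirDeriv (dirU α)).hasFDerivAt_of_smooth p).fun_sub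
        ((contDiff_along_vecY hks).hasFDerivAt_of_smooth p)).fderiv]
    rw [_root_.sub_apply, fderiv_along_vecY hks, ← fderiv_fderiv_eq_fderiv_dirDeriv hks,
      hks.fderiv_fderiv_comm p (vecY p), show ((0, 0, (vecX p).uy, 0, 0) : Jet1 m) = 0 from rfl]
    simp
  have s2 : fderiv ℝ (dirDeriv (dirU β) (dirDeriv (dirUy α) L)) p (vecY p) =
      fderiv ℝ (dirDeriv (dirU α) (dirDeriv (dirUy β) L)) p (vecY p) +
        fderiv ℝ (fderiv ℝ k) p (vecX p) (vecY p) := by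
    rw [show dirDeriv (dirU β) (dirDeriv (dirUy α) L) =
      fun p => dirDeriv (dirU β) (dirDeriv (dirUy α) L) p from rfl, e2.fderiv_eq_of_isOpen h.isOpen hp,
      ((((h.smooth.dirDeriv (dirUy β)).dirDeriv (dirU α)).hasFDerivAt_of_smooth p).fun_add
        ((contDiff_along_vecX hks).hasFDerivAt_of_smooth p)).fderiv]
    rw [_root_.add_apply, fderiv_along_vecX hks, ← fderiv_fderiv_eq_fderiv_dirDeriv hks,
      show ((0, 0, (vecY p).ux, 0, 0) : Jet1 m) = 0 from rfl]
    simp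
  rw [h.fderiv_force hp, h.fderiv_force hp, s1, s2,
    show ((0, 0, (dirU α : Jet1 m).ux, 0, 0) : Jet1 m) = 0 from rfl,
    show ((0, 0, (dirU α : Jet1 m).uy, 0, 0) : Jet1 m) = 0 from rfl,
    show ((0, 0, (dirU β : Jet1 m).ux, 0, 0) : Jet1 m) = 0 from rfl,
    show ((0, 0, (dirU β : Jet1 m).uy, 0, 0) : Jet1 m) = 0 from rfl,
    show fderiv ℝ (dirDeriv (dirU α) L) p (dirU β) = fderiv ℝ (dirDeriv (dirU β) L) p (dirU α) from
      h.smooth.fderiv_apply_comm _ _ _]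
  simp only [map_zero]
  ring

end HasEulerLagrange

end

/-! ### Multipliers as parallel symmetric forms. -/

section

variable {m : ℕ}

open Jet1

/-- The matrix (evaluated on the vector `v`) of the connection defined by the right-hand sides
`F` of a system `u_xy = F`. -/
def connMatrix (F : Jet1 m → Fin m → ℝ) (p : Jet1 m) (v : Jet0 m) (δ β : Fin m) : ℝ :=
  v.2.1 * dirDeriv (dirUx β) (fun p => F p δ) p + v.1 * dirDeriv (dirUy β) (fun p => F p δ) p +
    ∑ γ, (v.2.2 γ - v.1 * p.ux γ - v.2.1 * p.uy γ) *
      dirDeriv (dirUy γ) (dirDeriv (dirUx β) (fun p => F p δ)) p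

/-- `T` is a parallel symmetric form with respect to the connection of `F`. -/
def IsParallelForm (F : Jet1 m → Fin m → ℝ) (V : Set (Jet1 m)) (T : Fin m → Fin m → Jet1 m → ℝ) :
    Prop :=
  ∀ p ∈ V, ∀ α β, DifferentiableAt ℝ (T α β) p ∧ ∀ v : Jet1 m, fderiv ℝ (T α β) p v =
    - ∑ δ, (T α δ p * connMatrix F p v.toJet0 δ β + T β δ p * connMatrix F p v.toJet0 δ α)

theorem connMatrix_congr {F G : Jet1 m → Fin m → ℝ} {V : Set (Jet1 m)} (hV : IsOpen V)
    (h : ∀ p ∈ V, F p = G p) {p : Jet1 m} (hp : p ∈ V) : connMatrix F p = connMatrix G p := by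
  have h1 : ∀ δ, EqOn (fun p => F p δ) (fun p => G p δ) V := fun δ p hp => by simp only [h p hp]
  ext v δ β
  simp only [connMatrix]
  rw [dirDeriv_eqOn hV (h1 δ) (dirUx β) hp, dirDeriv_eqOn hV (h1 δ) (dirUy β) hp]
  congr 1
  exact Finset.sum_congr rfl fun γ _ => by
    rw [dirDeriv_eqOn hV (dirDeriv_eqOn hV (h1 δ) (dirUx β)) (dirUy γ) hp]

theorem Jet1.decompose (p v : Jet1 m) : v = v.x • vecX p + v.y • vecY p +
    ∑ γ, (v.u γ - v.x * p.ux γ - v.y * p.uy γ) • dirU γ + ∑ γ, v.ux γ • dirUx γ +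
      ∑ γ, v.uy γ • dirUy γ := by
  refine Prod.ext ?_ (Prod.ext ?_ (Prod.ext ?_ (Prod.ext ?_ ?_)))
  · simp [Prod.fst_sum, vecX, vecY, dirU, dirUx, dirUy, Jet1.x, Jet1.y]
  · simp [Prod.fst_sum, Prod.snd_sum, vecX, vecY, dirU, dirUx, dirUy, Jet1.x, Jet1.y]
  · ext i
    simp [Prod.fst_sum, Prod.snd_sum, vecX, vecY, dirU, dirUx, dirUy, Jet1.x, Jet1.y,
      Finset.sum_apply, Pi.single_apply, Jet1.u]
  · ext i
    simp [Prod.fst_sum, Prod.snd_sum, vecX, vecY, dirU, dirUx, dirUy, Jet1.x, Jet1.y,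
      Finset.sum_apply, Pi.single_apply, Jet1.ux]
  · ext i
    simp [Prod.snd_sum, vecX, vecY, dirU, dirUx, dirUy, Jet1.x, Jet1.y,
      Finset.sum_apply, Pi.single_apply, Jet1.uy]

/-- For `N = M F` with `M` free of first derivatives, the Helmholtz conditions are the derivatives
of `M` along `vecX` and `vecY`. The derivatives along `u` follow from a bracket. -/
theorem HasEulerLagrange.isParallelForm {L : Jet1 m → ℝ} {M : Fin m → Fin m → Jet1 m → ℝ}
    {F : Jet1 m → Fin m → ℝ} {V : Set (Jet1 m)}
    (h : HasEulerLagrange L M (fun α p => ∑ δ, M α δ p * F p δ) V)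
    (hM : ∀ α β, ContDiff ℝ ∞ (M α β)) (hF : ∀ α, ContDiff ℝ ∞ fun p => F p α) :
    IsParallelForm F V M := by
  have hN : ∀ p v α, fderiv ℝ (fun p => ∑ δ, M α δ p * F p δ) p v =
      ∑ δ, (M α δ p * fderiv ℝ (fun p => F p δ) p v + F p δ * fderiv ℝ (M α δ) p v) := by
    intro p v α
    have h1 : HasFDerivAt (fun p => ∑ δ, M α δ p * F p δ) (∑ δ, (M α δ p • fderiv ℝ (fun p => F p δ) p +
        F p δ • fderiv ℝ (M α δ) p)) p := HasFDerivAt.fun_sum fun δ _ =>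
      ((hM α δ).hasFDerivAt_of_smooth p).fun_mul ((hF δ).hasFDerivAt_of_smooth p)
    rw [h1.fderiv]
    simp
  have eqY : ∀ α β, EqOn (fun p => fderiv ℝ (M α β) p (vecY p)) (fun p => - ∑ δ,
      (M α δ p * dirDeriv (dirUx β) (fun p => F p δ) p +
        M β δ p * dirDeriv (dirUx α) (fun p => F p δ) p)) V := by
    intro α β p hp
    have h1 := h.helmholtz_ux hp α β
    rw [hN, hN] at h1
    simp only [h.fderiv_multiplier_ux hp, mul_zero, add_zero, ← Finset.sum_add_distrib] at h1
    simp only [dirDeriv]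
    linarith
  have eqX : ∀ α β, ∀ p ∈ V, fderiv ℝ (M α β) p (vecX p) = - ∑ δ,
      (M α δ p * dirDeriv (dirUy β) (fun p => F p δ) p +
        M β δ p * dirDeriv (dirUy α) (fun p => F p δ) p) := by
    intro α β p hp
    have h1 := h.helmholtz_uy hp α β
    rw [hN, hN] at h1
    simp only [h.fderiv_multiplier_uy hp, mul_zero, add_zero, ← Finset.sum_add_distrib] at h1
    simp only [dirDeriv]
    linarith
  -- Differentiate the equation along `vecY` by `u^γ_y`. As `M` does not depend on `u_y`, only the
  -- bracket term `∂M/∂u^γ` survives on the left, and only derivatives of `F` on the right.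
  have eqU : ∀ α β γ, ∀ p ∈ V, fderiv ℝ (M α β) p (dirU γ) = - ∑ δ,
      (M α δ p * dirDeriv (dirUy γ) (dirDeriv (dirUx β) (fun p => F p δ)) p +
        M β δ p * dirDeriv (dirUy γ) (dirDeriv (dirUx α) (fun p => F p δ)) p) := by
    intro α β γ p hp
    have h1 := congrArg (fun T => T (dirUy γ)) ((eqY α β).fderiv_eq_of_isOpen h.isOpen hp)
    have h2 : HasFDerivAt (fun p => - ∑ δ, (M α δ p * dirDeriv (dirUx β) (fun p => F p δ) p +
        M β δ p * dirDeriv (dirUx α) (fun p => F p δ) p))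
        (- ∑ δ, ((M α δ p • fderiv ℝ (dirDeriv (dirUx β) (fun p => F p δ)) p +
          dirDeriv (dirUx β) (fun p => F p δ) p • fderiv ℝ (M α δ) p) +
          (M β δ p • fderiv ℝ (dirDeriv (dirUx α) (fun p => F p δ)) p +
          dirDeriv (dirUx α) (fun p => F p δ) p • fderiv ℝ (M β δ) p))) p :=
      (HasFDerivAt.fun_sum fun δ _ => (((hM α δ).hasFDerivAt_of_smooth p).fun_mul
        (((hF δ).dirDeriv _).hasFDerivAt_of_smooth p)).fun_add
        (((hM β δ).hasFDerivAt_of_smooth p).fun_mul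
        (((hF δ).dirDeriv _).hasFDerivAt_of_smooth p))).fun_neg
    rw [h2.fderiv, fderiv_along_vecY (hM α β),
      show ((0, 0, (dirUy γ : Jet1 m).uy, 0, 0) : Jet1 m) = dirU γ from rfl,
      show fderiv ℝ (dirDeriv (dirUy γ) (M α β)) p = 0 from
        fderiv_eq_zero_of_eqOn_zero h.isOpen (fun p hp => h.fderiv_multiplier_uy hp α β γ) hp] at h1
    simp [h.fderiv_multiplier_uy hp] at h1
    exact h1
  intro p hp α β
  refine ⟨((hM α β).differentiable (by simp)) p, fun v => ?_⟩
  conv_lhs => rw [Jet1.decompose p v]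
  simp only [map_add, map_sum, map_smul, smul_eq_mul, h.fderiv_multiplier_ux hp,
    h.fderiv_multiplier_uy hp, mul_zero, Finset.sum_const_zero, add_zero, eqU _ _ _ p hp,
    eqX _ _ p hp, eqY _ _ hp, connMatrix, Jet1.toJet0_apply, Jet1.x, Jet1.y, Jet1.u, mul_neg,
    Finset.sum_neg_distrib]
  simp only [Finset.mul_sum]
  rw [Finset.sum_comm]
  rw [← neg_add, ← neg_add, ← Finset.sum_add_distrib, ← Finset.sum_add_distrib]
  congr 1
  refine Finset.sum_congr rfl fun δ _ => ?_
  simp only [mul_add _ _ (∑ γ, _), Finset.mul_sum]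
  have h3 : ∑ γ, (v.2.2.1 γ - v.1 * p.ux γ - v.2.1 * p.uy γ) *
      (M α δ p * dirDeriv (dirUy γ) (dirDeriv (dirUx β) (fun p => F p δ)) p +
        M β δ p * dirDeriv (dirUy γ) (dirDeriv (dirUx α) (fun p => F p δ)) p) =
      ∑ γ, M α δ p * ((v.2.2.1 γ - v.1 * p.ux γ - v.2.1 * p.uy γ) *
        dirDeriv (dirUy γ) (dirDeriv (dirUx β) (fun p => F p δ)) p) +
      ∑ γ, M β δ p * ((v.2.2.1 γ - v.1 * p.ux γ - v.2.1 * p.uy γ) *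
        dirDeriv (dirUy γ) (dirDeriv (dirUx α) (fun p => F p δ)) p) := by
    rw [← Finset.sum_add_distrib]
    exact Finset.sum_congr rfl fun γ _ => by ring
  rw [h3]
  ring

/-- The data of a Lagrangian, localized near a point and extended smoothly. -/
theorem IsLagrangianWithMultiplier.exists_localization {F : Jet1 m → Fin m → ℝ} {V : Set (Jet1 m)}
    (hV : IsOpen V) {L : Jet1 m → ℝ} {M : Jet1 m → Matrix (Fin m) (Fin m) ℝ}
    (h : IsLagrangianWithMultiplier F V L M) (hF : ∀ α, ContDiffOn ℝ ∞ (fun p => F p α) V)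
    {p : Jet1 m} (hp : p ∈ V) :
    ∃ r > 0, ball p r ⊆ V ∧ ∃ (L' : Jet1 m → ℝ) (M' : Fin m → Fin m → Jet1 m → ℝ)
      (F' : Jet1 m → Fin m → ℝ),
      HasEulerLagrange L' M' (fun α p => ∑ δ, M' α δ p * F' p δ) (ball p r) ∧
      (∀ α β, ContDiff ℝ ∞ (M' α β)) ∧ (∀ α, ContDiff ℝ ∞ fun p => F' p α) ∧
      (∀ p' ∈ ball p r, ∀ α β, M' α β p' = M p' α β) ∧ (∀ p' ∈ ball p r, F' p' = F p') := by
  obtain ⟨hL, hM, -, hE⟩ := h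
  obtain ⟨L', hL', r₁, hr₁, hs₁, he₁⟩ := hL.exists_contDiff_eqOn_ball hV hp
  have hM1 : ContDiffOn ℝ ∞ (fun p (i : Fin m × Fin m) => M p i.1 i.2) V :=
    contDiffOn_pi.2 fun i => hM i.1 i.2
  obtain ⟨M', hM', r₂, hr₂, hs₂, he₂⟩ := hM1.exists_contDiff_eqOn_ball hV hp
  have hF1 : ContDiffOn ℝ ∞ F V := contDiffOn_pi.2 hF
  obtain ⟨F', hF', r₃, hr₃, hs₃, he₃⟩ := hF1.exists_contDiff_eqOn_ball hV hp
  have hMs : ∀ α β, ContDiff ℝ ∞ (fun p => M' p (α, β)) := fun α β => contDiff_pi.1 hM' (α, β)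
  have hFs : ∀ α, ContDiff ℝ ∞ (fun p => F' p α) := contDiff_pi.1 hF'
  refine ⟨min r₁ (min r₂ r₃), by positivity, (ball_subset_ball (min_le_left _ _)).trans hs₁,
    L', fun α β p => M' p (α, β), F', ⟨isOpen_ball, hL', fun α => ContDiff.sum fun δ _ =>
      (hMs α δ).mul (hFs δ), fun q hq α => ?_⟩, hMs, hFs, fun p' hp' α β => ?_, fun p' hp' => ?_⟩
  · have hq1 : q.toJet1 ∈ ball p r₁ := ball_subset_ball (min_le_left _ _) hq
    have hq2 : q.toJet1 ∈ ball p r₂ :=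
      ball_subset_ball ((min_le_right _ _).trans (min_le_left _ _)) hq
    have hq3 : q.toJet1 ∈ ball p r₃ :=
      ball_subset_ball ((min_le_right _ _).trans (min_le_right _ _)) hq
    rw [eulerLagrange_congr (he₁.eventuallyEq_of_mem (isOpen_ball.mem_nhds hq1)),
      hE q (hs₁ hq1), ← Finset.sum_sub_distrib]
    refine Finset.sum_congr rfl fun β _ => ?_
    simp only [he₂ hq2, he₃ hq3]
    ring
  · exact congrFun (he₂ (ball_subset_ball ((min_le_right _ _).trans (min_le_left _ _)) hp')) (α, β)
  · exact he₃ (ball_subset_ball ((min_le_right _ _).trans (min_le_right _ _)) hp')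

theorem IsParallelForm.congr {F G : Jet1 m → Fin m → ℝ} {V : Set (Jet1 m)}
    {T S : Fin m → Fin m → Jet1 m → ℝ} (hV : IsOpen V) (h : IsParallelForm F V T)
    (hFG : ∀ p ∈ V, F p = G p) (hTS : ∀ p ∈ V, ∀ α β, T α β p = S α β p) :
    IsParallelForm G V S := by
  intro p hp α β
  have h1 : EqOn (T α β) (S α β) V := fun p hp => hTS p hp α β
  have h2 : T α β =ᶠ[𝓝 p] S α β := h1.eventuallyEq_of_mem (hV.mem_nhds hp)
  refine ⟨h2.differentiableAt_iff.1 (h p hp α β).1, fun v => ?_⟩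
  rw [← h1.fderiv_eq_of_isOpen hV hp, (h p hp α β).2, connMatrix_congr hV hFG hp]
  simp only [hTS p hp]

theorem IsParallelForm.mono {F : Jet1 m → Fin m → ℝ} {V W : Set (Jet1 m)}
    {T : Fin m → Fin m → Jet1 m → ℝ} (h : IsParallelForm F V T) (hW : W ⊆ V) :
    IsParallelForm F W T := fun p hp => h p (hW hp)

theorem IsLagrangianWithMultiplier.isParallelForm {F : Jet1 m → Fin m → ℝ} {V : Set (Jet1 m)}
    (hV : IsOpen V) {L : Jet1 m → ℝ} {M : Jet1 m → Matrix (Fin m) (Fin m) ℝ}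
    (h : IsLagrangianWithMultiplier F V L M) (hF : ∀ α, ContDiffOn ℝ ∞ (fun p => F p α) V) :
    IsParallelForm F V (fun α β p => M p α β) := by
  intro p hp
  obtain ⟨r, hr, -, L', M', F', hL', hM', hF', hMM, hFF⟩ := h.exists_localization hV hF hp
  exact (hL'.isParallelForm hM' hF').congr isOpen_ball hFF hMM p (mem_ball_self hr)

theorem IsLagrangianWithMultiplier.isSymm {F : Jet1 m → Fin m → ℝ} {V : Set (Jet1 m)}
    (hV : IsOpen V) {L : Jet1 m → ℝ} {M : Jet1 m → Matrix (Fin m) (Fin m) ℝ}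
    (h : IsLagrangianWithMultiplier F V L M) (hF : ∀ α, ContDiffOn ℝ ∞ (fun p => F p α) V)
    {p : Jet1 m} (hp : p ∈ V) : (M p).IsSymm := by
  obtain ⟨r, hr, -, L', M', F', hL', hM', hF', hMM, hFF⟩ := h.exists_localization hV hF hp
  refine Matrix.IsSymm.ext fun α β => ?_
  rw [← hMM p (mem_ball_self hr), ← hMM p (mem_ball_self hr),
    hL'.multiplier_symm (mem_ball_self hr)]

theorem IsParallelForm.sum {ι : Type*} (s : Finset ι) {F : Jet1 m → Fin m → ℝ} {V : Set (Jet1 m)}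
    {T : ι → Fin m → Fin m → Jet1 m → ℝ} (c : ι → ℝ) (h : ∀ i ∈ s, IsParallelForm F V (T i)) :
    IsParallelForm F V (fun α β p => ∑ i ∈ s, c i * T i α β p) := by
  intro p hp α β
  have h1 : HasFDerivAt (fun p => ∑ i ∈ s, c i * T i α β p) (∑ i ∈ s, c i • fderiv ℝ (T i α β) p) p :=
    HasFDerivAt.fun_sum fun i hi => ((h i hi p hp α β).1.hasFDerivAt).const_mul (c i)
  refine ⟨h1.differentiableAt, fun v => ?_⟩
  rw [h1.fderiv]
  simp only [_root_.sum_apply, _root_.smul_apply, smul_eq_mul]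
  rw [Finset.sum_congr rfl fun i hi => by rw [(h i hi p hp α β).2 v]]
  simp only [mul_neg, Finset.sum_neg_distrib, Finset.mul_sum, Finset.sum_mul]
  rw [Finset.sum_comm]
  congr 1
  refine Finset.sum_congr rfl fun δ _ => ?_
  rw [← Finset.sum_add_distrib]
  exact Finset.sum_congr rfl fun i _ => by ring

/-- Along the segment the components solve a homogeneous linear system of ordinary differential
equations with continuous coefficients. -/
theorem IsParallelForm.eq_zero_of_segment {F : Jet1 m → Fin m → ℝ}
    (hF : ∀ α, ContDiff ℝ ∞ fun p => F p α) {V : Set (Jet1 m)}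
    {T : Fin m → Fin m → Jet1 m → ℝ} (h : IsParallelForm F V T) {p₀ p₁ : Jet1 m}
    (hseg : segment ℝ p₀ p₁ ⊆ V) (h0 : ∀ α β, T α β p₀ = 0) (α β : Fin m) : T α β p₁ = 0 := by
  let c : ℝ → Jet1 m := fun t => p₀ + t • (p₁ - p₀)
  let B : ℝ → Fin m → Fin m → ℝ := fun t => connMatrix F (c t) (Jet1.toJet0 (p₁ - p₀))
  have hc : Continuous c := by fun_prop
  have hux : Continuous fun t => (c t).ux := by
    exact (Jet1.uxL (m := m)).continuous.comp hc
  have huy : Continuous fun t => (c t).uy := by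
    exact (Jet1.uyL (m := m)).continuous.comp hc
  have hB : ∀ δ β, Continuous fun t => B t δ β := by
    intro δ β
    have h1 : ∀ v, Continuous fun t => dirDeriv v (fun p => F p δ) (c t) := fun v =>
      ((hF δ).dirDeriv v).continuous.comp hc
    have h2 : ∀ v w, Continuous fun t => dirDeriv v (dirDeriv w (fun p => F p δ)) (c t) := fun v w =>
      (((hF δ).dirDeriv w).dirDeriv v).continuous.comp hc
    refine ((continuous_const.mul (h1 _)).add (continuous_const.mul (h1 _))).add
      (continuous_finsetSum _ fun γ _ => Continuous.mul ?_ (h2 _ _))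
    have h3 := (continuous_apply γ).comp hux
    have h4 := (continuous_apply γ).comp huy
    exact (continuous_const.sub (continuous_const.mul h3)).sub (continuous_const.mul h4)
  let Al : ℝ → (Fin m × Fin m → ℝ) →ₗ[ℝ] (Fin m × Fin m → ℝ) := fun t =>
    { toFun := fun s i => - ∑ δ, (s (i.1, δ) * B t δ i.2 + s (i.2, δ) * B t δ i.1)
      map_add' := fun s s' => by
        ext i
        simp only [Pi.add_apply]
        rw [← neg_add, ← Finset.sum_add_distrib]
        congr 1
        exact Finset.sum_congr rfl fun δ _ => by ring
      map_smul' := fun a s => by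
        ext i
        simp only [Pi.smul_apply, smul_eq_mul, RingHom.id_apply, mul_neg, Finset.mul_sum]
        congr 1
        exact Finset.sum_congr rfl fun δ _ => by ring }
  let A : ℝ → (Fin m × Fin m → ℝ) →L[ℝ] (Fin m × Fin m → ℝ) := fun t => (Al t).toContinuousLinearMap
  have hA : Continuous A := by
    rw [continuous_clm_apply]
    intro s
    refine continuous_pi fun i => (continuous_finsetSum _ fun δ _ => ?_).neg
    exact (continuous_const.mul (hB _ _)).add (continuous_const.mul (hB _ _))
  have hcV : ∀ t ∈ Icc (0 : ℝ) 1, c t ∈ V := by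
    intro t ht
    apply hseg
    rw [segment_eq_image']
    exact ⟨t, ht, rfl⟩
  have key := eq_zero_of_hasDerivAt_linear (s := fun t i => T i.1 i.2 (c t)) (A := A)
    hA.continuousOn (fun t ht => by
      rw [hasDerivAt_pi]
      intro i
      have h1 := (h (c t) (hcV t ht) i.1 i.2)
      have h2 : HasDerivAt c (p₁ - p₀) t := by
        have := ((hasDerivAt_id t).smul_const (p₁ - p₀)).const_add p₀
        rwa [one_smul] at this
      have h3 := h1.1.hasFDerivAt.comp_hasDerivAt t h2
      rw [h1.2] at h3
      exact h3) (by
      ext i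
      simp [c, h0])
  have := congrFun key (α, β)
  simpa [c] using this

theorem IsParallelForm.eq_zero_of_isPreconnected {F : Jet1 m → Fin m → ℝ} {V : Set (Jet1 m)}
    (hV : IsOpen V) (hVc : IsPreconnected V) (hF : ∀ α, ContDiffOn ℝ ∞ (fun p => F p α) V)
    {T : Fin m → Fin m → Jet1 m → ℝ} (h : IsParallelForm F V T) {p₀ : Jet1 m} (hp₀ : p₀ ∈ V)
    (h0 : ∀ α β, T α β p₀ = 0) {p : Jet1 m} (hp : p ∈ V) (α β : Fin m) : T α β p = 0 := by
  have key : ∀ p ∈ V, ∃ r > 0, ball p r ⊆ V ∧ ∀ p₁ ∈ ball p r, ∀ p₂ ∈ ball p r,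
      (∀ α β, T α β p₁ = 0) → ∀ α β, T α β p₂ = 0 := by
    intro p hp
    have hF1 : ContDiffOn ℝ ∞ F V := contDiffOn_pi.2 hF
    obtain ⟨F', hF', r, hr, hs, he⟩ := hF1.exists_contDiff_eqOn_ball hV hp
    refine ⟨r, hr, hs, fun p₁ h₁ p₂ h₂ hz => ?_⟩
    exact ((h.mono hs).congr isOpen_ball (fun p hp => (he hp).symm)
      (fun _ _ _ _ => rfl)).eq_zero_of_segment (contDiff_pi.1 hF')
      ((convex_ball p r).segment_subset h₁ h₂) hz
  -- The set where `T` vanishes in a whole neighbourhood is open by definition. It is relatively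
  -- closed because one zero in a small ball forces vanishing on that ball.
  let u : Set (Jet1 m) := {p | p ∈ V ∧ ∀ᶠ p' in 𝓝 p, ∀ α β, T α β p' = 0}
  have hu : IsOpen u := hV.inter isOpen_setOfPred_eventually_nhds
  have hsub : V ⊆ u := by
    refine hVc.subset_of_closure_inter_subset hu ⟨p₀, hp₀, hp₀, ?_⟩ ?_
    · obtain ⟨r, hr, -, hk⟩ := key p₀ hp₀
      filter_upwards [ball_mem_nhds p₀ hr] with p' hp' using hk p₀ (mem_ball_self hr) p' hp' h0
    · rintro p ⟨hpc, hpV⟩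
      obtain ⟨r, hr, -, hk⟩ := key p hpV
      obtain ⟨p', hp', hp'u⟩ := mem_closure_iff.1 hpc (ball p r) isOpen_ball (mem_ball_self hr)
      refine ⟨hpV, ?_⟩
      filter_upwards [ball_mem_nhds p hr] with p'' hp'' using hk p' hp' p'' hp'' hp'u.2.self_of_nhds
  exact (hsub hp).2.self_of_nhds α β

/-- Multipliers that are linearly independent on a connected open set are linearly independent
at each point. -/
theorem linearIndependent_multiplier_at {ι : Type*} [Fintype ι] {F : Jet1 m → Fin m → ℝ}
    {V : Set (Jet1 m)}
    (hV : IsOpen V) (hVc : IsPreconnected V) (hF : ∀ α, ContDiffOn ℝ ∞ (fun p => F p α) V)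
    {M : ι → Jet1 m → Matrix (Fin m) (Fin m) ℝ}
    (h : ∀ i, IsParallelForm F V (fun α β p => M i p α β))
    (hM : LinearIndependent ℝ (fun i => (fun p : V => M i p))) {p : Jet1 m} (hp : p ∈ V) :
    LinearIndependent ℝ (fun i => M i p) := by
  rw [Fintype.linearIndependent_iff] at hM ⊢
  intro c hc
  apply hM c
  have h1 := IsParallelForm.sum Finset.univ c (fun i _ => h i)
  have h2 := fun p' (hp' : p' ∈ V) => h1.eq_zero_of_isPreconnected hV hVc hF hp (fun α β => by
    have := congrFun (congrFun hc α) β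
    simpa [Matrix.sum_apply] using this) hp'
  funext ⟨p', hp'⟩
  ext α β
  have := h2 p' hp' α β
  simpa [Matrix.sum_apply, Finset.sum_apply] using this

end

/-! ### Algebra of pairs of symmetric 2 × 2 matrices. -/

section

section MatrixAlgebra

open Matrix

theorem cayley_hamilton_fin_two (J : Matrix (Fin 2) (Fin 2) ℝ) :
    J * J = J.trace • J - J.det • (1 : Matrix (Fin 2) (Fin 2) ℝ) := by
  ext i j
  fin_cases i <;> fin_cases j <;>
    simp [Matrix.mul_apply, Matrix.trace_fin_two, Matrix.det_fin_two, Fin.sum_univ_two] <;> ring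

/-- `A X` and `D X` are skew, and skew 2 × 2 matrices form a line. Hence `A X = x ε` and `D X = y
ε`, so `x D = y A`. Independence gives `x = 0`, and then `X = 0`. -/
theorem eq_zero_of_infinitesimal_isometry {A D X : Matrix (Fin 2) (Fin 2) ℝ}
    (hdet : A.det ≠ 0) (hind : ∀ x y : ℝ, x • D = y • A → x = 0)
    (hA : Xᵀ * A + A * X = 0) (hD : Xᵀ * D + D * X = 0) (hAs : A.IsSymm) (hDs : D.IsSymm) :
    X = 0 := by
  let ε : Matrix (Fin 2) (Fin 2) ℝ := !![0, 1; -1, 0]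
  have hε : ε * ε = -1 := by
    ext i j
    fin_cases i <;> fin_cases j <;> simp [ε]
  have anti : ∀ C : Matrix (Fin 2) (Fin 2) ℝ, C.IsSymm → Xᵀ * C + C * X = 0 →
      ∃ x : ℝ, C * X = x • ε := by
    intro C hCs hC
    have h1 : (C * X)ᵀ + C * X = 0 := by rw [Matrix.transpose_mul, hCs]; exact hC
    refine ⟨(C * X) 0 1, ?_⟩
    generalize C * X = Y at h1
    have h00 := congrFun (congrFun h1 0) 0
    have h01 := congrFun (congrFun h1 0) 1
    have h11 := congrFun (congrFun h1 1) 1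
    simp only [Matrix.add_apply, Matrix.transpose_apply, Matrix.zero_apply] at h00 h01 h11
    ext i j
    fin_cases i <;> fin_cases j <;> simp [ε] <;> linarith
  obtain ⟨x, hx⟩ := anti A hAs hA
  obtain ⟨y, hy⟩ := anti D hDs hD
  have hu : IsUnit A.det := hdet.isUnit
  have hX : X = x • (A⁻¹ * ε) := by
    rw [← Matrix.mul_smul, ← hx, Matrix.nonsing_inv_mul_cancel_left _ _ hu]
  have h2 : x • (D * A⁻¹) = y • (1 : Matrix (Fin 2) (Fin 2) ℝ) := by
    have h3 : x • (D * A⁻¹ * ε) = y • ε := by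
      rw [← hy, hX, Matrix.mul_smul, Matrix.mul_assoc]
    have h4 := congrArg (fun Y => Y * ε) h3
    simp only [Matrix.smul_mul, Matrix.mul_assoc, hε, Matrix.mul_neg, Matrix.mul_one, smul_neg,
      neg_inj] at h4
    exact h4
  have h5 : x • D = y • A := by
    have h6 := congrArg (fun Y => Y * A) h2
    simpa only [Matrix.smul_mul, Matrix.nonsing_inv_mul_cancel_right _ _ hu, Matrix.one_mul] using h6
  rw [hX, hind x y h5, zero_smul]

/-- A matrix that conjugates `J` to `J₀` if these have the same trace and determinant. -/
def intertwiner (J₀ J : Matrix (Fin 2) (Fin 2) ℝ) : Matrix (Fin 2) (Fin 2) ℝ :=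
  let X := J₀ᵀ - (J₀.trace / 2) • 1
  ((J₀ - (J₀.trace / 2) • 1) * X).trace⁻¹ • (J₀ * X + X * (J - J₀.trace • 1))

/-- With common trace `t` and determinant `d`, Cayley-Hamilton turns both products into `J₀ X J - d
X`, up to the scalar factor. This holds for every `X`; the particular one only serves to normalize.
-/
theorem mul_intertwiner {J₀ J : Matrix (Fin 2) (Fin 2) ℝ} (ht : J.trace = J₀.trace)
    (hd : J.det = J₀.det) : J₀ * intertwiner J₀ J = intertwiner J₀ J * J := by
  simp only [intertwiner]
  generalize J₀ᵀ - (J₀.trace / 2) • 1 = X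
  rw [Matrix.mul_smul, Matrix.smul_mul]
  congr 1
  rw [Matrix.mul_add, Matrix.add_mul, ← Matrix.mul_assoc, cayley_hamilton_fin_two J₀,
    Matrix.mul_assoc X, Matrix.sub_mul J, cayley_hamilton_fin_two J, ht, hd]
  simp only [Matrix.sub_mul, Matrix.mul_sub, Matrix.smul_mul, Matrix.mul_smul, Matrix.one_mul,
    Matrix.mul_one, Matrix.mul_assoc]
  abel

/-- For the trace-free part `Y` of `J₀`, the choice `X = Yᵀ` gives `Y Yᵀ + Yᵀ Y = tr(Y Yᵀ) · 1`, by
the polarized Cayley-Hamilton identity. The trace is nonzero because `J₀` is not scalar. -/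
theorem intertwiner_self {J₀ : Matrix (Fin 2) (Fin 2) ℝ}
    (h : J₀ ≠ (J₀.trace / 2) • 1) : intertwiner J₀ J₀ = 1 := by
  have hc : ((J₀ - (J₀.trace / 2) • 1) * (J₀ᵀ - (J₀.trace / 2) • 1)).trace ≠ 0 := by
    intro h0
    apply h
    have h1 : J₀ᵀ - (J₀.trace / 2) • 1 = (J₀ - (J₀.trace / 2) • (1 : Matrix (Fin 2) (Fin 2) ℝ))ᵀ := by
      simp [Matrix.transpose_sub, Matrix.transpose_smul]
    rw [h1] at h0
    generalize hY : J₀ - (J₀.trace / 2) • (1 : Matrix (Fin 2) (Fin 2) ℝ) = Y at h0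
    have h2 : Y = 0 := by
      simp only [Matrix.trace_fin_two, Matrix.mul_apply, Fin.sum_univ_two, Matrix.transpose_apply] at h0
      have e00 : Y 0 0 = 0 := by nlinarith [sq_nonneg (Y 0 0), sq_nonneg (Y 0 1), sq_nonneg (Y 1 0), sq_nonneg (Y 1 1)]
      have e01 : Y 0 1 = 0 := by nlinarith [sq_nonneg (Y 0 0), sq_nonneg (Y 0 1), sq_nonneg (Y 1 0), sq_nonneg (Y 1 1)]
      have e10 : Y 1 0 = 0 := by nlinarith [sq_nonneg (Y 0 0), sq_nonneg (Y 0 1), sq_nonneg (Y 1 0), sq_nonneg (Y 1 1)]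
      have e11 : Y 1 1 = 0 := by nlinarith [sq_nonneg (Y 0 0), sq_nonneg (Y 0 1), sq_nonneg (Y 1 0), sq_nonneg (Y 1 1)]
      ext i j
      fin_cases i <;> fin_cases j <;> simpa
    rw [h2] at hY
    exact sub_eq_zero.1 hY
  simp only [intertwiner]
  have key : J₀ * (J₀ᵀ - (J₀.trace / 2) • 1) + (J₀ᵀ - (J₀.trace / 2) • 1) * (J₀ - J₀.trace • 1) =
      ((J₀ - (J₀.trace / 2) • 1) * (J₀ᵀ - (J₀.trace / 2) • 1)).trace • 1 := by
    ext i j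
    fin_cases i <;> fin_cases j <;>
      simp [Matrix.mul_apply, Matrix.trace_fin_two, Fin.sum_univ_two] <;> ring
  rw [key, smul_smul, inv_mul_cancel₀ hc, one_smul]

/-- The inverse square root of a matrix near the identity. -/
def invSqrtMatrix (N : Matrix (Fin 2) (Fin 2) ℝ) : Matrix (Fin 2) (Fin 2) ℝ :=
  (√N.det * √(N.trace + 2 * √N.det))⁻¹ • ((N.trace + √N.det) • 1 - N)

/-- With `s = √det N` and `t = √(tr N + 2 s)`, the square root of `N` is `(N + s) / t`. Its inverse
is the formula used, since `det (N + s) = s t²`. -/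
theorem invSqrtMatrix_mul {N : Matrix (Fin 2) (Fin 2) ℝ} (h1 : 0 < N.det)
    (h2 : 0 < N.trace + 2 * √N.det) : invSqrtMatrix N * N * invSqrtMatrix N = 1 := by
  have hs := Real.sq_sqrt h1.le
  have ht := Real.sq_sqrt h2.le
  have hs0 := (Real.sqrt_pos.2 h1).ne'
  have ht0 := (Real.sqrt_pos.2 h2).ne'
  set s := √N.det with hsdef
  set t := √(N.trace + 2 * s) with htdef
  have hCH := cayley_hamilton_fin_two N
  rw [← hs] at hCH
  have hinv : invSqrtMatrix N = (s * t)⁻¹ • ((N.trace + s) • 1 - N) := rfl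
  rw [hinv, Matrix.smul_mul, Matrix.smul_mul, Matrix.mul_smul, smul_smul]
  have key : ((N.trace + s) • 1 - N) * N * ((N.trace + s) • 1 - N) = (s * t) ^ 2 • (1 : Matrix (Fin 2) (Fin 2) ℝ) := by
    rw [mul_pow, ht, Matrix.sub_mul, hCH, Matrix.smul_mul, Matrix.one_mul]
    have e1 : (N.trace + s) • N - (N.trace • N - s ^ 2 • 1) = s • (N + s • (1 : Matrix (Fin 2) (Fin 2) ℝ)) := by
      rw [add_smul, smul_add, smul_smul, pow_two]; abel
    rw [e1, Matrix.smul_mul, Matrix.add_mul, Matrix.mul_sub, hCH, Matrix.mul_smul, Matrix.mul_one, Matrix.smul_mul,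
      Matrix.one_mul]
    module
  rw [key, smul_smul]
  have : (s * t)⁻¹ * (s * t)⁻¹ * (s * t) ^ 2 = 1 := by field_simp
  rw [this, one_smul]

/-- The matrix `A⁻¹ Rᵀ A₀ R`, where `R` is the intertwiner of `A₀⁻¹ D₀` and `A⁻¹ D`. -/
def frameDefect (A₀ D₀ A D : Matrix (Fin 2) (Fin 2) ℝ) : Matrix (Fin 2) (Fin 2) ℝ :=
  A⁻¹ * ((intertwiner (A₀⁻¹ * D₀) (A⁻¹ * D))ᵀ * A₀ * intertwiner (A₀⁻¹ * D₀) (A⁻¹ * D))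

/-- A matrix `P` such that `Pᵀ A₀ P = A` and `Pᵀ D₀ P = D`. -/
def frameMatrix (A₀ D₀ A D : Matrix (Fin 2) (Fin 2) ℝ) : Matrix (Fin 2) (Fin 2) ℝ :=
  intertwiner (A₀⁻¹ * D₀) (A⁻¹ * D) * invSqrtMatrix (frameDefect A₀ D₀ A D)

theorem frameDefect_self {A₀ D₀ : Matrix (Fin 2) (Fin 2) ℝ} (h₀ : A₀.det ≠ 0)
    (h : ∀ y : ℝ, D₀ ≠ y • A₀) : frameDefect A₀ D₀ A₀ D₀ = 1 := by
  have hu : IsUnit A₀.det := h₀.isUnit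
  have h1 : A₀⁻¹ * D₀ ≠ ((A₀⁻¹ * D₀).trace / 2) • 1 := by
    intro h2
    refine h ((A₀⁻¹ * D₀).trace / 2) ?_
    have h3 := congrArg (fun Y => A₀ * Y) h2
    simpa only [Matrix.mul_nonsing_inv_cancel_left _ _ hu, Matrix.mul_smul, Matrix.mul_one] using h3
  rw [frameDefect, intertwiner_self h1]
  simp [Matrix.nonsing_inv_mul _ hu]

/-- The intertwiner `R` conjugates `J = A⁻¹ D` to `J₀` but carries `A₀` only to `A N`, with `N` the
frame defect. Symmetry of `Rᵀ A₀ R` and `Rᵀ D₀ R` makes `N` self-adjoint for `A` and commuting with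
`J`. Hence so is `N^(-1/2)`, and multiplying `R` by it corrects both forms at once. -/
theorem frameMatrix_spec {A₀ D₀ A D : Matrix (Fin 2) (Fin 2) ℝ} (h₀ : A₀.det ≠ 0) (h : A.det ≠ 0)
    (hA₀ : A₀.IsSymm) (hD₀ : D₀.IsSymm) (hA : A.IsSymm) (hD : D.IsSymm)
    (ht : (A⁻¹ * D).trace = (A₀⁻¹ * D₀).trace) (hd : (A⁻¹ * D).det = (A₀⁻¹ * D₀).det)
    (h1 : 0 < (frameDefect A₀ D₀ A D).det)
    (h2 : 0 < (frameDefect A₀ D₀ A D).trace + 2 * √(frameDefect A₀ D₀ A D).det) :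
    (frameMatrix A₀ D₀ A D)ᵀ * A₀ * frameMatrix A₀ D₀ A D = A ∧
      (frameMatrix A₀ D₀ A D)ᵀ * D₀ * frameMatrix A₀ D₀ A D = D := by
  have hu₀ : IsUnit A₀.det := h₀.isUnit
  have hu : IsUnit A.det := h.isUnit
  have hRJ := mul_intertwiner ht hd
  have hK := invSqrtMatrix_mul h1 h2
  have hAN : A * frameDefect A₀ D₀ A D =
      (intertwiner (A₀⁻¹ * D₀) (A⁻¹ * D))ᵀ * A₀ * intertwiner (A₀⁻¹ * D₀) (A⁻¹ * D) := by
    rw [frameDefect, Matrix.mul_nonsing_inv_cancel_left _ _ hu]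
  rw [frameMatrix]
  -- Being a polynomial in `N`, the inverse square root inherits self-adjointness and commutation
  -- with `J`.
  have hKdef : ∀ N : Matrix (Fin 2) (Fin 2) ℝ, ∃ a b : ℝ, invSqrtMatrix N = a • 1 + b • N := by
    intro N
    refine ⟨(√N.det * √(N.trace + 2 * √N.det))⁻¹ * (N.trace + √N.det),
      -(√N.det * √(N.trace + 2 * √N.det))⁻¹, ?_⟩
    rw [invSqrtMatrix]
    module
  obtain ⟨a, b, hab⟩ := hKdef (frameDefect A₀ D₀ A D)
  generalize frameDefect A₀ D₀ A D = N at *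
  generalize invSqrtMatrix N = K at *
  generalize intertwiner (A₀⁻¹ * D₀) (A⁻¹ * D) = R at *
  have hD₀J : D₀ = A₀ * (A₀⁻¹ * D₀) := (Matrix.mul_nonsing_inv_cancel_left _ _ hu₀).symm
  have hDJ : A * (A⁻¹ * D) = D := Matrix.mul_nonsing_inv_cancel_left _ _ hu
  generalize A₀⁻¹ * D₀ = J₀ at *
  generalize A⁻¹ * D = J at *
  have hNA : Nᵀ * A = A * N := by
    have h3 : (A * N)ᵀ = A * N := by
      rw [hAN]
      simp only [Matrix.transpose_mul, Matrix.transpose_transpose, hA₀.eq, Matrix.mul_assoc]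
    rw [Matrix.transpose_mul, hA.eq] at h3
    exact h3
  have hRD : Rᵀ * D₀ * R = A * (N * J) := by
    rw [hD₀J, ← Matrix.mul_assoc A, hAN]
    simp only [Matrix.mul_assoc, hRJ]
  have hNJ : N * J = J * N := by
    have h3 : (A * (N * J))ᵀ = A * (N * J) := by
      rw [← hRD]
      simp only [Matrix.transpose_mul, Matrix.transpose_transpose, hD₀.eq, Matrix.mul_assoc]
    have h4 : A * (N * J) = A * (J * N) := by
      rw [← h3, ← Matrix.mul_assoc, Matrix.transpose_mul, Matrix.transpose_mul, hA.eq, hNA,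
        ← Matrix.mul_assoc, ← Matrix.mul_assoc, hDJ]
      have h5 : Jᵀ * A = D := by
        rw [← hD.eq, ← hDJ, Matrix.transpose_mul, hA.eq]
      rw [h5]
    have h6 := congrArg (fun Y => A⁻¹ * Y) h4
    simpa only [Matrix.nonsing_inv_mul_cancel_left _ _ hu] using h6
  have hKA : Kᵀ * A = A * K := by
    rw [hab]
    simp only [Matrix.transpose_add, Matrix.transpose_smul, Matrix.transpose_one, Matrix.add_mul,
      Matrix.mul_add, Matrix.smul_mul, Matrix.mul_smul, Matrix.one_mul, Matrix.mul_one, hNA]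
  have hKJ : J * K = K * J := by
    rw [hab]
    simp only [Matrix.add_mul, Matrix.mul_add, Matrix.smul_mul, Matrix.mul_smul, Matrix.one_mul,
      Matrix.mul_one, hNJ]
  constructor
  · calc (R * K)ᵀ * A₀ * (R * K) = Kᵀ * (Rᵀ * A₀ * R) * K := by
          simp only [Matrix.transpose_mul, Matrix.mul_assoc]
      _ = Kᵀ * A * N * K := by rw [← hAN]; simp only [Matrix.mul_assoc]
      _ = A * (K * N * K) := by rw [hKA]; simp only [Matrix.mul_assoc]
      _ = A := by rw [hK, Matrix.mul_one]
  · calc (R * K)ᵀ * D₀ * (R * K) = Kᵀ * (Rᵀ * D₀ * R) * K := by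
          simp only [Matrix.transpose_mul, Matrix.mul_assoc]
      _ = Kᵀ * A * N * (J * K) := by rw [hRD]; simp only [Matrix.mul_assoc]
      _ = A * (K * N * K) * J := by rw [hKA, hKJ]; simp only [Matrix.mul_assoc]
      _ = D := by rw [hK, Matrix.mul_one, hDJ]

end MatrixAlgebra

end

/-! ### Smoothness of the frame, invariants of a pair, and parallelism of frames. -/

section

section SmoothMatrix

variable {E : Type*} [NormedAddCommGroup E] [NormedSpace ℝ E]

/-- The entries of the matrix function `W` are smooth on `V`. -/
def SmoothMatrixOn (W : E → Matrix (Fin 2) (Fin 2) ℝ) (V : Set E) : Prop :=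
  ∀ i j, ContDiffOn ℝ ∞ (fun p => W p i j) V

namespace SmoothMatrixOn

variable {W W' : E → Matrix (Fin 2) (Fin 2) ℝ} {V : Set E}

theorem const (A : Matrix (Fin 2) (Fin 2) ℝ) : SmoothMatrixOn (fun _ : E => A) V :=
  fun _ _ => contDiffOn_const

theorem add (h : SmoothMatrixOn W V) (h' : SmoothMatrixOn W' V) :
    SmoothMatrixOn (fun p => W p + W' p) V := fun i j => (h i j).add (h' i j)

theorem sub (h : SmoothMatrixOn W V) (h' : SmoothMatrixOn W' V) :
    SmoothMatrixOn (fun p => W p - W' p) V := fun i j => (h i j).sub (h' i j)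

theorem smul {c : E → ℝ} (hc : ContDiffOn ℝ ∞ c V) (h : SmoothMatrixOn W V) :
    SmoothMatrixOn (fun p => c p • W p) V := fun i j => hc.mul (h i j)

theorem mul (h : SmoothMatrixOn W V) (h' : SmoothMatrixOn W' V) :
    SmoothMatrixOn (fun p => W p * W' p) V := fun i j => by
  simp only [Matrix.mul_apply]
  exact ContDiffOn.sum fun k _ => (h i k).mul (h' k j)

theorem transpose (h : SmoothMatrixOn W V) : SmoothMatrixOn (fun p => (W p).transpose) V :=
  fun i j => h j i

theorem trace (h : SmoothMatrixOn W V) : ContDiffOn ℝ ∞ (fun p => (W p).trace) V := by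
  simp only [Matrix.trace_fin_two]
  exact (h 0 0).add (h 1 1)

theorem det (h : SmoothMatrixOn W V) : ContDiffOn ℝ ∞ (fun p => (W p).det) V := by
  simp only [Matrix.det_fin_two]
  exact ((h 0 0).mul (h 1 1)).sub ((h 0 1).mul (h 1 0))

theorem inv (h : SmoothMatrixOn W V) (hdet : ∀ p ∈ V, (W p).det ≠ 0) :
    SmoothMatrixOn (fun p => (W p)⁻¹) V := by
  simp only [Matrix.inv_def, Ring.inverse_eq_inv', Matrix.adjugate_fin_two]
  refine smul (h.det.inv hdet) fun i j => ?_
  fin_cases i <;> fin_cases j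
  · exact h 1 1
  · exact (h 0 1).neg
  · exact (h 1 0).neg
  · exact h 0 0

theorem intertwiner (h : SmoothMatrixOn W V) (J₀ : Matrix (Fin 2) (Fin 2) ℝ) :
    SmoothMatrixOn (fun p => intertwiner J₀ (W p)) V := by
  unfold _root_.intertwiner
  exact smul contDiffOn_const ((const _).add ((const _).mul (h.sub (const _))))

theorem invSqrtMatrix (h : SmoothMatrixOn W V) (h1 : ∀ p ∈ V, 0 < (W p).det)
    (h2 : ∀ p ∈ V, 0 < (W p).trace + 2 * √(W p).det) :
    SmoothMatrixOn (fun p => invSqrtMatrix (W p)) V := by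
  unfold _root_.invSqrtMatrix
  have hs : ContDiffOn ℝ ∞ (fun p => √(W p).det) V := h.det.sqrt fun p hp => (h1 p hp).ne'
  have ht : ContDiffOn ℝ ∞ (fun p => √((W p).trace + 2 * √(W p).det)) V :=
    (h.trace.add (contDiffOn_const.mul hs)).sqrt fun p hp => (h2 p hp).ne'
  refine smul ((hs.mul ht).inv fun p hp => ?_) ((smul (h.trace.add hs) (const 1)).sub h)
  have := Real.sqrt_pos.2 (h1 p hp)
  have := Real.sqrt_pos.2 (h2 p hp)
  positivity

theorem frameDefect (h : SmoothMatrixOn W V) (h' : SmoothMatrixOn W' V)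
    (hdet : ∀ p ∈ V, (W p).det ≠ 0) (A₀ D₀ : Matrix (Fin 2) (Fin 2) ℝ) :
    SmoothMatrixOn (fun p => frameDefect A₀ D₀ (W p) (W' p)) V := by
  have hR := ((h.inv hdet).mul h').intertwiner (A₀⁻¹ * D₀)
  exact (h.inv hdet).mul ((hR.transpose.mul (const A₀)).mul hR)

end SmoothMatrixOn

end SmoothMatrix

open Jet1

/-- The expression is the polarized determinant `tr(adj(M) M')`. For parallel forms its logarithmic
derivative is `-2 tr B`, whichever forms are inserted, so quotients of such expressions are
constant. -/
theorem IsParallelForm.fderiv_polarDet {F : Jet1 2 → Fin 2 → ℝ} {V : Set (Jet1 2)}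
    {M M' : Jet1 2 → Matrix (Fin 2) (Fin 2) ℝ}
    (h : IsParallelForm F V (fun α β p => M p α β)) (h' : IsParallelForm F V (fun α β p => M' p α β))
    (hs : ∀ p ∈ V, (M p).IsSymm) (hs' : ∀ p ∈ V, (M' p).IsSymm) {p : Jet1 2} (hp : p ∈ V) :
    DifferentiableAt ℝ (fun p => M p 1 1 * M' p 0 0 - M p 0 1 * M' p 1 0 - M p 1 0 * M' p 0 1 +
      M p 0 0 * M' p 1 1) p ∧
    ∀ v, fderiv ℝ (fun p => M p 1 1 * M' p 0 0 - M p 0 1 * M' p 1 0 - M p 1 0 * M' p 0 1 +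
      M p 0 0 * M' p 1 1) p v =
      -2 * (connMatrix F p v.toJet0 0 0 + connMatrix F p v.toJet0 1 1) *
      (M p 1 1 * M' p 0 0 - M p 0 1 * M' p 1 0 - M p 1 0 * M' p 0 1 + M p 0 0 * M' p 1 1) := by
  have hd := fun α β => (h p hp α β).1.hasFDerivAt
  have hd' := fun α β => (h' p hp α β).1.hasFDerivAt
  have H := ((((hd 1 1).fun_mul (hd' 0 0)).fun_sub ((hd 0 1).fun_mul (hd' 1 0))).fun_sub
    ((hd 1 0).fun_mul (hd' 0 1))).fun_add ((hd 0 0).fun_mul (hd' 1 1))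
  refine ⟨H.differentiableAt, fun v => ?_⟩
  rw [H.fderiv]
  simp only [_root_.add_apply, _root_.sub_apply, _root_.smul_apply, smul_eq_mul,
    (h p hp _ _).2 v, (h' p hp _ _).2 v, Fin.sum_univ_two]
  have e1 : M p 1 0 = M p 0 1 := (hs p hp).apply 0 1
  have e2 : M' p 1 0 = M' p 0 1 := (hs' p hp).apply 0 1
  rw [e1, e2]
  ring

theorem fderiv_div_eq_zero {E : Type*} [NormedAddCommGroup E] [NormedSpace ℝ E] {f g : E → ℝ}
    {p : E} (hf : DifferentiableAt ℝ f p) (hg : DifferentiableAt ℝ g p) (hg0 : g p ≠ 0)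
    {k : E → ℝ} (hfk : ∀ v, fderiv ℝ f p v = k v * f p) (hgk : ∀ v, fderiv ℝ g p v = k v * g p) :
    DifferentiableAt ℝ (fun p => f p / g p) p ∧ fderiv ℝ (fun p => f p / g p) p = 0 := by
  have hi : HasFDerivAt (fun p => (g p)⁻¹) (-(g p ^ 2)⁻¹ • fderiv ℝ g p) p :=
    (hasDerivAt_inv hg0).comp_hasFDerivAt p hg.hasFDerivAt
  have H' : HasFDerivAt (fun p => f p * (g p)⁻¹) (0 : E →L[ℝ] ℝ) p := by
    refine (hf.hasFDerivAt.fun_mul hi).congr_fderiv ?_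
    ext v
    simp only [_root_.add_apply, _root_.smul_apply, smul_eq_mul, hfk, hgk, _root_.zero_apply]
    field_simp
    ring
  simp only [div_eq_mul_inv]
  exact ⟨H'.differentiableAt, H'.fderiv⟩

/-- Trace and determinant of `M⁻¹ M'` are quotients of polarized determinants, up to a constant
factor. All of these have the same logarithmic derivative, and a ball is connected. -/
theorem IsParallelForm.trace_det_const {F : Jet1 2 → Fin 2 → ℝ} {p₀ : Jet1 2} {r : ℝ}
    {M M' : Jet1 2 → Matrix (Fin 2) (Fin 2) ℝ}
    (h : IsParallelForm F (ball p₀ r) (fun α β p => M p α β))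
    (h' : IsParallelForm F (ball p₀ r) (fun α β p => M' p α β))
    (hs : ∀ p ∈ ball p₀ r, (M p).IsSymm) (hs' : ∀ p ∈ ball p₀ r, (M' p).IsSymm)
    (hdet : ∀ p ∈ ball p₀ r, (M p).det ≠ 0) {p : Jet1 2} (hp : p ∈ ball p₀ r) :
    ((M p)⁻¹ * M' p).trace = ((M p₀)⁻¹ * M' p₀).trace ∧
      ((M p)⁻¹ * M' p).det = ((M p₀)⁻¹ * M' p₀).det := by
  have hp₀ : p₀ ∈ ball p₀ r := mem_ball_self (pos_of_mem_ball hp)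
  let pol : (Jet1 2 → Matrix (Fin 2) (Fin 2) ℝ) → (Jet1 2 → Matrix (Fin 2) (Fin 2) ℝ) → Jet1 2 → ℝ :=
    fun M M' p => M p 1 1 * M' p 0 0 - M p 0 1 * M' p 1 0 - M p 1 0 * M' p 0 1 + M p 0 0 * M' p 1 1
  have hpol : ∀ M p, pol M M p = 2 * (M p).det := fun M p => by
    simp only [pol, Matrix.det_fin_two]; ring
  have hne : ∀ p ∈ ball p₀ r, pol M M p ≠ 0 := fun p hp => by
    rw [hpol]; exact mul_ne_zero two_ne_zero (hdet p hp)
  have htr : ∀ p ∈ ball p₀ r, ((M p)⁻¹ * M' p).trace = 2 * (pol M M' p / pol M M p) := by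
    intro p hp
    rw [hpol, Matrix.inv_def, Ring.inverse_eq_inv', Matrix.adjugate_fin_two]
    have := hdet p hp
    simp only [pol, Matrix.trace_fin_two, Matrix.mul_apply, Fin.sum_univ_two, Matrix.smul_apply,
      Matrix.of_apply, Matrix.cons_val', Matrix.cons_val_zero, Matrix.cons_val_one, smul_eq_mul,
      Matrix.cons_val_fin_one]
    field_simp
    ring
  have hdt : ∀ p ∈ ball p₀ r, ((M p)⁻¹ * M' p).det = pol M' M' p / pol M M p := by
    intro p hp
    rw [hpol, hpol, Matrix.det_mul, Matrix.det_nonsing_inv, Ring.inverse_eq_inv']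
    have := hdet p hp
    field_simp
  have const : ∀ f : Jet1 2 → ℝ, (∀ p ∈ ball p₀ r, DifferentiableAt ℝ f p ∧ fderiv ℝ f p = 0) →
      f p = f p₀ := fun f hf =>
    isOpen_ball.is_const_of_fderiv_eq_zero (convex_ball p₀ r).isPreconnected
      (fun p hp => (hf p hp).1.differentiableWithinAt) (fun p hp => (hf p hp).2) hp hp₀
  have c1 := const (fun p => pol M M' p / pol M M p) fun p hp =>
    fderiv_div_eq_zero (h.fderiv_polarDet h' hs hs' hp).1 (h.fderiv_polarDet h hs hs hp).1 (hne p hp)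
      (h.fderiv_polarDet h' hs hs' hp).2 (h.fderiv_polarDet h hs hs hp).2
  have c2 := const (fun p => pol M' M' p / pol M M p) fun p hp =>
    fderiv_div_eq_zero (h'.fderiv_polarDet h' hs' hs' hp).1 (h.fderiv_polarDet h hs hs hp).1 (hne p hp)
      (h'.fderiv_polarDet h' hs' hs' hp).2 (h.fderiv_polarDet h hs hs hp).2
  rw [htr p hp, htr p₀ hp₀, hdt p hp, hdt p₀ hp₀]
  exact ⟨congrArg _ c1, c2⟩

/-- A frame in which two parallel symmetric forms are constant is parallel. -/
theorem IsParallelForm.frame_parallel {F : Jet1 2 → Fin 2 → ℝ} {V : Set (Jet1 2)} (hV : IsOpen V)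
    {M M' P : Jet1 2 → Matrix (Fin 2) (Fin 2) ℝ}
    (h : IsParallelForm F V (fun α β p => M p α β)) (h' : IsParallelForm F V (fun α β p => M' p α β))
    {A D : Matrix (Fin 2) (Fin 2) ℝ} (hA : A.IsSymm) (hD : D.IsSymm) (hAdet : A.det ≠ 0)
    (hind : ∀ x y : ℝ, x • D = y • A → x = 0)
    (hP : SmoothMatrixOn P V) (hPA : ∀ p ∈ V, (P p).transpose * A * P p = M p)
    (hPD : ∀ p ∈ V, (P p).transpose * D * P p = M' p) (hPdet : ∀ p ∈ V, (P p).det ≠ 0)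
    {p : Jet1 2} (hp : p ∈ V) (v : Jet1 2) (α β : Fin 2) :
    fderiv ℝ (fun p => P p α β) p v = - ∑ δ, P p α δ * connMatrix F p v.toJet0 δ β := by
  let P' : Matrix (Fin 2) (Fin 2) ℝ := Matrix.of fun α β => fderiv ℝ (fun p => P p α β) p v
  let B : Matrix (Fin 2) (Fin 2) ℝ := Matrix.of (connMatrix F p v.toJet0)
  have hdP : ∀ α β, HasFDerivAt (fun p => P p α β) (fderiv ℝ (fun p => P p α β) p) p := fun α β =>
    (((hP α β).contDiffAt (hV.mem_nhds hp)).differentiableAt (by simp)).hasFDerivAt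
  -- Subtracting the parallelism of `S` from the derivative of `Pᵀ C P = S` shows that `(P' + P B)
  -- P⁻¹` is an infinitesimal isometry of `C`. Applied to both constant forms this makes it zero,
  -- which is `P' = -P B`.
  have key : ∀ (C : Matrix (Fin 2) (Fin 2) ℝ) (S : Jet1 2 → Matrix (Fin 2) (Fin 2) ℝ), C.IsSymm →
      IsParallelForm F V (fun α β p => S p α β) → (∀ p ∈ V, (P p).transpose * C * P p = S p) →
      ((P' + P p * B) * (P p)⁻¹).transpose * C + C * ((P' + P p * B) * (P p)⁻¹) = 0 := by
    intro C S hC hS hPC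
    have hu : IsUnit (P p).det := (hPdet p hp).isUnit
    have hut : IsUnit (P p).transpose.det := by rwa [Matrix.det_transpose]
    have h1 : P'.transpose * C * P p + (P p).transpose * C * P' =
        - (S p * B + B.transpose * S p) := by
      ext α β
      have e1 : EqOn (fun p => S p α β) (fun p => ∑ j, (∑ i, P p i α * C i j) * P p j β) V := by
        intro p hp
        simp only [← hPC p hp, Matrix.mul_apply, Matrix.transpose_apply]
      have e2 : HasFDerivAt (fun p => ∑ j, (∑ i, P p i α * C i j) * P p j β)
          (∑ j, ((∑ i, P p i α * C i j) • fderiv ℝ (fun p => P p j β) p +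
            P p j β • (∑ i, C i j • fderiv ℝ (fun p => P p i α) p))) p :=
        HasFDerivAt.fun_sum fun j _ => (HasFDerivAt.fun_sum fun i _ =>
          (hdP i α).mul_const (C i j)).fun_mul (hdP j β)
      have e3 := (hS p hp α β).2 v
      rw [e1.fderiv_eq_of_isOpen hV hp, e2.fderiv] at e3
      have e4 : (- (S p * B + B.transpose * S p)) α β =
          - ∑ δ, (S p α δ * connMatrix F p v.toJet0 δ β + S p β δ * connMatrix F p v.toJet0 δ α) := by
        have hSs : ∀ δ, S p δ β = S p β δ := by
          intro δ
          have : (S p).IsSymm := by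
            rw [← hPC p hp]
            simp only [Matrix.IsSymm, Matrix.transpose_mul, Matrix.transpose_transpose, hC.eq,
              Matrix.mul_assoc]
          exact this.apply β δ
        simp only [Matrix.neg_apply, Matrix.add_apply, Matrix.mul_apply, B, Matrix.of_apply,
          Matrix.transpose_apply, Finset.sum_add_distrib, hSs]
        simp only [mul_comm]
      rw [e4, ← e3]
      simp only [_root_.sum_apply, _root_.add_apply, _root_.smul_apply, smul_eq_mul, Matrix.add_apply,
        Matrix.mul_apply, Matrix.transpose_apply, P', Matrix.of_apply, Finset.sum_add_distrib,
        Finset.mul_sum, Finset.sum_mul]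
      rw [add_comm]
      congr 1
      exact Finset.sum_congr rfl fun j _ => Finset.sum_congr rfl fun i _ => by ring
    have h2 : (P' + P p * B).transpose * C * P p + (P p).transpose * C * (P' + P p * B) = 0 := by
      have h3 : (P' + P p * B).transpose * C * P p + (P p).transpose * C * (P' + P p * B) =
          (P'.transpose * C * P p + (P p).transpose * C * P') +
          (((P p).transpose * C * P p) * B + B.transpose * ((P p).transpose * C * P p)) := by
        simp only [Matrix.transpose_add, Matrix.transpose_mul, Matrix.add_mul, Matrix.mul_add,
          Matrix.mul_assoc]
        abel
      rw [h3, h1, hPC p hp]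
      abel
    have h4 : (P p).transpose⁻¹ * ((P' + P p * B).transpose * C * P p +
        (P p).transpose * C * (P' + P p * B)) * (P p)⁻¹ = 0 := by rw [h2]; simp
    clear h2
    generalize P' + P p * B = Y at h4 ⊢
    rw [← h4, Matrix.mul_add, Matrix.add_mul, Matrix.transpose_mul, Matrix.transpose_nonsing_inv]
    congr 1
    · simp only [Matrix.mul_assoc, Matrix.mul_nonsing_inv _ hu, Matrix.mul_one]
    · simp only [← Matrix.mul_assoc, Matrix.nonsing_inv_mul _ hut, Matrix.one_mul]
  have hX := eq_zero_of_infinitesimal_isometry hAdet hind (key A M hA h hPA) (key D M' hD h' hPD) hA hD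
  have hY : P' + P p * B = 0 := by
    have := congrArg (fun Y => Y * P p) hX
    simpa only [Matrix.nonsing_inv_mul_cancel_right _ _ (hPdet p hp).isUnit, Matrix.zero_mul] using this
  have hY' := congrFun (congrFun hY α) β
  simp only [Matrix.add_apply, Matrix.mul_apply, P', B, Matrix.of_apply, Matrix.zero_apply] at hY'
  linarith

end

/-! ### Parallel coframes integrate to normalizing substitutions. -/

section

open Jet1

variable {m : ℕ}

theorem eq_of_fderiv_sub_eq_zero {E : Type*} [NormedAddCommGroup E] [NormedSpace ℝ E] {f : E → ℝ}
    {V : Set E} (hVc : Convex ℝ V) {p q : E} (hp : p ∈ V) (hq : q ∈ V)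
    (hd : ∀ x ∈ V, DifferentiableAt ℝ f x) (h0 : ∀ x ∈ V, fderiv ℝ f x (q - p) = 0) : f p = f q := by
  obtain ⟨z, hz, h⟩ := domain_mvt (f := f) (f' := fderiv ℝ f)
    (fun x hx => (hd x hx).hasFDerivAt.hasFDerivWithinAt) hVc hp hq
  rw [h0 z (hVc.segment_subset hp hq hz)] at h
  linarith

/-- The section of `J¹ → J⁰` with the same first derivatives as `p₀`. -/
def Jet0.lift (p₀ : Jet1 m) (z : Jet0 m) : Jet1 m := (z.1, z.2.1, z.2.2, p₀.ux, p₀.uy)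

theorem Jet0.lift_mem_ball {p₀ : Jet1 m} {z : Jet0 m} {r : ℝ} (hz : z ∈ ball p₀.toJet0 r) :
    Jet0.lift p₀ z ∈ ball p₀ r := by
  have hr : 0 < r := pos_of_mem_ball hz
  simp only [mem_ball, Prod.dist_eq, max_lt_iff, Jet1.toJet0_apply] at hz ⊢
  exact ⟨hz.1, hz.2.1, hz.2.2, by simpa [Jet0.lift, Jet1.ux] using hr,
    by simpa [Jet0.lift, Jet1.uy] using hr⟩

theorem Jet0.toJet0_lift (p₀ : Jet1 m) (z : Jet0 m) : (Jet0.lift p₀ z).toJet0 = z := rfl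

theorem Jet0.contDiff_lift (p₀ : Jet1 m) : ContDiff ℝ ∞ (Jet0.lift p₀) := by
  unfold Jet0.lift
  fun_prop

theorem Jet1.vertical_eq (v : Jet1 m) (hv : v.toJet0 = 0) :
    v = ∑ γ, v.ux γ • dirUx γ + ∑ γ, v.uy γ • dirUy γ := by
  have h := Jet1.decompose 0 v
  simp only [Jet1.toJet0_apply, Prod.mk_eq_zero] at hv
  have hx : v.x = 0 := hv.1
  have hy : v.y = 0 := hv.2.1
  have hu : v.u = 0 := hv.2.2
  simpa [hx, hy, hu] using h

/-- Smooth functions on a ball of `J¹` that do not depend on the first derivatives are functions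
on `J⁰`. -/
theorem exists_descent {ι : Type*} [Fintype ι] {G : ι → Jet1 m → ℝ} {p₀ : Jet1 m} {r : ℝ} (hr : 0 < r)
    (hG : ∀ i, ContDiffOn ℝ ∞ (G i) (ball p₀ r))
    (hx : ∀ i, ∀ p ∈ ball p₀ r, ∀ γ, fderiv ℝ (G i) p (dirUx γ) = 0)
    (hy : ∀ i, ∀ p ∈ ball p₀ r, ∀ γ, fderiv ℝ (G i) p (dirUy γ) = 0) :
    ∃ g : ι → Jet0 m → ℝ, (∀ i, ContDiff ℝ ∞ (g i)) ∧ ∃ s > 0, s ≤ r ∧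
      ∀ i, ∀ p ∈ ball p₀ s, G i p = g i p.toJet0 := by
  have h1 : ContDiffOn ℝ ∞ (fun z i => G i (Jet0.lift p₀ z)) (ball p₀.toJet0 r) :=
    contDiffOn_pi.2 fun i => (hG i).comp (Jet0.contDiff_lift p₀).contDiffOn
      fun z hz => Jet0.lift_mem_ball hz
  obtain ⟨g, hg, s, hs, -, heq⟩ := h1.exists_contDiff_eqOn_ball isOpen_ball (mem_ball_self hr)
  refine ⟨fun i z => g z i, contDiff_pi.1 hg, min s r, lt_min hs hr, min_le_right _ _,
    fun i p hp => ?_⟩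
  have hp1 : p ∈ ball p₀ r := ball_subset_ball (min_le_right _ _) hp
  have hp2 : p ∈ ball p₀ s := ball_subset_ball (min_le_left _ _) hp
  simp only [heq (Jet1.toJet0_mem_ball hp2)]
  refine eq_of_fderiv_sub_eq_zero (convex_ball p₀ r) hp1
    (Jet0.lift_mem_ball (Jet1.toJet0_mem_ball hp1))
    (fun x hx' => ((hG i).contDiffAt (isOpen_ball.mem_nhds hx')).differentiableAt (by simp))
    fun x hx' => ?_
  rw [Jet1.vertical_eq (Jet0.lift p₀ p.toJet0 - p) (by rw [map_sub, Jet0.toJet0_lift, sub_self])]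
  simp [hx i x hx', hy i x hx']

theorem Jet1.hasFDerivAt_totalXY {φ : Jet0 m → ℝ} (hφ : ContDiff ℝ ∞ φ) (p v : Jet1 m)
    (hv : v.toJet0 = 0) : fderiv ℝ (Jet1.totalXY φ) p v =
      fderiv ℝ (fderiv ℝ φ) p.toJet0 (0, 0, v.ux) (0, 1, p.uy) +
        fderiv ℝ (fderiv ℝ φ) p.toJet0 (1, 0, p.ux) (0, 0, v.uy) := by
  have h1 : HasFDerivAt (fun p : Jet1 m => fderiv ℝ (fderiv ℝ φ) p.toJet0)
      ((fderiv ℝ (fderiv ℝ (fderiv ℝ φ)) p.toJet0).comp Jet1.toJet0) p :=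
    (hφ.fderiv_smooth.fderiv_smooth.hasFDerivAt_of_smooth _).comp p Jet1.toJet0.hasFDerivAt
  have h2 : HasFDerivAt (fun p : Jet1 m => ((1, 0, p.ux) : Jet0 m))
      ((0 : Jet1 m →L[ℝ] ℝ).prod ((0 : Jet1 m →L[ℝ] ℝ).prod Jet1.uxL)) p :=
    (hasFDerivAt_const _ _).prodMk ((hasFDerivAt_const _ _).prodMk Jet1.uxL.hasFDerivAt)
  have h3 : HasFDerivAt (fun p : Jet1 m => ((0, 1, p.uy) : Jet0 m))
      ((0 : Jet1 m →L[ℝ] ℝ).prod ((0 : Jet1 m →L[ℝ] ℝ).prod Jet1.uyL)) p :=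
    (hasFDerivAt_const _ _).prodMk ((hasFDerivAt_const _ _).prodMk Jet1.uyL.hasFDerivAt)
  have h4 := ((h1.clm_apply h2).clm_apply h3).fderiv
  have h5 : fderiv ℝ (Jet1.totalXY φ) p v = _ := congrArg (fun T => T v) h4
  rw [h5]
  simp only [_root_.add_apply, ContinuousLinearMap.comp_apply, ContinuousLinearMap.flip_apply, hv,
    ContinuousLinearMap.prod_apply, map_zero, _root_.zero_apply, Jet1.uxL_apply, Jet1.uyL_apply, add_zero]
  exact add_comm _ _

theorem connMatrix_vecX (F : Jet1 m → Fin m → ℝ) (p : Jet1 m) (δ β : Fin m) :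
    connMatrix F p (vecX p).toJet0 δ β = dirDeriv (dirUy β) (fun p => F p δ) p := by
  simp [connMatrix, vecX]

theorem connMatrix_vecY (F : Jet1 m → Fin m → ℝ) (p : Jet1 m) (δ β : Fin m) :
    connMatrix F p (vecY p).toJet0 δ β = dirDeriv (dirUx β) (fun p => F p δ) p := by
  simp [connMatrix, vecY]

theorem connMatrix_dirU (F : Jet1 m → Fin m → ℝ) (p : Jet1 m) (δ β γ : Fin m) :
    connMatrix F p (dirU γ).toJet0 δ β =
      dirDeriv (dirUy γ) (dirDeriv (dirUx β) (fun p => F p δ)) p := by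
  simp [connMatrix, dirU, Pi.single_apply]

theorem connMatrix_zero (F : Jet1 m → Fin m → ℝ) (p : Jet1 m) (δ β : Fin m) :
    connMatrix F p 0 δ β = 0 := by
  simp [connMatrix]

/-- The coframe with components `a` is parallel with respect to the connection of `F`. -/
def IsParallelCoframe (F : Jet1 m → Fin m → ℝ) (V : Set (Jet1 m)) (a : Fin m → Fin m → Jet0 m → ℝ) :
    Prop :=
  ∀ p ∈ V, ∀ α β v, fderiv ℝ (a α β) p.toJet0 v = - ∑ δ, a α δ p.toJet0 * connMatrix F p v δ β

/-- The `u^γ`-derivative of `a α β` contains `∂²F/∂u^γ_y∂u^β_x`. Differentiating the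
`vecX`-derivative of `a α γ` by `u^β_x` gives its `u^β`-derivative with the same two
differentiations in the other order, and these commute. -/
theorem IsParallelCoframe.closed {F : Jet1 m → Fin m → ℝ} {V : Set (Jet1 m)}
    {a : Fin m → Fin m → Jet0 m → ℝ} (hV : IsOpen V) (hF : ∀ α, ContDiff ℝ ∞ fun p => F p α)
    (ha : ∀ α β, ContDiff ℝ ∞ (a α β)) (h : IsParallelCoframe F V a) {p : Jet1 m} (hp : p ∈ V)
    (α β γ : Fin m) : Jet0.partialU (a α β) γ p.toJet0 = Jet0.partialU (a α γ) β p.toJet0 := by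
  have hu : ∀ β γ, Jet0.partialU (a α β) γ p.toJet0 =
      - ∑ δ, a α δ p.toJet0 * dirDeriv (dirUy γ) (dirDeriv (dirUx β) (fun p => F p δ)) p := by
    intro β γ
    have := h p hp α β (dirU γ).toJet0
    simp only [connMatrix_dirU] at this
    exact this
  have hcomp : ∀ α β, ContDiff ℝ ∞ fun p : Jet1 m => a α β p.toJet0 := fun α β =>
    (ha α β).comp Jet1.toJet0.contDiff
  have hx : Jet0.partialU (a α γ) β p.toJet0 =
      - ∑ δ, a α δ p.toJet0 * dirDeriv (dirUx β) (dirDeriv (dirUy γ) (fun p => F p δ)) p := by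
    have e1 : EqOn (fun p : Jet1 m => fderiv ℝ (fun p : Jet1 m => a α γ p.toJet0) p (vecX p))
        (fun p : Jet1 m => - ∑ δ, a α δ p.toJet0 * dirDeriv (dirUy γ) (fun p => F p δ) p) V := by
      intro p hp
      have := h p hp α γ (vecX p).toJet0
      simp only [connMatrix_vecX] at this
      simp only []
      rw [← this]
      exact Jet1.fderiv_comp_toJet0 (ha α γ) p (vecX p)
    have e2 := congrArg (fun T => T (dirUx β)) (e1.fderiv_eq_of_isOpen hV hp)
    have e3 : HasFDerivAt
        (fun p : Jet1 m => - ∑ δ, a α δ p.toJet0 * dirDeriv (dirUy γ) (fun p => F p δ) p)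
        (- ∑ δ, (a α δ p.toJet0 • fderiv ℝ (dirDeriv (dirUy γ) (fun p => F p δ)) p +
          dirDeriv (dirUy γ) (fun p => F p δ) p • fderiv ℝ (fun p : Jet1 m => a α δ p.toJet0) p)) p :=
      (HasFDerivAt.fun_sum fun δ _ => ((hcomp α δ).hasFDerivAt_of_smooth p).fun_mul
        (((hF δ).dirDeriv _).hasFDerivAt_of_smooth p)).fun_neg
    have e4 : dirDeriv (dirUx β) (fun p : Jet1 m => a α γ p.toJet0) = fun _ => 0 := by
      funext p
      exact (Jet1.fderiv_comp_toJet0 (ha α γ) p (dirUx β)).trans (map_zero _)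
    have e5 : ∀ δ, fderiv ℝ (fun p : Jet1 m => a α δ p.toJet0) p (dirUx β) = 0 := fun δ =>
      (Jet1.fderiv_comp_toJet0 (ha α δ) p (dirUx β)).trans (map_zero _)
    rw [fderiv_along_vecX (hcomp α γ), e3.fderiv, e4] at e2
    simp only [fderiv_fun_const, Pi.zero_apply, _root_.zero_apply, zero_add, _root_.neg_apply,
      _root_.sum_apply, _root_.add_apply, _root_.smul_apply, smul_eq_mul, e5, mul_zero, add_zero] at e2
    rw [show ((0, 0, (dirUx β : Jet1 m).ux, 0, 0) : Jet1 m) = dirU β from rfl] at e2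
    exact (Jet1.fderiv_comp_toJet0 (ha α γ) p (dirU β)).symm.trans e2
  rw [hu, hx]
  congr 1
  exact Finset.sum_congr rfl fun δ _ => by rw [dirDeriv_comm (hF δ)]

/-- A parallel coframe is the differential of a normalizing substitution. -/
theorem IsParallelCoframe.exists_normalizesAt {F : Jet1 m → Fin m → ℝ} {p₀ : Jet1 m} {r : ℝ}
    (hr : 0 < r) {a : Fin m → Fin m → Jet0 m → ℝ} (hF : ∀ α, ContDiff ℝ ∞ fun p => F p α)
    (ha : ∀ α β, ContDiff ℝ ∞ (a α β)) (h : IsParallelCoframe F (ball p₀ r) a)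
    (hdet : ∀ p ∈ ball p₀ r, (Matrix.of fun α β => a α β p.toJet0).det ≠ 0) :
    ∃ s, s ≤ r ∧ ∃ φ n, NormalizesAt F p₀ s φ n ∧
      ∀ p ∈ ball p₀ s, jacobianU φ p.toJet0 = Matrix.of fun α β => a α β p.toJet0 := by
  have hpot : ∀ α, ∃ φ : Jet0 m → ℝ, ContDiff ℝ ∞ φ ∧ ∀ z ∈ ball p₀.toJet0 r, ∀ β,
      fderiv ℝ φ z (0, 0, Pi.single β 1) = a α β z := fun α =>
    exists_potential (ha α) fun z hz β γ =>
      h.closed isOpen_ball hF ha (Jet0.lift_mem_ball hz) α β γ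
  choose φ hφ hφa using hpot
  -- This is `D_x D_y φ` restricted to the equation, the right-hand side of the transformed system.
  -- It remains to see that it does not depend on first derivatives.
  let G : Fin m → Jet1 m → ℝ := fun α p => Jet1.totalXY (φ α) p +
    ∑ β, Jet0.partialU (φ α) β p.toJet0 * F p β
  have hGs : ∀ α, ContDiff ℝ ∞ (G α) := fun α =>
    (Jet1.contDiff_totalXY (hφ α)).add (ContDiff.sum fun β _ =>
      (((hφ α).jet0_partialU β).comp Jet1.toJet0.contDiff).mul (hF β))
  have hpart : ∀ α β, ∀ p ∈ ball p₀ r, ∀ v, fderiv ℝ (Jet0.partialU (φ α) β) p.toJet0 v =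
      - ∑ δ, a α δ p.toJet0 * connMatrix F p v δ β := by
    intro α β p hp v
    have h1 : EqOn (Jet0.partialU (φ α) β) (a α β) (ball p₀.toJet0 r) := fun z hz => hφa α z hz β
    rw [h1.fderiv_eq_of_isOpen isOpen_ball (Jet1.toJet0_mem_ball hp), h p hp]
  have hGd : ∀ α p v, v.toJet0 = 0 → fderiv ℝ (G α) p v =
      fderiv ℝ (Jet1.totalXY (φ α)) p v + ∑ β, Jet0.partialU (φ α) β p.toJet0 *
        fderiv ℝ (fun p => F p β) p v := by
    intro α p v hv
    have e : HasFDerivAt (G α) (fderiv ℝ (Jet1.totalXY (φ α)) p +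
        ∑ β, (Jet0.partialU (φ α) β p.toJet0 • fderiv ℝ (fun p => F p β) p +
          F p β • fderiv ℝ (fun p : Jet1 m => Jet0.partialU (φ α) β p.toJet0) p)) p :=
      ((Jet1.contDiff_totalXY (hφ α)).hasFDerivAt_of_smooth p).add (HasFDerivAt.fun_sum fun β _ =>
        (((((hφ α).jet0_partialU β).comp Jet1.toJet0.contDiff)).hasFDerivAt_of_smooth p).fun_mul
          ((hF β).hasFDerivAt_of_smooth p))
    have e5 : ∀ δ, fderiv ℝ (fun p : Jet1 m => Jet0.partialU (φ α) δ p.toJet0) p v = 0 := fun δ =>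
      (Jet1.fderiv_comp_toJet0 ((hφ α).jet0_partialU δ) p v).trans (by rw [hv, map_zero])
    rw [e.fderiv]
    simp [e5, -Jet1.toJet0_apply]
  -- The `u^γ_x`-derivative of `G` is the `vecY`-derivative of `φ_γ` plus `φ_β ∂F^β/∂u^γ_x`, which
  -- is the parallel equation along `vecY`.
  have hx : ∀ α, ∀ p ∈ ball p₀ r, ∀ γ, fderiv ℝ (G α) p (dirUx γ) = 0 := by
    intro α p hp γ
    rw [hGd α p _ rfl, Jet1.hasFDerivAt_totalXY (hφ α) p _ rfl,
      (hφ α).fderiv_fderiv_comm, show ((0, 0, (dirUx γ : Jet1 m).uy) : Jet0 m) = 0 from rfl, map_zero,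
      add_zero, show ((0, 0, (dirUx γ : Jet1 m).ux) : Jet0 m) = (0, 0, Pi.single γ 1) from rfl,
      ← (hφ α).fderiv_fderiv_apply]
    have e1 := hpart α γ p hp (vecY p).toJet0
    simp only [connMatrix_vecY] at e1
    have e2 : fderiv ℝ (fun z => fderiv ℝ (φ α) z (0, 0, Pi.single γ 1)) p.toJet0 (0, 1, p.uy) =
      fderiv ℝ (Jet0.partialU (φ α) γ) p.toJet0 (vecY p).toJet0 := rfl
    rw [e2, e1, neg_add_eq_zero]
    exact Finset.sum_congr rfl fun δ _ => by
      rw [Jet0.partialU, hφa α _ (Jet1.toJet0_mem_ball hp)]; rfl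
  have hy : ∀ α, ∀ p ∈ ball p₀ r, ∀ γ, fderiv ℝ (G α) p (dirUy γ) = 0 := by
    intro α p hp γ
    rw [hGd α p _ rfl, Jet1.hasFDerivAt_totalXY (hφ α) p _ rfl,
      show ((0, 0, (dirUy γ : Jet1 m).ux) : Jet0 m) = 0 from rfl, map_zero,
      _root_.zero_apply, zero_add,
      show ((0, 0, (dirUy γ : Jet1 m).uy) : Jet0 m) = (0, 0, Pi.single γ 1) from rfl,
      ← (hφ α).fderiv_fderiv_apply]
    have e1 := hpart α γ p hp (vecX p).toJet0
    simp only [connMatrix_vecX] at e1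
    have e2 : fderiv ℝ (fun z => fderiv ℝ (φ α) z (0, 0, Pi.single γ 1)) p.toJet0 (1, 0, p.ux) =
      fderiv ℝ (Jet0.partialU (φ α) γ) p.toJet0 (vecX p).toJet0 := rfl
    rw [e2, e1, neg_add_eq_zero]
    exact Finset.sum_congr rfl fun δ _ => by
      rw [Jet0.partialU, hφa α _ (Jet1.toJet0_mem_ball hp)]; rfl
  obtain ⟨n, hn, s, hs, hsr, hGn⟩ := exists_descent hr (fun α => (hGs α).contDiffOn) hx hy
  have hjac : ∀ p ∈ ball p₀ s, jacobianU φ p.toJet0 = Matrix.of fun α β => a α β p.toJet0 := by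
    intro p hp
    ext α β
    exact hφa α _ (Jet1.toJet0_mem_ball (ball_subset_ball hsr hp)) β
  exact ⟨s, hsr, φ, n, ⟨hs, hφ, hn, fun p hp => by
    rw [hjac p hp]; exact hdet p (ball_subset_ball hsr hp), fun p hp α => hGn α p hp⟩, hjac⟩

end

/-! ### Simultaneous reduction of multipliers to constant matrices. -/

section

open Jet1

/-- Two independent parallel symmetric forms, one of them nondegenerate, admit a common frame. -/
theorem exists_frame {F : Jet1 2 → Fin 2 → ℝ} {p₀ : Jet1 2} {r : ℝ} (hr : 0 < r)
    {M M' : Jet1 2 → Matrix (Fin 2) (Fin 2) ℝ}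
    (h : IsParallelForm F (ball p₀ r) (fun α β p => M p α β))
    (h' : IsParallelForm F (ball p₀ r) (fun α β p => M' p α β))
    (hM : SmoothMatrixOn M (ball p₀ r)) (hM' : SmoothMatrixOn M' (ball p₀ r))
    (hs : ∀ p ∈ ball p₀ r, (M p).IsSymm) (hs' : ∀ p ∈ ball p₀ r, (M' p).IsSymm)
    (hdet : ∀ p ∈ ball p₀ r, (M p).det ≠ 0)
    (hind : ∀ x y : ℝ, x • M' p₀ = y • M p₀ → x = 0) :
    ∃ s > 0, s ≤ r ∧ ∃ P : Jet1 2 → Matrix (Fin 2) (Fin 2) ℝ, SmoothMatrixOn P (ball p₀ s) ∧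
      (∀ p ∈ ball p₀ s, (P p).det ≠ 0) ∧
      ∀ p ∈ ball p₀ s, ∀ (v : Jet1 2) (α β : Fin 2),
        fderiv ℝ (fun p => P p α β) p v = - ∑ δ, P p α δ * connMatrix F p v.toJet0 δ β := by
  have hp₀ : p₀ ∈ ball p₀ r := mem_ball_self hr
  have hN := hM.frameDefect hM' hdet (M p₀) (M' p₀)
  -- At `p₀` the defect is the identity, so the positivity needed for the inverse square root
  -- persists nearby.
  have hN0 : frameDefect (M p₀) (M' p₀) (M p₀) (M' p₀) = 1 :=
    frameDefect_self (hdet p₀ hp₀) fun y hy => one_ne_zero (hind 1 y (by rw [one_smul, hy]))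
  have hd : ContinuousAt (fun p => (frameDefect (M p₀) (M' p₀) (M p) (M' p)).det) p₀ :=
    (hN.det.contDiffAt (isOpen_ball.mem_nhds hp₀)).continuousAt
  have ht : ContinuousAt (fun p => (frameDefect (M p₀) (M' p₀) (M p) (M' p)).trace) p₀ :=
    (hN.trace.contDiffAt (isOpen_ball.mem_nhds hp₀)).continuousAt
  have e1 : ∀ᶠ p in 𝓝 p₀, 0 < (frameDefect (M p₀) (M' p₀) (M p) (M' p)).det := by
    refine hd.eventually (lt_mem_nhds ?_)
    change 0 < (frameDefect (M p₀) (M' p₀) (M p₀) (M' p₀)).det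
    rw [hN0]; simp
  have e2 : ∀ᶠ p in 𝓝 p₀, 0 < (frameDefect (M p₀) (M' p₀) (M p) (M' p)).trace +
      2 * √(frameDefect (M p₀) (M' p₀) (M p) (M' p)).det := by
    refine (ht.add (continuousAt_const.mul hd.sqrt)).eventually (lt_mem_nhds ?_)
    change 0 < (frameDefect (M p₀) (M' p₀) (M p₀) (M' p₀)).trace +
      2 * √(frameDefect (M p₀) (M' p₀) (M p₀) (M' p₀)).det
    rw [hN0]; simp
  obtain ⟨s, hs0, hsub⟩ := Metric.mem_nhds_iff.1 (Filter.inter_mem (e1.and e2) (ball_mem_nhds p₀ hr))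
  have hsub1 : ball p₀ (min s r) ⊆ ball p₀ r := ball_subset_ball (min_le_right _ _)
  have hpos : ∀ p ∈ ball p₀ (min s r), _ := fun p hp =>
    (hsub (ball_subset_ball (min_le_left _ _) hp)).1
  let P : Jet1 2 → Matrix (Fin 2) (Fin 2) ℝ := fun p => frameMatrix (M p₀) (M' p₀) (M p) (M' p)
  have hspec : ∀ p ∈ ball p₀ (min s r), (P p).transpose * M p₀ * P p = M p ∧
      (P p).transpose * M' p₀ * P p = M' p := by
    intro p hp
    obtain ⟨c1, c2⟩ := h.trace_det_const h' hs hs' hdet (hsub1 hp)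
    exact frameMatrix_spec (hdet p₀ hp₀) (hdet p (hsub1 hp)) (hs p₀ hp₀) (hs' p₀ hp₀)
      (hs p (hsub1 hp)) (hs' p (hsub1 hp)) c1 c2 (hpos p hp).1 (hpos p hp).2
  have hPs : SmoothMatrixOn P (ball p₀ (min s r)) := by
    have hM1 : SmoothMatrixOn M (ball p₀ (min s r)) := fun i j => (hM i j).mono hsub1
    have hM2 : SmoothMatrixOn M' (ball p₀ (min s r)) := fun i j => (hM' i j).mono hsub1
    have hdet1 : ∀ p ∈ ball p₀ (min s r), (M p).det ≠ 0 := fun p hp => hdet p (hsub1 hp)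
    exact (((hM1.inv hdet1).mul hM2).intertwiner _).mul ((hM1.frameDefect hM2 hdet1 _ _).invSqrtMatrix
      (fun p hp => (hpos p hp).1) (fun p hp => (hpos p hp).2))
  have hPd : ∀ p ∈ ball p₀ (min s r), (P p).det ≠ 0 := by
    intro p hp h0
    apply hdet p (hsub1 hp)
    rw [← (hspec p hp).1, Matrix.det_mul, h0, mul_zero]
  exact ⟨min s r, lt_min hs0 hr, min_le_right _ _, P, hPs, hPd, fun p hp v α β =>
    IsParallelForm.frame_parallel isOpen_ball (h.mono hsub1) (h'.mono hsub1) (hs p₀ hp₀) (hs' p₀ hp₀)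
      (hdet p₀ hp₀) hind hPs (fun p hp => (hspec p hp).1) (fun p hp => (hspec p hp).2) hPd hp v α β⟩

/-- Constant symmetric forms with respect to a parallel frame are parallel. -/
theorem IsParallelCoframe.isParallelForm {F : Jet1 2 → Fin 2 → ℝ} {V : Set (Jet1 2)}
    {a : Fin 2 → Fin 2 → Jet0 2 → ℝ} (ha : ∀ α β, ContDiff ℝ ∞ (a α β))
    (h : IsParallelCoframe F V a) {C : Matrix (Fin 2) (Fin 2) ℝ} (hC : C.IsSymm) :
    IsParallelForm F V (fun α β p => ∑ i, ∑ j, a i α p.toJet0 * C i j * a j β p.toJet0) := by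
  intro p hp α β
  have hcomp : ∀ α β, HasFDerivAt (fun p : Jet1 2 => a α β p.toJet0)
      ((fderiv ℝ (a α β) p.toJet0).comp Jet1.toJet0) p := fun α β =>
    ((ha α β).hasFDerivAt_of_smooth _).comp p Jet1.toJet0.hasFDerivAt
  have e : HasFDerivAt (fun p : Jet1 2 => ∑ i, ∑ j, a i α p.toJet0 * C i j * a j β p.toJet0)
      (∑ i, ∑ j, ((a i α p.toJet0 * C i j) • (fderiv ℝ (a j β) p.toJet0).comp Jet1.toJet0 +
        a j β p.toJet0 • (C i j • (fderiv ℝ (a i α) p.toJet0).comp Jet1.toJet0))) p :=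
    HasFDerivAt.fun_sum fun i _ => HasFDerivAt.fun_sum fun j _ =>
      ((hcomp i α).mul_const (C i j)).fun_mul (hcomp j β)
  refine ⟨e.differentiableAt, fun v => ?_⟩
  rw [e.fderiv]
  have hC' : C 1 0 = C 0 1 := hC.apply 0 1
  simp only [_root_.add_apply, _root_.smul_apply, ContinuousLinearMap.comp_apply,
    smul_eq_mul, h p hp, Fin.sum_univ_two, hC']
  ring

/-- On a ball around `p`, multipliers can be simultaneously reduced to constant matrices. -/
theorem exists_normalizesAt {U : Set (Jet1 2)} {F : Jet1 2 → Fin 2 → ℝ}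
    (hF : ∀ α, ContDiffOn ℝ ∞ (fun p => F p α) U) {k : ℕ} (hk : 2 ≤ k) {p : Jet1 2}
    (h : AdmitsLagrangiansAt U F k p) :
    ∃ r φ n, ball p r ⊆ U ∧ NormalizesAt F p r φ n ∧ ∃ C : Fin k → Matrix (Fin 2) (Fin 2) ℝ,
      (∀ i, (C i).IsSymm) ∧ LinearIndependent ℝ C ∧ ∀ i, IsPotentialForm φ n p.toJet0 r (C i) := by
  obtain ⟨V, hVo, hVc, hpV, hVU, L, M, hLM, -, hMi⟩ := h
  have hFV : ∀ α, ContDiffOn ℝ ∞ (fun p => F p α) V := fun α => (hF α).mono hVU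
  have hpar := fun i => (hLM i).isParallelForm hVo hFV
  have hsym := fun i p (hp : p ∈ V) => (hLM i).isSymm hVo hFV hp
  have hind := linearIndependent_multiplier_at hVo hVc.isPreconnected hFV hpar hMi hpV
  obtain ⟨F', hF', r₁, hr₁, hr₁V, hFF⟩ :=
    (contDiffOn_pi.2 hFV : ContDiffOn ℝ ∞ F V).exists_contDiff_eqOn_ball hVo hpV
  have hF's := contDiff_pi.1 hF'
  have hpar' : ∀ i, IsParallelForm F' (ball p r₁) (fun α β p => M i p α β) := fun i =>
    ((hpar i).mono hr₁V).congr isOpen_ball (fun p hp => (hFF hp).symm) (fun _ _ _ _ => rfl)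
  let i₀ : Fin k := ⟨0, by omega⟩
  let i₁ : Fin k := ⟨1, by omega⟩
  have hne : i₀ ≠ i₁ := by simp [i₀, i₁]
  obtain ⟨r₂, hr₂, hr₂₁, P, hPs, hPd, hPv⟩ := exists_frame hr₁ (hpar' i₀) (hpar' i₁)
    (fun α β => ((hLM i₀).2.1 α β).mono hr₁V) (fun α β => ((hLM i₁).2.1 α β).mono hr₁V)
    (fun p hp => hsym i₀ p (hr₁V hp)) (fun p hp => hsym i₁ p (hr₁V hp))
    (fun p hp => (hLM i₀).2.2.1 p (hr₁V hp)) (fun x y hxy => by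
      have h1 := Fintype.linearIndependent_iff.1 hind (Pi.single i₁ x - Pi.single i₀ y) (by
        simp [sub_smul, Pi.single_apply, ite_smul, Finset.sum_sub_distrib, hxy]) i₁
      simpa [Pi.single_apply, hne.symm] using h1)
  obtain ⟨a', ha', r₃, hr₃, hr₃₂, hPa⟩ := exists_descent (ι := Fin 2 × Fin 2)
    (G := fun i p => P p i.1 i.2) hr₂ (fun i => hPs i.1 i.2)
    (fun i p hp γ => by
      rw [hPv p hp, show (dirUx γ : Jet1 2).toJet0 = 0 from rfl]; simp [connMatrix_zero])
    (fun i p hp γ => by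
      rw [hPv p hp, show (dirUy γ : Jet1 2).toJet0 = 0 from rfl]; simp [connMatrix_zero])
  let a : Fin 2 → Fin 2 → Jet0 2 → ℝ := fun α β => a' (α, β)
  have ha : ∀ α β, ContDiff ℝ ∞ (a α β) := fun α β => ha' (α, β)
  have haP : ∀ p' ∈ ball p r₃, (Matrix.of fun α β => a α β p'.toJet0) = P p' := fun p' hp' => by
    ext α β
    exact (hPa (α, β) p' hp').symm
  have hcof : IsParallelCoframe F' (ball p r₃) a := by
    intro p' hp' α β v
    have e1 : EqOn (fun p => P p α β) (fun p : Jet1 2 => a α β p.toJet0) (ball p r₃) :=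
      fun p' hp' => hPa (α, β) p' hp'
    -- Any lift of `v` to `J¹` may be inserted, since both sides depend on its projection to `J⁰`
    -- only; first derivatives are given the increment 0.
    have e2 := hPv p' (ball_subset_ball hr₃₂ hp') (v.1, v.2.1, v.2.2, 0, 0) α β
    rw [e1.fderiv_eq_of_isOpen isOpen_ball hp', Jet1.fderiv_comp_toJet0 (ha α β)] at e2
    refine e2.trans ?_
    congr 1
    exact Finset.sum_congr rfl fun δ _ => by rw [← haP p' hp']; rfl
  obtain ⟨r₄, hr₄₃, φ, n, hnorm, hjac⟩ := hcof.exists_normalizesAt hr₃ hF's ha (fun p' hp' => by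
    rw [haP p' hp']; exact hPd p' (ball_subset_ball hr₃₂ hp'))
  have h41 : r₄ ≤ r₁ := hr₄₃.trans (hr₃₂.trans hr₂₁)
  have hpr₄ : p ∈ ball p r₄ := mem_ball_self hnorm.pos
  set J := fun p' : Jet1 2 => jacobianU φ p'.toJet0 with hJ
  have hJd : ∀ p' ∈ ball p r₄, (J p').det ≠ 0 := hnorm.det_ne_zero
  -- These constants are fixed by the multipliers at the single point `p`.
  let C : Fin k → Matrix (Fin 2) (Fin 2) ℝ := fun i => (J p).transpose⁻¹ * M i p * (J p)⁻¹
  have hu : IsUnit (J p).det := (hJd p hpr₄).isUnit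
  have hut : IsUnit (J p).transpose.det := by rwa [Matrix.det_transpose]
  have hCp : ∀ i, (J p).transpose * C i * J p = M i p := by
    intro i
    simp only [C]
    rw [Matrix.mul_assoc, Matrix.nonsing_inv_mul_cancel_right _ _ hu,
      Matrix.mul_nonsing_inv_cancel_left _ _ hut]
  have hCs : ∀ i, (C i).IsSymm := by
    intro i
    simp only [C, Matrix.IsSymm, Matrix.transpose_mul, Matrix.transpose_nonsing_inv,
      Matrix.transpose_transpose, (hsym i p hpV).eq, Matrix.mul_assoc]
  -- Both sides are parallel and agree at `p`, so their difference vanishes along every segment from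
  -- `p`. This also covers multipliers beyond the two that produced the frame.
  have hMC : ∀ i, ∀ p' ∈ ball p r₄, M i p' = (J p').transpose * C i * J p' := by
    intro i p' hp'
    have h1 := hcof.isParallelForm ha (hCs i)
    have h2 := IsParallelForm.sum Finset.univ (F := F') (V := ball p r₄)
      (T := ![fun α β p => M i p α β,
        fun α β p => ∑ i', ∑ j, a i' α p.toJet0 * C i i' j * a j β p.toJet0]) ![1, -1] (by
        intro j _
        fin_cases j
        · exact (hpar' i).mono (ball_subset_ball h41)
        · exact h1.mono (ball_subset_ball hr₄₃))
    have e : ∀ p' ∈ ball p r₄, ∀ α β, ∑ i', ∑ j, a i' α p'.toJet0 * C i i' j * a j β p'.toJet0 =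
        ((J p').transpose * C i * J p') α β := by
      intro p' hp' α β
      simp only [hJ, hjac p' hp', Matrix.mul_apply, Matrix.transpose_apply, Matrix.of_apply,
        Finset.sum_mul]
      rw [Finset.sum_comm]
    ext α β
    have h3 := h2.eq_zero_of_segment hF's (p₀ := p) (p₁ := p')
      ((convex_ball p r₄).segment_subset hpr₄ hp') (fun α β => by
        rw [Fin.sum_univ_two]
        simp only [Matrix.cons_val_zero, Matrix.cons_val_one]
        rw [e p hpr₄, hCp]
        ring) α β
    rw [Fin.sum_univ_two] at h3
    simp only [Matrix.cons_val_zero, Matrix.cons_val_one] at h3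
    rw [e p' hp'] at h3
    linarith
  have hnorm' : NormalizesAt F p r₄ φ n := ⟨hnorm.pos, hnorm.smooth_map, hnorm.smooth_rhs,
    hnorm.det_ne_zero, fun p' hp' α => by
      rw [← hFF (ball_subset_ball h41 hp')]; exact hnorm.totalXY_eq p' hp' α⟩
  refine ⟨r₄, φ, n, ((ball_subset_ball h41).trans hr₁V).trans hVU, hnorm', C, hCs, ?_, ?_⟩
  · rw [Fintype.linearIndependent_iff] at hind ⊢
    intro c hc
    apply hind c
    have : ∑ i, c i • M i p = (J p).transpose * (∑ i, c i • C i) * J p := by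
      rw [Finset.mul_sum, Finset.sum_mul]
      refine Finset.sum_congr rfl fun i _ => ?_
      rw [Matrix.mul_smul, Matrix.smul_mul, hCp]
    rw [this, hc]
    simp
  · intro i z hz γ δ
    have hp' : Jet0.lift p z ∈ ball p r₄ := Jet0.lift_mem_ball hz
    have hp'V : Jet0.lift p z ∈ V := hr₁V (ball_subset_ball h41 hp')
    obtain ⟨t, ht, -, L', M', F'', hEL, hM's, hF''s, hM'M, hF''F⟩ :=
      (hLM i).exists_localization hVo hFV hp'V
    have hkin := contDiff_kineticLagrangian (C i) hnorm.smooth_map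
    have hforce := contDiff_forceForm hnorm.smooth_map hnorm.smooth_rhs (C i)
    -- The kinetic Lagrangian and the given one have the same multiplier, so `u_xy` drops out of the
    -- difference. What remains is minus the force form on `J⁰`, which is then closed.
    have key : HasEulerLagrange (fun p => kineticLagrangian (C i) φ p - L' p) (fun _ _ _ => 0)
        (fun γ p => - forceForm φ n (C i) γ p.toJet0) (ball (Jet0.lift p z) t ∩ ball p r₄) := by
      refine ⟨isOpen_ball.inter isOpen_ball, hkin.sub hEL.smooth,
        fun α => ((hforce α).comp Jet1.toJet0.contDiff).neg, fun q hq γ => ?_⟩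
      rw [eulerLagrange_sub hkin hEL.smooth, hEL.eq q hq.1,
        eulerLagrange_kineticLagrangian (fun α β => (hCs i).apply β α) hnorm.smooth_map]
      have e1 : ∑ δ, M' γ δ q.toJet1 * q.uxy δ - ∑ δ, M' γ δ q.toJet1 * F'' q.toJet1 δ =
          ∑ α, ∑ β, Jet0.partialU (φ α) γ q.toJet1.toJet0 * C i α β *
            ∑ δ, Jet0.partialU (φ β) δ q.toJet1.toJet0 * (q.uxy δ - F q.toJet1 δ) := by
        simp only [hM'M _ hq.1, hF''F _ hq.1, hMC i _ hq.2, Matrix.mul_apply, Fin.sum_univ_two,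
          Matrix.transpose_apply, hJ, jacobianU, Matrix.of_apply]
        ring
      rw [e1, forceForm]
      simp only [← hnorm'.totalXY_eq _ hq.2, Fin.sum_univ_two]
      ring
    have hz' : Jet0.lift p z ∈ ball (Jet0.lift p z) t ∩ ball p r₄ := ⟨mem_ball_self ht, hp'⟩
    have hvert : ∀ α (p' v : Jet1 2), fderiv ℝ (fun p : Jet1 2 => - forceForm φ n (C i) α p.toJet0) p' v =
        - fderiv ℝ (forceForm φ n (C i) α) p'.toJet0 v.toJet0 := fun α p' v =>
      Jet1.fderiv_comp_toJet0 (hforce α).neg p' v |>.trans (by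
        rw [((hforce α).hasFDerivAt_of_smooth _).fun_neg.fderiv]; rfl)
    have := key.closed_of_multiplier_eq_zero (fun _ _ _ _ => rfl)
      (fun p' _ α β => by
        rw [hvert, show (dirUx β : Jet1 2).toJet0 = 0 from rfl]; simp)
      (fun p' _ α β => by
        rw [hvert, show (dirUy β : Jet1 2).toJet0 = 0 from rfl]; simp) hz' γ δ
    rw [hvert, hvert, neg_inj] at this
    exact this

end

/-! ### Prolonged point transformations and contact equivalence. -/

section

open Jet1

variable {m : ℕ}

/-- A smooth map with injective derivative at every point of an open set restricts to a
diffeomorphism near each point of the set. -/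
theorem ContDiff.exists_openPartialHomeomorph {E : Type*} [NormedAddCommGroup E] [NormedSpace ℝ E]
    [FiniteDimensional ℝ E] {f : E → E} (hf : ContDiff ℝ ∞ f) {s : Set E} (hs : IsOpen s)
    (hinj : ∀ a ∈ s, ∀ v, fderiv ℝ f a v = 0 → v = 0) {a : E} (ha : a ∈ s) :
    ∃ Φ : OpenPartialHomeomorph E E, a ∈ Φ.source ∧ Φ.source ⊆ s ∧ (Φ : E → E) = f ∧
      ContDiffOn ℝ ∞ Φ.symm Φ.target := by
  have : CompleteSpace E := FiniteDimensional.complete ℝ E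
  have heq : ∀ b ∈ s, ∃ A : E ≃L[ℝ] E, HasFDerivAt f (A : E →L[ℝ] E) b := by
    intro b hb
    have hi : Function.Injective (fderiv ℝ f b : E →ₗ[ℝ] E) :=
      (injective_iff_map_eq_zero _).2 fun v hv => hinj b hb v hv
    refine ⟨(LinearEquiv.ofInjectiveEndo _ hi).toContinuousLinearEquiv, ?_⟩
    exact (hf.hasFDerivAt_of_smooth b).congr_fderiv (by ext v; rfl)
  obtain ⟨A, hA⟩ := heq a ha
  let Ψ := hf.contDiffAt.toOpenPartialHomeomorph f hA (by simp)
  have hΨ : (Ψ : E → E) = f := rfl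
  let Φ := Ψ.restrOpen s hs
  have hsrc : Φ.source = Ψ.source ∩ s := Ψ.restrOpen_source s hs
  refine ⟨Φ, ?_, ?_, rfl, fun b hb => ?_⟩
  · rw [hsrc]
    exact ⟨hf.contDiffAt.mem_toOpenPartialHomeomorph_source hA (by simp), ha⟩
  · rw [hsrc]
    exact inter_subset_right
  · have hb' : Φ.symm b ∈ Φ.source := Φ.map_target hb
    obtain ⟨B, hB⟩ := heq (Φ.symm b) (by rw [hsrc] at hb'; exact hb'.2)
    exact (Φ.contDiffAt_symm hb hB hf.contDiffAt).contDiffWithinAt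

namespace Jet2

theorem toJet1_contDiff : ContDiff ℝ ∞ (toJet1 : Jet2 m → Jet1 m) := contDiff_fst

/-- The coordinates `u_xx`, as a linear map. -/
def uxxL : Jet2 m →L[ℝ] (Fin m → ℝ) :=
  (ContinuousLinearMap.fst ℝ _ _).comp (ContinuousLinearMap.snd ℝ _ _)

/-- The coordinates `u_xy`, as a linear map. -/
def uxyL : Jet2 m →L[ℝ] (Fin m → ℝ) :=
  (ContinuousLinearMap.fst ℝ _ _).comp ((ContinuousLinearMap.snd ℝ _ _).comp
    (ContinuousLinearMap.snd ℝ _ _))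

/-- The coordinates `u_yy`, as a linear map. -/
def uyyL : Jet2 m →L[ℝ] (Fin m → ℝ) :=
  (ContinuousLinearMap.snd ℝ _ _).comp ((ContinuousLinearMap.snd ℝ _ _).comp
    (ContinuousLinearMap.snd ℝ _ _))

theorem hasFDerivAt_totalX {h : Jet1 m → ℝ} (hh : ContDiff ℝ ∞ h) (r : Jet2 m) :
    HasFDerivAt (Jet2.totalX h)
      (((fderiv ℝ (fderiv ℝ h) r.toJet1).flip (1, 0, r.ux, r.uxx, r.uxy)).comp dJet1 +
        (fderiv ℝ h r.toJet1).comp ((0 : Jet2 m →L[ℝ] ℝ).prod ((0 : Jet2 m →L[ℝ] ℝ).prod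
          ((Jet1.uxL.comp dJet1).prod (uxxL.prod uxyL))))) r := by
  have h1 : HasFDerivAt (fun r : Jet2 m => fderiv ℝ h r.toJet1)
      ((fderiv ℝ (fderiv ℝ h) r.toJet1).comp dJet1) r :=
    (hh.fderiv_smooth.hasFDerivAt_of_smooth _).comp r dJet1.hasFDerivAt
  have h2 : HasFDerivAt (fun r : Jet2 m => ((1, 0, r.ux, r.uxx, r.uxy) : Jet1 m))
      ((0 : Jet2 m →L[ℝ] ℝ).prod ((0 : Jet2 m →L[ℝ] ℝ).prod
          ((Jet1.uxL.comp dJet1).prod (uxxL.prod uxyL)))) r :=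
    (hasFDerivAt_const _ _).prodMk ((hasFDerivAt_const _ _).prodMk
      ((Jet1.uxL.comp dJet1).hasFDerivAt.prodMk (uxxL.hasFDerivAt.prodMk uxyL.hasFDerivAt)))
  refine (h1.clm_apply h2).congr_fderiv ?_
  rw [add_comm]
  rfl

theorem hasFDerivAt_totalY {h : Jet1 m → ℝ} (hh : ContDiff ℝ ∞ h) (r : Jet2 m) :
    HasFDerivAt (Jet2.totalY h)
      (((fderiv ℝ (fderiv ℝ h) r.toJet1).flip (0, 1, r.uy, r.uxy, r.uyy)).comp dJet1 +
        (fderiv ℝ h r.toJet1).comp ((0 : Jet2 m →L[ℝ] ℝ).prod ((0 : Jet2 m →L[ℝ] ℝ).prod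
          ((Jet1.uyL.comp dJet1).prod (uxyL.prod uyyL))))) r := by
  have h1 : HasFDerivAt (fun r : Jet2 m => fderiv ℝ h r.toJet1)
      ((fderiv ℝ (fderiv ℝ h) r.toJet1).comp dJet1) r :=
    (hh.fderiv_smooth.hasFDerivAt_of_smooth _).comp r dJet1.hasFDerivAt
  have h2 : HasFDerivAt (fun r : Jet2 m => ((0, 1, r.uy, r.uxy, r.uyy) : Jet1 m))
      ((0 : Jet2 m →L[ℝ] ℝ).prod ((0 : Jet2 m →L[ℝ] ℝ).prod
          ((Jet1.uyL.comp dJet1).prod (uxyL.prod uyyL)))) r :=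
    (hasFDerivAt_const _ _).prodMk ((hasFDerivAt_const _ _).prodMk
      ((Jet1.uyL.comp dJet1).hasFDerivAt.prodMk (uxyL.hasFDerivAt.prodMk uyyL.hasFDerivAt)))
  refine (h1.clm_apply h2).congr_fderiv ?_
  rw [add_comm]
  rfl

theorem contDiff_totalX {h : Jet1 m → ℝ} (hh : ContDiff ℝ ∞ h) : ContDiff ℝ ∞ (Jet2.totalX h) := by
  refine (hh.fderiv_smooth.comp toJet1_contDiff).clm_apply ?_
  exact contDiff_const.prodMk (contDiff_const.prodMk ((Jet1.uxL.comp dJet1).contDiff.prodMk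
    ((contDiff_fst.comp contDiff_snd).prodMk (contDiff_fst.comp (contDiff_snd.comp contDiff_snd)))))

theorem contDiff_totalY {h : Jet1 m → ℝ} (hh : ContDiff ℝ ∞ h) : ContDiff ℝ ∞ (Jet2.totalY h) := by
  refine (hh.fderiv_smooth.comp toJet1_contDiff).clm_apply ?_
  exact contDiff_const.prodMk (contDiff_const.prodMk ((Jet1.uyL.comp dJet1).contDiff.prodMk
    ((contDiff_fst.comp (contDiff_snd.comp contDiff_snd)).prodMk
      (contDiff_snd.comp (contDiff_snd.comp contDiff_snd)))))

/-- The form `ℓ - ℓ(D_x) dx - ℓ(D_y) dy` is a contact form. -/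
theorem sub_mem_contactSpan (ℓ : Jet1 m →L[ℝ] ℝ) (q : Jet2 m) :
    ℓ.comp dJet1 - ℓ (1, 0, q.ux, q.uxx, q.uxy) • dx - ℓ (0, 1, q.uy, q.uxy, q.uyy) • dy ∈
      contactSpan q := by
  have key : ℓ.comp dJet1 - ℓ (1, 0, q.ux, q.uxx, q.uxy) • dx -
      ℓ (0, 1, q.uy, q.uxy, q.uyy) • dy =
      ∑ γ, ℓ (dirU γ) • theta γ q + ∑ γ, ℓ (dirUx γ) • thetaX γ q +
        ∑ γ, ℓ (dirUy γ) • thetaY γ q := by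
    refine ContinuousLinearMap.ext fun v => ?_
    have e1 : v.1 = v.1.x • ((1, 0, q.ux, q.uxx, q.uxy) : Jet1 m) +
        v.1.y • ((0, 1, q.uy, q.uxy, q.uyy) : Jet1 m) + ∑ γ, theta γ q v • dirU γ +
        ∑ γ, thetaX γ q v • dirUx γ + ∑ γ, thetaY γ q v • dirUy γ := by
      refine Prod.ext ?_ (Prod.ext ?_ (Prod.ext ?_ (Prod.ext ?_ ?_)))
      · simp [Prod.fst_sum, dirU, dirUx, dirUy, Jet1.x, Jet1.y]
      · simp [Prod.fst_sum, Prod.snd_sum, dirU, dirUx, dirUy, Jet1.x, Jet1.y]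
      all_goals
        ext i
        simp [Prod.fst_sum, Prod.snd_sum, dirU, dirUx, dirUy, Jet1.x, Jet1.y,
          Finset.sum_apply, Pi.single_apply, theta, thetaX, thetaY, du, dux, duy, dx, dy, dJet1]
        ring
    have e2 := congrArg ℓ e1
    simp only [map_add, map_sum, map_smul, smul_eq_mul] at e2
    have e3 : ∀ (η : Fin m → Jet2 m →L[ℝ] ℝ) (c : Fin m → ℝ),
        (∑ γ, c γ • η γ) v = ∑ γ, η γ v * c γ := by
      intro η c
      simp [_root_.sum_apply, mul_comm]
    simp only [_root_.add_apply, _root_.sub_apply, _root_.smul_apply, e3, smul_eq_mul]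
    change ℓ v.1 - _ * v.1.x - _ * v.1.y = _
    rw [e2]
    ring
  rw [key]
  have hmem : ∀ η ∈ contactGenerators m, η q ∈ contactSpan q := fun η hη =>
    Submodule.subset_span ⟨η, hη, rfl⟩
  refine Submodule.add_mem _ (Submodule.add_mem _ ?_ ?_) ?_ <;>
    refine Submodule.sum_mem _ fun γ _ => Submodule.smul_mem _ _ (hmem _ ?_)
  · exact Or.inl (Or.inl ⟨γ, rfl⟩)
  · exact Or.inl (Or.inr ⟨γ, rfl⟩)
  · exact Or.inr ⟨γ, rfl⟩

end Jet2

/-- The first prolongation of the map `(x, y, u) ↦ (x, y, φ(x, y, u))`. -/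
def Jet1.prolong (φ : Fin m → Jet0 m → ℝ) (p : Jet1 m) : Jet1 m :=
  (p.x, p.y, fun α => φ α p.toJet0, fun α => Jet1.totalX (φ α) p, fun α => Jet1.totalY (φ α) p)

/-- The second prolongation of the map `(x, y, u) ↦ (x, y, φ(x, y, u))`. -/
def Jet2.prolong (φ : Fin m → Jet0 m → ℝ) (r : Jet2 m) : Jet2 m :=
  (Jet1.prolong φ r.toJet1, fun α => Jet2.totalX (Jet1.totalX (φ α)) r,
    fun α => Jet2.totalX (Jet1.totalY (φ α)) r, fun α => Jet2.totalY (Jet1.totalY (φ α)) r)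

theorem Jet1.contDiff_prolong {φ : Fin m → Jet0 m → ℝ} (hφ : ∀ α, ContDiff ℝ ∞ (φ α)) :
    ContDiff ℝ ∞ (Jet1.prolong φ) :=
  contDiff_fst.prodMk ((contDiff_fst.comp contDiff_snd).prodMk
    ((contDiff_pi.2 fun α => (hφ α).comp Jet1.toJet0.contDiff).prodMk
      ((contDiff_pi.2 fun α => Jet1.contDiff_totalX (hφ α)).prodMk
        (contDiff_pi.2 fun α => Jet1.contDiff_totalY (hφ α)))))

theorem Jet2.contDiff_prolong {φ : Fin m → Jet0 m → ℝ} (hφ : ∀ α, ContDiff ℝ ∞ (φ α)) :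
    ContDiff ℝ ∞ (Jet2.prolong φ) :=
  ((Jet1.contDiff_prolong hφ).comp toJet1_contDiff).prodMk
    ((contDiff_pi.2 fun α => Jet2.contDiff_totalX (Jet1.contDiff_totalX (hφ α))).prodMk
      ((contDiff_pi.2 fun α => Jet2.contDiff_totalX (Jet1.contDiff_totalY (hφ α))).prodMk
        (contDiff_pi.2 fun α => Jet2.contDiff_totalY (Jet1.contDiff_totalY (hφ α)))))

theorem Jet2.totalX_totalY {φ : Jet0 m → ℝ} (hφ : ContDiff ℝ ∞ φ) (r : Jet2 m) :
    Jet2.totalX (Jet1.totalY φ) r = Jet1.totalXY φ r.toJet1 +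
      ∑ β, Jet0.partialU φ β r.toJet1.toJet0 * r.uxy β := by
  rw [Jet2.totalX, Jet1.fderiv_totalY hφ, ← Jet0.fderiv_vertical]
  rfl

theorem Jet2.totalY_totalX {φ : Jet0 m → ℝ} (hφ : ContDiff ℝ ∞ φ) (r : Jet2 m) :
    Jet2.totalY (Jet1.totalX φ) r = Jet2.totalX (Jet1.totalY φ) r := by
  rw [Jet2.totalX, Jet1.fderiv_totalY hφ, Jet2.totalY, Jet1.fderiv_totalX hφ]
  congr 1
  exact hφ.fderiv_fderiv_comm _ _ _

theorem Jet2.fderiv_prolong {φ : Fin m → Jet0 m → ℝ} (hφ : ∀ α, ContDiff ℝ ∞ (φ α))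
    (r v : Jet2 m) : fderiv ℝ (Jet2.prolong φ) r v =
      ((v.1.x, v.1.y, fun α => fderiv ℝ (φ α) r.toJet1.toJet0 v.1.toJet0,
        fun α => fderiv ℝ (Jet1.totalX (φ α)) r.toJet1 v.1,
        fun α => fderiv ℝ (Jet1.totalY (φ α)) r.toJet1 v.1),
        fun α => fderiv ℝ (Jet2.totalX (Jet1.totalX (φ α))) r v,
        fun α => fderiv ℝ (Jet2.totalX (Jet1.totalY (φ α))) r v,
        fun α => fderiv ℝ (Jet2.totalY (Jet1.totalY (φ α))) r v) := by
  have h0 : ∀ {h : Jet1 m → ℝ}, ContDiff ℝ ∞ h →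
      HasFDerivAt (fun r : Jet2 m => h r.toJet1) ((fderiv ℝ h r.toJet1).comp dJet1) r :=
    fun hh => (hh.hasFDerivAt_of_smooth _).comp r dJet1.hasFDerivAt
  have h1 : HasFDerivAt (Jet2.prolong φ) _ r :=
    (dx.hasFDerivAt.prodMk (dy.hasFDerivAt.prodMk
      ((hasFDerivAt_pi.2 fun α => h0 ((hφ α).comp Jet1.toJet0.contDiff)).prodMk
      ((hasFDerivAt_pi.2 fun α => h0 (Jet1.contDiff_totalX (hφ α))).prodMk
        (hasFDerivAt_pi.2 fun α => h0 (Jet1.contDiff_totalY (hφ α))))))).prodMk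
    ((hasFDerivAt_pi.2 fun α => (Jet2.contDiff_totalX (Jet1.contDiff_totalX
        (hφ α))).hasFDerivAt_of_smooth r).prodMk
      ((hasFDerivAt_pi.2 fun α => (Jet2.contDiff_totalX (Jet1.contDiff_totalY
        (hφ α))).hasFDerivAt_of_smooth r).prodMk
        (hasFDerivAt_pi.2 fun α => (Jet2.contDiff_totalY (Jet1.contDiff_totalY
        (hφ α))).hasFDerivAt_of_smooth r)))
  rw [h1.fderiv]
  refine Prod.ext (Prod.ext rfl (Prod.ext rfl (Prod.ext ?_ rfl))) rfl
  funext α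
  exact Jet1.fderiv_comp_toJet0 (hφ α) r.toJet1 v.1

theorem Jet1.fderiv_totalX_vertical {φ : Jet0 m → ℝ} (hφ : ContDiff ℝ ∞ φ) (p : Jet1 m)
    (a b : Fin m → ℝ) : fderiv ℝ (Jet1.totalX φ) p (0, 0, 0, a, b) =
      fderiv ℝ φ p.toJet0 (0, 0, a) := by
  rw [Jet1.fderiv_totalX hφ, show (Jet1.toJet0 ((0, 0, 0, a, b) : Jet1 m)) = 0 from rfl, map_zero,
    _root_.zero_apply, zero_add]
  rfl

theorem Jet1.fderiv_totalY_vertical {φ : Jet0 m → ℝ} (hφ : ContDiff ℝ ∞ φ) (p : Jet1 m)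
    (a b : Fin m → ℝ) : fderiv ℝ (Jet1.totalY φ) p (0, 0, 0, a, b) =
      fderiv ℝ φ p.toJet0 (0, 0, b) := by
  rw [Jet1.fderiv_totalY hφ, show (Jet1.toJet0 ((0, 0, 0, a, b) : Jet1 m)) = 0 from rfl, map_zero,
    _root_.zero_apply, zero_add]
  rfl

theorem Jet2.fderiv_totalX_vertical {h : Jet1 m → ℝ} (hh : ContDiff ℝ ∞ h) (r : Jet2 m)
    (a b c : Fin m → ℝ) : fderiv ℝ (Jet2.totalX h) r (0, a, b, c) =
      fderiv ℝ h r.toJet1 (0, 0, 0, a, b) := by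
  rw [(Jet2.hasFDerivAt_totalX hh r).fderiv, _root_.add_apply, ContinuousLinearMap.comp_apply,
    show dJet1 ((0, a, b, c) : Jet2 m) = 0 from rfl, map_zero, zero_add]
  rfl

theorem Jet2.fderiv_totalY_vertical {h : Jet1 m → ℝ} (hh : ContDiff ℝ ∞ h) (r : Jet2 m)
    (a b c : Fin m → ℝ) : fderiv ℝ (Jet2.totalY h) r (0, a, b, c) =
      fderiv ℝ h r.toJet1 (0, 0, 0, b, c) := by
  rw [(Jet2.hasFDerivAt_totalY hh r).fderiv, _root_.add_apply, ContinuousLinearMap.comp_apply,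
    show dJet1 ((0, a, b, c) : Jet2 m) = 0 from rfl, map_zero, zero_add]
  rfl

theorem eq_zero_of_fderiv_vertical_eq_zero {φ : Fin m → Jet0 m → ℝ} {z : Jet0 m}
    (hdet : (jacobianU φ z).det ≠ 0) {w : Fin m → ℝ} (h : ∀ α, fderiv ℝ (φ α) z (0, 0, w) = 0) :
    w = 0 := by
  refine Matrix.eq_zero_of_mulVec_eq_zero hdet ?_
  funext α
  rw [Pi.zero_apply, ← h α, Jet0.fderiv_vertical]
  rfl

/-- The derivative is block triangular for the order of jets, with the identity on `x`, `y` and the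
Jacobian matrix of `φ` in all other diagonal blocks. -/
theorem Jet2.eq_zero_of_fderiv_prolong_eq_zero {φ : Fin m → Jet0 m → ℝ}
    (hφ : ∀ α, ContDiff ℝ ∞ (φ α)) {r v : Jet2 m}
    (hdet : (jacobianU φ r.toJet1.toJet0).det ≠ 0) (h : fderiv ℝ (Jet2.prolong φ) r v = 0) :
    v = 0 := by
  rw [Jet2.fderiv_prolong hφ] at h
  have hx := congrArg (fun w => w.1.1) h
  have hy := congrArg (fun w => w.1.2.1) h
  have hu := congrArg (fun w => w.1.2.2.1) h
  have hux := congrArg (fun w => w.1.2.2.2.1) h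
  have huy := congrArg (fun w => w.1.2.2.2.2) h
  have huxx := congrArg (fun w => w.2.1) h
  have huxy := congrArg (fun w => w.2.2.1) h
  have huyy := congrArg (fun w => w.2.2.2) h
  clear h
  obtain ⟨⟨x, y, u, ux, uy⟩, uxx, uxy, uyy⟩ := v
  obtain rfl : x = 0 := hx
  obtain rfl : y = 0 := hy
  obtain rfl : u = 0 := eq_zero_of_fderiv_vertical_eq_zero hdet fun α => congrFun hu α
  obtain rfl : ux = 0 := eq_zero_of_fderiv_vertical_eq_zero hdet fun α =>
    (Jet1.fderiv_totalX_vertical (hφ α) _ _ _).symm.trans (congrFun hux α)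
  obtain rfl : uy = 0 := eq_zero_of_fderiv_vertical_eq_zero hdet fun α =>
    (Jet1.fderiv_totalY_vertical (hφ α) _ _ _).symm.trans (congrFun huy α)
  obtain rfl : uxx = 0 := eq_zero_of_fderiv_vertical_eq_zero hdet fun α =>
    (Jet1.fderiv_totalX_vertical (hφ α) _ _ uxy).symm.trans
      ((Jet2.fderiv_totalX_vertical (Jet1.contDiff_totalX (hφ α)) _ _ _ uyy).symm.trans
        (congrFun huxx α))
  obtain rfl : uxy = 0 := eq_zero_of_fderiv_vertical_eq_zero hdet fun α =>
    (Jet1.fderiv_totalY_vertical (hφ α) _ 0 _).symm.trans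
      ((Jet2.fderiv_totalX_vertical (Jet1.contDiff_totalY (hφ α)) _ _ _ uyy).symm.trans
        (congrFun huxy α))
  obtain rfl : uyy = 0 := eq_zero_of_fderiv_vertical_eq_zero hdet fun α =>
    (Jet1.fderiv_totalY_vertical (hφ α) _ 0 _).symm.trans
      ((Jet2.fderiv_totalY_vertical (Jet1.contDiff_totalY (hφ α)) _ 0 _ _).symm.trans
        (congrFun huyy α))
  rfl

/-- For `h = φ^α`, `D_x φ^α`, `D_y φ^α` the pulled-back generator is `dh - D_x h dx - D_y h dy`, a
combination of contact forms. The second of these uses `D_x D_y φ = D_y D_x φ`. -/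
theorem Jet2.preservesContact_prolong {φ : Fin m → Jet0 m → ℝ} (hφ : ∀ α, ContDiff ℝ ∞ (φ α))
    (s : Set (Jet2 m)) : Jet2.PreservesContact (Jet2.prolong φ) s := by
  rintro r - η ((⟨α, rfl⟩ | ⟨α, rfl⟩) | ⟨α, rfl⟩)
  · convert sub_mem_contactSpan ((fderiv ℝ (φ α) r.toJet1.toJet0).comp Jet1.toJet0) r using 1
    refine ContinuousLinearMap.ext fun v => ?_
    simp [theta, du, dx, dy, dJet1, Jet2.fderiv_prolong hφ, Jet1.x, Jet1.y, Jet2.ux, Jet2.uy,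
      Jet2.prolong, Jet1.prolong, Jet1.totalX, Jet1.totalY, Jet1.ux, Jet1.uy, Jet2.toJet1]
  · convert sub_mem_contactSpan (fderiv ℝ (Jet1.totalX (φ α)) r.toJet1) r using 1
    refine ContinuousLinearMap.ext fun v => ?_
    simp only [thetaX, dux, dx, dy, dJet1, Jet2.uxx, Jet2.uxy, Jet2.prolong,
      ← Jet2.totalY_totalX (hφ α), _root_.sub_apply, _root_.smul_apply,
      ContinuousLinearMap.comp_apply, Jet2.fderiv_prolong hφ]
    rfl
  · convert sub_mem_contactSpan (fderiv ℝ (Jet1.totalY (φ α)) r.toJet1) r using 1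
    refine ContinuousLinearMap.ext fun v => ?_
    simp only [thetaY, duy, dx, dy, dJet1, Jet2.uyy, Jet2.uxy, Jet2.prolong,
      _root_.sub_apply, _root_.smul_apply,
      ContinuousLinearMap.comp_apply, Jet2.fderiv_prolong hφ]
    rfl

/-- A normalized system is contact equivalent to the system that it is transformed into. -/
theorem NormalizesAt.contactEquivalentAt {F : Jet1 m → Fin m → ℝ} {s : ℝ}
    {φ n : Fin m → Jet0 m → ℝ} {U U' : Set (Jet1 m)} {G : Jet1 m → Fin m → ℝ} {q : Jet2 m}
    (h : NormalizesAt F q.toJet1 s φ n) (hU : ball q.toJet1 s ⊆ U) (hU' : IsOpen U')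
    (hq : Jet1.prolong φ q.toJet1 ∈ U')
    (hG : ∀ p' ∈ ball q.toJet1 s, Jet1.prolong φ p' ∈ U' →
      ∀ α, G (Jet1.prolong φ p') α = n α p'.toJet0) :
    ContactEquivalentAt U F U' G q := by
  -- The second condition puts the image over `U'`, where the transformed system is defined.
  have ho : IsOpen {r : Jet2 m | r.toJet1 ∈ ball q.toJet1 s ∧ Jet1.prolong φ r.toJet1 ∈ U'} :=
    (isOpen_ball.preimage Jet2.toJet1_contDiff.continuous).inter
      (hU'.preimage ((Jet1.contDiff_prolong h.smooth_map).comp Jet2.toJet1_contDiff).continuous)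
  obtain ⟨Φ, hqΦ, hΦs, hΦ, hΦsymm⟩ := (Jet2.contDiff_prolong h.smooth_map).exists_openPartialHomeomorph
    ho (fun r hr v hv => Jet2.eq_zero_of_fderiv_prolong_eq_zero h.smooth_map
      (h.det_ne_zero _ hr.1) hv) (a := q) ⟨mem_ball_self h.pos, hq⟩
  refine ⟨Φ, hqΦ, fun r hr => hU (hΦs hr).1, fun r hr => ?_, ?_, hΦsymm, ?_, 
    fun r => jacobianU φ r.toJet1.toJet0, fun α γ => ?_, fun r hr α => ?_⟩
  · have := (hΦs (Φ.map_target hr)).2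
    have h2 : Jet2.prolong φ (Φ.symm r) = r := by rw [← hΦ]; exact Φ.right_inv hr
    rw [← h2]
    exact this
  · rw [hΦ]; exact (Jet2.contDiff_prolong h.smooth_map).contDiffOn
  · rw [hΦ]; exact Jet2.preservesContact_prolong h.smooth_map _
  · exact (((h.smooth_map α).jet0_partialU γ).comp
      (Jet1.toJet0.contDiff.comp Jet2.toJet1_contDiff)).contDiffOn
  · rw [hΦ]
    have h1 : (Jet2.prolong φ r).toJet1 = Jet1.prolong φ r.toJet1 := rfl
    have h2 : (Jet2.prolong φ r).uxy α = Jet2.totalX (Jet1.totalY (φ α)) r := rfl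
    rw [h1, h2, hG _ (hΦs hr).1 (hΦs hr).2, Jet2.totalX_totalY (h.smooth_map α),
      ← h.totalXY_eq _ (hΦs hr).1, add_sub_add_left_eq_sub, ← Finset.sum_sub_distrib]
    exact Finset.sum_congr rfl fun β _ => by rw [mul_sub]; rfl

end

/-! ### The right-hand side as a function of the new variables. -/

section

open Jet1

variable {m : ℕ}

/-- The map `(x, y, u) ↦ (x, y, φ(x, y, u))`. -/
def Jet0.graphMap (φ : Fin m → Jet0 m → ℝ) (z : Jet0 m) : Jet0 m := (z.1, z.2.1, fun α => φ α z)

theorem Jet0.contDiff_graphMap {φ : Fin m → Jet0 m → ℝ} (hφ : ∀ α, ContDiff ℝ ∞ (φ α)) :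
    ContDiff ℝ ∞ (Jet0.graphMap φ) :=
  contDiff_fst.prodMk ((contDiff_fst.comp contDiff_snd).prodMk (contDiff_pi.2 hφ))

theorem Jet0.fderiv_graphMap {φ : Fin m → Jet0 m → ℝ} (hφ : ∀ α, ContDiff ℝ ∞ (φ α))
    (z v : Jet0 m) :
    fderiv ℝ (Jet0.graphMap φ) z v = (v.1, v.2.1, fun α => fderiv ℝ (φ α) z v) := by
  have h : HasFDerivAt (Jet0.graphMap φ) ((ContinuousLinearMap.fst ℝ _ _).prod
      (((ContinuousLinearMap.fst ℝ _ _).comp (ContinuousLinearMap.snd ℝ _ _)).prod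
        (ContinuousLinearMap.pi fun α => fderiv ℝ (φ α) z))) z :=
    hasFDerivAt_fst.prodMk ((hasFDerivAt_fst.comp z hasFDerivAt_snd).prodMk
      (hasFDerivAt_pi.2 fun α => (hφ α).hasFDerivAt_of_smooth z))
  rw [h.fderiv]
  rfl

theorem jacobianU_comp_graphMap {φ h : Fin m → Jet0 m → ℝ} (hφ : ∀ α, ContDiff ℝ ∞ (φ α))
    (hh : ∀ α, ContDiff ℝ ∞ (h α)) (z : Jet0 m) :
    jacobianU (fun α z => h α (Jet0.graphMap φ z)) z =
      jacobianU h (Jet0.graphMap φ z) * jacobianU φ z := by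
  ext α β
  have h1 : HasFDerivAt (fun z => h α (Jet0.graphMap φ z)) _ z :=
    ((hh α).hasFDerivAt_of_smooth (Jet0.graphMap φ z)).comp z
      ((Jet0.contDiff_graphMap hφ).hasFDerivAt_of_smooth z)
  rw [Matrix.mul_apply, jacobianU, Matrix.of_apply, Jet0.partialU, h1.fderiv,
    ContinuousLinearMap.comp_apply, Jet0.fderiv_graphMap hφ, Jet0.fderiv_vertical]
  rfl

/-- A form `C_{αβ} n^β dφ^α` is closed if and only if `PᵀCN` is symmetric, for the Jacobian
matrices `P` and `N` of `φ` and `n`. -/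
theorem isPotentialForm_iff_isSymm {φ n : Fin m → Jet0 m → ℝ} (hφ : ∀ α, ContDiff ℝ ∞ (φ α))
    (hn : ∀ α, ContDiff ℝ ∞ (n α)) {z₀ : Jet0 m} {r : ℝ} {C : Matrix (Fin m) (Fin m) ℝ} :
    IsPotentialForm φ n z₀ r C ↔
      ∀ z ∈ ball z₀ r, ((jacobianU φ z).transpose * C * jacobianU n z).IsSymm := by
  refine forall₂_congr fun z _ => ?_
  -- The terms in which `∂φ` is differentiated contain second derivatives of `φ`, hence are
  -- symmetric in `γ`, `δ`, and play no role for closedness.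
  have key : ∀ γ δ, Jet0.partialU (forceForm φ n C γ) δ z =
      ∑ α, ∑ β, Jet0.partialU (Jet0.partialU (φ α) γ) δ z * C α β * n β z +
        ((jacobianU φ z).transpose * C * jacobianU n z) γ δ := by
    intro γ δ
    have h1 : HasFDerivAt (forceForm φ n C γ) (∑ α, ∑ β,
        ((Jet0.partialU (φ α) γ z * C α β) • fderiv ℝ (n β) z +
          n β z • (C α β • fderiv ℝ (Jet0.partialU (φ α) γ) z))) z :=
      HasFDerivAt.fun_sum fun α _ => HasFDerivAt.fun_sum fun β _ =>
        ((((hφ α).jet0_partialU γ).hasFDerivAt_of_smooth z).mul_const (C α β)).fun_mul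
          ((hn β).hasFDerivAt_of_smooth z)
    rw [Jet0.partialU, h1.fderiv]
    simp only [_root_.sum_apply, _root_.add_apply, _root_.smul_apply, smul_eq_mul,
      Finset.sum_add_distrib, Matrix.mul_apply, Matrix.transpose_apply, jacobianU, Matrix.of_apply,
      Finset.sum_mul]
    rw [add_comm]
    congr 1
    · refine Finset.sum_congr rfl fun α _ => Finset.sum_congr rfl fun β _ => ?_
      simp only [Jet0.partialU]
      ring
    · rw [Finset.sum_comm]
      rfl
  have hsymm : ∀ α γ δ, Jet0.partialU (Jet0.partialU (φ α) γ) δ z =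
      Jet0.partialU (Jet0.partialU (φ α) δ) γ z := fun α γ δ => (hφ α).fderiv_apply_comm z _ _
  constructor
  · intro h
    ext γ δ
    have := h γ δ
    rw [key, key] at this
    simp only [hsymm _ γ δ] at this
    rw [Matrix.transpose_apply]
    linarith
  · intro h γ δ
    rw [key, key, h.apply]
    simp only [hsymm _ γ δ]

/-- Normalized right-hand sides are functions of the new variables. -/
theorem NormalizesAt.exists_field {F : Jet1 m → Fin m → ℝ} {p : Jet1 m} {r : ℝ}
    {φ n : Fin m → Jet0 m → ℝ} (hN : NormalizesAt F p r φ n) :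
    ∃ h : Fin m → Jet0 m → ℝ, (∀ α, ContDiff ℝ ∞ (h α)) ∧ ∃ t > 0, ∃ s > 0, s ≤ r ∧
      (∀ z ∈ ball p.toJet0 s, Jet0.graphMap φ z ∈ ball (Jet0.graphMap φ p.toJet0) t ∧
        ∀ α, h α (Jet0.graphMap φ z) = n α z) ∧
      ∀ C, IsPotentialForm φ n p.toJet0 r C →
        ∀ w ∈ ball (Jet0.graphMap φ p.toJet0) t, (C * jacobianU h w).IsSymm := by
  have hφ := hN.smooth_map
  have hdet : ∀ z ∈ ball p.toJet0 r, (jacobianU φ z).det ≠ 0 := fun z hz =>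
    hN.det_ne_zero _ (Jet0.lift_mem_ball (p₀ := p) hz)
  have hg := Jet0.contDiff_graphMap hφ
  obtain ⟨Ψ, hpΨ, hΨs, hΨ, hΨsymm⟩ := hg.exists_openPartialHomeomorph (s := ball p.toJet0 r)
    isOpen_ball (fun z hz v hv => by
      rw [Jet0.fderiv_graphMap hφ] at hv
      obtain ⟨x, y, u⟩ := v
      obtain rfl : x = 0 := congrArg (fun w => w.1) hv
      obtain rfl : y = 0 := congrArg (fun w => w.2.1) hv
      obtain rfl : u = 0 := eq_zero_of_fderiv_vertical_eq_zero (hdet z hz) fun α =>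
        congrFun (congrArg (fun w => w.2.2) hv) α
      rfl) (mem_ball_self hN.pos)
  have hnΨ : ContDiffOn ℝ ∞ (fun w α => n α (Ψ.symm w)) Ψ.target :=
    contDiffOn_pi.2 fun α => (hN.smooth_rhs α).comp_contDiffOn hΨsymm
  have hw₀ : Jet0.graphMap φ p.toJet0 ∈ Ψ.target := by rw [← hΨ]; exact Ψ.map_source hpΨ
  obtain ⟨h, hh, t, ht, htΨ, heq⟩ := hnΨ.exists_contDiff_eqOn_ball Ψ.open_target hw₀
  have hopen : IsOpen (Ψ.source ∩ Jet0.graphMap φ ⁻¹' ball (Jet0.graphMap φ p.toJet0) t) :=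
    Ψ.open_source.inter (isOpen_ball.preimage hg.continuous)
  have hval : ∀ z ∈ Ψ.source ∩ Jet0.graphMap φ ⁻¹' ball (Jet0.graphMap φ p.toJet0) t, ∀ α,
      h (Jet0.graphMap φ z) α = n α z := by
    intro z hz α
    rw [congrFun (heq hz.2) α, ← hΨ]
    exact congrArg (n α) (Ψ.left_inv hz.1)
  obtain ⟨s, hs, hsub⟩ := Metric.isOpen_iff.1 hopen p.toJet0 ⟨hpΨ, mem_ball_self ht⟩
  refine ⟨fun α w => h w α, contDiff_pi.1 hh, t, ht, min s r, lt_min hs hN.pos, min_le_right _ _,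
    fun z hz => ?_, fun C hC w hw => ?_⟩
  · have hz' := hsub (ball_subset_ball (min_le_left _ _) hz)
    exact ⟨hz'.2, hval z hz'⟩
  · set z := Ψ.symm w with hz
    have hzs : z ∈ Ψ.source := Ψ.map_target (htΨ hw)
    have hzw : Jet0.graphMap φ z = w := by rw [← hΨ]; exact Ψ.right_inv (htΨ hw)
    have hz2 : z ∈ Ψ.source ∩ Jet0.graphMap φ ⁻¹' ball (Jet0.graphMap φ p.toJet0) t :=
      ⟨hzs, by rw [mem_preimage, hzw]; exact hw⟩
    have hJ : jacobianU n z = jacobianU (fun α w => h w α) w * jacobianU φ z := by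
      rw [← hzw, ← jacobianU_comp_graphMap hφ (contDiff_pi.1 hh)]
      ext α β
      have : n α =ᶠ[𝓝 z] fun z => h (Jet0.graphMap φ z) α := by
        filter_upwards [hopen.mem_nhds hz2] with z' hz' using (hval z' hz' α).symm
      simp only [jacobianU, Matrix.of_apply, Jet0.partialU, this.fderiv_eq]
    have h1 := (isPotentialForm_iff_isSymm hφ hN.smooth_rhs).1 hC z (hΨs hzs)
    have hu : IsUnit (jacobianU φ z).det := (hdet z (hΨs hzs)).isUnit
    have hut : IsUnit (jacobianU φ z).transpose.det := by rwa [Matrix.det_transpose]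
    rw [hJ] at h1
    set J := jacobianU φ z
    set B := jacobianU (fun α w => h w α) w
    -- With `∂n/∂u = B J` the symmetric matrix is `Jᵀ (C B) J`, so `C B` is symmetric by undoing the
    -- congruence.
    have h2 : C * B = J.transpose⁻¹ * (J.transpose * C * (B * J)) * J⁻¹ := by
      rw [Matrix.mul_assoc J.transpose, Matrix.nonsing_inv_mul_cancel_left _ _ hut, ← Matrix.mul_assoc,
        Matrix.mul_nonsing_inv_cancel_right _ _ hu]
    rw [Matrix.IsSymm, h2, Matrix.transpose_mul, Matrix.transpose_mul, h1.eq,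
      Matrix.transpose_nonsing_inv, Matrix.transpose_nonsing_inv, Matrix.transpose_transpose]
    simp only [Matrix.mul_assoc]

end

/-! ### Three Lagrangians: reduction to a linear system. -/

section

open Jet1

/-- Three independent symmetric `2 × 2` matrices span the symmetric matrices. -/
theorem Matrix.IsSymm.exists_eq_sum_three {C : Fin 3 → Matrix (Fin 2) (Fin 2) ℝ}
    (hs : ∀ i, (C i).IsSymm) (hind : LinearIndependent ℝ C) {D : Matrix (Fin 2) (Fin 2) ℝ}
    (hD : D.IsSymm) : ∃ g : Fin 3 → ℝ, D = ∑ i, g i • C i := by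
  let c : Matrix (Fin 2) (Fin 2) ℝ → Fin 3 → ℝ := fun A => ![A 0 0, A 0 1, A 1 1]
  have hsum : ∀ g : Fin 3 → ℝ, c (∑ i, g i • C i) = ∑ i, g i • c (C i) := by
    intro g
    ext j
    fin_cases j <;> simp [c, Fin.sum_univ_three]
  have hinj : ∀ A B : Matrix (Fin 2) (Fin 2) ℝ, A.IsSymm → B.IsSymm → c A = c B → A = B := by
    intro A B hA hB h
    have h0 := congrFun h 0
    have h1 := congrFun h 1
    have h2 := congrFun h 2
    simp only [c, Matrix.cons_val] at h0 h1 h2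
    ext i j
    fin_cases i <;> fin_cases j
    · exact h0
    · exact h1
    · exact ((hA.apply 0 1).trans h1).trans (hB.apply 0 1).symm
    · exact h2
  have hsymm : ∀ g : Fin 3 → ℝ, (∑ i, g i • C i).IsSymm := by
    intro g
    rw [Matrix.IsSymm, Matrix.transpose_sum]
    exact Finset.sum_congr rfl fun i _ => by rw [Matrix.transpose_smul, (hs i).eq]
  have hc : LinearIndependent ℝ (fun i => c (C i)) := by
    rw [Fintype.linearIndependent_iff] at hind ⊢
    intro g hg
    apply hind g
    refine hinj _ _ (hsymm g) Matrix.isSymm_zero ?_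
    rw [hsum, hg]
    ext j
    fin_cases j <;> simp [c]
  have hspan := hc.span_eq_top_of_card_eq_finrank (by simp)
  have hmem : c D ∈ Submodule.span ℝ (range fun i => c (C i)) := by rw [hspan]; trivial
  obtain ⟨g, hg⟩ := (Submodule.mem_span_range_iff_exists_fun ℝ).1 hmem
  exact ⟨g, hinj _ _ hD (hsymm g) (by rw [hsum, hg])⟩

/-- If all constant symmetric forms are potential, then the field is affine in `u`. -/
theorem exists_affine_of_isSymm {h : Fin 2 → Jet0 2 → ℝ} (hh : ∀ α, ContDiff ℝ ∞ (h α))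
    {w₀ : Jet0 2} {t : ℝ} (hsymm : ∀ C : Matrix (Fin 2) (Fin 2) ℝ, C.IsSymm → ∀ w ∈ ball w₀ t,
      (C * jacobianU h w).IsSymm) :
    ∃ lam : ℝ × ℝ → ℝ, ContDiff ℝ ∞ lam ∧ ∃ mu : Fin 2 → ℝ × ℝ → ℝ, (∀ α, ContDiff ℝ ∞ (mu α)) ∧
      ∀ w ∈ ball w₀ t, ∀ α, h α w = lam (w.1, w.2.1) * w.2.2 α + mu α (w.1, w.2.1) := by
  -- Three test matrices spanning the symmetric ones force the Jacobian matrix of `h` to be scalar.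
  have h01 : ∀ w ∈ ball w₀ t, Jet0.partialU (h 0) 1 w = 0 := fun w hw => by
    have := (hsymm !![1, 0; 0, 0] (by ext i j; fin_cases i <;> fin_cases j <;> rfl) w hw).apply 0 1
    simpa [Matrix.mul_apply, Fin.sum_univ_two, jacobianU, eq_comm] using this
  have h10 : ∀ w ∈ ball w₀ t, Jet0.partialU (h 1) 0 w = 0 := fun w hw => by
    have := (hsymm !![0, 0; 0, 1] (by ext i j; fin_cases i <;> fin_cases j <;> rfl) w hw).apply 0 1
    simpa [Matrix.mul_apply, Fin.sum_univ_two, jacobianU] using this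
  have h11 : ∀ w ∈ ball w₀ t, Jet0.partialU (h 0) 0 w = Jet0.partialU (h 1) 1 w := fun w hw => by
    have := (hsymm !![0, 1; 1, 0] (by ext i j; fin_cases i <;> fin_cases j <;> rfl) w hw).apply 0 1
    simpa [Matrix.mul_apply, Fin.sum_univ_two, jacobianU] using this
  let σ : ℝ × ℝ → Jet0 2 := fun z => (z.1, z.2, w₀.2.2)
  have hσ : ContDiff ℝ ∞ σ := contDiff_fst.prodMk (contDiff_snd.prodMk contDiff_const)
  have hσb : ∀ w ∈ ball w₀ t, σ (w.1, w.2.1) ∈ ball w₀ t := by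
    intro w hw
    have ht : 0 < t := pos_of_mem_ball hw
    simp only [mem_ball, Prod.dist_eq, max_lt_iff, σ] at hw ⊢
    exact ⟨hw.1, hw.2.1, by simpa using ht⟩
  let lam : ℝ × ℝ → ℝ := fun z => Jet0.partialU (h 0) 0 (σ z)
  have hlam : ContDiff ℝ ∞ lam := ((hh 0).jet0_partialU 0).comp hσ
  have hdiff : ∀ w : Jet0 2, w - σ (w.1, w.2.1) = (0, 0, w.2.2 - w₀.2.2) := by
    intro w
    simp [σ, Prod.ext_iff]
  -- The scalar does not depend on `u`: its `u^0`-derivative is `∂₀∂₁h₁ = ∂₁∂₀h₁ = 0`, and its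
  -- `u^1`-derivative is `∂₀∂₁h₀ = 0`.
  have hg : ∀ w ∈ ball w₀ t, lam (w.1, w.2.1) = Jet0.partialU (h 0) 0 w := by
    intro w hw
    refine eq_of_fderiv_sub_eq_zero (convex_ball w₀ t) (hσb w hw) hw
      (fun x _ => (((hh 0).jet0_partialU 0).hasFDerivAt_of_smooth x).differentiableAt) fun x hx => ?_
    rw [hdiff, Jet0.fderiv_vertical, Fin.sum_univ_two]
    have e0 : Jet0.partialU (Jet0.partialU (h 0) 0) 0 x = 0 := by
      have e : EqOn (Jet0.partialU (h 0) 0) (Jet0.partialU (h 1) 1) (ball w₀ t) := h11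
      rw [Jet0.partialU, e.fderiv_eq_of_isOpen isOpen_ball hx]
      exact ((hh 1).fderiv_apply_comm x _ _).trans
        (DFunLike.congr_fun (fderiv_eq_zero_of_eqOn_zero isOpen_ball h10 hx) _)
    have e1 : Jet0.partialU (Jet0.partialU (h 0) 0) 1 x = 0 :=
      ((hh 0).fderiv_apply_comm x _ _).trans 
        (DFunLike.congr_fun (fderiv_eq_zero_of_eqOn_zero isOpen_ball h01 hx) _)
    rw [e0, e1]
    ring
  have hdα : ∀ w ∈ ball w₀ t, ∀ α (v : Fin 2 → ℝ),
      fderiv ℝ (h α) w (0, 0, v) = lam (w.1, w.2.1) * v α := by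
    intro w hw α v
    rw [Jet0.fderiv_vertical, Fin.sum_univ_two, hg w hw]
    fin_cases α
    · simp [h01 w hw]
    · simp [h10 w hw, h11 w hw]
  refine ⟨lam, hlam, fun α z => h α (σ z) - lam z * w₀.2.2 α,
    fun α => ((hh α).comp hσ).sub (hlam.mul contDiff_const), fun w hw α => ?_⟩
  let ℓ : Jet0 2 →L[ℝ] ℝ := ContinuousLinearMap.proj (R := ℝ) (φ := fun _ : Fin 2 => ℝ) α ∘L
    ContinuousLinearMap.snd ℝ _ _ ∘L ContinuousLinearMap.snd ℝ _ _
  have hℓ : ∀ x : Jet0 2, HasFDerivAt (fun w : Jet0 2 => w.2.2 α) ℓ x := fun x => ℓ.hasFDerivAt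
  have hd : ∀ x : Jet0 2, HasFDerivAt (fun w : Jet0 2 => h α w - lam (w.1, w.2.1) * w.2.2 α)
      (fderiv ℝ (h α) x - (lam (x.1, x.2.1) • ℓ + x.2.2 α •
        (fderiv ℝ lam (x.1, x.2.1)).comp ((ContinuousLinearMap.fst ℝ _ _).prod
          (ContinuousLinearMap.fst ℝ _ _ ∘L ContinuousLinearMap.snd ℝ _ _)))) x := fun x =>
    ((hh α).hasFDerivAt_of_smooth x).fun_sub
      (((hlam.hasFDerivAt_of_smooth (x.1, x.2.1)).comp x ((ContinuousLinearMap.fst ℝ _ _).prod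
        (ContinuousLinearMap.fst ℝ _ _ ∘L ContinuousLinearMap.snd ℝ _ _)).hasFDerivAt).fun_mul
        (hℓ x))
  have := eq_of_fderiv_sub_eq_zero (f := fun w : Jet0 2 => h α w - lam (w.1, w.2.1) * w.2.2 α)
    (convex_ball w₀ t) (hσb w hw) hw (fun x _ => (hd x).differentiableAt) fun x hx => by
      rw [hdiff, (hd x).fderiv, _root_.sub_apply, hdα x hx]
      have h0 : ((0, 0) : ℝ × ℝ) = 0 := rfl
      simp [ℓ, h0]
  simp only [σ] at this ⊢
  linarith

theorem Jet1.totalXY_sub_base {φ : Jet0 2 → ℝ} {s : ℝ × ℝ → ℝ} (hφ : ContDiff ℝ ∞ φ)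
    (hs : ContDiff ℝ ∞ s) (p : Jet1 2) :
    Jet1.totalXY (fun z => φ z - s (z.1, z.2.1)) p = Jet1.totalXY φ p -
      fderiv ℝ (fun w => fderiv ℝ s w (1, 0)) (p.x, p.y) (0, 1) := by
  let π : Jet0 2 →L[ℝ] ℝ × ℝ := (ContinuousLinearMap.fst ℝ _ _).prod
    (ContinuousLinearMap.fst ℝ _ _ ∘L ContinuousLinearMap.snd ℝ _ _)
  have hsπ : ContDiff ℝ ∞ fun z => s (π z) := hs.comp π.contDiff
  have h1 : ∀ z v, fderiv ℝ (fun z => φ z - s (π z)) z v = fderiv ℝ φ z v - fderiv ℝ s (π z) (π v) := by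
    intro z v
    have : HasFDerivAt (fun z => φ z - s (π z)) _ z := (hφ.hasFDerivAt_of_smooth z).fun_sub
      ((hs.hasFDerivAt_of_smooth (π z)).comp z π.hasFDerivAt)
    rw [this.fderiv]
    rfl
  have h2 : ∀ z v w, fderiv ℝ (fderiv ℝ fun z => φ z - s (π z)) z v w =
      fderiv ℝ (fderiv ℝ φ) z v w - fderiv ℝ (fun z => fderiv ℝ s z (π w)) (π z) (π v) := by
    intro z v w
    rw [← (hφ.sub hsπ).fderiv_fderiv_apply, ← hφ.fderiv_fderiv_apply]
    have h3 : (fun z => fderiv ℝ (fun z => φ z - s (π z)) z w) =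
        fun z => fderiv ℝ φ z w - fderiv ℝ s (π z) (π w) := funext fun z => h1 z w
    have h4 : HasFDerivAt (fun z => fderiv ℝ φ z w - fderiv ℝ s (π z) (π w)) _ z :=
      ((hφ.fderiv_apply_smooth w).hasFDerivAt_of_smooth z).fun_sub
      (((hs.fderiv_apply_smooth (π w)).hasFDerivAt_of_smooth (π z)).comp z π.hasFDerivAt)
    rw [h3, h4.fderiv]
    rfl
  refine (h2 p.toJet0 (1, 0, p.ux) (0, 1, p.uy)).trans ?_
  congr 1
  exact hs.fderiv_apply_comm (p.x, p.y) _ _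

/-- A normalized system with three independent potential forms is linear with a scalar
coefficient, after a further substitution. -/
theorem NormalizesAt.exists_linear {F : Jet1 2 → Fin 2 → ℝ} {p : Jet1 2} {r : ℝ}
    {φ n : Fin 2 → Jet0 2 → ℝ} (hN : NormalizesAt F p r φ n)
    {C : Fin 3 → Matrix (Fin 2) (Fin 2) ℝ} (hs : ∀ i, (C i).IsSymm) (hind : LinearIndependent ℝ C)
    (hC : ∀ i, IsPotentialForm φ n p.toJet0 r (C i)) :
    ∃ lam : ℝ × ℝ → ℝ, ContDiff ℝ ∞ lam ∧ ∃ φ' : Fin 2 → Jet0 2 → ℝ, ∃ s ≤ r,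
      NormalizesAt F p s φ' (fun α z => lam (z.1, z.2.1) * φ' α z) := by
  obtain ⟨h, hh, t, ht, s, hs0, hsr, hval, hsym⟩ := hN.exists_field
  obtain ⟨lam, hlam, mu, hmu, haff⟩ := exists_affine_of_isSymm hh
    (w₀ := Jet0.graphMap φ p.toJet0) (t := t) (fun D hD w hw => by
      obtain ⟨g, rfl⟩ := hD.exists_eq_sum_three hs hind
      rw [Matrix.IsSymm, Finset.sum_mul, Matrix.transpose_sum]
      refine Finset.sum_congr rfl fun i _ => ?_
      rw [Matrix.smul_mul, Matrix.transpose_smul, (hsym (C i) (hC i) w hw).eq])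
  -- Subtracting a particular solution of `S_xy = λ S + μ` from `φ` removes the inhomogeneous term
  -- and leaves the Jacobian matrix in `u` unchanged.
  choose S hS ρ hρ hSρ using fun α => exists_goursat hlam (hmu α) (p.x, p.y)
  have hbase : ContDiff ℝ ∞ fun z : Jet0 2 => (z.1, z.2.1) :=
    contDiff_fst.prodMk (contDiff_fst.comp contDiff_snd)
  have hφ' : ∀ α, ContDiff ℝ ∞ fun z : Jet0 2 => φ α z - S α (z.1, z.2.1) := fun α =>
    (hN.smooth_map α).sub ((hS α).comp hbase)
  have hpU : ∀ α β z, Jet0.partialU (fun z : Jet0 2 => φ α z - S α (z.1, z.2.1)) β z =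
      Jet0.partialU (φ α) β z := by
    intro α β z
    let π : Jet0 2 →L[ℝ] ℝ × ℝ := (ContinuousLinearMap.fst ℝ _ _).prod
      (ContinuousLinearMap.fst ℝ _ _ ∘L ContinuousLinearMap.snd ℝ _ _)
    have : HasFDerivAt (fun z : Jet0 2 => φ α z - S α (z.1, z.2.1))
        (fderiv ℝ (φ α) z - (fderiv ℝ (S α) (z.1, z.2.1)).comp π) z :=
      ((hN.smooth_map α).hasFDerivAt_of_smooth z).fun_sub
        (((hS α).hasFDerivAt_of_smooth (π z)).comp z π.hasFDerivAt)
    rw [Jet0.partialU, this.fderiv, _root_.sub_apply, ContinuousLinearMap.comp_apply,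
      show π (0, 0, Pi.single β 1) = 0 from rfl, map_zero, sub_zero]
    rfl
  let ρ' := min s (min (ρ 0) (ρ 1))
  have hρ's : ρ' ≤ s := min_le_left _ _
  have hρ'α : ∀ α, ρ' ≤ ρ α := fun α => by
    fin_cases α
    · exact (min_le_right _ _).trans (min_le_left _ _)
    · exact (min_le_right _ _).trans (min_le_right _ _)
  refine ⟨lam, hlam, fun α z => φ α z - S α (z.1, z.2.1), ρ', hρ's.trans hsr,
    lt_min hs0 (lt_min (hρ 0) (hρ 1)), hφ', fun α => (hlam.comp hbase).mul (hφ' α),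
    fun p' hp' => ?_, fun p' hp' α => ?_⟩
  · have : jacobianU (fun α (z : Jet0 2) => φ α z - S α (z.1, z.2.1)) p'.toJet0 =
        jacobianU φ p'.toJet0 := by
      ext α β
      exact hpU α β _
    rw [this]
    exact hN.det_ne_zero _ (ball_subset_ball (hρ's.trans hsr) hp')
  · have hbp : (p'.x, p'.y) ∈ ball (p.x, p.y) (ρ α) := by
      have := ball_subset_ball (hρ'α α) hp'
      simp only [mem_ball, Prod.dist_eq, max_lt_iff] at this ⊢
      exact ⟨this.1, this.2.1⟩
    have hz := hval p'.toJet0 (Jet1.toJet0_mem_ball (ball_subset_ball hρ's hp'))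
    have h1 := hN.totalXY_eq p' (ball_subset_ball (hρ's.trans hsr) hp') α
    have h2 := haff _ hz.1 α
    rw [hz.2 α] at h2
    have h3 := hSρ α _ hbp
    simp only [hpU]
    rw [Jet1.totalXY_sub_base (hN.smooth_map α) (hS α), h3]
    rw [h2] at h1
    have h4 : (Jet0.graphMap φ p'.toJet0).2.2 α = φ α p'.toJet0 := rfl
    have h5 : ((Jet0.graphMap φ p'.toJet0).1, (Jet0.graphMap φ p'.toJet0).2.1) = (p'.x, p'.y) := rfl
    rw [h4, h5] at h1
    change _ = lam (p'.x, p'.y) * (φ α p'.toJet0 - S α (p'.x, p'.y))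
    linarith

end

/-! ### Normal forms of pencils of binary quadratic forms. -/

section

open Jet1

/-- Two independent vectors span the plane orthogonal to their cross product. -/
theorem exists_eq_combination_of_cross {c d : Fin 3 → ℝ}
    (hind : ∀ x y : ℝ, (∀ i, x * c i + y * d i = 0) → x = 0 ∧ y = 0) {v : Fin 3 → ℝ}
    (hv : (c 1 * d 2 - c 2 * d 1) * v 0 + (c 2 * d 0 - c 0 * d 2) * v 1 +
      (c 0 * d 1 - c 1 * d 0) * v 2 = 0) : ∃ x y : ℝ, ∀ i, v i = x * c i + y * d i := by
  set a := c 1 * d 2 - c 2 * d 1 with ha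
  set b := c 2 * d 0 - c 0 * d 2 with hb
  set e := c 0 * d 1 - c 1 * d 0 with he
  have hN : a ^ 2 + b ^ 2 + e ^ 2 ≠ 0 := by
    intro h0
    have ha0 : a = 0 := by nlinarith [sq_nonneg a, sq_nonneg b, sq_nonneg e]
    have hb0 : b = 0 := by nlinarith [sq_nonneg a, sq_nonneg b, sq_nonneg e]
    have he0 : e = 0 := by nlinarith [sq_nonneg a, sq_nonneg b, sq_nonneg e]
    have hc : ∀ j, c j = 0 := by
      intro j
      have := (hind (d j) (-c j) fun i => by
        fin_cases i <;> fin_cases j <;> simp only [Fin.zero_eta, Fin.mk_one, Fin.reduceFinMk] <;>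
          linarith).2
      linarith
    exact one_ne_zero (hind 1 0 fun i => by rw [hc i]; ring).1
  -- Cramer's rule in the plane: the coefficients are `(v × d)·(c × d)` and `(c × v)·(c × d)`,
  -- divided by the squared length of `c × d`.
  refine ⟨((v 1 * d 2 - v 2 * d 1) * a + (v 2 * d 0 - v 0 * d 2) * b +
    (v 0 * d 1 - v 1 * d 0) * e) / (a ^ 2 + b ^ 2 + e ^ 2),
    ((c 1 * v 2 - c 2 * v 1) * a + (c 2 * v 0 - c 0 * v 2) * b +
    (c 0 * v 1 - c 1 * v 0) * e) / (a ^ 2 + b ^ 2 + e ^ 2), fun i => ?_⟩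
  field_simp
  fin_cases i <;> simp only [Fin.zero_eta, Fin.mk_one, Fin.reduceFinMk]
  · rw [ha, hb, he] at *
    linear_combination (c 1 * d 2 - c 2 * d 1) * hv
  · rw [ha, hb, he] at *
    linear_combination (c 2 * d 0 - c 0 * d 2) * hv
  · rw [ha, hb, he] at *
    linear_combination (c 0 * d 1 - c 1 * d 0) * hv

/-- Simultaneous normalization of a binary quadratic form, in the dual variables. -/
theorem exists_orthogonal_frame {a b c : ℝ} (h : a ≠ 0 ∨ b ≠ 0 ∨ c ≠ 0) :
    ∃ t₀₀ t₀₁ t₁₀ t₁₁ e : ℝ, t₀₀ * t₁₁ - t₀₁ * t₁₀ ≠ 0 ∧ (e = 1 ∨ e = -1 ∨ e = 0) ∧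
      a * (t₀₀ * t₁₀) + b * (t₀₀ * t₁₁ + t₀₁ * t₁₀) + c * (t₀₁ * t₁₁) = 0 ∧
      (a * t₀₀ ^ 2 + 2 * b * (t₀₀ * t₀₁) + c * t₀₁ ^ 2) +
        e * (a * t₁₀ ^ 2 + 2 * b * (t₁₀ * t₁₁) + c * t₁₁ ^ 2) = 0 := by
  -- Completing the square: the vector `(0, 1)` has value `c`, and `k (1, -b/c)` is orthogonal to it
  -- with value `k² δ`. The factor `k` scales this value to `±c` when `δ ≠ 0`, and the sign of `c/δ`
  -- decides `e`.
  have key : ∀ a b c : ℝ, c ≠ 0 →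
      ∃ t₀₀ t₀₁ t₁₀ t₁₁ e : ℝ, t₀₀ * t₁₁ - t₀₁ * t₁₀ ≠ 0 ∧ (e = 1 ∨ e = -1 ∨ e = 0) ∧
      a * (t₀₀ * t₁₀) + b * (t₀₀ * t₁₁ + t₀₁ * t₁₀) + c * (t₀₁ * t₁₁) = 0 ∧
      (a * t₀₀ ^ 2 + 2 * b * (t₀₀ * t₀₁) + c * t₀₁ ^ 2) +
        e * (a * t₁₀ ^ 2 + 2 * b * (t₁₀ * t₁₁) + c * t₁₁ ^ 2) = 0 := by
    intro a b c hc
    set δ := a - b ^ 2 / c with hδ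
    have hδc : δ * c = a * c - b ^ 2 := by rw [hδ]; field_simp
    have hbc : b / c * c = b := div_mul_cancel₀ b hc
    rcases lt_trichotomy (c / δ) 0 with hneg | h0 | hpos
    · have hδ0 : δ ≠ 0 := fun h => by simp [h] at hneg
      have hs := Real.sq_sqrt (neg_nonneg.2 hneg.le)
      have hs0 : √(-(c / δ)) ≠ 0 := (Real.sqrt_pos.2 (neg_pos.2 hneg)).ne'
      set k := √(-(c / δ))
      refine ⟨k, -(k * (b / c)), 0, 1, 1, by simpa using hs0, Or.inl rfl, ?_, ?_⟩
      · linear_combination (-k) * hbc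
      · have : k ^ 2 * δ = -c := by rw [hs]; field_simp
        have h2 : a + 2 * b * (-(b / c)) + c * (b / c) ^ 2 = δ := by rw [hδ]; field_simp; ring
        linear_combination k ^ 2 * h2 + this
    · have hδ0 : δ = 0 := by
        rcases div_eq_zero_iff.1 h0 with h | h
        · exact absurd h hc
        · exact h
      refine ⟨1, -(b / c), 0, 1, 0, by simp, Or.inr (Or.inr rfl), ?_, ?_⟩
      · linear_combination (-1) * hbc
      · have h2 : a + 2 * b * (-(b / c)) + c * (b / c) ^ 2 = δ := by rw [hδ]; field_simp; ring
        linear_combination h2 + hδ0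
    · have hδ0 : δ ≠ 0 := fun h => by simp [h] at hpos
      have hs := Real.sq_sqrt hpos.le
      have hs0 : √(c / δ) ≠ 0 := (Real.sqrt_pos.2 hpos).ne'
      set k := √(c / δ)
      refine ⟨k, -(k * (b / c)), 0, 1, -1, by simpa using hs0, Or.inr (Or.inl rfl), ?_, ?_⟩
      · linear_combination (-k) * hbc
      · have : k ^ 2 * δ = c := by rw [hs]; field_simp
        have h2 : a + 2 * b * (-(b / c)) + c * (b / c) ^ 2 = δ := by rw [hδ]; field_simp; ring
        linear_combination k ^ 2 * h2 + this
  by_cases hc : c = 0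
  · by_cases ha : a = 0
    · have hb : b ≠ 0 := by tauto
      -- For the form `2b t₀ t₁` the vectors `(1, 1)` and `(1, -1)` are orthogonal with opposite
      -- values.
      refine ⟨1, 1, 1, -1, 1, by norm_num, Or.inl rfl, ?_, ?_⟩ <;> rw [hc, ha] <;> ring
    · obtain ⟨t₀₀, t₀₁, t₁₀, t₁₁, e, h1, h2, h3, h4⟩ := key c b a ha
      refine ⟨t₀₁, t₀₀, t₁₁, t₁₀, e, fun h => h1 (by linarith), h2, by linarith, by linarith⟩
  · exact key a b c hc

/-- Normal forms of pencils of binary quadratic forms. -/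
theorem exists_congruence_pencil {C : Fin 2 → Matrix (Fin 2) (Fin 2) ℝ} (hs : ∀ i, (C i).IsSymm)
    (hind : LinearIndependent ℝ C) :
    ∃ (T : Matrix (Fin 2) (Fin 2) ℝ) (e : ℝ), T.det ≠ 0 ∧ (e = 1 ∨ e = -1 ∨ e = 0) ∧
      (∃ x y : ℝ, T.transpose * !![0, 1; 1, 0] * T = x • C 0 + y • C 1) ∧
      ∃ x y : ℝ, T.transpose * !![1, 0; 0, e] * T = x • C 0 + y • C 1 := by
  have h10 : ∀ i, C i 1 0 = C i 0 1 := fun i => (hs i).apply 0 1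
  let v : Matrix (Fin 2) (Fin 2) ℝ → Fin 3 → ℝ := fun A => ![A 0 0, A 0 1, A 1 1]
  have hind' : ∀ x y : ℝ, (∀ i, x * v (C 0) i + y * v (C 1) i = 0) → x = 0 ∧ y = 0 := by
    intro x y h
    have hz : x • C 0 + y • C 1 = 0 := by
      have e0 := h 0
      have e1 := h 1
      have e2 := h 2
      simp only [v, Matrix.cons_val] at e0 e1 e2
      ext i j
      fin_cases i <;> fin_cases j <;> simp [h10, e0, e1, e2]
    have := Fintype.linearIndependent_iff.1 hind ![x, y] (by simpa [Fin.sum_univ_two] using hz)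
    exact ⟨this 0, this 1⟩
  set c := v (C 0)
  set d := v (C 1)
  -- The cross product of the coefficient vectors is the linear functional vanishing on the pencil,
  -- read as a quadratic form on the dual plane. The half occurs because the off-diagonal entry of a
  -- form counts twice.
  have hne : c 1 * d 2 - c 2 * d 1 ≠ 0 ∨ (c 2 * d 0 - c 0 * d 2) / 2 ≠ 0 ∨
      c 0 * d 1 - c 1 * d 0 ≠ 0 := by
    by_contra! hcon
    obtain ⟨e0, e1, e2⟩ := hcon
    have hc : ∀ j, c j = 0 := by
      intro j
      have := (hind' (d j) (-c j) fun i => by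
        fin_cases i <;> fin_cases j <;> simp only [Fin.zero_eta, Fin.mk_one, Fin.reduceFinMk] <;>
          linarith).2
      linarith
    exact one_ne_zero (hind' 1 0 fun i => by rw [hc i]; ring).1
  -- For rows `t₀`, `t₁` of `T`, the two congruent matrices are `t₀ᵀt₁ + t₁ᵀt₀` and `t₀ᵀt₀ + e
  -- t₁ᵀt₁`. They lie in the pencil exactly when the functional vanishes on them: `t₀`, `t₁` are
  -- orthogonal, and their values satisfy the relation with `e`.
  obtain ⟨t₀₀, t₀₁, t₁₀, t₁₁, e, hdet, he, h1, h2⟩ := exists_orthogonal_frame hne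
  have hmem : ∀ A : Matrix (Fin 2) (Fin 2) ℝ, A.IsSymm →
      (c 1 * d 2 - c 2 * d 1) * A 0 0 + (c 2 * d 0 - c 0 * d 2) * A 0 1 +
        (c 0 * d 1 - c 1 * d 0) * A 1 1 = 0 → ∃ x y : ℝ, A = x • C 0 + y • C 1 := by
    intro A hA h
    obtain ⟨x, y, hxy⟩ := exists_eq_combination_of_cross (v := v A) hind' h
    refine ⟨x, y, ?_⟩
    have e0 := hxy 0
    have e1 := hxy 1
    have e2 := hxy 2
    have hA10 : A 1 0 = A 0 1 := hA.apply 0 1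
    simp only [v, c, d, Matrix.cons_val] at e0 e1 e2
    ext i j
    fin_cases i <;> fin_cases j <;> simp [h10, hA10, e0, e1, e2]
  refine ⟨!![t₀₀, t₀₁; t₁₀, t₁₁], e, by rwa [Matrix.det_fin_two_of], he, hmem _ ?_ ?_, hmem _ ?_ ?_⟩
  · ext i j
    fin_cases i <;> fin_cases j <;> simp [Matrix.mul_apply, Fin.sum_univ_two] <;> ring
  · simp only [Matrix.mul_apply, Fin.sum_univ_two, Matrix.transpose_apply, Matrix.of_apply,
      Matrix.cons_val', Matrix.cons_val_zero, Matrix.cons_val_one, Matrix.cons_val_fin_one]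
    linear_combination 2 * h1
  · ext i j
    fin_cases i <;> fin_cases j <;> simp [Matrix.mul_apply, Fin.sum_univ_two] <;> ring
  · simp only [Matrix.mul_apply, Fin.sum_univ_two, Matrix.transpose_apply, Matrix.of_apply,
      Matrix.cons_val', Matrix.cons_val_zero, Matrix.cons_val_one, Matrix.cons_val_fin_one]
    linear_combination h2

end

/-! ### Two Lagrangians: linear substitutions and the function `W`. -/

section

open Jet1

section LinearChange

variable {m : ℕ} {φ : Fin m → Jet0 m → ℝ} (T : Matrix (Fin m) (Fin m) ℝ)

theorem fderiv_matrix_mul (hφ : ∀ α, ContDiff ℝ ∞ (φ α)) (α : Fin m) (z : Jet0 m) :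
    fderiv ℝ (fun z => ∑ β, T α β * φ β z) z = ∑ β, T α β • fderiv ℝ (φ β) z :=
  HasFDerivAt.fderiv (HasFDerivAt.fun_sum fun β _ =>
    ((hφ β).hasFDerivAt_of_smooth z).const_mul (T α β))

theorem jacobianU_matrix_mul (hφ : ∀ α, ContDiff ℝ ∞ (φ α)) (z : Jet0 m) :
    jacobianU (fun α z => ∑ β, T α β * φ β z) z = T * jacobianU φ z := by
  ext α γ
  simp [jacobianU, Jet0.partialU, fderiv_matrix_mul T hφ, Matrix.mul_apply]

theorem totalXY_matrix_mul (hφ : ∀ α, ContDiff ℝ ∞ (φ α)) (α : Fin m) (p : Jet1 m) :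
    Jet1.totalXY (fun z => ∑ β, T α β * φ β z) p = ∑ β, T α β * Jet1.totalXY (φ β) p := by
  have h : fderiv ℝ (fun z => ∑ β, T α β * φ β z) = fun z => ∑ β, T α β • fderiv ℝ (φ β) z :=
    funext fun z => fderiv_matrix_mul T hφ α z
  have h2 : ∀ z, HasFDerivAt (fun z => ∑ β, T α β • fderiv ℝ (φ β) z)
      (∑ β, T α β • fderiv ℝ (fderiv ℝ (φ β)) z) z := fun z => HasFDerivAt.fun_sum fun β _ =>
    ((hφ β).fderiv_smooth.hasFDerivAt_of_smooth z).const_smul (T α β)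
  simp only [Jet1.totalXY]
  rw [h, (h2 _).fderiv]
  simp

theorem NormalizesAt.matrix_mul {F : Jet1 m → Fin m → ℝ} {p : Jet1 m} {r : ℝ}
    {n : Fin m → Jet0 m → ℝ} (h : NormalizesAt F p r φ n) (hT : T.det ≠ 0) :
    NormalizesAt F p r (fun α z => ∑ β, T α β * φ β z) (fun α z => ∑ β, T α β * n β z) where
  pos := h.pos
  smooth_map α := ContDiff.sum fun β _ => contDiff_const.mul (h.smooth_map β)
  smooth_rhs α := ContDiff.sum fun β _ => contDiff_const.mul (h.smooth_rhs β)
  det_ne_zero p' hp' := by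
    rw [jacobianU_matrix_mul T h.smooth_map, Matrix.det_mul]
    exact mul_ne_zero hT (h.det_ne_zero p' hp')
  totalXY_eq p' hp' α := by
    have h1 : ∀ γ, Jet0.partialU (fun z => ∑ β, T α β * φ β z) γ p'.toJet0 =
        ∑ β, T α β * Jet0.partialU (φ β) γ p'.toJet0 := fun γ =>
      congrFun (congrFun (jacobianU_matrix_mul T h.smooth_map p'.toJet0) α) γ
    rw [totalXY_matrix_mul T h.smooth_map]
    simp only [h1, ← h.totalXY_eq p' hp', mul_add, Finset.sum_add_distrib, Finset.mul_sum,
      Finset.sum_mul, mul_assoc]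
    congr 1
    exact Finset.sum_comm

theorem IsPotentialForm.matrix_mul {z₀ : Jet0 m} {r : ℝ} {n : Fin m → Jet0 m → ℝ}
    {C : Matrix (Fin m) (Fin m) ℝ} (hφ : ∀ α, ContDiff ℝ ∞ (φ α)) (hn : ∀ α, ContDiff ℝ ∞ (n α))
    (h : IsPotentialForm φ n z₀ r (T.transpose * C * T)) :
    IsPotentialForm (fun α z => ∑ β, T α β * φ β z) (fun α z => ∑ β, T α β * n β z) z₀ r C := by
  rw [isPotentialForm_iff_isSymm hφ hn] at h
  refine (isPotentialForm_iff_isSymm (fun α => ContDiff.sum fun β _ => contDiff_const.mul (hφ β))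
    (fun α => ContDiff.sum fun β _ => contDiff_const.mul (hn β))).2 fun z hz => ?_
  have h1 := h z hz
  rw [jacobianU_matrix_mul T hφ, jacobianU_matrix_mul T hn, Matrix.transpose_mul]
  simpa only [Matrix.mul_assoc] using h1

end LinearChange

theorem IsPotentialForm.combination {φ n : Fin 2 → Jet0 2 → ℝ} (hφ : ∀ α, ContDiff ℝ ∞ (φ α))
    (hn : ∀ α, ContDiff ℝ ∞ (n α)) {z₀ : Jet0 2} {r : ℝ} {C D : Matrix (Fin 2) (Fin 2) ℝ}
    (hC : IsPotentialForm φ n z₀ r C) (hD : IsPotentialForm φ n z₀ r D) (x y : ℝ) :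
    IsPotentialForm φ n z₀ r (x • C + y • D) := by
  rw [isPotentialForm_iff_isSymm hφ hn] at hC hD ⊢
  intro z hz
  simp only [Matrix.mul_add, Matrix.add_mul, Matrix.mul_smul, Matrix.smul_mul]
  exact ((hC z hz).smul x).add ((hD z hz).smul y)

/-- The identification of `(x, y, u, v)` with `(x, y, (u, v))`. -/
def Jet0.ofProd : ℝ × ℝ × ℝ × ℝ → Jet0 2 := fun z => (z.1, z.2.1, ![z.2.2.1, z.2.2.2])

theorem Jet0.contDiff_ofProd : ContDiff ℝ ∞ Jet0.ofProd := by
  refine contDiff_fst.prodMk ((contDiff_fst.comp contDiff_snd).prodMk (contDiff_pi.2 fun i => ?_))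
  fin_cases i
  · exact contDiff_fst.comp (contDiff_snd.comp contDiff_snd)
  · exact contDiff_snd.comp (contDiff_snd.comp contDiff_snd)

theorem Jet0.fderiv_comp_ofProd {W : Jet0 2 → ℝ} (hW : ContDiff ℝ ∞ W) (z v : ℝ × ℝ × ℝ × ℝ) :
    fderiv ℝ (fun z => W (Jet0.ofProd z)) z v = fderiv ℝ W (Jet0.ofProd z) (Jet0.ofProd v) := by
  let L : ℝ × ℝ × ℝ × ℝ →L[ℝ] Jet0 2 := LinearMap.toContinuousLinearMap
    { toFun := Jet0.ofProd
      map_add' := fun a b => by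
        refine Prod.ext rfl (Prod.ext rfl ?_)
        ext i
        fin_cases i <;> rfl
      map_smul' := fun a b => by
        refine Prod.ext rfl (Prod.ext rfl ?_)
        ext i
        fin_cases i <;> rfl }
  have : HasFDerivAt (fun z => W (Jet0.ofProd z)) ((fderiv ℝ W (Jet0.ofProd z)).comp L) z :=
    (hW.hasFDerivAt_of_smooth _).comp z L.hasFDerivAt
  rw [this.fderiv]
  rfl

theorem Jet0.ofProd_single (a : ℝ) : Jet0.ofProd (0, 0, a, 0) = (0, 0, Pi.single 0 a) ∧
    Jet0.ofProd (0, 0, 0, a) = (0, 0, Pi.single 1 a) := by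
  constructor <;> refine Prod.ext rfl (Prod.ext rfl ?_) <;> ext i <;> fin_cases i <;> rfl

theorem Jet0.dU_comp_ofProd {W : Jet0 2 → ℝ} (hW : ContDiff ℝ ∞ W) :
    dU (fun z => W (Jet0.ofProd z)) = fun z => Jet0.partialU W 0 (Jet0.ofProd z) :=
  funext fun z => by rw [dU, Jet0.fderiv_comp_ofProd hW, (Jet0.ofProd_single 1).1]; rfl

theorem Jet0.dV_comp_ofProd {W : Jet0 2 → ℝ} (hW : ContDiff ℝ ∞ W) :
    dV (fun z => W (Jet0.ofProd z)) = fun z => Jet0.partialU W 1 (Jet0.ofProd z) :=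
  funext fun z => by rw [dV, Jet0.fderiv_comp_ofProd hW, (Jet0.ofProd_single 1).2]; rfl

theorem Jet0.ofProd_zeroJet (p : Jet1 2) : Jet0.ofProd (zeroJet p) = p.toJet0 := by
  refine Prod.ext rfl (Prod.ext rfl ?_)
  ext i
  fin_cases i <;> rfl

theorem isOpen_preimage_zeroJet {D : Set (ℝ × ℝ × ℝ × ℝ)} (hD : IsOpen D) :
    IsOpen (zeroJet ⁻¹' D) := by
  refine hD.preimage ?_
  unfold zeroJet Jet1.x Jet1.y Jet1.u
  fun_prop

/-- A normalized system with two independent potential forms is given by a function `W`, after a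
further linear substitution. -/
theorem NormalizesAt.exists_hessian {F : Jet1 2 → Fin 2 → ℝ} {p : Jet1 2} {r : ℝ}
    {φ n : Fin 2 → Jet0 2 → ℝ} (hN : NormalizesAt F p r φ n)
    {C : Fin 2 → Matrix (Fin 2) (Fin 2) ℝ} (hs : ∀ i, (C i).IsSymm) (hind : LinearIndependent ℝ C)
    (hC : ∀ i, IsPotentialForm φ n p.toJet0 r (C i)) :
    ∃ (D : Set (ℝ × ℝ × ℝ × ℝ)) (W : ℝ × ℝ × ℝ × ℝ → ℝ), IsOpen D ∧ ContDiff ℝ ∞ W ∧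
      ((∀ z ∈ D, dU (dU W) z + dV (dV W) z = 0) ∨ (∀ z ∈ D, dU (dU W) z = dV (dV W) z) ∨
        (∀ z ∈ D, dV (dV W) z = 0)) ∧
      ∃ φ' n' : Fin 2 → Jet0 2 → ℝ, ∃ s ≤ r, NormalizesAt F p s φ' n' ∧
        zeroJet (Jet1.prolong φ' p) ∈ D ∧
        ∀ p' ∈ ball p s, zeroJet (Jet1.prolong φ' p') ∈ D → ∀ α,
          ![dV W (zeroJet (Jet1.prolong φ' p')), dU W (zeroJet (Jet1.prolong φ' p'))] α =
            n' α p'.toJet0 := by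
  obtain ⟨T, e, hT, he, ⟨x₁, y₁, hO⟩, x₂, y₂, hE⟩ := exists_congruence_pencil hs hind
  have hN' := hN.matrix_mul T hT
  have hpO : IsPotentialForm (fun α z => ∑ β, T α β * φ β z) (fun α z => ∑ β, T α β * n β z)
      p.toJet0 r !![0, 1; 1, 0] := IsPotentialForm.matrix_mul T hN.smooth_map hN.smooth_rhs (by
    rw [hO]
    exact (hC 0).combination hN.smooth_map hN.smooth_rhs (hC 1) x₁ y₁)
  have hpE : IsPotentialForm (fun α z => ∑ β, T α β * φ β z) (fun α z => ∑ β, T α β * n β z)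
      p.toJet0 r !![1, 0; 0, e] := IsPotentialForm.matrix_mul T hN.smooth_map hN.smooth_rhs (by
    rw [hE]
    exact (hC 0).combination hN.smooth_map hN.smooth_rhs (hC 1) x₂ y₂)
  set φ' := fun α z => ∑ β, T α β * φ β z
  set n' := fun α z => ∑ β, T α β * n β z
  obtain ⟨h, hh, t, ht, s, hs0, hsr, hval, hsym⟩ := hN'.exists_field
  set w₀ := Jet0.graphMap φ' p.toJet0 with hw₀
  -- The off-diagonal matrix makes `(h 1, h 0)`, in this order, closed in `u`. Its potential `W` has
  -- `W_u = h 1` and `W_v = h 0`.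
  have hh' : ∀ w ∈ ball w₀ t, Jet0.partialU (h 1) 1 w = Jet0.partialU (h 0) 0 w := fun w hw => by
    have := (hsym _ hpO w hw).apply 1 0
    simpa [Matrix.mul_apply, Fin.sum_univ_two, jacobianU] using this
  -- The matrix diag(1, e) gives `e W_uu = W_vv`, the three alternatives for `W`.
  have hh'' : ∀ w ∈ ball w₀ t, e * Jet0.partialU (h 1) 0 w = Jet0.partialU (h 0) 1 w :=
    fun w hw => by
      have := (hsym _ hpE w hw).apply 0 1
      simpa [Matrix.mul_apply, Fin.sum_univ_two, jacobianU] using this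
  obtain ⟨W, hW, hWh⟩ := exists_potential (a := ![h 1, h 0]) (z₀ := w₀) (r := t)
    (fun α => by fin_cases α; exacts [hh 1, hh 0]) (fun w hw α β => by
      fin_cases α <;> fin_cases β
      · rfl
      · exact hh' w hw
      · exact (hh' w hw).symm
      · rfl)
  have hW0 : EqOn (Jet0.partialU W 0) (h 1) (ball w₀ t) := fun w hw => hWh w hw 0
  have hW1 : EqOn (Jet0.partialU W 1) (h 0) (ball w₀ t) := fun w hw => hWh w hw 1
  have h00 : ∀ z ∈ Jet0.ofProd ⁻¹' ball w₀ t, dU (dU fun z => W (Jet0.ofProd z)) z =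
      Jet0.partialU (h 1) 0 (Jet0.ofProd z) := fun z hz => by
    rw [Jet0.dU_comp_ofProd hW, Jet0.dU_comp_ofProd (hW.jet0_partialU 0)]
    exact DFunLike.congr_fun (hW0.fderiv_eq_of_isOpen isOpen_ball hz) _
  have h11 : ∀ z ∈ Jet0.ofProd ⁻¹' ball w₀ t, dV (dV fun z => W (Jet0.ofProd z)) z =
      Jet0.partialU (h 0) 1 (Jet0.ofProd z) := fun z hz => by
    rw [Jet0.dV_comp_ofProd hW, Jet0.dV_comp_ofProd (hW.jet0_partialU 1)]
    exact DFunLike.congr_fun (hW1.fderiv_eq_of_isOpen isOpen_ball hz) _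
  refine ⟨Jet0.ofProd ⁻¹' ball w₀ t, fun z => W (Jet0.ofProd z),
    isOpen_ball.preimage Jet0.contDiff_ofProd.continuous, hW.comp Jet0.contDiff_ofProd, ?_,
    φ', n', s, hsr, hN'.mono hs0 hsr, ?_, fun p' hp' hD α => ?_⟩
  · rcases he with rfl | rfl | rfl
    · refine Or.inr (Or.inl fun z hz => ?_)
      rw [h00 z hz, h11 z hz, ← hh'' _ hz, one_mul]
    · refine Or.inl fun z hz => ?_
      rw [h00 z hz, h11 z hz, ← hh'' _ hz]
      ring
    · refine Or.inr (Or.inr fun z hz => ?_)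
      rw [h11 z hz, ← hh'' _ hz, zero_mul]
  · rw [mem_preimage, Jet0.ofProd_zeroJet]
    exact mem_ball_self ht
  · have hz := hval p'.toJet0 (Jet1.toJet0_mem_ball hp')
    have hg : (Jet1.prolong φ' p').toJet0 = Jet0.graphMap φ' p'.toJet0 := rfl
    rw [Jet0.dU_comp_ofProd hW, Jet0.dV_comp_ofProd hW]
    simp only [Jet0.ofProd_zeroJet, hg]
    rw [hW0 hz.1, hW1 hz.1, hz.2, hz.2]
    fin_cases α <;> rfl

/-- A system with two Lagrangians is contact equivalent to the normal form given by a
function `W`. -/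
theorem AdmitsLagrangiansAt.exists_contactEquivalentAt_hessian {U : Set (Jet1 2)}
    {F : Jet1 2 → Fin 2 → ℝ} (hF : ∀ α, ContDiffOn ℝ ∞ (fun p => F p α) U) {q : Jet2 2}
    (h : AdmitsLagrangiansAt U F 2 q.toJet1) :
    ∃ (D : Set (ℝ × ℝ × ℝ × ℝ)) (W : ℝ × ℝ × ℝ × ℝ → ℝ), IsOpen D ∧ ContDiffOn ℝ ∞ W D ∧
      ((∀ z ∈ D, dU (dU W) z + dV (dV W) z = 0) ∨ (∀ z ∈ D, dU (dU W) z = dV (dV W) z) ∨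
        (∀ z ∈ D, dV (dV W) z = 0)) ∧
      ContactEquivalentAt U F (zeroJet ⁻¹' D)
        (fun p => ![dV W (zeroJet p), dU W (zeroJet p)]) q := by
  obtain ⟨r, φ, n, hU, hN, C, hCs, hind, hC⟩ := exists_normalizesAt hF le_rfl h
  obtain ⟨D, W, hD, hW, hWD, φ', n', s, hsr, hN', hp, hval⟩ := hN.exists_hessian hCs hind hC
  exact ⟨D, W, hD, hW.contDiffOn, hWD, hN'.contactEquivalentAt ((ball_subset_ball hsr).trans hU)
    (isOpen_preimage_zeroJet hD) hp hval⟩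

/-- A system with three Lagrangians is contact equivalent to two copies of a linear equation. -/
theorem AdmitsLagrangiansAt.exists_contactEquivalentAt_linear {U : Set (Jet1 2)}
    {F : Jet1 2 → Fin 2 → ℝ} (hF : ∀ α, ContDiffOn ℝ ∞ (fun p => F p α) U) {q : Jet2 2}
    (h : AdmitsLagrangiansAt U F 3 q.toJet1) :
    ∃ (D : Set (ℝ × ℝ)) (lam : ℝ × ℝ → ℝ), IsOpen D ∧ ContDiffOn ℝ ∞ lam D ∧
      ContactEquivalentAt U F (basePoint ⁻¹' D)
        (fun p => ![lam (basePoint p) * p.u 0, lam (basePoint p) * p.u 1]) q := by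
  obtain ⟨r, φ, n, hU, hN, C, hCs, hind, hC⟩ := exists_normalizesAt hF (by norm_num) h
  obtain ⟨lam, hlam, φ', s, hsr, hN'⟩ := hN.exists_linear hCs hind hC
  refine ⟨univ, lam, isOpen_univ, hlam.contDiffOn, hN'.contactEquivalentAt
    ((ball_subset_ball hsr).trans hU) (by simp) (by simp) fun p' _ _ α => ?_⟩
  fin_cases α <;> rfl

end

/-! ### Cartan's formula and the contact distribution. -/

section

open Jet1

/-- Cartan's formula for the form `dU - A dX - B dY` and two affine vector fields on which it
vanishes. -/
theorem cartan_of_vanishing {E : Type*} [NormedAddCommGroup E] [NormedSpace ℝ E] {U X Y A B : E → ℝ}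
    (hU : ContDiff ℝ ∞ U) (hX : ContDiff ℝ ∞ X) (hY : ContDiff ℝ ∞ Y) (hA : ContDiff ℝ ∞ A)
    (hB : ContDiff ℝ ∞ B) {V : Set E} (hV : IsOpen V) {Z₁ Z₂ : E → E} {L₁ L₂ : E →L[ℝ] E}
    (hZ₁ : ∀ r, HasFDerivAt Z₁ L₁ r) (hZ₂ : ∀ r, HasFDerivAt Z₂ L₂ r)
    (h₁ : ∀ r ∈ V, fderiv ℝ U r (Z₁ r) = A r * fderiv ℝ X r (Z₁ r) + B r * fderiv ℝ Y r (Z₁ r))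
    (h₂ : ∀ r ∈ V, fderiv ℝ U r (Z₂ r) = A r * fderiv ℝ X r (Z₂ r) + B r * fderiv ℝ Y r (Z₂ r))
    {r : E} (hr : r ∈ V) :
    fderiv ℝ A r (Z₂ r) * fderiv ℝ X r (Z₁ r) - fderiv ℝ A r (Z₁ r) * fderiv ℝ X r (Z₂ r) +
      (fderiv ℝ B r (Z₂ r) * fderiv ℝ Y r (Z₁ r) - fderiv ℝ B r (Z₁ r) * fderiv ℝ Y r (Z₂ r)) =
    fderiv ℝ U r (L₁ (Z₂ r) - L₂ (Z₁ r)) - A r * fderiv ℝ X r (L₁ (Z₂ r) - L₂ (Z₁ r)) -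
      B r * fderiv ℝ Y r (L₁ (Z₂ r) - L₂ (Z₁ r)) := by
  -- Differentiating the vanishing of the form on one field along the other and subtracting cancels
  -- the second derivatives of `U`, `X`, `Y`. The linear parts leave the bracket.
  have key : ∀ {Z : E → E} {L : E →L[ℝ] E}, (∀ r, HasFDerivAt Z L r) →
      (∀ r ∈ V, fderiv ℝ U r (Z r) = A r * fderiv ℝ X r (Z r) + B r * fderiv ℝ Y r (Z r)) → ∀ v,
      fderiv ℝ (fderiv ℝ U) r v (Z r) + fderiv ℝ U r (L v) -
        (A r * (fderiv ℝ (fderiv ℝ X) r v (Z r) + fderiv ℝ X r (L v)) +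
          fderiv ℝ A r v * fderiv ℝ X r (Z r)) -
        (B r * (fderiv ℝ (fderiv ℝ Y) r v (Z r) + fderiv ℝ Y r (L v)) +
          fderiv ℝ B r v * fderiv ℝ Y r (Z r)) = 0 := by
    intro Z L hZ hzero v
    have hd : ∀ {h : E → ℝ}, ContDiff ℝ ∞ h → HasFDerivAt (fun r => fderiv ℝ h r (Z r))
        ((fderiv ℝ h r).comp L + (fderiv ℝ (fderiv ℝ h) r).flip (Z r)) r := fun hh =>
      (hh.fderiv_smooth.hasFDerivAt_of_smooth r).clm_apply (hZ r)
    have h3 := ((hd hU).fun_sub ((hA.hasFDerivAt_of_smooth r).fun_mul (hd hX))).fun_sub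
      ((hB.hasFDerivAt_of_smooth r).fun_mul (hd hY))
    have h4 := fderiv_eq_zero_of_eqOn_zero hV (h := fun r => fderiv ℝ U r (Z r) -
      A r * fderiv ℝ X r (Z r) - B r * fderiv ℝ Y r (Z r))
      (fun r hr => by rw [hzero r hr]; ring) hr
    rw [h3.fderiv] at h4
    have h5 := DFunLike.congr_fun h4 v
    simp only [_root_.sub_apply, _root_.add_apply, _root_.smul_apply, ContinuousLinearMap.comp_apply,
      ContinuousLinearMap.flip_apply, smul_eq_mul, _root_.zero_apply] at h5
    linarith
  have k1 := key hZ₁ h₁ (Z₂ r)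
  have k2 := key hZ₂ h₂ (Z₁ r)
  rw [hU.fderiv_fderiv_comm r (Z₂ r), hX.fderiv_fderiv_comm r (Z₂ r),
    hY.fderiv_fderiv_comm r (Z₂ r)] at k1
  simp only [map_sub]
  linarith

/-- The value on two vectors of the two-form `ξ ∧ X + η ∧ Y`, in terms of the values
`(ξ, X, η, Y)` on the vectors. -/
def wedgeForm (v w : Fin 4 → ℝ) : ℝ :=
  v 0 * w 1 - w 0 * v 1 + (v 2 * w 3 - w 2 * v 3)

/-- The four vectors form a symplectic basis: `A S Aᵀ = S` makes the matrix `A` of the basis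
invertible, so a vector orthogonal to all of them is zero. -/
theorem eq_zero_of_wedgeForm_eq_zero {e : Fin 4 → Fin 4 → ℝ} (h01 : wedgeForm (e 0) (e 1) = 1)
    (h23 : wedgeForm (e 2) (e 3) = 1) (h02 : wedgeForm (e 0) (e 2) = 0)
    (h03 : wedgeForm (e 0) (e 3) = 0) (h12 : wedgeForm (e 1) (e 2) = 0)
    (h13 : wedgeForm (e 1) (e 3) = 0) {v : Fin 4 → ℝ} (hv : ∀ i, wedgeForm (e i) v = 0) : v = 0 := by
  let S : Matrix (Fin 4) (Fin 4) ℝ := !![0, 1, 0, 0; -1, 0, 0, 0; 0, 0, 0, 1; 0, 0, -1, 0]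
  have hSS : S * (-S) = 1 := by
    ext i j
    fin_cases i <;> fin_cases j <;> simp [S, Matrix.mul_apply, Fin.sum_univ_four]
  have hS : ∀ a b : Fin 4 → ℝ, a ⬝ᵥ (S.mulVec b) = wedgeForm a b := by
    intro a b
    simp [S, Matrix.mulVec, dotProduct, Fin.sum_univ_four, wedgeForm]
    ring
  let A : Matrix (Fin 4) (Fin 4) ℝ := Matrix.of e
  have hanti : ∀ a b, wedgeForm b a = - wedgeForm a b := fun a b => by simp only [wedgeForm]; ring
  have hself : ∀ a, wedgeForm a a = 0 := fun a => by simp only [wedgeForm]; ring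
  have hA : A * S * A.transpose = S := by
    ext i j
    have h1 : (A * S * A.transpose) i j = wedgeForm (e i) (e j) := by
      rw [← hS, Matrix.mul_assoc, Matrix.mul_apply]
      rfl
    rw [h1]
    fin_cases i <;> fin_cases j <;>
      simp [S, h01, h23, h02, h03, h12, h13, hself, hanti (e 0) (e 1), hanti (e 0) (e 2),
        hanti (e 0) (e 3), hanti (e 1) (e 2), hanti (e 1) (e 3), hanti (e 2) (e 3)]
  have hAS : A.mulVec (S.mulVec v) = 0 := funext fun i => by
    rw [Pi.zero_apply, ← hv i, ← hS]
    rfl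
  have hdS : S.det ≠ 0 := by
    have := congrArg Matrix.det hSS
    rw [Matrix.det_mul, Matrix.det_one] at this
    exact left_ne_zero_of_mul_eq_one this
  have hdA : A.det ≠ 0 := fun h0 => hdS (by rw [← hA, Matrix.det_mul, Matrix.det_mul, h0]; ring)
  exact Matrix.eq_zero_of_mulVec_eq_zero hdS (Matrix.eq_zero_of_mulVec_eq_zero hdA hAS)

namespace Jet2

variable {m : ℕ}

/-- The vectors of the contact distribution. -/
def IsContactVector (r v : Jet2 m) : Prop :=
  ∀ γ, theta γ r v = 0 ∧ thetaX γ r v = 0 ∧ thetaY γ r v = 0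

theorem IsContactVector.eq_zero_of_mem_contactSpan {r v : Jet2 m} (hv : IsContactVector r v)
    {η : Jet2 m →L[ℝ] ℝ} (hη : η ∈ contactSpan r) : η v = 0 := by
  induction hη using Submodule.span_induction with
  | mem η h =>
    obtain ⟨η, (⟨γ, rfl⟩ | ⟨γ, rfl⟩) | ⟨γ, rfl⟩, rfl⟩ := h
    exacts [(hv γ).1, (hv γ).2.1, (hv γ).2.2]
  | zero => rfl
  | add a b _ _ ha hb => rw [_root_.add_apply, ha, hb, add_zero]
  | smul c a _ ha => rw [_root_.smul_apply, ha, smul_zero]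

/-- The truncated total derivative `D_x`, as a vector field on `J²`. -/
def fieldX (r : Jet2 m) : Jet2 m := ((1, 0, r.ux, r.uxx, r.uxy), 0)

/-- The truncated total derivative `D_y`, as a vector field on `J²`. -/
def fieldY (r : Jet2 m) : Jet2 m := ((0, 1, r.uy, r.uxy, r.uyy), 0)

/-- The linear part of `fieldX`. -/
def fieldXL : Jet2 m →L[ℝ] Jet2 m :=
  ((0 : Jet2 m →L[ℝ] ℝ).prod ((0 : Jet2 m →L[ℝ] ℝ).prod
    ((Jet1.uxL.comp dJet1).prod (uxxL.prod uxyL)))).prod 0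

/-- The linear part of `fieldY`. -/
def fieldYL : Jet2 m →L[ℝ] Jet2 m :=
  ((0 : Jet2 m →L[ℝ] ℝ).prod ((0 : Jet2 m →L[ℝ] ℝ).prod
    ((Jet1.uyL.comp dJet1).prod (uxyL.prod uyyL)))).prod 0

theorem hasFDerivAt_fieldX (r : Jet2 m) : HasFDerivAt fieldX fieldXL r :=
  ((hasFDerivAt_const _ _).prodMk ((hasFDerivAt_const _ _).prodMk
      ((Jet1.uxL.comp dJet1).hasFDerivAt.prodMk
        (uxxL.hasFDerivAt.prodMk uxyL.hasFDerivAt)))).prodMk (hasFDerivAt_const _ _)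

theorem hasFDerivAt_fieldY (r : Jet2 m) : HasFDerivAt fieldY fieldYL r :=
  ((hasFDerivAt_const _ _).prodMk ((hasFDerivAt_const _ _).prodMk
      ((Jet1.uyL.comp dJet1).hasFDerivAt.prodMk
        (uxyL.hasFDerivAt.prodMk uyyL.hasFDerivAt)))).prodMk (hasFDerivAt_const _ _)

theorem isContactVector_fieldX (r : Jet2 m) : IsContactVector r (fieldX r) := fun γ => by
  simp [theta, thetaX, thetaY, du, dux, duy, dx, dy, dJet1, fieldX]

theorem isContactVector_fieldY (r : Jet2 m) : IsContactVector r (fieldY r) := fun γ => by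
  simp [theta, thetaX, thetaY, du, dux, duy, dx, dy, dJet1, fieldY]

theorem isContactVector_vertical (r : Jet2 m) (w : (Fin m → ℝ) × (Fin m → ℝ) × (Fin m → ℝ)) :
    IsContactVector r (0, w) := fun γ => by
  simp [theta, thetaX, thetaY, du, dux, duy, dx, dy, dJet1]

theorem decompose (r v : Jet2 m) : v = v.1.x • fieldX r + v.1.y • fieldY r +
    ∑ γ, theta γ r v • ((dirU γ, 0) : Jet2 m) + ∑ γ, thetaX γ r v • ((dirUx γ, 0) : Jet2 m) +
      ∑ γ, thetaY γ r v • ((dirUy γ, 0) : Jet2 m) + (0, v.2) := by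
  refine Prod.ext (Prod.ext ?_ (Prod.ext ?_ (Prod.ext ?_ (Prod.ext ?_ ?_)))) ?_
  · simp [Prod.fst_sum, dirU, dirUx, dirUy, Jet1.x, Jet1.y, fieldX, fieldY]
  · simp [Prod.fst_sum, Prod.snd_sum, dirU, dirUx, dirUy, Jet1.x, Jet1.y, fieldX, fieldY]
  iterate 3
    ext i
    simp [Prod.fst_sum, Prod.snd_sum, dirU, dirUx, dirUy, Jet1.x, Jet1.y, fieldX, fieldY,
      Finset.sum_apply, Pi.single_apply, theta, thetaX, thetaY, du, dux, duy, dx, dy, dJet1]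
    ring
  · simp [Prod.snd_sum, fieldX, fieldY]

end Jet2

end

/-! ### Contact maps of `J²` come from point transformations. -/

section

open Jet1 Jet2

/-- The components of a smooth map between second jet spaces that preserves the contact
distribution on `B`; the pullbacks of the contact forms `θ` are independent. -/
structure IsContactMap {m : ℕ} (B : Set (Jet2 m)) (X Y : Jet2 m → ℝ)
    (u ux uy uxx uxy uyy : Fin m → Jet2 m → ℝ) : Prop where
  isOpen : IsOpen B
  smooth_x : ContDiff ℝ ∞ X
  smooth_y : ContDiff ℝ ∞ Y
  smooth_u (α) : ContDiff ℝ ∞ (u α)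
  smooth_ux (α) : ContDiff ℝ ∞ (ux α)
  smooth_uy (α) : ContDiff ℝ ∞ (uy α)
  smooth_uxx (α) : ContDiff ℝ ∞ (uxx α)
  smooth_uxy (α) : ContDiff ℝ ∞ (uxy α)
  smooth_uyy (α) : ContDiff ℝ ∞ (uyy α)
  contact_u : ∀ r ∈ B, ∀ v, IsContactVector r v → ∀ α,
    fderiv ℝ (u α) r v = ux α r * fderiv ℝ X r v + uy α r * fderiv ℝ Y r v
  contact_ux : ∀ r ∈ B, ∀ v, IsContactVector r v → ∀ α,
    fderiv ℝ (ux α) r v = uxx α r * fderiv ℝ X r v + uxy α r * fderiv ℝ Y r v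
  contact_uy : ∀ r ∈ B, ∀ v, IsContactVector r v → ∀ α,
    fderiv ℝ (uy α) r v = uxy α r * fderiv ℝ X r v + uyy α r * fderiv ℝ Y r v
  nondeg : ∀ r ∈ B, ∀ c : Fin m → ℝ, (∀ v, ∑ α, c α * (fderiv ℝ (u α) r v -
    ux α r * fderiv ℝ X r v - uy α r * fderiv ℝ Y r v) = 0) → c = 0

namespace IsContactMap

section General

variable {m : ℕ} {B : Set (Jet2 m)} {X Y : Jet2 m → ℝ} {u ux uy uxx uxy uyy : Fin m → Jet2 m → ℝ}

/-- The pullback of the contact form `θ^α`. -/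
def pullback (X Y : Jet2 m → ℝ) (u ux uy : Fin m → Jet2 m → ℝ) (α : Fin m) (r v : Jet2 m) : ℝ :=
  fderiv ℝ (u α) r v - ux α r * fderiv ℝ X r v - uy α r * fderiv ℝ Y r v

/-- The pullback of the differential of the contact form `θ^α`, up to sign. -/
def curvature (X Y : Jet2 m → ℝ) (ux uy : Fin m → Jet2 m → ℝ) (α : Fin m) (r v w : Jet2 m) : ℝ :=
  fderiv ℝ (ux α) r v * fderiv ℝ X r w - fderiv ℝ (ux α) r w * fderiv ℝ X r v +
    (fderiv ℝ (uy α) r v * fderiv ℝ Y r w - fderiv ℝ (uy α) r w * fderiv ℝ Y r v)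

theorem curvature_comm (α : Fin m) (r v w : Jet2 m) :
    curvature X Y ux uy α r v w = - curvature X Y ux uy α r w v := by
  simp only [curvature]
  ring

/-- The matrix with which the contact forms `θ` are transformed. -/
def frame (X Y : Jet2 m → ℝ) (u ux uy : Fin m → Jet2 m → ℝ) (r : Jet2 m) :
    Matrix (Fin m) (Fin m) ℝ :=
  Matrix.of fun α γ => pullback X Y u ux uy α r (dirU γ, 0)

theorem pullback_dirU_mul {r : Jet2 m} (a : Fin m → ℝ) (α : Fin m) :
    pullback X Y u ux uy α r ((0, 0, a, 0, 0), 0) = ∑ γ, frame X Y u ux uy r α γ * a γ := by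
  let ℓ : Jet2 m →L[ℝ] ℝ := fderiv ℝ (u α) r - ux α r • fderiv ℝ X r - uy α r • fderiv ℝ Y r
  have ha : (((0, 0, a, 0, 0), 0) : Jet2 m) = ∑ γ, a γ • ((dirU γ, 0) : Jet2 m) := by
    refine Prod.ext (Prod.ext ?_ (Prod.ext ?_ (Prod.ext ?_ (Prod.ext ?_ ?_)))) ?_
    · simp [Prod.fst_sum, dirU]
    · simp [Prod.fst_sum, Prod.snd_sum, dirU]
    iterate 3
      ext i
      simp [Prod.fst_sum, Prod.snd_sum, dirU, Finset.sum_apply, Pi.single_apply]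
    · simp [Prod.snd_sum]
  change ℓ _ = _
  rw [ha, map_sum]
  exact Finset.sum_congr rfl fun γ _ => by rw [map_smul, smul_eq_mul, mul_comm]; rfl

variable (h : IsContactMap B X Y u ux uy uxx uxy uyy)
include h

theorem curvature_eq {Z₁ Z₂ : Jet2 m → Jet2 m} {L₁ L₂ : Jet2 m →L[ℝ] Jet2 m} (α : Fin m)
    (hZ₁ : ∀ r, HasFDerivAt Z₁ L₁ r) (hZ₂ : ∀ r, HasFDerivAt Z₂ L₂ r)
    (h₁ : ∀ r ∈ B, pullback X Y u ux uy α r (Z₁ r) = 0)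
    (h₂ : ∀ r ∈ B, pullback X Y u ux uy α r (Z₂ r) = 0) {r : Jet2 m} (hr : r ∈ B) :
    curvature X Y ux uy α r (Z₂ r) (Z₁ r) =
      pullback X Y u ux uy α r (L₁ (Z₂ r) - L₂ (Z₁ r)) :=
  cartan_of_vanishing (h.smooth_u α) h.smooth_x h.smooth_y (h.smooth_ux α) (h.smooth_uy α) h.isOpen
    hZ₁ hZ₂ (fun r hr => by have := h₁ r hr; simp only [pullback] at this; linarith)
    (fun r hr => by have := h₂ r hr; simp only [pullback] at this; linarith) hr

theorem pullback_eq_zero {r v : Jet2 m} (hr : r ∈ B) (hv : IsContactVector r v) (α : Fin m) :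
    pullback X Y u ux uy α r v = 0 := by
  rw [pullback, h.contact_u r hr v hv]
  ring

theorem curvature_eq_zero {r v w : Jet2 m} (hr : r ∈ B) (hv : IsContactVector r v)
    (hw : IsContactVector r w) (α : Fin m) : curvature X Y ux uy α r v w = 0 := by
  rw [curvature, h.contact_ux r hr v hv, h.contact_ux r hr w hw, h.contact_uy r hr v hv,
    h.contact_uy r hr w hw]
  ring

/-- The curvature vanishes on pairs of contact vectors, because there the differentials of `u_x`,
`u_y` are combinations of `dX`, `dY` with a symmetric matrix. By Cartan's formula the pulled-back
`θ` also vanishes on brackets of contact fields, in particular on all `∂/∂u_x`, `∂/∂u_y`. -/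
theorem pullback_fieldXL {r : Jet2 m} (hr : r ∈ B) (w : (Fin m → ℝ) × (Fin m → ℝ) × (Fin m → ℝ))
    (α : Fin m) : pullback X Y u ux uy α r (fieldXL (0, w)) = 0 := by
  have := h.curvature_eq (Z₁ := fieldX) (Z₂ := fun _ => (0, w)) (L₂ := 0) α hasFDerivAt_fieldX
    (fun _ => hasFDerivAt_const _ _) (fun r hr => h.pullback_eq_zero hr (isContactVector_fieldX r) α)
    (fun r hr => h.pullback_eq_zero hr (isContactVector_vertical r w) α) hr
  rw [h.curvature_eq_zero hr (isContactVector_vertical r w) (isContactVector_fieldX r)] at this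
  simpa using this.symm

theorem pullback_vertical {r : Jet2 m} (hr : r ∈ B) (a b : Fin m → ℝ) (α : Fin m) :
    pullback X Y u ux uy α r ((0, 0, 0, a, b), 0) = 0 :=
  h.pullback_fieldXL hr (a, b, 0) α

/-- Cartan's formula once more: the bracket of `∂/∂u_x` with `D_x` is `∂/∂u`, whereas `∂/∂u_y`
commutes with `D_x` in the truncated fields. -/
theorem curvature_vertical_fieldX {r : Jet2 m} (hr : r ∈ B) (a b : Fin m → ℝ) (α : Fin m) :
    curvature X Y ux uy α r ((0, 0, 0, a, b), 0) (fieldX r) =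
      pullback X Y u ux uy α r ((0, 0, a, 0, 0), 0) := by
  have := h.curvature_eq (Z₁ := fieldX) (Z₂ := fun _ => ((0, 0, 0, a, b), 0)) (L₂ := 0) α
    hasFDerivAt_fieldX (fun _ => hasFDerivAt_const _ _)
    (fun r hr => h.pullback_eq_zero hr (isContactVector_fieldX r) α)
    (fun r hr => h.pullback_vertical hr a b α) hr
  rw [this]
  congr 1
  simp only [_root_.zero_apply, sub_zero]
  rfl

theorem curvature_vertical_fieldY {r : Jet2 m} (hr : r ∈ B) (a b : Fin m → ℝ) (α : Fin m) :
    curvature X Y ux uy α r ((0, 0, 0, a, b), 0) (fieldY r) =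
      pullback X Y u ux uy α r ((0, 0, b, 0, 0), 0) := by
  have := h.curvature_eq (Z₁ := fieldY) (Z₂ := fun _ => ((0, 0, 0, a, b), 0)) (L₂ := 0) α
    hasFDerivAt_fieldY (fun _ => hasFDerivAt_const _ _)
    (fun r hr => h.pullback_eq_zero hr (isContactVector_fieldY r) α)
    (fun r hr => h.pullback_vertical hr a b α) hr
  rw [this]
  congr 1
  simp only [_root_.zero_apply, sub_zero]
  rfl

theorem curvature_vertical_vertical {r : Jet2 m} (hr : r ∈ B) (a b a' b' : Fin m → ℝ) (α : Fin m) :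
    curvature X Y ux uy α r ((0, 0, 0, a, b), 0) ((0, 0, 0, a', b'), 0) = 0 := by
  have := h.curvature_eq (Z₁ := fun _ => ((0, 0, 0, a', b'), 0))
    (Z₂ := fun _ => ((0, 0, 0, a, b), 0)) (L₁ := 0) (L₂ := 0) α
    (fun _ => hasFDerivAt_const _ _) (fun _ => hasFDerivAt_const _ _)
    (fun r hr => h.pullback_vertical hr a' b' α) (fun r hr => h.pullback_vertical hr a b α) hr
  rw [this]
  simp [pullback]

theorem curvature_second_vertical {r : Jet2 m} (hr : r ∈ B)
    (w : (Fin m → ℝ) × (Fin m → ℝ) × (Fin m → ℝ)) (a b : Fin m → ℝ) (α : Fin m) :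
    curvature X Y ux uy α r (0, w) ((0, 0, 0, a, b), 0) = 0 := by
  have := h.curvature_eq (Z₁ := fun _ => ((0, 0, 0, a, b), 0)) (Z₂ := fun _ => (0, w))
    (L₁ := 0) (L₂ := 0) α (fun _ => hasFDerivAt_const _ _) (fun _ => hasFDerivAt_const _ _)
    (fun r hr => h.pullback_vertical hr a b α)
    (fun r hr => h.pullback_eq_zero hr (isContactVector_vertical r w) α) hr
  rw [this]
  simp [pullback]

/-- The pulled-back forms vanish on contact vectors and on first-order vertical vectors, so no
`thetaX` or `thetaY` can occur. -/
theorem pullback_eq {r : Jet2 m} (hr : r ∈ B) (v : Jet2 m) (α : Fin m) :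
    pullback X Y u ux uy α r v = ∑ γ, frame X Y u ux uy r α γ * theta γ r v := by
  let ℓ : Jet2 m →L[ℝ] ℝ := fderiv ℝ (u α) r - ux α r • fderiv ℝ X r - uy α r • fderiv ℝ Y r
  have hℓ : ∀ v, pullback X Y u ux uy α r v = ℓ v := fun v => rfl
  have h1 : ∀ γ, ℓ (dirUx γ, 0) = 0 := fun γ => h.pullback_vertical hr (Pi.single γ 1) 0 α
  have h2 : ∀ γ, ℓ (dirUy γ, 0) = 0 := fun γ => h.pullback_vertical hr 0 (Pi.single γ 1) α
  have h3 : ℓ (fieldX r) = 0 := h.pullback_eq_zero hr (isContactVector_fieldX r) α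
  have h4 : ℓ (fieldY r) = 0 := h.pullback_eq_zero hr (isContactVector_fieldY r) α
  have h5 : ℓ (0, v.2) = 0 := h.pullback_eq_zero hr (isContactVector_vertical r v.2) α
  rw [hℓ]
  conv_lhs => rw [Jet2.decompose r v]
  simp only [map_add, map_sum, map_smul, smul_eq_mul, h1, h2, h3, h4, h5, mul_zero,
    Finset.sum_const_zero, add_zero, zero_add]
  exact Finset.sum_congr rfl fun γ _ => mul_comm (theta γ r v) _

theorem frame_det_ne_zero {r : Jet2 m} (hr : r ∈ B) : (frame X Y u ux uy r).det ≠ 0 := by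
  intro h0
  obtain ⟨c, hc, hc0⟩ := Matrix.exists_vecMul_eq_zero_iff.2 h0
  refine hc (h.nondeg r hr c fun v => ?_)
  change ∑ α, c α * pullback X Y u ux uy α r v = 0
  simp only [h.pullback_eq hr, Finset.mul_sum]
  rw [Finset.sum_comm]
  refine Finset.sum_eq_zero fun γ _ => ?_
  have := congrFun hc0 γ
  simp only [Matrix.vecMul, dotProduct, Pi.zero_apply] at this
  simp only [← mul_assoc, ← Finset.sum_mul, this, zero_mul]

end General

section TwoVariables

variable {B : Set (Jet2 2)} {X Y : Jet2 2 → ℝ} {u ux uy uxx uxy uyy : Fin 2 → Jet2 2 → ℝ}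
  (h : IsContactMap B X Y u ux uy uxx uxy uyy)
include h

/-- A vector in the kernel of the combination with index `β` of the curvature forms is annihilated
by `dX` and `dY`. -/
theorem fderiv_base_eq_zero {r : Jet2 2} (hr : r ∈ B) (β : Fin 2) {v : Jet2 2}
    (hx : ∀ α, curvature X Y ux uy α r ((0, 0, 0, Pi.single β 1, 0), 0) v = 0)
    (hy : ∀ α, curvature X Y ux uy α r ((0, 0, 0, 0, Pi.single β 1), 0) v = 0)
    (hX : ∑ α, (frame X Y u ux uy r)⁻¹ β α * curvature X Y ux uy α r (fieldX r) v = 0)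
    (hY : ∑ α, (frame X Y u ux uy r)⁻¹ β α * curvature X Y ux uy α r (fieldY r) v = 0) :
    fderiv ℝ X r v = 0 ∧ fderiv ℝ Y r v = 0 := by
  set A := frame X Y u ux uy r with hA
  have hAu : IsUnit A.det := (h.frame_det_ne_zero hr).isUnit
  let L : Jet2 2 → Fin 4 → ℝ := fun v => ![∑ α, A⁻¹ β α * fderiv ℝ (ux α) r v, fderiv ℝ X r v,
    ∑ α, A⁻¹ β α * fderiv ℝ (uy α) r v, fderiv ℝ Y r v]
  have hL : ∀ v w, wedgeForm (L v) (L w) = ∑ α, A⁻¹ β α * curvature X Y ux uy α r v w := by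
    intro v w
    simp only [wedgeForm, L, curvature, Fin.sum_univ_two, Matrix.cons_val]
    ring
  have hinv : ∑ α, A⁻¹ β α * A α β = 1 := by
    rw [← Matrix.mul_apply, Matrix.nonsing_inv_mul _ hAu, Matrix.one_apply_eq]
  have hAβ : ∀ α, ∑ γ, A α γ * (Pi.single β 1 : Fin 2 → ℝ) γ = A α β := fun α => by
    simp [Pi.single_apply]
  have hp0 : ∀ α, pullback X Y u ux uy α r ((0, 0, 0, 0, 0), 0) = 0 := fun α =>
    h.pullback_vertical hr 0 0 α
  -- For the combination with row `β` of the inverse frame, `∂/∂u^β_x`, `D_x`, `∂/∂u^β_y`, `D_y` is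
  -- a symplectic basis modulo the kernel. A vector orthogonal to it annihilates all four one-forms,
  -- `dX` and `dY` among them.
  have key := eq_zero_of_wedgeForm_eq_zero (e := fun i => L (![((0, 0, 0, Pi.single β 1, 0), 0),
    fieldX r, ((0, 0, 0, 0, Pi.single β 1), 0), fieldY r] i)) (v := L v) ?_ ?_ ?_ ?_ ?_ ?_ ?_
  · exact ⟨congrFun key 1, congrFun key 3⟩
  · simp only [hL, Matrix.cons_val, h.curvature_vertical_fieldX hr, pullback_dirU_mul, ← hA, hAβ, hinv]
  · simp only [hL, Matrix.cons_val, h.curvature_vertical_fieldY hr, pullback_dirU_mul, ← hA, hAβ, hinv]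
  · simp only [hL, Matrix.cons_val, h.curvature_vertical_vertical hr, mul_zero, Finset.sum_const_zero]
  · simp only [hL, Matrix.cons_val, h.curvature_vertical_fieldY hr, hp0, mul_zero, Finset.sum_const_zero]
  · simp only [hL, Matrix.cons_val, curvature_comm _ r (fieldX r), h.curvature_vertical_fieldX hr, hp0,
      mul_zero, neg_zero, Finset.sum_const_zero]
  · simp only [hL, Matrix.cons_val, h.curvature_eq_zero hr (isContactVector_fieldX r)
      (isContactVector_fieldY r), mul_zero, Finset.sum_const_zero]
  · intro i
    fin_cases i <;> simp [hL, hx, hy, hX, hY]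

theorem fderiv_base_second {r : Jet2 2} (hr : r ∈ B)
    (w : (Fin 2 → ℝ) × (Fin 2 → ℝ) × (Fin 2 → ℝ)) :
    fderiv ℝ X r (0, w) = 0 ∧ fderiv ℝ Y r (0, w) = 0 := by
  have hw := isContactVector_vertical r w
  refine h.fderiv_base_eq_zero hr 0 (fun α => ?_) (fun α => ?_) ?_ ?_
  · rw [curvature_comm, h.curvature_second_vertical hr, neg_zero]
  · rw [curvature_comm, h.curvature_second_vertical hr, neg_zero]
  · simp [h.curvature_eq_zero hr (isContactVector_fieldX r) hw]
  · simp [h.curvature_eq_zero hr (isContactVector_fieldY r) hw]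

/-- First-order vertical directions of index `γ` lie in the kernel of the combination with the other
index `β`. This requires a second dependent variable; with one, contact transformations such as
Legendre's exist. -/
theorem fderiv_base_first {r : Jet2 2} (hr : r ∈ B) (a b : Fin 2 → ℝ) :
    fderiv ℝ X r ((0, 0, 0, a, b), 0) = 0 ∧ fderiv ℝ Y r ((0, 0, 0, a, b), 0) = 0 := by
  set A := frame X Y u ux uy r with hA
  have hAu : IsUnit A.det := (h.frame_det_ne_zero hr).isUnit
  have hinv : ∀ β γ, β ≠ γ → ∀ s : ℝ, ∑ α, A⁻¹ β α * ∑ δ, A α δ * (Pi.single γ s : Fin 2 → ℝ) δ = 0 := by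
    intro β γ hβγ s
    have : ∀ α, ∑ δ, A α δ * (Pi.single γ s : Fin 2 → ℝ) δ = A α γ * s := fun α => by
      simp [Pi.single_apply]
    simp only [this, ← mul_assoc, ← Finset.sum_mul]
    rw [← Matrix.mul_apply, Matrix.nonsing_inv_mul _ hAu, Matrix.one_apply_ne hβγ, zero_mul]
  have key : ∀ β γ, β ≠ γ → ∀ s t : ℝ,
      fderiv ℝ X r ((0, 0, 0, Pi.single γ s, Pi.single γ t), 0) = 0 ∧
      fderiv ℝ Y r ((0, 0, 0, Pi.single γ s, Pi.single γ t), 0) = 0 := by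
    intro β γ hβγ s t
    refine h.fderiv_base_eq_zero hr β (fun α => ?_) (fun α => ?_) ?_ ?_
    · exact h.curvature_vertical_vertical hr _ _ _ _ α
    · exact h.curvature_vertical_vertical hr _ _ _ _ α
    · simp only [curvature_comm _ r (fieldX r), h.curvature_vertical_fieldX hr, pullback_dirU_mul,
        mul_neg, Finset.sum_neg_distrib, ← hA, hinv β γ hβγ, neg_zero]
    · simp only [curvature_comm _ r (fieldY r), h.curvature_vertical_fieldY hr, pullback_dirU_mul,
        mul_neg, Finset.sum_neg_distrib, ← hA, hinv β γ hβγ, neg_zero]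
  have hsplit : (((0, 0, 0, a, b), 0) : Jet2 2) =
      ((0, 0, 0, Pi.single 0 (a 0), Pi.single 0 (b 0)), 0) +
        ((0, 0, 0, Pi.single 1 (a 1), Pi.single 1 (b 1)), 0) := by
    refine Prod.ext (Prod.ext ?_ (Prod.ext ?_ (Prod.ext ?_ (Prod.ext ?_ ?_)))) ?_ <;> simp
    · ext i
      fin_cases i <;> simp
    · ext i
      fin_cases i <;> simp
  have h0 := key 1 0 (by simp) (a 0) (b 0)
  have h1 := key 0 1 (by simp) (a 1) (b 1)
  rw [hsplit, map_add, map_add, h0.1, h0.2, h1.1, h1.2]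
  simp

/-- A contact transformation of `J²` is the prolongation of a point transformation. -/
theorem fderiv_vertical {r : Jet2 2} (hr : r ∈ B) (a b : Fin 2 → ℝ)
    (w : (Fin 2 → ℝ) × (Fin 2 → ℝ) × (Fin 2 → ℝ)) :
    fderiv ℝ X r ((0, 0, 0, a, b), w) = 0 ∧ fderiv ℝ Y r ((0, 0, 0, a, b), w) = 0 ∧
      ∀ α, fderiv ℝ (u α) r ((0, 0, 0, a, b), w) = 0 := by
  have hs : (((0, 0, 0, a, b), w) : Jet2 2) = ((0, 0, 0, a, b), 0) + (0, w) := by simp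
  have h1 := h.fderiv_base_first hr a b
  have h2 := h.fderiv_base_second hr w
  have hX : fderiv ℝ X r ((0, 0, 0, a, b), w) = 0 := by rw [hs, map_add, h1.1, h2.1, add_zero]
  have hY : fderiv ℝ Y r ((0, 0, 0, a, b), w) = 0 := by rw [hs, map_add, h1.2, h2.2, add_zero]
  refine ⟨hX, hY, fun α => ?_⟩
  have h3 := h.pullback_vertical hr a b α
  have h4 := h.pullback_eq_zero hr (isContactVector_vertical r w) α
  rw [pullback, h1.1, h1.2] at h3
  rw [pullback, h2.1, h2.2] at h4
  rw [hs, map_add]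
  linarith

end TwoVariables

end IsContactMap

end

/-! ### Behaviour of the characteristics under contact maps. -/

section

open Jet1 Jet2

namespace IsContactMap

variable {B : Set (Jet2 2)} {X Y : Jet2 2 → ℝ} {u ux uy uxx uxy uyy : Fin 2 → Jet2 2 → ℝ}
  (h : IsContactMap B X Y u ux uy uxx uxy uyy)
include h

/-- Cartan's formula one order higher, for `∂/∂(u_xx, u_xy, u_yy)` and `D_x`. The bracket is a
first-order vertical vector, on which `dX` and `dY` vanish. -/
theorem second_order_fieldX {r : Jet2 2} (hr : r ∈ B)
    (w : (Fin 2 → ℝ) × (Fin 2 → ℝ) × (Fin 2 → ℝ)) (α : Fin 2) :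
    fderiv ℝ (uxx α) r (0, w) * fderiv ℝ X r (fieldX r) +
      fderiv ℝ (uxy α) r (0, w) * fderiv ℝ Y r (fieldX r) =
    fderiv ℝ (ux α) r ((0, 0, 0, w.1, w.2.1), 0) := by
  have key := cartan_of_vanishing (h.smooth_ux α) h.smooth_x h.smooth_y (h.smooth_uxx α)
    (h.smooth_uxy α) h.isOpen hasFDerivAt_fieldX (Z₂ := fun _ => (0, w)) (L₂ := 0)
    (fun _ => hasFDerivAt_const _ _)
    (fun r hr => h.contact_ux r hr _ (isContactVector_fieldX r) α)
    (fun r hr => h.contact_ux r hr _ (isContactVector_vertical r w) α) hr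
  have hL : fieldXL ((0, w) : Jet2 2) = ((0, 0, 0, w.1, w.2.1), 0) := rfl
  have h1 := h.fderiv_base_second hr w
  have h2 := h.fderiv_base_first hr w.1 w.2.1
  simp only [_root_.zero_apply, sub_zero, hL, h1.1, h1.2, h2.1, h2.2, mul_zero] at key
  exact key

theorem second_order_fieldY {r : Jet2 2} (hr : r ∈ B)
    (w : (Fin 2 → ℝ) × (Fin 2 → ℝ) × (Fin 2 → ℝ)) (α : Fin 2) :
    fderiv ℝ (uxx α) r (0, w) * fderiv ℝ X r (fieldY r) +
      fderiv ℝ (uxy α) r (0, w) * fderiv ℝ Y r (fieldY r) =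
    fderiv ℝ (ux α) r ((0, 0, 0, w.2.1, w.2.2), 0) := by
  have key := cartan_of_vanishing (h.smooth_ux α) h.smooth_x h.smooth_y (h.smooth_uxx α)
    (h.smooth_uxy α) h.isOpen hasFDerivAt_fieldY (Z₂ := fun _ => (0, w)) (L₂ := 0)
    (fun _ => hasFDerivAt_const _ _)
    (fun r hr => h.contact_ux r hr _ (isContactVector_fieldY r) α)
    (fun r hr => h.contact_ux r hr _ (isContactVector_vertical r w) α) hr
  have hL : fieldYL ((0, w) : Jet2 2) = ((0, 0, 0, w.2.1, w.2.2), 0) := rfl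
  have h1 := h.fderiv_base_second hr w
  have h2 := h.fderiv_base_first hr w.2.1 w.2.2
  simp only [_root_.zero_apply, sub_zero, hL, h1.1, h1.2, h2.1, h2.2, mul_zero] at key
  exact key

/-- Where the transformed mixed derivatives do not depend on `u_xx` and `u_yy`, the characteristic
directions are preserved or interchanged. -/
theorem characteristic_dichotomy {r : Jet2 2} (hr : r ∈ B)
    (hxx : ∀ α a, fderiv ℝ (uxy α) r (0, a, 0, 0) = 0)
    (hyy : ∀ α a, fderiv ℝ (uxy α) r (0, 0, 0, a) = 0) :
    (fderiv ℝ X r (fieldX r) ≠ 0 ∧ fderiv ℝ Y r (fieldY r) ≠ 0 ∧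
      fderiv ℝ Y r (fieldX r) = 0 ∧ fderiv ℝ X r (fieldY r) = 0) ∨
    (fderiv ℝ X r (fieldX r) = 0 ∧ fderiv ℝ Y r (fieldY r) = 0 ∧
      fderiv ℝ Y r (fieldX r) ≠ 0 ∧ fderiv ℝ X r (fieldY r) ≠ 0) := by
  obtain ⟨α, γ, hA⟩ : ∃ α γ, frame X Y u ux uy r α γ ≠ 0 := by
    by_contra! hcon
    apply h.frame_det_ne_zero hr
    simp [Matrix.det_fin_two, hcon]
  have hAe : ∀ e : Fin 2 → ℝ, e = Pi.single γ 1 → pullback X Y u ux uy α r ((0, 0, e, 0, 0), 0) =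
      frame X Y u ux uy r α γ := fun e he => by rw [he]; rfl
  have h0 : pullback X Y u ux uy α r ((0, 0, 0, 0, 0), 0) = 0 := h.pullback_vertical hr 0 0 α
  have hz : fderiv ℝ (ux α) r ((0, 0, 0, 0, 0), 0) = 0 := map_zero _
  have c1 := h.curvature_vertical_fieldX hr (Pi.single γ 1) 0 α
  have c2 := h.curvature_vertical_fieldY hr (Pi.single γ 1) 0 α
  have c3 := h.curvature_vertical_fieldX hr 0 (Pi.single γ 1) α
  have c4 := h.curvature_vertical_fieldY hr 0 (Pi.single γ 1) α
  rw [hAe _ rfl] at c1 c4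
  rw [h0] at c2 c3
  have b1 := h.fderiv_base_first hr (Pi.single γ 1) 0
  have b2 := h.fderiv_base_first hr 0 (Pi.single γ 1)
  simp only [curvature, b1.1, b1.2, b2.1, b2.2, mul_zero, sub_zero] at c1 c2 c3 c4
  -- With the mixed derivatives insensitive to `u_xx` and `u_yy`, these four relations become `V₁ a
  -- = P`, `V₁ c = 0`, `V₂ a = 0`, `V₂ c = R` in the names introduced below. Together with the
  -- first-order relations `c1` to `c4` they decouple the two characteristic directions.
  have d1 := h.second_order_fieldX hr (Pi.single γ 1, 0, 0) α
  have d2 := h.second_order_fieldY hr (Pi.single γ 1, 0, 0) α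
  have d3 := h.second_order_fieldX hr (0, 0, Pi.single γ 1) α
  have d4 := h.second_order_fieldY hr (0, 0, Pi.single γ 1) α
  simp only [hxx, hyy, zero_mul, add_zero, hz] at d1 d2 d3 d4
  generalize fderiv ℝ X r (fieldX r) = a at *
  generalize fderiv ℝ X r (fieldY r) = c at *
  generalize fderiv ℝ Y r (fieldX r) = b at *
  generalize fderiv ℝ Y r (fieldY r) = d at *
  generalize fderiv ℝ (ux α) r ((0, 0, 0, Pi.single γ 1, 0), 0) = P at *
  generalize fderiv ℝ (uy α) r ((0, 0, 0, Pi.single γ 1, 0), 0) = Q at *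
  generalize fderiv ℝ (ux α) r ((0, 0, 0, 0, Pi.single γ 1), 0) = R at *
  generalize fderiv ℝ (uy α) r ((0, 0, 0, 0, Pi.single γ 1), 0) = S at *
  generalize fderiv ℝ (uxx α) r (0, Pi.single γ 1, 0, 0) = V₁ at *
  generalize fderiv ℝ (uxx α) r (0, 0, 0, Pi.single γ 1) = V₂ at *
  by_cases ha : a = 0
  · right
    subst ha
    rw [mul_zero] at d1
    subst d1
    rw [zero_mul, zero_add] at c1 c2
    rw [mul_zero, zero_add] at c3
    have hQb : Q * b ≠ 0 := by rwa [c1]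
    have hQ := left_ne_zero_of_mul hQb
    have hb := right_ne_zero_of_mul hQb
    have hd : d = 0 := (mul_eq_zero.1 c2).resolve_left hQ
    rw [hd, mul_zero, add_zero] at c4
    have hRc : R * c ≠ 0 := by rwa [c4]
    exact ⟨rfl, hd, hb, right_ne_zero_of_mul hRc⟩
  · left
    have hV₂ : V₂ = 0 := (mul_eq_zero.1 d3).resolve_right ha
    rw [hV₂, zero_mul] at d4
    subst d4
    rw [zero_mul, zero_add] at c3 c4
    have hSd : S * d ≠ 0 := by rwa [c4]
    have hb : b = 0 := (mul_eq_zero.1 c3).resolve_left (left_ne_zero_of_mul hSd)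
    rw [hb, mul_zero, add_zero] at c1
    have hPa : P * a ≠ 0 := by rwa [c1]
    have hV₁ : V₁ ≠ 0 := fun h0 => left_ne_zero_of_mul hPa (by rw [← d1, h0, zero_mul])
    exact ⟨ha, right_ne_zero_of_mul hSd, hb, (mul_eq_zero.1 d2).resolve_left hV₁⟩

end IsContactMap

/-- The section of `J² → J⁰` with the same derivatives as `q`. -/
def Jet0.lift2 {m : ℕ} (q : Jet2 m) (z : Jet0 m) : Jet2 m := (Jet0.lift q.1 z, q.2)

theorem Jet0.contDiff_lift2 {m : ℕ} (q : Jet2 m) : ContDiff ℝ ∞ (Jet0.lift2 q) :=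
  (Jet0.contDiff_lift q.1).prodMk contDiff_const

theorem eqOn_lift2 {m : ℕ} {f : Jet2 m → ℝ} (hf : ContDiff ℝ ∞ f) {q : Jet2 m} {ρ : ℝ}
    (h0 : ∀ r ∈ ball q ρ, ∀ a b w, fderiv ℝ f r ((0, 0, 0, a, b), w) = 0) :
    EqOn f (fun r => f (Jet0.lift2 q r.toJet1.toJet0)) (ball q ρ) := by
  intro r hr
  have hr' : Jet0.lift2 q r.toJet1.toJet0 ∈ ball q ρ := by
    rw [mem_ball, Prod.dist_eq, max_lt_iff] at hr ⊢
    exact ⟨Jet0.lift_mem_ball (Jet1.toJet0_mem_ball hr.1), by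
      simpa [Jet0.lift2] using dist_nonneg.trans_lt hr.1⟩
  refine (eq_of_fderiv_sub_eq_zero (convex_ball q ρ) hr' hr
    (fun x _ => (hf.hasFDerivAt_of_smooth x).differentiableAt) fun x hx => ?_).symm
  have : r - Jet0.lift2 q r.toJet1.toJet0 =
      ((0, 0, 0, r.ux - q.ux, r.uy - q.uy), r.2 - q.2) :=
    Prod.ext (Prod.ext (sub_self _) (Prod.ext (sub_self _) (Prod.ext (sub_self _) rfl))) rfl
  rw [this]
  exact h0 x hx _ _ _

theorem fderiv_eq_of_eqOn_lift2 {m : ℕ} {f : Jet2 m → ℝ} (hf : ContDiff ℝ ∞ f) {q : Jet2 m} {ρ : ℝ}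
    (h : EqOn f (fun r => f (Jet0.lift2 q r.toJet1.toJet0)) (ball q ρ)) {r : Jet2 m}
    (hr : r ∈ ball q ρ) (v : Jet2 m) :
    fderiv ℝ f r v = fderiv ℝ (fun z => f (Jet0.lift2 q z)) r.toJet1.toJet0 v.toJet1.toJet0 := by
  have h1 : HasFDerivAt (fun r : Jet2 m => f (Jet0.lift2 q r.toJet1.toJet0))
      ((fderiv ℝ (fun z => f (Jet0.lift2 q z)) r.toJet1.toJet0).comp (Jet1.toJet0.comp dJet1)) r :=
    ((hf.comp (Jet0.contDiff_lift2 q)).hasFDerivAt_of_smooth _).comp r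
      (Jet1.toJet0.comp dJet1).hasFDerivAt
  rw [h.fderiv_eq_of_isOpen isOpen_ball hr, h1.fderiv]
  rfl

/-- `D_y X` is affine in the free variables `u_y`, with coefficients `∂X/∂u^β`. -/
theorem partialU_eq_zero_of_totalY_eq_zero {m : ℕ} {X : Jet0 m → ℝ} (hX : ContDiff ℝ ∞ X)
    {p : Jet1 m} {s : ℝ} (h : ∀ p' ∈ ball p s, Jet1.totalY X p' = 0) :
    ∀ z ∈ ball p.toJet0 s, ∀ β, Jet0.partialU X β z = 0 := by
  intro z hz β
  have := fderiv_eq_zero_of_eqOn_zero isOpen_ball h (Jet0.lift_mem_ball hz)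
  exact (Jet1.fderiv_totalY_vertical hX (Jet0.lift p z) 0 _).symm.trans (by rw [this]; rfl)

theorem partialU_eq_zero_of_totalX_eq_zero {m : ℕ} {X : Jet0 m → ℝ} (hX : ContDiff ℝ ∞ X)
    {p : Jet1 m} {s : ℝ} (h : ∀ p' ∈ ball p s, Jet1.totalX X p' = 0) :
    ∀ z ∈ ball p.toJet0 s, ∀ β, Jet0.partialU X β z = 0 := by
  intro z hz β
  have := fderiv_eq_zero_of_eqOn_zero isOpen_ball h (Jet0.lift_mem_ball hz)
  exact (Jet1.fderiv_totalX_vertical hX (Jet0.lift p z) _ 0).symm.trans (by rw [this]; rfl)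

/-- The normalized right-hand side for a transformation which preserves the characteristics. -/
theorem totalXY_eq_of_characteristic {m : ℕ} {X Y φ : Jet0 m → ℝ} (hX : ContDiff ℝ ∞ X)
    (hY : ContDiff ℝ ∞ Y) (hφ : ContDiff ℝ ∞ φ) {p : Jet1 m} {s : ℝ}
    (hYX : ∀ p' ∈ ball p s, Jet1.totalX Y p' = 0) (hXY : ∀ p' ∈ ball p s, Jet1.totalY X p' = 0)
    {v w : Jet2 m → ℝ} (hv : ContDiff ℝ ∞ v) {V : Set (Jet2 m)} (hV : IsOpen V)
    (hVp : ∀ r ∈ V, r.toJet1 ∈ ball p s)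
    (h1 : ∀ r ∈ V, Jet1.totalY φ r.toJet1 = v r * Jet1.totalY Y r.toJet1)
    (h2 : ∀ r ∈ V, fderiv ℝ v r (fieldX r) = w r * Jet1.totalX X r.toJet1) {r : Jet2 m} (hr : r ∈ V) :
    Jet1.totalXY φ r.toJet1 + ∑ β, Jet0.partialU φ β r.toJet1.toJet0 * r.uxy β =
      fderiv ℝ X r.toJet1.toJet0 (1, 0, 0) * fderiv ℝ Y r.toJet1.toJet0 (0, 1, 0) * w r := by
  have hz := Jet1.toJet0_mem_ball (hVp r hr)
  have hXe : Jet1.totalX X r.toJet1 = fderiv ℝ X r.toJet1.toJet0 (1, 0, 0) := by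
    have : ((1, 0, r.toJet1.ux) : Jet0 m) = (1, 0, 0) + (0, 0, r.toJet1.ux) := by simp
    rw [Jet1.totalX, this, map_add, Jet0.fderiv_vertical]
    simp [-Jet1.toJet0_apply, partialU_eq_zero_of_totalY_eq_zero hX hXY _ hz]
  have hYe : Jet1.totalY Y r.toJet1 = fderiv ℝ Y r.toJet1.toJet0 (0, 1, 0) := by
    have : ((0, 1, r.toJet1.uy) : Jet0 m) = (0, 1, 0) + (0, 0, r.toJet1.uy) := by simp
    rw [Jet1.totalY, this, map_add, Jet0.fderiv_vertical]
    simp [-Jet1.toJet0_apply, partialU_eq_zero_of_totalX_eq_zero hY hYX _ hz]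
  have hd : ∀ {f : Jet1 m → ℝ}, ContDiff ℝ ∞ f →
      HasFDerivAt (fun r : Jet2 m => f r.toJet1) ((fderiv ℝ f r.toJet1).comp dJet1) r := fun hf =>
    (hf.hasFDerivAt_of_smooth _).comp r dJet1.hasFDerivAt
  have e : EqOn (fun r : Jet2 m => Jet1.totalY φ r.toJet1)
      (fun r => v r * Jet1.totalY Y r.toJet1) V := h1
  -- Differentiate `D_y φ = v D_y Y` along `D_x`. The factor `D_y Y` contributes nothing, because
  -- `D_x D_y Y = D_y D_x Y = 0`.
  have e1 := DFunLike.congr_fun (e.fderiv_eq_of_isOpen hV hr) (fieldX r)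
  rw [(hd (Jet1.contDiff_totalY hφ)).fderiv,
    ((hv.hasFDerivAt_of_smooth r).fun_mul (hd (Jet1.contDiff_totalY hY))).fderiv] at e1
  have e2 : Jet2.totalX (Jet1.totalY Y) r = 0 := by
    rw [← Jet2.totalY_totalX hY, Jet2.totalY,
      fderiv_eq_zero_of_eqOn_zero isOpen_ball hYX (hVp r hr)]
    rfl
  rw [← Jet2.totalX_totalY hφ, ← hXe, ← hYe]
  change Jet2.totalX (Jet1.totalY φ) r = v r * Jet2.totalX (Jet1.totalY Y) r +
    Jet1.totalY Y r.toJet1 * fderiv ℝ v r (fieldX r) at e1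
  rw [e1, e2, h2 r hr]
  ring

/-- The Jacobian matrix of a right-hand side which is transformed by a change of the independent
variables. -/
theorem jacobianU_mul_comp {m : ℕ} {J X Y : Jet0 m → ℝ} {φ g : Fin m → Jet0 m → ℝ}
    (hJ : ContDiff ℝ ∞ J) (hX : ContDiff ℝ ∞ X) (hY : ContDiff ℝ ∞ Y)
    (hφ : ∀ α, ContDiff ℝ ∞ (φ α)) (hg : ∀ α, ContDiff ℝ ∞ (g α)) {z : Jet0 m}
    (hJ0 : ∀ β, Jet0.partialU J β z = 0) (hX0 : ∀ β, Jet0.partialU X β z = 0)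
    (hY0 : ∀ β, Jet0.partialU Y β z = 0) :
    jacobianU (fun α z => J z * g α (X z, Y z, fun β => φ β z)) z =
      J z • (jacobianU g (X z, Y z, fun β => φ β z) * jacobianU φ z) := by
  ext α γ
  have h1 : HasFDerivAt (fun z => (X z, Y z, fun β => φ β z)) _ z :=
    (hX.hasFDerivAt_of_smooth z).prodMk ((hY.hasFDerivAt_of_smooth z).prodMk
      (hasFDerivAt_pi.2 fun β => (hφ β).hasFDerivAt_of_smooth z))
  have h2 : HasFDerivAt (fun z => J z * g α (X z, Y z, fun β => φ β z)) _ z :=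
    (hJ.hasFDerivAt_of_smooth z).fun_mul (((hg α).hasFDerivAt_of_smooth _).comp z h1)
  have hv : ∀ {f : Jet0 m → ℝ}, (∀ β, Jet0.partialU f β z = 0) →
      fderiv ℝ f z (0, 0, Pi.single γ 1) = 0 := fun hf => hf γ
  have h3 : fderiv ℝ (g α) (X z, Y z, fun β => φ β z)
      (0, 0, fun β => fderiv ℝ (φ β) z (0, 0, Pi.single γ 1)) =
      ∑ β, jacobianU g (X z, Y z, fun β => φ β z) α β * jacobianU φ z β γ :=
    Jet0.fderiv_vertical _ _ _
  rw [Matrix.smul_apply, Matrix.mul_apply, ← h3, jacobianU, Matrix.of_apply, Jet0.partialU, h2.fderiv]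
  simp only [_root_.add_apply, _root_.smul_apply, hv hJ0, smul_zero, add_zero,
    ContinuousLinearMap.comp_apply, ContinuousLinearMap.prod_apply, hv hX0, hv hY0]
  rfl

end

/-! ### A contact map normalizes the source system. -/

section

open Jet1 Jet2

/-- `X₁`, `Y₁` supply the factor in front of `g` and may be `X`, `Y` in either order, which covers
interchanged characteristics. As nothing but `φ` depends on `u`, the matrix `Pᵀ C ∂n/∂u` is a
multiple of a congruence transform of `C ∂g/∂u`. -/
theorem exists_normalizesAt_of_totalXY_eq {m : ℕ} {F : Jet1 m → Fin m → ℝ} {p : Jet1 m} {s : ℝ}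
    (hs : 0 < s) {X Y X₁ Y₁ : Jet0 m → ℝ} {φ g : Fin m → Jet0 m → ℝ} (hX : ContDiff ℝ ∞ X)
    (hY : ContDiff ℝ ∞ Y) (hX₁ : ContDiff ℝ ∞ X₁) (hY₁ : ContDiff ℝ ∞ Y₁)
    (hφ : ∀ α, ContDiff ℝ ∞ (φ α)) (hg : ∀ α, ContDiff ℝ ∞ (g α))
    (hX0 : ∀ z ∈ ball p.toJet0 s, ∀ β, Jet0.partialU X β z = 0)
    (hY0 : ∀ z ∈ ball p.toJet0 s, ∀ β, Jet0.partialU Y β z = 0)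
    (hX₁0 : ∀ z ∈ ball p.toJet0 s, ∀ β, Jet0.partialU X₁ β z = 0)
    (hY₁0 : ∀ z ∈ ball p.toJet0 s, ∀ β, Jet0.partialU Y₁ β z = 0)
    (hdet : ∀ p' ∈ ball p s, (jacobianU φ p'.toJet0).det ≠ 0)
    (htot : ∀ p' ∈ ball p s, ∀ α, Jet1.totalXY (φ α) p' +
      ∑ β, Jet0.partialU (φ α) β p'.toJet0 * F p' β = fderiv ℝ X₁ p'.toJet0 (1, 0, 0) *
        fderiv ℝ Y₁ p'.toJet0 (0, 1, 0) *
        g α (X p'.toJet0, Y p'.toJet0, fun β => φ β p'.toJet0)) :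
    ∃ n, NormalizesAt F p s φ n ∧ ∀ C : Matrix (Fin m) (Fin m) ℝ, (∀ z ∈ ball p.toJet0 s,
      (C * jacobianU g (X z, Y z, fun β => φ β z)).IsSymm) → IsPotentialForm φ n p.toJet0 s C := by
  have hJ₁ := hX₁.fderiv_apply_smooth (1, 0, 0)
  have hJ₂ := hY₁.fderiv_apply_smooth (0, 1, 0)
  have hn : ∀ α, ContDiff ℝ ∞ fun z => fderiv ℝ X₁ z (1, 0, 0) * fderiv ℝ Y₁ z (0, 1, 0) *
      g α (X z, Y z, fun β => φ β z) := fun α =>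
    (hJ₁.mul hJ₂).mul ((hg α).comp (hX.prodMk (hY.prodMk (contDiff_pi.2 hφ))))
  have hzero : ∀ {f : Jet0 m → ℝ}, ContDiff ℝ ∞ f →
      (∀ z ∈ ball p.toJet0 s, ∀ β, Jet0.partialU f β z = 0) → ∀ v, ∀ z ∈ ball p.toJet0 s, ∀ β,
      fderiv ℝ (fun z => fderiv ℝ f z v) z (0, 0, Pi.single β 1) = 0 := fun hf h0 v z hz β => by
    rw [hf.fderiv_apply_comm]
    exact DFunLike.congr_fun (fderiv_eq_zero_of_eqOn_zero isOpen_ball (fun z hz => h0 z hz β) hz) v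
  refine ⟨_, ⟨hs, hφ, hn, hdet, htot⟩, fun C hC => ?_⟩
  refine (isPotentialForm_iff_isSymm hφ hn).2 fun z hz => ?_
  rw [jacobianU_mul_comp (hJ₁.mul hJ₂) hX hY hφ hg (fun β => ?_) (hX0 z hz) (hY0 z hz)]
  · rw [Matrix.mul_smul]
    refine Matrix.IsSymm.smul ?_ _
    have h1 := hC z hz
    set A := jacobianU φ z
    set D := jacobianU g (X z, Y z, fun β => φ β z)
    have h2 : A.transpose * C * (D * A) = A.transpose * (C * D) * A := by
      simp only [Matrix.mul_assoc]
    rw [h2, Matrix.IsSymm, Matrix.transpose_mul, Matrix.transpose_mul, h1.eq,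
      Matrix.transpose_transpose]
    simp only [Matrix.mul_assoc]
  · rw [Jet0.partialU, fderiv_mul_apply hJ₁ hJ₂, hzero hX₁ hX₁0 _ z hz, hzero hY₁ hY₁0 _ z hz]
    ring

/-- A contact transformation which maps solutions of `u_xy = F` to solutions of a system without
first derivatives normalizes the system. -/
theorem IsContactMap.exists_normalizesAt {q : Jet2 2} {ρ : ℝ} (hρ : 0 < ρ) {X Y : Jet2 2 → ℝ}
    {u ux uy uxx uxy uyy : Fin 2 → Jet2 2 → ℝ}
    (h : IsContactMap (ball q ρ) X Y u ux uy uxx uxy uyy) {F : Jet1 2 → Fin 2 → ℝ}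
    (hF : ContinuousAt F q.toJet1) (hq : q.uxy = F q.toJet1) {g : Fin 2 → Jet0 2 → ℝ}
    (hg : ∀ α, ContDiff ℝ ∞ (g α))
    (hrhs : ∀ r ∈ ball q ρ, r.uxy = F r.toJet1 → ∀ α, uxy α r = g α (X r, Y r, fun β => u β r)) :
    ∃ φ n s, s ≤ ρ ∧ NormalizesAt F q.toJet1 s φ n ∧ ∀ C : Matrix (Fin 2) (Fin 2) ℝ,
      (∀ r ∈ ball q ρ, (C * jacobianU g (X r, Y r, fun β => u β r)).IsSymm) →
      IsPotentialForm φ n q.toJet1.toJet0 s C := by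
  set X₀ : Jet0 2 → ℝ := fun z => X (Jet0.lift2 q z) with hX₀
  set Y₀ : Jet0 2 → ℝ := fun z => Y (Jet0.lift2 q z) with hY₀
  set φ : Fin 2 → Jet0 2 → ℝ := fun α z => u α (Jet0.lift2 q z) with hφ
  have hlift := Jet0.contDiff_lift2 q
  have sX : ContDiff ℝ ∞ X₀ := h.smooth_x.comp hlift
  have sY : ContDiff ℝ ∞ Y₀ := h.smooth_y.comp hlift
  have sφ : ∀ α, ContDiff ℝ ∞ (φ α) := fun α => (h.smooth_u α).comp hlift
  have eX := eqOn_lift2 h.smooth_x fun r hr a b w => (h.fderiv_vertical hr a b w).1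
  have eY := eqOn_lift2 h.smooth_y fun r hr a b w => (h.fderiv_vertical hr a b w).2.1
  have eu := fun α => eqOn_lift2 (h.smooth_u α) fun r hr a b w => (h.fderiv_vertical hr a b w).2.2 α
  have dX : ∀ {r}, r ∈ ball q ρ → ∀ v, fderiv ℝ X r v = fderiv ℝ X₀ r.toJet1.toJet0 v.toJet1.toJet0 :=
    fun hr => fderiv_eq_of_eqOn_lift2 h.smooth_x eX hr
  have dY : ∀ {r}, r ∈ ball q ρ → ∀ v, fderiv ℝ Y r v = fderiv ℝ Y₀ r.toJet1.toJet0 v.toJet1.toJet0 :=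
    fun hr => fderiv_eq_of_eqOn_lift2 h.smooth_y eY hr
  have du : ∀ {r}, r ∈ ball q ρ → ∀ α v,
      fderiv ℝ (u α) r v = fderiv ℝ (φ α) r.toJet1.toJet0 v.toJet1.toJet0 :=
    fun hr α => fderiv_eq_of_eqOn_lift2 (h.smooth_u α) (eu α) hr
  have hval : ∀ {r}, r ∈ ball q ρ → (X r, Y r, fun β => u β r) =
      (X₀ r.toJet1.toJet0, Y₀ r.toJet1.toJet0, fun β => φ β r.toJet1.toJet0) := fun {r} hr => by
    refine Prod.ext (eX hr) (Prod.ext (eY hr) (funext fun β => eu β hr))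
  -- A section of `J² → J¹` with values in the equation manifold and passing through `q`. Continuity
  -- of `F` keeps it in the ball.
  let σ : Jet1 2 → Jet2 2 := fun p => (p, q.uxx, F p, q.uyy)
  obtain ⟨s₁, hs₁, hs₁F⟩ := Metric.mem_nhds_iff.1 (hF (Metric.ball_mem_nhds _ hρ))
  have hσ : ∀ p ∈ ball q.toJet1 (min s₁ ρ), σ p ∈ ball q ρ := by
    intro p hp
    have h1 : dist (F p) (F q.toJet1) < ρ := hs₁F (ball_subset_ball (min_le_left _ _) hp)
    have h2 : dist p q.toJet1 < ρ := ball_subset_ball (min_le_right _ _) hp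
    rw [← hq] at h1
    simp only [mem_ball, Prod.dist_eq (x := σ p), Prod.dist_eq (x := (σ p).2),
      Prod.dist_eq (x := (σ p).2.2), max_lt_iff]
    exact ⟨h2, by simpa [σ, Jet2.uxx] using hρ, h1, by simpa [σ, Jet2.uyy] using hρ⟩
  -- Moving `u_xx` and `u_yy` stays on the equation manifold, where the transformed `u_xy` equals
  -- `g(X, Y, u)`, a function on `J⁰`. So it is constant along such lines.
  have hshell : ∀ p ∈ ball q.toJet1 (min s₁ ρ), ∀ α a c,
      fderiv ℝ (uxy α) (σ p) (0, a, 0, c) = 0 := by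
    intro p hp α a c
    have hline := ((h.smooth_uxy α).hasFDerivAt_of_smooth (σ p)).hasLineDerivAt
      ((0, a, 0, c) : Jet2 2)
    have hcont : ContinuousAt (fun t : ℝ => σ p + t • ((0, a, 0, c) : Jet2 2)) 0 := by fun_prop
    have hconst : (fun t : ℝ => uxy α (σ p + t • ((0, a, 0, c) : Jet2 2))) =ᶠ[𝓝 0]
        fun _ => g α (X₀ p.toJet0, Y₀ p.toJet0, fun β => φ β p.toJet0) := by
      filter_upwards [hcont (isOpen_ball.mem_nhds (x := σ p + (0 : ℝ) • ((0, a, 0, c) : Jet2 2))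
        (by rw [zero_smul, add_zero]; exact hσ p hp))] with t ht
      have e1 : (σ p + t • ((0, a, 0, c) : Jet2 2)).toJet1 = p := by simp [σ, Jet2.toJet1]
      have e2 : (σ p + t • ((0, a, 0, c) : Jet2 2)).uxy = F p := by simp [σ, Jet2.uxy]
      rw [hrhs _ ht (by rw [e1, e2]), hval ht, e1]
    exact hline.unique ((hasDerivAt_const _ _).congr_of_eventuallyEq hconst)
  have hdich : ∀ p ∈ ball q.toJet1 (min s₁ ρ),
      (Jet1.totalX X₀ p ≠ 0 ∧ Jet1.totalY Y₀ p ≠ 0 ∧ Jet1.totalX Y₀ p = 0 ∧ Jet1.totalY X₀ p = 0) ∨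
      (Jet1.totalX X₀ p = 0 ∧ Jet1.totalY Y₀ p = 0 ∧ Jet1.totalX Y₀ p ≠ 0 ∧
        Jet1.totalY X₀ p ≠ 0) := by
    intro p hp
    have := h.characteristic_dichotomy (hσ p hp) (fun α a => hshell p hp α a 0)
      (fun α a => hshell p hp α 0 a)
    rw [dX (hσ p hp), dX (hσ p hp), dY (hσ p hp), dY (hσ p hp)] at this
    exact this
  have hs₀ : 0 < min s₁ ρ := lt_min hs₁ hρ
  -- When `X` and `Y` do not depend on `u`, the invertible frame of the contact map is the Jacobian
  -- matrix of `φ`.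
  have hdet : (∀ z ∈ ball q.toJet1.toJet0 (min s₁ ρ), (∀ β, Jet0.partialU X₀ β z = 0) →
      (∀ β, Jet0.partialU Y₀ β z = 0) → (jacobianU φ z).det ≠ 0) := by
    intro z hz hXz hYz
    have hr := hσ _ (Jet0.lift_mem_ball hz)
    convert h.frame_det_ne_zero hr using 2
    ext α γ
    have e1 : fderiv ℝ (u α) (σ (Jet0.lift q.toJet1 z)) (dirU γ, 0) = Jet0.partialU (φ α) γ z :=
      du hr α _
    have e2 : fderiv ℝ X (σ (Jet0.lift q.toJet1 z)) (dirU γ, 0) = 0 := (dX hr _).trans (hXz γ)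
    have e3 : fderiv ℝ Y (σ (Jet0.lift q.toJet1 z)) (dirU γ, 0) = 0 := (dY hr _).trans (hYz γ)
    rw [frame, Matrix.of_apply, pullback, e1, e2, e3]
    simp [jacobianU]
  have hsmall : ∀ {f : Jet1 2 → ℝ}, ContDiff ℝ ∞ f → f q.toJet1 ≠ 0 →
      ∃ s > 0, s ≤ min s₁ ρ ∧ ∀ p ∈ ball q.toJet1 s, f p ≠ 0 := by
    intro f hf h0
    obtain ⟨s, hs, hsf⟩ := Metric.mem_nhds_iff.1 (hf.continuous.continuousAt.eventually_ne h0)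
    exact ⟨min s (min s₁ ρ), lt_min hs hs₀, min_le_right _ _, fun p hp =>
      hsf (ball_subset_ball (min_le_left _ _) hp)⟩
  have hVo : ∀ s, IsOpen (ball q ρ ∩ Jet2.toJet1 ⁻¹' ball q.toJet1 s) := fun s =>
    isOpen_ball.inter (isOpen_ball.preimage toJet1_contDiff.continuous)
  -- Common end of both cases: `v` stands for the transformed `u_y` if the characteristics are
  -- preserved, and for the transformed `u_x` if they are interchanged.
  have hfin : ∀ {s : ℝ} {X₁ Y₁ : Jet0 2 → ℝ} {v : Fin 2 → Jet2 2 → ℝ}, 0 < s → s ≤ min s₁ ρ →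
      ContDiff ℝ ∞ X₁ → ContDiff ℝ ∞ Y₁ → (∀ α, ContDiff ℝ ∞ (v α)) →
      (∀ z ∈ ball q.toJet1.toJet0 s, ∀ β, Jet0.partialU X₀ β z = 0) →
      (∀ z ∈ ball q.toJet1.toJet0 s, ∀ β, Jet0.partialU Y₀ β z = 0) →
      (∀ p ∈ ball q.toJet1 s, Jet1.totalX Y₁ p = 0) → (∀ p ∈ ball q.toJet1 s, Jet1.totalY X₁ p = 0) →
      (∀ r ∈ ball q ρ ∩ Jet2.toJet1 ⁻¹' ball q.toJet1 s, ∀ α,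
        fderiv ℝ (u α) r (fieldY r) = v α r * Jet1.totalY Y₁ r.toJet1) →
      (∀ r ∈ ball q ρ ∩ Jet2.toJet1 ⁻¹' ball q.toJet1 s, ∀ α,
        fderiv ℝ (v α) r (fieldX r) = uxy α r * Jet1.totalX X₁ r.toJet1) →
      ∃ n, NormalizesAt F q.toJet1 s φ n ∧ ∀ C : Matrix (Fin 2) (Fin 2) ℝ,
        (∀ r ∈ ball q ρ, (C * jacobianU g (X r, Y r, fun β => u β r)).IsSymm) →
        IsPotentialForm φ n q.toJet1.toJet0 s C := by
    intro s X₁ Y₁ v hs hss sX₁ sY₁ sv hX0 hY0 hYX hXY hv hw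
    have hsub := ball_subset_ball (x := q.toJet1.toJet0) hss
    obtain ⟨n, hn, hpot⟩ := exists_normalizesAt_of_totalXY_eq (F := F) (p := q.toJet1) hs sX sY sX₁
      sY₁ sφ hg hX0 hY0 (partialU_eq_zero_of_totalY_eq_zero sX₁ hXY)
      (partialU_eq_zero_of_totalX_eq_zero sY₁ hYX)
      (fun p hp => hdet _ (hsub (Jet1.toJet0_mem_ball hp)) (hX0 _ (Jet1.toJet0_mem_ball hp))
        (hY0 _ (Jet1.toJet0_mem_ball hp))) (fun p hp α => by
        have hr := hσ p (ball_subset_ball hss hp)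
        have key := totalXY_eq_of_characteristic sX₁ sY₁ (sφ α) hYX hXY (sv α) (hVo s)
          (fun r hr => hr.2) (fun r hr => (du hr.1 α (fieldY r)).symm.trans (hv r hr α))
          (fun r hr => hw r hr α) (r := σ p) ⟨hr, hp⟩
        rw [hrhs _ hr rfl, hval hr] at key
        exact key)
    refine ⟨n, hn, fun C hC => hpot C fun z hz => ?_⟩
    have hr := hσ _ (Jet0.lift_mem_ball (hsub hz))
    have := hC _ hr
    rw [hval hr] at this
    exact this
  -- The alternative that holds at `q` persists nearby, because each is excluded where a function
  -- that vanishes in it is nonzero.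
  rcases hdich q.toJet1 (mem_ball_self hs₀) with ⟨ha, -, -, -⟩ | ⟨-, -, hb, -⟩
  · obtain ⟨s, hs, hss, hsa⟩ := hsmall (Jet1.contDiff_totalX sX) ha
    have hd : ∀ p ∈ ball q.toJet1 s, Jet1.totalX Y₀ p = 0 ∧ Jet1.totalY X₀ p = 0 := fun p hp => by
      rcases hdich p (ball_subset_ball hss hp) with ⟨-, -, h1, h2⟩ | ⟨h1, -⟩
      · exact ⟨h1, h2⟩
      · exact absurd h1 (hsa p hp)
    obtain ⟨n, hn⟩ := hfin hs hss sX sY h.smooth_uy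
      (partialU_eq_zero_of_totalY_eq_zero sX fun p hp => (hd p hp).2)
      (partialU_eq_zero_of_totalX_eq_zero sY fun p hp => (hd p hp).1)
      (fun p hp => (hd p hp).1) (fun p hp => (hd p hp).2)
      (fun r hr α => by
        rw [h.contact_u r hr.1 _ (isContactVector_fieldY r), dX hr.1, dY hr.1]
        change _ * Jet1.totalY X₀ r.toJet1 + _ * Jet1.totalY Y₀ r.toJet1 = _
        rw [(hd _ hr.2).2, mul_zero, zero_add])
      (fun r hr α => by
        rw [h.contact_uy r hr.1 _ (isContactVector_fieldX r), dX hr.1, dY hr.1]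
        change _ * Jet1.totalX X₀ r.toJet1 + _ * Jet1.totalX Y₀ r.toJet1 = _
        rw [(hd _ hr.2).1, mul_zero, add_zero])
    exact ⟨φ, n, s, hss.trans (min_le_right _ _), hn⟩
  · obtain ⟨s, hs, hss, hsb⟩ := hsmall (Jet1.contDiff_totalX sY) hb
    have hd : ∀ p ∈ ball q.toJet1 s, Jet1.totalX X₀ p = 0 ∧ Jet1.totalY Y₀ p = 0 := fun p hp => by
      rcases hdich p (ball_subset_ball hss hp) with ⟨-, -, h1, -⟩ | ⟨h1, h2, -⟩
      · exact absurd h1 (hsb p hp)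
      · exact ⟨h1, h2⟩
    obtain ⟨n, hn⟩ := hfin hs hss sY sX h.smooth_ux
      (partialU_eq_zero_of_totalX_eq_zero sX fun p hp => (hd p hp).1)
      (partialU_eq_zero_of_totalY_eq_zero sY fun p hp => (hd p hp).2)
      (fun p hp => (hd p hp).1) (fun p hp => (hd p hp).2)
      (fun r hr α => by
        rw [h.contact_u r hr.1 _ (isContactVector_fieldY r), dX hr.1, dY hr.1]
        change _ * Jet1.totalY X₀ r.toJet1 + _ * Jet1.totalY Y₀ r.toJet1 = _
        rw [(hd _ hr.2).2, mul_zero, add_zero])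
      (fun r hr α => by
        rw [h.contact_ux r hr.1 _ (isContactVector_fieldX r), dX hr.1, dY hr.1]
        change _ * Jet1.totalX X₀ r.toJet1 + _ * Jet1.totalX Y₀ r.toJet1 = _
        rw [(hd _ hr.2).1, mul_zero, zero_add])
    exact ⟨φ, n, s, hss.trans (min_le_right _ _), hn⟩

end

/-! ### Lagrangians of a system that is contact equivalent to one without first derivatives. -/

section

open Jet1 Jet2

/-- A system which is contact equivalent to a system `u_xy = g(x, y, u)` has a Lagrangian for each
symmetric constant matrix which makes `g` a gradient. -/
theorem ContactEquivalentAt.admitsLagrangiansAt {U U' : Set (Jet1 2)} {F G : Jet1 2 → Fin 2 → ℝ}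
    {q : Jet2 2} (h : ContactEquivalentAt U F U' G q) (hU : IsOpen U)
    (hF : ∀ α, ContDiffOn ℝ ∞ (fun p => F p α) U) (hq : q.uxy = F q.toJet1) {k : ℕ}
    {C : Fin k → Matrix (Fin 2) (Fin 2) ℝ} (hsymm : ∀ i, (C i).IsSymm) (hdet : ∀ i, (C i).det ≠ 0)
    (hind : LinearIndependent ℝ C)
    (hG : ∀ p₀ ∈ U', ∃ g : Fin 2 → Jet0 2 → ℝ, (∀ α, ContDiff ℝ ∞ (g α)) ∧ ∃ t > 0,
      (∀ p ∈ ball p₀ t, ∀ α, G p α = g α p.toJet0) ∧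
      ∀ z ∈ ball p₀.toJet0 t, ∀ i, (C i * jacobianU g z).IsSymm) :
    AdmitsLagrangiansAt U F k q.toJet1 := by
  obtain ⟨Φ, hqs, hsU, htU', hΦ, hΦ', hpres, Q, -, hQ⟩ := h
  obtain ⟨g, hg, t, ht, hGg, hC⟩ := hG _ (htU' _ (Φ.map_source hqs))
  have hS : IsOpen (Φ.source ∩ Φ ⁻¹' (Jet2.toJet1 ⁻¹' ball (Φ q).toJet1 t)) :=
    Φ.isOpen_inter_preimage (isOpen_ball.preimage toJet1_contDiff.continuous)
  obtain ⟨Ψ, hΨ, ρ, hρ, hsub, heq⟩ := (hΦ.mono inter_subset_left).exists_contDiff_eqOn_ball hS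
    (p := q) ⟨hqs, mem_ball_self ht⟩
  have hd : ∀ r ∈ ball q ρ, fderiv ℝ Φ r = fderiv ℝ Ψ r := fun r hr =>
    ((heq.symm.eventuallyEq_of_mem (isOpen_ball.mem_nhds hr)).fderiv_eq)
  have hcomp : ∀ (ℓ : Jet2 2 →L[ℝ] ℝ) r v, fderiv ℝ (fun r => ℓ (Ψ r)) r v =
      ℓ (fderiv ℝ Ψ r v) := fun ℓ r v => by
    have := ℓ.hasFDerivAt.comp r (hΨ.hasFDerivAt_of_smooth r)
    exact DFunLike.congr_fun this.fderiv v
  have hcont : ∀ r ∈ ball q ρ, ∀ v, IsContactVector r v → ∀ η ∈ contactGenerators 2,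
      η (Ψ r) (fderiv ℝ Ψ r v) = 0 := fun r hr v hv η hη => by
    have := hv.eq_zero_of_mem_contactSpan (hpres r (hsub hr).1 η hη)
    rwa [hd r hr, ← heq hr] at this
  have hmap : IsContactMap (ball q ρ) (fun r => dx (Ψ r)) (fun r => dy (Ψ r))
      (fun α r => du α (Ψ r)) (fun α r => dux α (Ψ r)) (fun α r => duy α (Ψ r))
      (fun α r => (Ψ r).uxx α) (fun α r => (Ψ r).uxy α) (fun α r => (Ψ r).uyy α) := by
    refine ⟨isOpen_ball, dx.contDiff.comp hΨ, dy.contDiff.comp hΨ,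
      fun α => (du α).contDiff.comp hΨ, fun α => (dux α).contDiff.comp hΨ,
      fun α => (duy α).contDiff.comp hΨ, fun α => contDiff_pi.1 (uxxL.contDiff.comp hΨ) α,
      fun α => contDiff_pi.1 (uxyL.contDiff.comp hΨ) α,
      fun α => contDiff_pi.1 (uyyL.contDiff.comp hΨ) α, ?_, ?_, ?_, ?_⟩
    · intro r hr v hv α
      have h1 : du α _ - _ * dx _ - _ * dy _ = 0 := hcont r hr v hv _ (.inl (.inl ⟨α, rfl⟩))
      rw [hcomp, hcomp, hcomp]
      change _ = (Ψ r).ux α * _ + (Ψ r).uy α * _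
      linarith
    · intro r hr v hv α
      have h1 : dux α _ - _ * dx _ - _ * dy _ = 0 := hcont r hr v hv _ (.inl (.inr ⟨α, rfl⟩))
      rw [hcomp, hcomp, hcomp]
      linarith
    · intro r hr v hv α
      have h1 : duy α _ - _ * dx _ - _ * dy _ = 0 := hcont r hr v hv _ (.inr ⟨α, rfl⟩)
      rw [hcomp, hcomp, hcomp]
      linarith
    -- The map is a local diffeomorphism, so some vector is carried to `∂/∂u^γ` at the image point.
    -- On it the relation reads `c γ = 0`.
    · intro r hr c hc
      have hrs := (hsub hr).1
      have hinv : ∀ w, fderiv ℝ Ψ r (fderiv ℝ Φ.symm (Φ r) w) = w := fun w => by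
        have h1 := ((hΦ' _ (Φ.map_source hrs)).contDiffAt
          (Φ.open_target.mem_nhds (Φ.map_source hrs))).differentiableAt (by simp) |>.hasFDerivAt
        have h2 : HasFDerivAt Ψ (fderiv ℝ Ψ r) (Φ.symm (Φ r)) := by
          rw [Φ.left_inv hrs]
          exact hΨ.hasFDerivAt_of_smooth r
        have h3 : (fun z => Ψ (Φ.symm z)) =ᶠ[𝓝 (Φ r)] id := by
          have hc := h1.continuousAt
          filter_upwards [hc (isOpen_ball.mem_nhds (x := Φ.symm (Φ r))
            (by rwa [Φ.left_inv hrs])), Φ.open_target.mem_nhds (Φ.map_source hrs)] with z hz hzt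
          rw [heq hz, Φ.right_inv hzt]
          rfl
        have h4 := (h2.comp _ h1).unique ((hasFDerivAt_id _).congr_of_eventuallyEq h3)
        exact DFunLike.congr_fun h4 w
      funext γ
      have h1 := hc (fderiv ℝ Φ.symm (Φ r) (dirU γ, 0))
      simp only [hcomp, hinv] at h1
      simpa [du, dx, dy, dJet1, dirU, Pi.single_apply] using h1
  have hFc : ContinuousAt F q.toJet1 := continuousAt_pi.2 fun α =>
    (hF α).continuousOn.continuousAt (hU.mem_nhds (hsU q hqs))
  -- The relation with `Q` enters only through its consequence that solutions of the first equation
  -- are mapped to solutions of the second.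
  obtain ⟨φ, n, s, hs, hn, hpot⟩ := hmap.exists_normalizesAt hρ hFc hq hg fun r hr hr' α => by
    have h1 := hQ r (hsub hr).1 α
    rw [hr'] at h1
    simp only [sub_self, mul_zero, Finset.sum_const_zero] at h1
    have h2 := sub_eq_zero.1 h1
    rw [hGg _ (hsub hr).2] at h2
    rw [heq hr, h2]
    rfl
  refine hn.admitsLagrangiansAt (fun p hp => ?_) hsymm hdet hind fun i => hpot _ fun r hr => ?_
  · refine hsU (p, q.2) (hsub ?_).1
    simp only [mem_ball, Prod.dist_eq (x := (p, q.2)), max_lt_iff]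
    exact ⟨lt_of_lt_of_le hp hs, by simpa using hρ⟩
  · have h1 := hC _ (Jet1.toJet0_mem_ball (hsub hr).2) i
    rw [← heq hr] at h1
    exact h1

end

/-! ### The normal forms have the required Lagrangians. -/

section

open Jet1 Jet2

theorem linearIndependent_of_linear : LinearIndependent ℝ
    (![1, !![1, 0; 0, -1], !![0, 1; 1, 0]] : Fin 3 → Matrix (Fin 2) (Fin 2) ℝ) := by
  rw [Fintype.linearIndependent_iff]
  intro c hc
  have h00 := congrFun (congrFun hc 0) 0
  have h01 := congrFun (congrFun hc 0) 1
  have h11 := congrFun (congrFun hc 1) 1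
  simp [Fin.sum_univ_three] at h00 h01 h11
  intro i
  fin_cases i <;> simp <;> linarith

/-- Two copies of a linear equation have three Lagrangians. -/
theorem ContactEquivalentAt.admitsLagrangiansAt_linear {U : Set (Jet1 2)} {F : Jet1 2 → Fin 2 → ℝ}
    {D : Set (ℝ × ℝ)} {lam : ℝ × ℝ → ℝ} {q : Jet2 2}
    (h : ContactEquivalentAt U F (basePoint ⁻¹' D)
      (fun p => ![lam (basePoint p) * p.u 0, lam (basePoint p) * p.u 1]) q) (hU : IsOpen U)
    (hF : ∀ α, ContDiffOn ℝ ∞ (fun p => F p α) U) (hq : q.uxy = F q.toJet1) (hD : IsOpen D)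
    (hlam : ContDiffOn ℝ ∞ lam D) : AdmitsLagrangiansAt U F 3 q.toJet1 := by
  have hs : ∀ i, (![1, !![1, 0; 0, -1], !![0, 1; 1, 0]] i : Matrix (Fin 2) (Fin 2) ℝ).IsSymm := by
    intro i
    ext a b
    fin_cases i <;> fin_cases a <;> fin_cases b <;> simp
  refine h.admitsLagrangiansAt hU hF hq hs (fun i => ?_) linearIndependent_of_linear
    fun p₀ hp₀ => ?_
  · fin_cases i <;> simp [Matrix.det_fin_two]
  · obtain ⟨l, hl, t, ht, -, heq⟩ := hlam.exists_contDiff_eqOn_ball hD hp₀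
    let L : Jet0 2 →L[ℝ] ℝ × ℝ := (ContinuousLinearMap.fst ℝ _ _).prod
      ((ContinuousLinearMap.fst ℝ _ _).comp (ContinuousLinearMap.snd ℝ _ _))
    let π : Fin 2 → Jet0 2 →L[ℝ] ℝ := fun α => (ContinuousLinearMap.proj α).comp
      ((ContinuousLinearMap.snd ℝ _ _).comp (ContinuousLinearMap.snd ℝ _ _))
    refine ⟨fun α z => l (L z) * π α z, fun α => (hl.comp L.contDiff).mul (π α).contDiff, t, ht,
      fun p hp α => ?_, fun z _ i => ?_⟩
    · have hp' : basePoint p ∈ ball (basePoint p₀) t := by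
        rw [mem_ball, Prod.dist_eq, Prod.dist_eq, max_lt_iff, max_lt_iff] at hp
        rw [mem_ball, Prod.dist_eq]
        exact max_lt hp.1 hp.2.1
      fin_cases α <;> simp only [← heq hp'] <;> rfl
    · have hJ : jacobianU (fun α z => l (L z) * π α z) z = l (L z) • 1 := by
        ext α β
        have hd : HasFDerivAt (fun z => l (L z) * π α z) _ z :=
          ((hl.hasFDerivAt_of_smooth (L z)).comp z L.hasFDerivAt).fun_mul (π α).hasFDerivAt
        have hL : L (0, 0, Pi.single β 1) = 0 := rfl
        have hπ : π α (0, 0, Pi.single β 1) = (Pi.single β 1 : Fin 2 → ℝ) α := rfl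
        simp [jacobianU, Jet0.partialU, hd.fderiv, hL, hπ, Matrix.one_apply, Pi.single_apply]
      rw [hJ, Matrix.mul_smul, Matrix.mul_one]
      exact (hs i).smul _

/-- A system given by a solution `W` of `W_vv = e W_uu` has two Lagrangians. -/
theorem ContactEquivalentAt.admitsLagrangiansAt_hessian {U : Set (Jet1 2)} {F : Jet1 2 → Fin 2 → ℝ}
    {D : Set (ℝ × ℝ × ℝ × ℝ)} {W : ℝ × ℝ × ℝ × ℝ → ℝ} {q : Jet2 2}
    (h : ContactEquivalentAt U F (zeroJet ⁻¹' D)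
      (fun p => ![dV W (zeroJet p), dU W (zeroJet p)]) q) (hU : IsOpen U)
    (hF : ∀ α, ContDiffOn ℝ ∞ (fun p => F p α) U) (hq : q.uxy = F q.toJet1) (hD : IsOpen D)
    (hW : ContDiffOn ℝ ∞ W D) {e c : ℝ} (hec : e - c * c ≠ 0)
    (heq : ∀ z ∈ D, dV (dV W) z = e * dU (dU W) z) : AdmitsLagrangiansAt U F 2 q.toJet1 := by
  -- The second matrix is diag(1, e) plus `c` times the first. Such a shift stays in the pencil, and
  -- `c` is available to make the determinant `e - c²` nonzero.
  refine h.admitsLagrangiansAt hU hF hq (C := ![!![0, 1; 1, 0], !![1, c; c, e]]) (fun i => ?_)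
    (fun i => ?_) ?_ fun p₀ hp₀ => ?_
  · ext a b
    fin_cases i <;> fin_cases a <;> fin_cases b <;> simp
  · fin_cases i <;> simp [Matrix.det_fin_two, hec]
  · rw [Fintype.linearIndependent_iff]
    intro a ha
    have h00 := congrFun (congrFun ha 0) 0
    have h01 := congrFun (congrFun ha 0) 1
    simp [Fin.sum_univ_two] at h00 h01
    rw [h00] at h01
    intro i
    fin_cases i <;> simp <;> linarith
  · obtain ⟨V, hV, t, ht, htD, hVW⟩ := hW.exists_contDiff_eqOn_ball hD hp₀
    -- Inverse of `Jet0.ofProd`; it transfers the derivatives `dU`, `dV` to `Jet0.partialU`.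
    let κ : Jet0 2 → ℝ × ℝ × ℝ × ℝ := fun z => (z.1, z.2.1, z.2.2 0, z.2.2 1)
    have hκ : ContDiff ℝ ∞ κ := by unfold κ; fun_prop
    have hVκ : ContDiff ℝ ∞ fun z => V (κ z) := hV.comp hκ
    have hV' : (fun z => V (κ (Jet0.ofProd z))) = V := rfl
    have hU0 := Jet0.dU_comp_ofProd hVκ
    have hV0 := Jet0.dV_comp_ofProd hVκ
    have hU1 := Jet0.dU_comp_ofProd (hVκ.jet0_partialU 0)
    have hV1 := Jet0.dV_comp_ofProd (hVκ.jet0_partialU 1)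
    rw [← hU0] at hU1
    rw [← hV0] at hV1
    rw [hV'] at hU0 hV0 hU1 hV1
    have hdU : EqOn (dU V) (dU W) (ball (zeroJet p₀) t) := fun z hz => by
      rw [dU, dU, hVW.fderiv_eq_of_isOpen isOpen_ball hz]
    have hdV : EqOn (dV V) (dV W) (ball (zeroJet p₀) t) := fun z hz => by
      rw [dV, dV, hVW.fderiv_eq_of_isOpen isOpen_ball hz]
    refine ⟨![Jet0.partialU (fun z => V (κ z)) 1, Jet0.partialU (fun z => V (κ z)) 0], fun α => ?_,
      t, ht, fun p hp α => ?_, fun z hz i => ?_⟩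
    · fin_cases α
      exacts [hVκ.jet0_partialU 1, hVκ.jet0_partialU 0]
    · have hp' : zeroJet p ∈ ball (zeroJet p₀) t := by
        simp only [mem_ball, Prod.dist_eq, max_lt_iff] at hp ⊢
        exact ⟨hp.1, hp.2.1, (dist_le_pi_dist _ _ 0).trans_lt hp.2.2.1,
          (dist_le_pi_dist _ _ 1).trans_lt hp.2.2.1⟩
      rw [← hdU hp', ← hdV hp', hU0, hV0]
      fin_cases α <;> simp [-Jet1.toJet0_apply, Jet0.ofProd_zeroJet]
    · have hz' : κ z ∈ ball (zeroJet p₀) t := by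
        simp only [mem_ball, Prod.dist_eq, max_lt_iff] at hz ⊢
        exact ⟨hz.1, hz.2.1, (dist_le_pi_dist _ _ 0).trans_lt hz.2.2,
          (dist_le_pi_dist _ _ 1).trans_lt hz.2.2⟩
      have hzκ : Jet0.ofProd (κ z) = z := by
        refine Prod.ext rfl (Prod.ext rfl (funext fun i => ?_))
        fin_cases i <;> rfl
      have h11 : Jet0.partialU (Jet0.partialU (fun z => V (κ z)) 1) 1 z =
          e * Jet0.partialU (Jet0.partialU (fun z => V (κ z)) 0) 0 z := by
        have h1 := heq _ (htD hz')
        have h2 : dU (dU V) (κ z) = dU (dU W) (κ z) := by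
          rw [dU, dU, hdU.fderiv_eq_of_isOpen isOpen_ball hz']
        have h3 : dV (dV V) (κ z) = dV (dV W) (κ z) := by
          rw [dV, dV, hdV.fderiv_eq_of_isOpen isOpen_ball hz']
        rw [← h2, ← h3, hU1, hV1] at h1
        simpa only [hzκ] using h1
      have h01 : Jet0.partialU (Jet0.partialU (fun z => V (κ z)) 0) 1 z =
          Jet0.partialU (Jet0.partialU (fun z => V (κ z)) 1) 0 z := hVκ.fderiv_apply_comm _ _ _
      set w₀ := Jet0.partialU (Jet0.partialU (fun z => V (κ z)) 0) 0 z
      set w₁ := Jet0.partialU (Jet0.partialU (fun z => V (κ z)) 1) 0 z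
      have hJ : jacobianU ![Jet0.partialU (fun z => V (κ z)) 1, Jet0.partialU (fun z => V (κ z)) 0]
          z = !![w₁, e * w₀; w₀, w₁] := by
        ext a b
        fin_cases a <;> fin_cases b
        exacts [rfl, h11, rfl, h01]
      rw [hJ]
      ext a b
      fin_cases i <;> fin_cases a <;> fin_cases b <;> simp <;> ring

end

end

theorem theorem4p1
    (U : Set (Jet1 2)) (hU : IsOpen U) (f g : Jet1 2 → ℝ)
    (hf : ContDiffOn ℝ ∞ f U) (hg : ContDiffOn ℝ ∞ g U)
    (q : Jet2 2) (hq : q ∈ equationManifold U (fun p => ![f p, g p])) :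
    (AdmitsLagrangiansAt U (fun p => ![f p, g p]) 3 q.toJet1 ↔
      ∃ (D : Set (ℝ × ℝ)) (lam : ℝ × ℝ → ℝ), IsOpen D ∧ ContDiffOn ℝ ∞ lam D ∧
        ContactEquivalentAt U (fun p => ![f p, g p]) (basePoint ⁻¹' D)
          (fun p => ![lam (basePoint p) * p.u 0, lam (basePoint p) * p.u 1]) q) ∧
    (AdmitsLagrangiansAt U (fun p => ![f p, g p]) 2 q.toJet1 ↔
      ∃ (D : Set (ℝ × ℝ × ℝ × ℝ)) (W : ℝ × ℝ × ℝ × ℝ → ℝ), IsOpen D ∧ ContDiffOn ℝ ∞ W D ∧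
        ((∀ z ∈ D, dU (dU W) z + dV (dV W) z = 0) ∨
          (∀ z ∈ D, dU (dU W) z = dV (dV W) z) ∨
          (∀ z ∈ D, dV (dV W) z = 0)) ∧
        ContactEquivalentAt U (fun p => ![f p, g p]) (zeroJet ⁻¹' D)
          (fun p => ![dV W (zeroJet p), dU W (zeroJet p)]) q) := by
  have hF : ∀ α, ContDiffOn ℝ ∞ (fun p => ![f p, g p] α) U := fun α => by
    fin_cases α
    exacts [hf, hg]
  refine ⟨⟨fun h => h.exists_contactEquivalentAt_linear hF, ?_⟩,
    ⟨fun h => h.exists_contactEquivalentAt_hessian hF, ?_⟩⟩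
  · rintro ⟨D, lam, hD, hlam, h⟩
    exact h.admitsLagrangiansAt_linear hU hF hq.2 hD hlam
  · rintro ⟨D, W, hD, hW, hWD | hWD | hWD, h⟩
    · exact h.admitsLagrangiansAt_hessian hU hF hq.2 hD hW (e := -1) (c := 0) (by norm_num)
        fun z hz => by linarith [hWD z hz]
    · exact h.admitsLagrangiansAt_hessian hU hF hq.2 hD hW (e := 1) (c := 0) (by norm_num)
        fun z hz => by linarith [hWD z hz]
    -- Here diag(1, 0) is degenerate and cannot be a multiplier, whence `c = 1` instead of 0.
    · exact h.admitsLagrangiansAt_hessian hU hF hq.2 hD hW (e := 0) (c := 1) (by norm_num)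
        fun z hz => by rw [hWD z hz, zero_mul]
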